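/- Throughout, manifolds are smooth Hausdorff manifolds modelled on Fréchet spaces, and a Lie 2-group $\Gamma=(H\stackrel{t}{\to}G\stackrel{\alpha}{\to}\mathrm{Aut}(H))$ is a crossed module of (possibly Fréchet) Lie groups: $t$ is a smooth homomorphism, $\alpha:G\times H\to H$ is a smooth action by automorphisms, $t(\alpha(g,h))=g\,t(h)g^{-1}$ and $\alpha(t(h),h')=hh'h^{-1}$. Put $\tilde\alpha_h(g):=h^{-1}\alpha(g,h)$; $\theta,\bar\theta$ denote the left- and right-invariant Maurer–Cartan forms. $\Gamma$ is central if $\alpha(g,a)=a$ for all $g\in G$ and $a\in\ker t$; an adjustment of a central $\Gamma$ is a map $\kappa:G\times\mathfrak g\to\mathfrak h$, linear and continuous in $\mathfrak g$ and smooth in $G$, with $\kappa(g_1g_2,X)=\kappa(g_1,\mathrm{Ad}_{g_2}X)+\kappa(g_2,X)$, $\kappa(t(h),X)=(\tilde\alpha_{h^{-1}})_*X$ and $\kappa(g,t_*Y)=(\alpha_g)_*Y-Y$. Let $X$ be a manifold. A $\Gamma$-connection on $X$ is a pair $(A,B)\in\Omega^1(X,\mathfrak g)\times\Omega^2(X,\mathfrak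 h)$, with fake curvature $\mathrm{fcurv}(A,B)=dA+\frac12[A\wedge A]-t_*B$; it is fake-flat if this vanishes. A gauge transformation $(g,\varphi):(A,B)\to(A',B')$ is a smooth $g:X\to G$ and $\varphi\in\Omega^1(X,\mathfrak h)$ with $A'+t_*\varphi=\mathrm{Ad}_g(A)-g^*\bar\theta$. Its curvature is $\mathrm{curv}(g,\varphi)=d\varphi+\frac12[\varphi\wedge\varphi]+\alpha_*(A'\wedge\varphi)+B'-(\alpha_g)_*B$; it is adjusted if $\mathrm{curv}(g,\varphi)=\kappa(g,\mathrm{fcurv}(A,B))$ and flat if $\mathrm{curv}(g,\varphi)=0$. A gauge 2-transformation $h:(g_1,\varphi_1)\Rightarrow(g_2,\varphi_2)$ is a smooth $h:X\to H$ with $g_2=(t\circ h)g_1$ and $\mathrm{Ad}_h^{-1}(\varphi_2)+(\tilde\alpha_h)_*(A')=\varphi_1-h^*\theta$. *Local data.* A 1-morphism $(A,B)\to(A',B')$ of the Hom-closure is a quadruple $(\pi,\varphi,g,a)$ of a surjective submersion $\pi:Y\to X$, a gauge transformation $(g,\varphi):\pi^*(A,B)\to\pi^*(A',B')$ and a gauge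 2-transformation $a:\mathrm{pr}_1^*(g,\varphi)\Rightarrow\mathrm{pr}_2^*(g,\varphi)$ over $Y\times_XY$ with $a(y',y'')a(y,y')=a(y,y'')$. A 2-morphism $(\pi_1,\varphi_1,g_1,a_1)\Rightarrow(\pi_2,\varphi_2,g_2,a_2)$ is a gauge 2-transformation $h:\mathrm{pr}_{Y_1}^*(g_1,\varphi_1)\Rightarrow\mathrm{pr}_{Y_2}^*(g_2,\varphi_2)$ over $Y_1\times_XY_2$ with $a_2(y_2,y_2')h(y_1,y_2)=h(y_1',y_2')a_1(y_1,y_1')$; vertical composition is the descent of $h_{23}(y_2,y_3)h_{12}(y_1,y_2)$, and the identity of $(\pi,\varphi,g,a)$ is $a$. These form the category $\mathrm{Loc}((A,B),(A',B'))$. The composition of $(\pi,\varphi,g,a):(A,B)\to(A',B')$ and $(\pi',\varphi',g',a'):(A',B')\to(A'',B'')$ is given by $\tilde Y=Y\times_XY'$, $\tilde\varphi=(\alpha_{g'})_*\varphi+\varphi'$, $\tilde g(y,y')=g'(y')g(y)$ and $\tilde a((y_1,y_1'),(y_2,y_2'))=a'(y_1',y_2')\,\alpha(g'(y_1'),a(y_1,y_2))$;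 horizontal composition of 2-morphisms $h$ and $h'$ is $h'(y_1',y_2')\,\alpha(g_1'(y_1'),h(y_1,y_2))$. Write $\mathrm{Loc}^{\kappa}$ (for central $\Gamma$ with adjustment $\kappa$), respectively $\mathrm{Loc}^{\mathrm{fl}}$ (for fake-flat $\Gamma$-connections), for the full subcategory where $(g,\varphi)$ is adjusted, respectively flat. *Bundles.* A principal $\Gamma$-bundle is a principal $H$-bundle $P\to X$ with a smooth anchor $\phi:P\to G$, $\phi(ph)=t(h)^{-1}\phi(p)$. An $A$-$A'$-connection on it is $\omega\in\Omega^1(P,\mathfrak h)$ with $\rho^*\omega=\mathrm{Ad}_h^{-1}(\mathrm{pr}_P^*\omega)+(\tilde\alpha_h)_*(A')+h^*\theta$ on $P\times H$ ($\rho$ the action, $h$ the projection to $H$) and $t_*\omega=\mathrm{Ad}_\phi(A)-A'-\phi^*\bar\theta$. With $\mathrm{curv}_{B,B'}(\omega)=d\omega+\frac12[\omega\wedge\omega]+\alpha_*(A'\wedge\omega)-(\alpha_\phi)_*B+B'$, it is $B$-$B'$-adjusted if $\mathrm{curv}_{B,B'}(\omega)=\kappa(\phi,\mathrm{fcurv}(A,B))$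 and $B$-$B'$-flat if $\mathrm{curv}_{B,B'}(\omega)=0$. With the connection-preserving morphisms of $H$-bundles that respect the anchors these form a category $\mathrm{Bun}_{A,A'}$, with full subcategories $\mathrm{Bun}^{\kappa}_{(A,B),(A',B')}$ and $\mathrm{Bun}^{\mathrm{fl}}_{(A,B),(A',B')}$. The partial tensor product $\mathrm{Bun}_{A',A''}\times\mathrm{Bun}_{A,A'}\to\mathrm{Bun}_{A,A''}$ sends $(P_1,P_2)$ to $(P_1\times_XP_2)/\!\sim$ with $(p_1h,p_2)\sim(p_1,p_2\,\alpha(\phi_1(p_1)^{-1},h))$, with action $(p_1,p_2)h=(p_1h,p_2)$, anchor $\phi_1\phi_2$ and connection induced by $\mathrm{pr}_1^*\omega_1+(\alpha_{\phi_1})_*(\mathrm{pr}_2^*\omega_2)$. *Reconstruction.* Local data $(\pi,\varphi,g,a)$ are sent to $P=(Y\times H)/\!\sim$, $(y_1,h)\sim(y_2,a(y_1,y_2)h)$, with action $(y,h)h'=(y,hh')$, anchor $(y,h)\mapsto t(h)^{-1}g(y)$ and connection induced by $\mathrm{Ad}_{h}^{-1}(\varphi)+(\tilde\alpha_{h})_*(A')+h^*\theta$;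 a 2-morphism $h$ is sent to $(y_1,h')\mapsto(y_2,h(y_1,y_2)h')$ for any $y_2$ over the same point as $y_1$. **Proposition.** Composition, partial tensor product and reconstruction are well-defined functors. For all $\Gamma$-connections on $X$, composition, tensor product and reconstruction restrict to $\mathrm{Loc}^\kappa$ and $\mathrm{Bun}^\kappa$ (if $\Gamma$ is central with adjustment $\kappa$), and for fake-flat $\Gamma$-connections they restrict to $\mathrm{Loc}^{\mathrm{fl}}$ and $\mathrm{Bun}^{\mathrm{fl}}$. Moreover: (a) Each of the three reconstruction functors $\mathrm{Loc}\to\mathrm{Bun}$, $\mathrm{Loc}^\kappa\to\mathrm{Bun}^\kappa$, $\mathrm{Loc}^{\mathrm{fl}}\to\mathrm{Bun}^{\mathrm{fl}}$ sends the composition of 1-morphisms to the partial tensor product, up to natural isomorphism. (b) If $\Gamma$ is central with adjustment $\kappa$, then for any two $\Gamma$-connections $(A,B)$, $(A',B')$ on $X$ reconstruction $\mathrm{Loc}^\kappa((A,B),(A',B'))\to\mathrm{Bun}^\kappa_{(A,B),(A',B')}$ is an equivalence of categories. (c) For any two fake-flat $\Gamma$-connections $(A,B)$, $(A',B')$ on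 $X$ reconstruction $\mathrm{Loc}^{\mathrm{fl}}((A,B),(A',B'))\to\mathrm{Bun}^{\mathrm{fl}}_{(A,B),(A',B')}$ is an equivalence of categories. -/

import Mathlib

open Set Filter Topology

universe u v w

namespace HGT

set_option linter.unusedSectionVars false

noncomputable section

section Calculus

/-- `L` is the directional derivative of `f` at `x` in the direction `v`. -/
def HasDirDeriv {E : Type u} {F : Type v} [AddCommGroup E] [Module ℝ E]
    [AddCommGroup F] [Module ℝ F] [TopologicalSpace F] (f : E → F) (x v : E) (L : F) : Prop :=
  Tendsto (fun s : ℝ => s⁻¹ • (f (x + s • v) - f x)) (𝓝[≠] 0) (𝓝 L)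

open Classical in
/-- The directional derivative (zero if it does not exist). -/
def dirDeriv {E : Type u} {F : Type v} [AddCommGroup E] [Module ℝ E]
    [AddCommGroup F] [Module ℝ F] [TopologicalSpace F] (f : E → F) (x v : E) : F :=
  if h : ∃ L, HasDirDeriv f x v L then h.choose else 0

/-- Maps of class `C^n` on an open subset, in the sense of Michal--Bastiani (and Hamilton): all
directional derivatives exist, and `(x, v) ↦ df(x)(v)` is again of class `C^(n-1)`. -/
def CkOn : ℕ → ∀ {E : Type u} {F : Type v} [AddCommGroup E] [Module ℝ E] [TopologicalSpace E]
    [AddCommGroup F] [Module ℝ F] [TopologicalSpace F], (E → F) → Set E → Prop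
  | 0, _, _, _, _, _, _, _, _, f, U => ContinuousOn f U
  | n + 1, E, _, _, _, _, _, _, _, f, U =>
      ContinuousOn f U ∧ (∀ x ∈ U, ∀ v, ∃ L, HasDirDeriv f x v L) ∧
        CkOn n (fun p : E × E => dirDeriv f p.1 p.2) (U ×ˢ (univ : Set E))

/-- Smooth maps on an open subset of a Fréchet space. -/
def SmoothOn {E : Type u} {F : Type v} [AddCommGroup E] [Module ℝ E] [TopologicalSpace E]
    [AddCommGroup F] [Module ℝ F] [TopologicalSpace F] (f : E → F) (U : Set E) : Prop :=
  ∀ n, CkOn n f U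

section Algebraic

variable {E : Type u} {F : Type v} [AddCommGroup E] [Module ℝ E]
    [AddCommGroup F] [Module ℝ F] [TopologicalSpace F]

theorem HasDirDeriv.eq [T2Space F] {f : E → F} {x v : E} {L L' : F} (h : HasDirDeriv f x v L)
    (h' : HasDirDeriv f x v L') : L = L' := tendsto_nhds_unique h h'

theorem hasDirDeriv_dirDeriv {f : E → F} {x v : E} (h : ∃ L, HasDirDeriv f x v L) :
    HasDirDeriv f x v (dirDeriv f x v) := by
  rw [dirDeriv, dif_pos h]; exact h.choose_spec

theorem HasDirDeriv.dirDeriv [T2Space F] {f : E → F} {x v : E} {L : F}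
    (h : HasDirDeriv f x v L) : dirDeriv f x v = L := (hasDirDeriv_dirDeriv ⟨L, h⟩).eq h

theorem dirDeriv_eq_of {E' : Type w} [AddCommGroup E'] [Module ℝ E'] {f : E → F} {g : E' → F}
    {x v : E} {x' v' : E'} (h : ∀ L, HasDirDeriv f x v L ↔ HasDirDeriv g x' v' L) :
    dirDeriv f x v = dirDeriv g x' v' := by
  have h2 : ∀ P Q : F → Prop, P = Q → (open Classical in if h : ∃ L, P L then h.choose else 0) =
      (open Classical in if h : ∃ L, Q L then h.choose else 0) := by
    rintro P Q rfl; rfl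
  exact h2 _ _ (funext fun L => propext (h L))

theorem hasDirDeriv_zero (f : E → F) (x : E) : HasDirDeriv f x 0 0 := by
  simp [HasDirDeriv, tendsto_const_nhds]

theorem HasDirDeriv.const_smul [ContinuousSMul ℝ F] {f : E → F} {x v : E} {L : F}
    (h : HasDirDeriv f x v L) (c : ℝ) : HasDirDeriv f x (c • v) (c • L) := by
  rcases eq_or_ne c 0 with rfl | hc
  · simpa using hasDirDeriv_zero f x
  · have h1 : Tendsto (fun s : ℝ => s * c) (𝓝[≠] 0) (𝓝[≠] 0) := by
      refine tendsto_nhdsWithin_iff.2 ⟨?_, ?_⟩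
      · have : Tendsto (fun s : ℝ => s * c) (𝓝 0) (𝓝 (0 * c)) :=
          (continuous_id.mul continuous_const).tendsto 0
        rw [zero_mul] at this
        exact this.mono_left nhdsWithin_le_nhds
      · filter_upwards [self_mem_nhdsWithin] with s hs
        exact mul_ne_zero hs hc
    refine ((Tendsto.comp h h1).const_smul c).congr' ?_
    filter_upwards [self_mem_nhdsWithin] with s hs
    have hs' : s ≠ 0 := hs
    simp only [Function.comp, smul_smul]
    congr 1
    field_simp

end Algebraic

section Topological

variable {E : Type u} {F : Type v} {K : Type w} [AddCommGroup E] [Module ℝ E] [TopologicalSpace E]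
    [IsTopologicalAddGroup E] [ContinuousSMul ℝ E]
    [AddCommGroup F] [Module ℝ F] [TopologicalSpace F]
    [IsTopologicalAddGroup F] [ContinuousSMul ℝ F]
    [AddCommGroup K] [Module ℝ K] [TopologicalSpace K]
    [IsTopologicalAddGroup K] [ContinuousSMul ℝ K]

theorem tendsto_line (x v : E) : Tendsto (fun s : ℝ => x + s • v) (𝓝 0) (𝓝 x) := by
  have : Continuous (fun s : ℝ => x + s • v) := by fun_prop
  simpa using this.tendsto 0

theorem hasDirDeriv_congr {f g : E → F} {x : E} (h : f =ᶠ[𝓝 x] g) (v : E) (L : F) :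
    HasDirDeriv f x v L ↔ HasDirDeriv g x v L := by
  refine tendsto_congr' ?_
  have h1 := ((tendsto_line x v).eventually h).filter_mono (nhdsWithin_le_nhds (s := {0}ᶜ))
  filter_upwards [h1] with s hs
  rw [hs, h.eq_of_nhds]

theorem dirDeriv_congr {f g : E → F} {x : E} (h : f =ᶠ[𝓝 x] g) (v : E) :
    dirDeriv f x v = dirDeriv g x v := by
  exact dirDeriv_eq_of fun L => hasDirDeriv_congr h v L

theorem CkOn.congr {n : ℕ} {f g : E → F} {U : Set E} (hU : IsOpen U) (hf : CkOn n f U)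
    (h : EqOn f g U) : CkOn n g U := by
  induction n generalizing E with
  | zero => exact ContinuousOn.congr hf h.symm
  | succ n ih =>
    obtain ⟨h0, h1, h2⟩ := hf
    have he : ∀ x ∈ U, f =ᶠ[𝓝 x] g := fun x hx => h.eventuallyEq_of_mem (hU.mem_nhds hx)
    refine ⟨h0.congr h.symm, fun x hx v => ?_, ih (hU.prod isOpen_univ) h2 ?_⟩
    · obtain ⟨L, hL⟩ := h1 x hx v
      exact ⟨L, (hasDirDeriv_congr (he x hx) v L).1 hL⟩
    · intro p hp
      exact dirDeriv_congr (he p.1 hp.1) p.2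

theorem CkOn.mono {n : ℕ} {f : E → F} {U V : Set E} (hf : CkOn n f U) (h : V ⊆ U) :
    CkOn n f V := by
  induction n generalizing E with
  | zero => exact ContinuousOn.mono hf h
  | succ n ih =>
    obtain ⟨h0, h1, h2⟩ := hf
    exact ⟨h0.mono h, fun x hx v => h1 x (h hx) v, ih h2 (prod_mono h subset_rfl)⟩

theorem CkOn.of_local {n : ℕ} {f : E → F} {U : Set E}
    (h : ∀ x ∈ U, ∃ V, IsOpen V ∧ x ∈ V ∧ CkOn n f V) : CkOn n f U := by
  induction n generalizing E with
  | zero =>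
    intro x hx
    obtain ⟨V, hV, hxV, hf⟩ := h x hx
    exact (ContinuousOn.continuousAt hf (hV.mem_nhds hxV)).continuousWithinAt
  | succ n ih =>
    refine ⟨?_, ?_, ih ?_⟩
    · intro x hx
      obtain ⟨V, hV, hxV, hf⟩ := h x hx
      exact (ContinuousOn.continuousAt hf.1 (hV.mem_nhds hxV)).continuousWithinAt
    · intro x hx v
      obtain ⟨V, hV, hxV, hf⟩ := h x hx
      exact hf.2.1 x hxV v
    · rintro ⟨x, v⟩ hx
      obtain ⟨V, hV, hxV, hf⟩ := h x hx.1
      exact ⟨V ×ˢ univ, hV.prod isOpen_univ, ⟨hxV, mem_univ _⟩, hf.2.2⟩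

theorem CkOn.continuousOn {n : ℕ} {f : E → F} {U : Set E} (hf : CkOn n f U) :
    ContinuousOn f U := by
  cases n with
  | zero => exact hf
  | succ n => exact hf.1

theorem CkOn.of_succ {n : ℕ} {f : E → F} {U : Set E} (hf : CkOn (n + 1) f U) : CkOn n f U := by
  induction n generalizing E with
  | zero => exact hf.1
  | succ n ih => exact ⟨hf.1, hf.2.1, ih hf.2.2⟩

theorem hasDirDeriv_clm (L : E →L[ℝ] F) (x v : E) : HasDirDeriv L x v (L v) := by
  refine tendsto_const_nhds.congr' ?_
  filter_upwards [self_mem_nhdsWithin] with s hs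
  have hs' : s ≠ 0 := hs
  simp [smul_smul, hs']

theorem CkOn.clm [T2Space F] (n : ℕ) (L : E →L[ℝ] F) (U : Set E) : CkOn n L U := by
  induction n generalizing E with
  | zero => exact L.continuous.continuousOn
  | succ n ih =>
    refine ⟨L.continuous.continuousOn, fun x _ v => ⟨_, hasDirDeriv_clm L x v⟩, ?_⟩
    have : (fun p : E × E => dirDeriv L p.1 p.2) = (L.comp (ContinuousLinearMap.snd ℝ E E)) := by
      funext p; exact (hasDirDeriv_clm L p.1 p.2).dirDeriv
    rw [this]; exact ih _ _

theorem hasDirDeriv_const (c : F) (x v : E) : HasDirDeriv (fun _ : E => c) x v 0 := by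
  simp [HasDirDeriv, tendsto_const_nhds]

theorem CkOn.const [T2Space F] (n : ℕ) (c : F) (U : Set E) : CkOn n (fun _ : E => c) U := by
  induction n generalizing E c with
  | zero => exact continuousOn_const
  | succ n ih =>
    refine ⟨continuousOn_const, fun x _ v => ⟨_, hasDirDeriv_const c x v⟩, ?_⟩
    have : (fun p : E × E => dirDeriv (fun _ : E => c) p.1 p.2) = fun _ => 0 := by
      funext p; exact (hasDirDeriv_const c p.1 p.2).dirDeriv
    rw [this]; exact ih _ _

theorem HasDirDeriv.prodMk {f : E → F} {g : E → K} {x v : E} {L : F} {L' : K}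
    (hf : HasDirDeriv f x v L) (hg : HasDirDeriv g x v L') :
    HasDirDeriv (fun y => (f y, g y)) x v (L, L') :=
  Tendsto.prodMk_nhds hf hg

theorem CkOn.prodMk [T2Space F] [T2Space K] {n : ℕ} {f : E → F} {g : E → K} {U : Set E}
    (hU : IsOpen U) (hf : CkOn n f U) (hg : CkOn n g U) : CkOn n (fun y => (f y, g y)) U := by
  induction n generalizing E with
  | zero => exact ContinuousOn.prodMk hf hg
  | succ n ih =>
    have key : ∀ x ∈ U, ∀ v, HasDirDeriv (fun y => (f y, g y)) x v
        (dirDeriv f x v, dirDeriv g x v) := fun x hx v =>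
      (hasDirDeriv_dirDeriv (hf.2.1 x hx v)).prodMk (hasDirDeriv_dirDeriv (hg.2.1 x hx v))
    refine ⟨hf.1.prodMk hg.1, fun x hx v => ⟨_, key x hx v⟩, ?_⟩
    refine (ih (hU.prod isOpen_univ) hf.2.2 hg.2.2).congr (hU.prod isOpen_univ) ?_
    intro p hp
    exact (key p.1 hp.1 p.2).dirDeriv.symm

theorem CkOn.comp_clm {n : ℕ} {f : E → F} {U : Set E} (hf : CkOn n f U)
    (L : K →L[ℝ] E) {V : Set K} (hV : IsOpen V) (h : MapsTo L V U) :
    CkOn n (fun y => f (L y)) V := by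
  induction n generalizing E K with
  | zero => exact ContinuousOn.comp hf L.continuous.continuousOn h
  | succ n ih =>
    have key : ∀ x v (D : F), HasDirDeriv (fun y => f (L y)) x v D ↔ HasDirDeriv f (L x) (L v) D :=
      fun x v D => by simp [HasDirDeriv]
    refine ⟨hf.1.comp L.continuous.continuousOn h, fun x hx v => ?_, ?_⟩
    · obtain ⟨D, hD⟩ := hf.2.1 (L x) (h hx) (L v)
      exact ⟨D, (key x v D).2 hD⟩
    · refine (ih hf.2.2 (L.prodMap L) (hV.prod isOpen_univ)
        fun p hp => ⟨h hp.1, mem_univ _⟩).congr (hV.prod isOpen_univ) fun p hp => ?_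
      exact (dirDeriv_eq_of fun D => key p.1 p.2 D).symm

/-- Strong form of differentiability for maps of class `C^1`, by the Hahn--Banach theorem. -/
theorem CkOn.tendsto_slope [T2Space F] [LocallyConvexSpace ℝ E] [LocallyConvexSpace ℝ F]
    {f : E → F} {U : Set E}
    (hU : IsOpen U) (hf : CkOn 1 f U) {y : E} (hy : y ∈ U) {v : E} {l : Filter ℝ}
    {b a : ℝ → E} (hl : l ≤ 𝓝[≠] 0) (hb : Tendsto b l (𝓝 y)) (ha : Tendsto a l (𝓝 v)) :
    Tendsto (fun s : ℝ => s⁻¹ • (f (b s + s • a s) - f (b s))) l (𝓝 (dirDeriv f y v)) := by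
  have hcont : ContinuousAt (fun p : E × E => dirDeriv f p.1 p.2) (y, v) :=
    ContinuousOn.continuousAt hf.2.2 ((hU.prod isOpen_univ).mem_nhds ⟨hy, mem_univ _⟩)
  have : RegularSpace F := inferInstance
  -- closed convex neighbourhoods form a basis
  rw [(closed_nhds_basis (dirDeriv f y v)).tendsto_right_iff]
  rintro N₀ ⟨hN₀, hN₀c⟩
  obtain ⟨N₁, ⟨hN₁, hN₁c⟩, hN₁N₀⟩ :=
    ((LocallyConvexSpace.convex_basis (𝕜 := ℝ) (dirDeriv f y v)).mem_iff).1 hN₀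
  have hN₁N₀' : closure N₁ ⊆ N₀ := closure_minimal hN₁N₀ hN₀c
  have hNconv : Convex ℝ (closure N₁) := hN₁c.closure
  have hs0 : Tendsto (fun s : ℝ => s) l (𝓝 0) := (tendsto_id.mono_left nhdsWithin_le_nhds).mono_left hl
  obtain ⟨V, hV, W, hW, hVW⟩ := mem_nhds_prod_iff.1 (hcont.preimage_mem_nhds hN₁)
  have hVU : V ∩ U ∈ 𝓝 y := inter_mem hV (hU.mem_nhds hy)
  obtain ⟨C, ⟨hC, hCc⟩, hCV⟩ :=
    ((LocallyConvexSpace.convex_basis (𝕜 := ℝ) y).mem_iff).1 hVU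
  have hbs : Tendsto (fun s => b s + s • a s) l (𝓝 y) := by
    simpa using hb.add (hs0.smul ha)
  filter_upwards [hb hC, hbs hC, ha hW, hl self_mem_nhdsWithin] with s h1 h2 h3 hs
  have hs' : s ≠ 0 := hs
  apply hN₁N₀'
  have hmem : ∀ r ∈ Icc (0 : ℝ) 1, b s + r • (s • a s) ∈ V ∩ U := by
    intro r hr
    apply hCV
    have := hCc.add_smul_sub_mem h1 h2 hr
    simpa using this
  have hder : ∀ r ∈ Icc (0 : ℝ) 1, HasDirDeriv f (b s + r • (s • a s)) (s • a s)
      (s • dirDeriv f (b s + r • (s • a s)) (a s)) := fun r hr =>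
    (hasDirDeriv_dirDeriv (hf.2.1 _ (hmem r hr).2 _)).const_smul s
  by_contra hnot
  obtain ⟨φ, c, hφ1, hφ2⟩ := geometric_hahn_banach_closed_point hNconv isClosed_closure hnot
  have hd : ∀ r ∈ Icc (0 : ℝ) 1, HasDerivAt (fun r : ℝ => φ (s⁻¹ • f (b s + r • (s • a s))))
      (φ (dirDeriv f (b s + r • (s • a s)) (a s))) r := by
    intro r hr
    rw [hasDerivAt_iff_tendsto_slope_zero]
    have h4 := (φ.continuous.tendsto _).comp ((Filter.Tendsto.const_smul (hder r hr) s⁻¹))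
    rw [inv_smul_smul₀ hs'] at h4
    refine h4.congr fun t => ?_
    simp only [Function.comp, map_smul, map_sub, smul_eq_mul, add_smul, add_assoc]
    ring
  obtain ⟨r, hr, hre⟩ := exists_hasDerivAt_eq_slope
    (fun r : ℝ => φ (s⁻¹ • f (b s + r • (s • a s))))
    (fun r => φ (dirDeriv f (b s + r • (s • a s)) (a s))) one_pos
    (fun r hr => (hd r hr).continuousAt.continuousWithinAt)
    (fun r hr => hd r ⟨hr.1.le, hr.2.le⟩)
  have hrI : r ∈ Icc (0 : ℝ) 1 := ⟨hr.1.le, hr.2.le⟩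
  have h5 := hφ1 _ (subset_closure (hVW (show (b s + r • (s • a s), a s) ∈ V ×ˢ W from
    ⟨(hmem r hrI).1, h3⟩)))
  simp only [one_smul, zero_smul, add_zero, sub_zero, div_one] at hre
  rw [← map_sub, ← smul_sub] at hre
  rw [← hre] at hφ2
  exact lt_asymm h5 hφ2

variable [LocallyConvexSpace ℝ E] [LocallyConvexSpace ℝ F] [LocallyConvexSpace ℝ K]
  [T2Space F] [T2Space K]

/-- The chain rule. -/
theorem HasDirDeriv.comp {g : F → K} {V : Set F} (hV : IsOpen V) (hg : CkOn 1 g V)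
    {f : E → F} {x v : E} {L : F} (hx : f x ∈ V) (hf : HasDirDeriv f x v L) :
    HasDirDeriv (fun y => g (f y)) x v (HGT.dirDeriv g (f x) L) := by
  have h := hg.tendsto_slope hV hx (v := L) (l := 𝓝[≠] 0) (b := fun _ => f x) (a := fun s : ℝ => s⁻¹ • (f (x + s • v) - f x))
    le_rfl tendsto_const_nhds hf
  refine h.congr' ?_
  filter_upwards [self_mem_nhdsWithin] with s hs
  have hs' : s ≠ 0 := hs
  simp [smul_smul, hs']

theorem CkOn.dirDeriv_add {f : E → F} {U : Set E} (hU : IsOpen U) (hf : CkOn 1 f U) {x : E}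
    (hx : x ∈ U) (v w : E) : dirDeriv f x (v + w) = dirDeriv f x v + dirDeriv f x w := by
  refine HasDirDeriv.dirDeriv ?_
  have h1 := hf.tendsto_slope hU hx (v := v) (l := 𝓝[≠] 0) (b := fun s : ℝ => x + s • w)
    (a := fun _ => v) le_rfl ((tendsto_line x w).mono_left nhdsWithin_le_nhds) tendsto_const_nhds
  have h2 := hasDirDeriv_dirDeriv (hf.2.1 x hx w)
  refine (h1.add h2).congr fun s => ?_
  rw [← smul_add, sub_add_sub_cancel]
  rw [smul_add, add_comm (s • v), add_assoc]

theorem CkOn.dirDeriv_smul {f : E → F} {U : Set E} (hf : CkOn 1 f U) {x : E}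
    (hx : x ∈ U) (c : ℝ) (v : E) : dirDeriv f x (c • v) = c • dirDeriv f x v :=
  ((hasDirDeriv_dirDeriv (hf.2.1 x hx v)).const_smul c).dirDeriv

theorem CkOn.comp {n : ℕ} {g : F → K} {V : Set F} (hV : IsOpen V) (hg : CkOn n g V)
    {f : E → F} {U : Set E} (hU : IsOpen U) (hf : CkOn n f U) (h : MapsTo f U V) :
    CkOn n (fun y => g (f y)) U := by
  induction n generalizing E F with
  | zero => exact ContinuousOn.comp hg hf h
  | succ n ih =>
    have hg1 : CkOn 1 g V := by
      clear ih hf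
      induction n with
      | zero => exact hg
      | succ n ih => exact ih hg.of_succ
    have key : ∀ x ∈ U, ∀ v, HasDirDeriv (fun y => g (f y)) x v
        (dirDeriv g (f x) (dirDeriv f x v)) := fun x hx v =>
      HasDirDeriv.comp hV hg1 (h hx) (hasDirDeriv_dirDeriv (hf.2.1 x hx v))
    refine ⟨hg.1.comp hf.1 h, fun x hx v => ⟨_, key x hx v⟩, ?_⟩
    have hU' : IsOpen (U ×ˢ (univ : Set E)) := hU.prod isOpen_univ
    have h1 : CkOn n (fun p : E × E => f p.1) (U ×ˢ (univ : Set E)) := by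
      exact hf.of_succ.comp_clm (ContinuousLinearMap.fst ℝ E E) hU' fun p hp => hp.1
    have h2 := ih (g := fun p : F × F => dirDeriv g p.1 p.2) (hV.prod isOpen_univ) hg.2.2 hU'
      (h1.prodMk hU' hf.2.2) fun p hp => ⟨h hp.1, mem_univ _⟩
    refine h2.congr hU' fun p hp => (key p.1 hp.1 p.2).dirDeriv.symm

end Topological
end Calculus

/-- A Fréchet space: a complete metrizable (i.e. first countable Hausdorff) locally convex real
topological vector space. -/
structure FrechetSpace : Type (u + 1) where
  carrier : Type u
  [addCommGroup : AddCommGroup carrier]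
  [module : Module ℝ carrier]
  [topology : TopologicalSpace carrier]
  [topAddGroup : IsTopologicalAddGroup carrier]
  [contSMul : ContinuousSMul ℝ carrier]
  [locallyConvex : LocallyConvexSpace ℝ carrier]
  [t2 : T2Space carrier]
  [firstCountable : FirstCountableTopology carrier]
  complete : ∀ a : ℕ → carrier, Tendsto (fun p : ℕ × ℕ => a p.1 - a p.2) atTop (𝓝 0) →
    ∃ l, Tendsto a atTop (𝓝 l)

namespace FrechetSpace

instance : CoeSort FrechetSpace.{u} (Type u) := ⟨FrechetSpace.carrier⟩

attribute [instance] addCommGroup module topology topAddGroup contSMul locallyConvex t2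
  firstCountable

/-- The product of two Fréchet spaces. -/
@[reducible] def prod (E F : FrechetSpace.{u}) : FrechetSpace.{u} where
  carrier := E × F
  complete a ha := by
    obtain ⟨l, hl⟩ := E.complete (fun n => (a n).1) ((continuous_fst.tendsto _).comp ha)
    obtain ⟨l', hl'⟩ := F.complete (fun n => (a n).2) ((continuous_snd.tendsto _).comp ha)
    exact ⟨(l, l'), hl.prodMk_nhds hl'⟩

end FrechetSpace

/-- A smooth Hausdorff manifold modelled on Fréchet spaces, given by an atlas; `chartIdx x` is a
preferred chart around `x`. -/
structure Mfd : Type (u + 1) where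
  carrier : Type u
  [topology : TopologicalSpace carrier]
  [t2 : T2Space carrier]
  ι : Type u
  model : ι → FrechetSpace.{u}
  chart : ∀ i, OpenPartialHomeomorph carrier (model i)
  chartIdx : carrier → ι
  mem_chart : ∀ x, x ∈ (chart (chartIdx x)).source
  smooth_transition : ∀ i j, SmoothOn (fun e => chart j ((chart i).symm e))
    ((chart i).target ∩ (chart i).symm ⁻¹' (chart j).source)

namespace Mfd

instance : CoeSort Mfd.{u} (Type u) := ⟨Mfd.carrier⟩

attribute [instance] topology t2

/-- The tangent space at `x`, identified with the model space of the preferred chart at `x`. -/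
abbrev T (M : Mfd.{u}) (x : M) : FrechetSpace.{u} := M.model (M.chartIdx x)

/-- A Fréchet space as a manifold. -/
@[reducible] def ofFrechet (E : FrechetSpace.{u}) : Mfd.{u} where
  carrier := E
  ι := PUnit
  model _ := E
  chart _ := OpenPartialHomeomorph.refl E
  chartIdx _ := ⟨⟩
  mem_chart _ := mem_univ _
  smooth_transition _ _ n := CkOn.clm n (ContinuousLinearMap.id ℝ E) _

theorem isOpen_overlap (M : Mfd.{u}) (i j : M.ι) :
    IsOpen ((M.chart i).target ∩ (M.chart i).symm ⁻¹' (M.chart j).source) :=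
  (M.chart i).isOpen_inter_preimage_symm (M.chart j).open_source

/-- The product of two manifolds. -/
@[reducible] def prod (M N : Mfd.{u}) : Mfd.{u} where
  carrier := M × N
  ι := M.ι × N.ι
  model i := (M.model i.1).prod (N.model i.2)
  chart i := (M.chart i.1).prod (N.chart i.2)
  chartIdx p := (M.chartIdx p.1, N.chartIdx p.2)
  mem_chart p := ⟨M.mem_chart p.1, N.mem_chart p.2⟩
  smooth_transition i j n := by
    have hO : IsOpen ((((M.chart i.1).target ∩ (M.chart i.1).symm ⁻¹' (M.chart j.1).source)) ×ˢ
        ((N.chart i.2).target ∩ (N.chart i.2).symm ⁻¹' (N.chart j.2).source)) :=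
      (M.isOpen_overlap i.1 j.1).prod (N.isOpen_overlap i.2 j.2)
    refine CkOn.mono (U := (((M.chart i.1).target ∩ (M.chart i.1).symm ⁻¹' (M.chart j.1).source)) ×ˢ
        ((N.chart i.2).target ∩ (N.chart i.2).symm ⁻¹' (N.chart j.2).source)) ?_ ?_
    · have h1 := (M.smooth_transition i.1 j.1 n).comp_clm
        (ContinuousLinearMap.fst ℝ (M.model i.1) (N.model i.2)) hO fun p hp => hp.1
      have h2 := (N.smooth_transition i.2 j.2 n).comp_clm
        (ContinuousLinearMap.snd ℝ (M.model i.1) (N.model i.2)) hO fun p hp => hp.2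
      exact h1.prodMk hO h2
    · rintro p ⟨hp1, hp2⟩
      exact ⟨⟨hp1.1, hp2.1⟩, ⟨hp1.2, hp2.2⟩⟩

end Mfd

/-- The coordinate representation of `f` in the charts `i` and `j`. -/
def rep (M N : Mfd.{u}) (i : M.ι) (j : N.ι) (f : M → N) : M.model i → N.model j :=
  fun e => N.chart j (f ((M.chart i).symm e))

/-- The domain of the coordinate representation of a map defined on `U`. -/
def repDom (M N : Mfd.{u}) (i : M.ι) (j : N.ι) (f : M → N) (U : Set M) : Set (M.model i) :=
  (M.chart i).target ∩ (M.chart i).symm ⁻¹' (U ∩ f ⁻¹' (N.chart j).source)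

/-- Smoothness of `f` on the open subset `U`. -/
def IsSmoothOn (M N : Mfd.{u}) (f : M → N) (U : Set M) : Prop :=
  ContinuousOn f U ∧ ∀ i j, SmoothOn (rep M N i j f) (repDom M N i j f U)

/-- Smooth maps between manifolds. -/
def IsSmooth (M N : Mfd.{u}) (f : M → N) : Prop := IsSmoothOn M N f univ

/-- The derivative of `f` at `x`, followed by the identification (via the chart `j`) of the
tangent space of the target with a model space. -/
def mderivTo (M N : Mfd.{u}) (f : M → N) (x : M) (j : N.ι) (v : M.T x) : N.model j :=
  dirDeriv (rep M N (M.chartIdx x) j f) (M.chart (M.chartIdx x) x) v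

/-- The tangent map `T_x f : T_x M → T_{f x} N`. -/
def mderiv (M N : Mfd.{u}) (f : M → N) (x : M) (v : M.T x) : N.T (f x) :=
  mderivTo M N f x (N.chartIdx (f x)) v

section SmoothMaps

variable {M N K : Mfd.{u}}

theorem isOpen_repDom {f : M → N} {U : Set M} (hU : IsOpen U) (hf : ContinuousOn f U)
    (i : M.ι) (j : N.ι) : IsOpen (repDom M N i j f U) :=
  (M.chart i).isOpen_inter_preimage_symm (hf.isOpen_inter_preimage hU (N.chart j).open_source)

theorem mem_repDom {f : M → N} {U : Set M} {x : M} (hx : x ∈ U) {j : N.ι}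
    (hj : f x ∈ (N.chart j).source) :
    M.chart (M.chartIdx x) x ∈ repDom M N (M.chartIdx x) j f U := by
  have h := M.mem_chart x
  refine ⟨(M.chart _).map_source h, ?_⟩
  rw [mem_preimage, (M.chart _).left_inv h]
  exact ⟨hx, hj⟩

theorem IsSmoothOn.mono {f : M → N} {U V : Set M} (hf : IsSmoothOn M N f U) (h : V ⊆ U) :
    IsSmoothOn M N f V :=
  ⟨hf.1.mono h, fun i j n => (hf.2 i j n).mono fun _ he => ⟨he.1, h he.2.1, he.2.2⟩⟩

theorem IsSmooth.on {f : M → N} (hf : IsSmooth M N f) (U : Set M) : IsSmoothOn M N f U :=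
  IsSmoothOn.mono hf (subset_univ U)

theorem IsSmooth.continuous {f : M → N} (hf : IsSmooth M N f) : Continuous f :=
  continuousOn_univ.1 hf.1

theorem IsSmoothOn.congr {f g : M → N} {U : Set M} (hU : IsOpen U) (hf : IsSmoothOn M N f U)
    (h : EqOn f g U) : IsSmoothOn M N g U := by
  refine ⟨hf.1.congr h.symm, fun i j n => ?_⟩
  have he : repDom M N i j g U = repDom M N i j f U := by
    ext e
    constructor
    · rintro ⟨h1, h2, h3⟩
      exact ⟨h1, h2, by rw [mem_preimage, h h2]; exact h3⟩
    · rintro ⟨h1, h2, h3⟩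
      exact ⟨h1, h2, by rw [mem_preimage, ← h h2]; exact h3⟩
  rw [he]
  refine (hf.2 i j n).congr (isOpen_repDom hU hf.1 i j) fun e he => ?_
  simp only [rep, h he.2.1]

theorem IsSmoothOn.of_local {f : M → N} {U : Set M}
    (h : ∀ x ∈ U, ∃ V, IsOpen V ∧ x ∈ V ∧ IsSmoothOn M N f V) : IsSmoothOn M N f U := by
  refine ⟨fun x hx => ?_, fun i j n => CkOn.of_local fun e he => ?_⟩
  · obtain ⟨V, hV, hxV, hf⟩ := h x hx
    exact (hf.1.continuousAt (hV.mem_nhds hxV)).continuousWithinAt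
  · obtain ⟨V, hV, hxV, hf⟩ := h _ he.2.1
    exact ⟨_, isOpen_repDom hV hf.1 i j, ⟨he.1, hxV, he.2.2⟩, hf.2 i j n⟩

theorem IsSmoothOn.comp {g : N → K} {V : Set N} (hV : IsOpen V) (hg : IsSmoothOn N K g V)
    {f : M → N} {U : Set M} (hU : IsOpen U) (hf : IsSmoothOn M N f U) (h : MapsTo f U V) :
    IsSmoothOn M K (fun x => g (f x)) U := by
  refine ⟨hg.1.comp hf.1 h, fun i k n => CkOn.of_local fun e he => ?_⟩
  set j := N.chartIdx (f ((M.chart i).symm e)) with hj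
  have hO := isOpen_repDom hU hf.1 i j
  have hO' : IsOpen (repDom M K i k (fun x => g (f x)) U) :=
    isOpen_repDom hU (hg.1.comp hf.1 h) i k
  have hO'' := isOpen_repDom hV hg.1 j k
  have hmaps : MapsTo (rep M N i j f)
      (repDom M N i j f U ∩ repDom M K i k (fun x => g (f x)) U) (repDom N K j k g V) := by
    rintro e' ⟨⟨h1, h2, h3⟩, ⟨_, _, h4⟩⟩
    refine ⟨(N.chart j).map_source h3, ?_⟩
    simp only [mem_preimage, rep, (N.chart j).left_inv h3]
    exact ⟨h h2, h4⟩
  refine ⟨_, hO.inter hO', ⟨⟨he.1, he.2.1, N.mem_chart _⟩, he⟩, ?_⟩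
  refine (((hg.2 j k n).comp hO'' (hO.inter hO') ((hf.2 i j n).mono inter_subset_left)
    hmaps)).congr (hO.inter hO') ?_
  rintro e' ⟨⟨h1, h2, h3⟩, _⟩
  simp only [rep, (N.chart j).left_inv h3]

theorem IsSmooth.comp {g : N → K} (hg : IsSmooth N K g) {f : M → N} (hf : IsSmooth M N f) :
    IsSmooth M K (fun x => g (f x)) :=
  IsSmoothOn.comp isOpen_univ hg isOpen_univ hf (mapsTo_univ _ _)

theorem IsSmooth.comp_on {g : N → K} (hg : IsSmooth N K g) {f : M → N} {U : Set M}
    (hU : IsOpen U) (hf : IsSmoothOn M N f U) : IsSmoothOn M K (fun x => g (f x)) U :=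
  IsSmoothOn.comp isOpen_univ hg hU hf (mapsTo_univ _ _)

theorem isSmooth_id : IsSmooth M M (fun x => x) :=
  ⟨continuousOn_id, fun i j n => (M.smooth_transition i j n).mono fun _ he => ⟨he.1, he.2.2⟩⟩

theorem isSmooth_const (y : N) : IsSmooth M N (fun _ => y) :=
  ⟨continuousOn_const, fun _ _ n => CkOn.const n _ _⟩

theorem isSmooth_fst : IsSmooth (M.prod N) M Prod.fst := by
  refine ⟨continuous_fst.continuousOn, fun i j n => ?_⟩
  have hO : IsOpen (repDom (M.prod N) M i j Prod.fst univ) :=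
    isOpen_repDom isOpen_univ continuous_fst.continuousOn i j
  exact (M.smooth_transition i.1 j n).comp_clm (ContinuousLinearMap.fst ℝ _ _) hO
    fun e he => ⟨he.1.1, he.2.2⟩

theorem isSmooth_snd : IsSmooth (M.prod N) N Prod.snd := by
  refine ⟨continuous_snd.continuousOn, fun i j n => ?_⟩
  have hO : IsOpen (repDom (M.prod N) N i j Prod.snd univ) :=
    isOpen_repDom isOpen_univ continuous_snd.continuousOn i j
  exact (N.smooth_transition i.2 j n).comp_clm (ContinuousLinearMap.snd ℝ _ _) hO
    fun e he => ⟨he.1.2, he.2.2⟩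

theorem IsSmoothOn.prodMk {f : M → N} {g : M → K} {U : Set M} (hU : IsOpen U)
    (hf : IsSmoothOn M N f U) (hg : IsSmoothOn M K g U) :
    IsSmoothOn M (N.prod K) (fun x => (f x, g x)) U := by
  refine ⟨hf.1.prodMk hg.1, fun i j n => ?_⟩
  have hO : IsOpen (repDom M (N.prod K) i j (fun x => (f x, g x)) U) :=
    isOpen_repDom hU (hf.1.prodMk hg.1) i j
  exact CkOn.prodMk hO ((hf.2 i j.1 n).mono fun e he => ⟨he.1, he.2.1, he.2.2.1⟩)
    ((hg.2 i j.2 n).mono fun e he => ⟨he.1, he.2.1, he.2.2.2⟩)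

theorem IsSmooth.prodMk {f : M → N} {g : M → K} (hf : IsSmooth M N f) (hg : IsSmooth M K g) :
    IsSmooth M (N.prod K) (fun x => (f x, g x)) :=
  IsSmoothOn.prodMk isOpen_univ hf hg

theorem rep_comp_eventuallyEq {f : M → N} {U : Set M} (hU : IsOpen U)
    (hf : IsSmoothOn M N f U) {x : M} (hx : x ∈ U) {j : N.ι}
    (hj : f x ∈ (N.chart j).source) (g : N → K) (k : K.ι) :
    rep M K (M.chartIdx x) k (fun x => g (f x)) =ᶠ[𝓝 (M.chart (M.chartIdx x) x)]
      fun e => rep N K j k g (rep M N (M.chartIdx x) j f e) := by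
  filter_upwards [(isOpen_repDom hU hf.1 (M.chartIdx x) j).mem_nhds (mem_repDom hx hj)]
    with e he
  simp only [rep, (N.chart j).left_inv he.2.2]

/-- The chain rule. -/
theorem mderivTo_comp {g : N → K} {V : Set N} (hV : IsOpen V) (hg : IsSmoothOn N K g V)
    {f : M → N} {U : Set M} (hU : IsOpen U) (hf : IsSmoothOn M N f U) {x : M} (hx : x ∈ U)
    {y : N} (hxy : f x = y) (hy : y ∈ V) {k : K.ι} (hk : g y ∈ (K.chart k).source) (v : M.T x) :
    mderivTo M K (fun x => g (f x)) x k v =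
      mderivTo N K g y k (mderivTo M N f x (N.chartIdx y) v) := by
  subst hxy
  have h1 := rep_comp_eventuallyEq hU hf hx (N.mem_chart (f x)) g k
  have hfx : rep M N (M.chartIdx x) (N.chartIdx (f x)) f (M.chart (M.chartIdx x) x) =
      N.chart (N.chartIdx (f x)) (f x) := by
    simp only [rep, (M.chart _).left_inv (M.mem_chart x)]
  have h2 : HasDirDeriv (rep M N (M.chartIdx x) (N.chartIdx (f x)) f) (M.chart (M.chartIdx x) x) v
      (mderivTo M N f x (N.chartIdx (f x)) v) :=
    hasDirDeriv_dirDeriv ((hf.2 _ _ 1).2.1 _ (mem_repDom hx (N.mem_chart _)) v)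
  have hg1 := hg.2 (N.chartIdx (f x)) k 1
  have hO := isOpen_repDom hV hg.1 (N.chartIdx (f x)) k
  have hmem : rep M N (M.chartIdx x) (N.chartIdx (f x)) f (M.chart (M.chartIdx x) x) ∈
      repDom N K (N.chartIdx (f x)) k g V := by
    rw [hfx]; exact mem_repDom hy hk
  have h3 := h2.comp hO hg1 hmem
  rw [hfx] at h3
  unfold mderivTo at h3 ⊢
  rw [dirDeriv_congr h1 v]
  exact h3.dirDeriv

theorem mderiv_comp {g : N → K} (hg : IsSmooth N K g) {f : M → N} (hf : IsSmooth M N f)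
    (x : M) (v : M.T x) :
    mderiv M K (fun x => g (f x)) x v = mderiv N K g (f x) (mderiv M N f x v) :=
  mderivTo_comp isOpen_univ hg isOpen_univ hf (mem_univ x) rfl (mem_univ _) (K.mem_chart _) v

theorem mderivTo_add {f : M → N} {U : Set M} (hU : IsOpen U) (hf : IsSmoothOn M N f U)
    {x : M} (hx : x ∈ U) {j : N.ι} (hj : f x ∈ (N.chart j).source) (v w : M.T x) :
    mderivTo M N f x j (v + w) = mderivTo M N f x j v + mderivTo M N f x j w :=
  (hf.2 _ j 1).dirDeriv_add (isOpen_repDom hU hf.1 _ _) (mem_repDom hx hj) v w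

theorem mderivTo_congr {f g : M → N} {x : M} (h : f =ᶠ[𝓝 x] g) (j : N.ι) (v : M.T x) :
    mderivTo M N f x j v = mderivTo M N g x j v := by
  refine dirDeriv_congr ?_ v
  have h1 : ContinuousAt (M.chart (M.chartIdx x)).symm (M.chart (M.chartIdx x) x) :=
    (M.chart _).continuousAt_symm ((M.chart _).map_source (M.mem_chart x))
  have h2 : Tendsto (M.chart (M.chartIdx x)).symm (𝓝 (M.chart (M.chartIdx x) x)) (𝓝 x) := by
    have := h1.tendsto
    rwa [(M.chart _).left_inv (M.mem_chart x)] at this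
  filter_upwards [h2.eventually h] with e he
  simp only [rep, he]

theorem mderivTo_prodMk {f : M → N} {g : M → K} {U : Set M}
    (hf : IsSmoothOn M N f U) (hg : IsSmoothOn M K g U) {x : M} (hx : x ∈ U) {j : N.ι} {k : K.ι}
    (hj : f x ∈ (N.chart j).source) (hk : g x ∈ (K.chart k).source) (v : M.T x) :
    mderivTo M (N.prod K) (fun x => (f x, g x)) x (j, k) v =
      (mderivTo M N f x j v, mderivTo M K g x k v) :=
  ((hasDirDeriv_dirDeriv ((hf.2 _ _ 1).2.1 _ (mem_repDom hx hj) v)).prodMk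
    (hasDirDeriv_dirDeriv ((hg.2 _ _ 1).2.1 _ (mem_repDom hx hk) v))).dirDeriv

theorem mderivTo_id (x : M) (v : M.T x) :
    mderivTo M M (fun x => x) x (M.chartIdx x) v = v := by
  unfold mderivTo
  rw [dirDeriv_congr (g := ContinuousLinearMap.id ℝ (M.model (M.chartIdx x)))]
  · exact (hasDirDeriv_clm (ContinuousLinearMap.id ℝ (M.model (M.chartIdx x))) _ v).dirDeriv
  · filter_upwards [(M.chart _).open_target.mem_nhds ((M.chart _).map_source (M.mem_chart x))]
      with e he
    simp only [rep, (M.chart _).right_inv he]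
    rfl

theorem mderivTo_const (x : M) (y : N) (j : N.ι) (v : M.T x) :
    mderivTo M N (fun _ => y) x j v = 0 :=
  (hasDirDeriv_const _ _ _).dirDeriv

end SmoothMaps

/-! ### Differential forms -/

/-- Families of maps `T_x M → V`; the underlying data of a `V`-valued 1-form. -/
abbrev Fam1 (M : Mfd.{u}) (V : FrechetSpace.{u}) : Type u := ∀ x : M, M.T x → V

/-- Families of maps `T_x M × T_x M → V`; the underlying data of a `V`-valued 2-form. -/
abbrev Fam2 (M : Mfd.{u}) (V : FrechetSpace.{u}) : Type u := ∀ x : M, M.T x → M.T x → V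

/-- The tangent vector at `x` that is represented by `v` in the chart `i`. -/
def chartVec (M : Mfd.{u}) (i : M.ι) (x : M) (v : M.model i) : M.T x :=
  dirDeriv (rep M M i (M.chartIdx x) (fun y => y)) (M.chart i x) v

/-- Smooth `V`-valued 1-forms. -/
structure IsForm1 (M : Mfd.{u}) (V : FrechetSpace.{u}) (ω : Fam1 M V) : Prop where
  add : ∀ x v w, ω x (v + w) = ω x v + ω x w
  smul : ∀ x (c : ℝ) v, ω x (c • v) = c • ω x v
  smooth : ∀ i, SmoothOn (fun p : M.model i × M.model i =>
      ω ((M.chart i).symm p.1) (chartVec M i ((M.chart i).symm p.1) p.2))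
    ((M.chart i).target ×ˢ (univ : Set (M.model i)))

/-- Smooth `V`-valued 2-forms. -/
structure IsForm2 (M : Mfd.{u}) (V : FrechetSpace.{u}) (β : Fam2 M V) : Prop where
  add : ∀ x v v' w, β x (v + v') w = β x v w + β x v' w
  smul : ∀ x (c : ℝ) v w, β x (c • v) w = c • β x v w
  antisymm : ∀ x v w, β x v w = - β x w v
  smooth : ∀ i, SmoothOn (fun p : M.model i × (M.model i × M.model i) =>
      β ((M.chart i).symm p.1) (chartVec M i ((M.chart i).symm p.1) p.2.1)
        (chartVec M i ((M.chart i).symm p.1) p.2.2))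
    ((M.chart i).target ×ˢ (univ : Set (M.model i × M.model i)))

/-- Pullback of 1-forms. -/
def pull {M N : Mfd.{u}} {V : FrechetSpace.{u}} (f : M → N) (ω : Fam1 N V) : Fam1 M V :=
  fun x v => ω (f x) (mderiv M N f x v)

/-- Pullback of 2-forms. -/
def pull2 {M N : Mfd.{u}} {V : FrechetSpace.{u}} (f : M → N) (β : Fam2 N V) : Fam2 M V :=
  fun x v w => β (f x) (mderiv M N f x v) (mderiv M N f x w)

/-- The exterior derivative of a 1-form, `dω(v, w) = ∂_v (ω(w)) - ∂_w (ω(v))`, computed with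
constant vector fields in the preferred chart at `x`. -/
def extD {M : Mfd.{u}} {V : FrechetSpace.{u}} (ω : Fam1 M V) : Fam2 M V :=
  fun x v w =>
    dirDeriv (fun e => ω ((M.chart (M.chartIdx x)).symm e)
        (chartVec M (M.chartIdx x) ((M.chart (M.chartIdx x)).symm e) w))
      (M.chart (M.chartIdx x) x) v
    - dirDeriv (fun e => ω ((M.chart (M.chartIdx x)).symm e)
        (chartVec M (M.chartIdx x) ((M.chart (M.chartIdx x)).symm e) v))
      (M.chart (M.chartIdx x) x) w

/-- The wedge product of 1-forms with respect to a pairing `b` of their values,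
`b(ω ∧ η)(v, w) = b(ω(v), η(w)) - b(ω(w), η(v))`. -/
def wedge {M : Mfd.{u}} {V V' V'' : FrechetSpace.{u}} (b : V → V' → V'') (ω : Fam1 M V)
    (η : Fam1 M V') : Fam2 M V'' :=
  fun x v w => b (ω x v) (η x w) - b (ω x w) (η x v)

/-! ### Submersions and fibre products -/

/-- Submersions: smooth maps that locally are projections `X × F → X`. -/
def IsSubmersion (Y X : Mfd.{u}) (π : Y → X) : Prop :=
  IsSmooth Y X π ∧ ∀ y : Y, ∃ (F : FrechetSpace.{u})
    (ψ : OpenPartialHomeomorph Y (X.prod (Mfd.ofFrechet F))), y ∈ ψ.source ∧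
      IsSmoothOn Y (X.prod (Mfd.ofFrechet F)) ψ ψ.source ∧
      IsSmoothOn (X.prod (Mfd.ofFrechet F)) Y ψ.symm ψ.target ∧
      ∀ z ∈ ψ.source, (ψ z).1 = π z

/-- `W`, with the projections `p₁` and `p₂`, is the fibre product of `π₁` and `π₂` in the category
of smooth manifolds. -/
def IsFiberProduct {Y₁ Y₂ X W : Mfd.{u}} (π₁ : Y₁ → X) (π₂ : Y₂ → X) (p₁ : W → Y₁)
    (p₂ : W → Y₂) : Prop :=
  IsSmooth W Y₁ p₁ ∧ IsSmooth W Y₂ p₂ ∧ (∀ w, π₁ (p₁ w) = π₂ (p₂ w)) ∧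
    ∀ (Z : Mfd.{u}) (f₁ : Z → Y₁) (f₂ : Z → Y₂), IsSmooth Z Y₁ f₁ → IsSmooth Z Y₂ f₂ →
      (∀ z, π₁ (f₁ z) = π₂ (f₂ z)) →
      ∃! f : Z → W, IsSmooth Z W f ∧ (∀ z, p₁ (f z) = f₁ z) ∧ ∀ z, p₂ (f z) = f₂ z

/-! ### Lie groups -/

/-- A (possibly infinite-dimensional) Fréchet Lie group. -/
structure FLieGroup : Type (u + 1) extends Mfd.{u} where
  [group : Group carrier]
  smooth_mul : IsSmooth (toMfd.prod toMfd) toMfd (fun p : carrier × carrier => p.1 * p.2)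
  smooth_inv : IsSmooth toMfd toMfd (fun g : carrier => g⁻¹)

attribute [instance] FLieGroup.group

instance : CoeSort FLieGroup.{u} (Type u) := ⟨fun G => G.carrier⟩

instance : Coe FLieGroup.{u} Mfd.{u} := ⟨FLieGroup.toMfd⟩

namespace FLieGroup

/-- The index of the preferred chart at the unit. -/
abbrev e (G : FLieGroup.{u}) : G.ι := G.chartIdx (1 : G)

/-- The (underlying Fréchet space of the) Lie algebra, i.e. the tangent space at the unit. -/
abbrev lie (G : FLieGroup.{u}) : FrechetSpace.{u} := G.T (1 : G)

/-- The adjoint action. -/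
def Ad (G : FLieGroup.{u}) (g : G) (X : G.lie) : G.lie :=
  mderivTo G G (fun x : G => g * x * g⁻¹) 1 G.e X

/-- The Lie bracket, as the derivative of the adjoint action. -/
def bracket (G : FLieGroup.{u}) (X Y : G.lie) : G.lie :=
  mderivTo G (Mfd.ofFrechet G.lie) (fun g : G => G.Ad g Y) 1 ⟨⟩ X

/-- The pullback `f^*θ` of the left-invariant Maurer--Cartan form. -/
def leftMC (G : FLieGroup.{u}) {M : Mfd.{u}} (f : M → G) : Fam1 M G.lie :=
  fun x v => mderivTo M G (fun y => (f x)⁻¹ * f y) x G.e v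

/-- The pullback `f^*θ̄` of the right-invariant Maurer--Cartan form. -/
def rightMC (G : FLieGroup.{u}) {M : Mfd.{u}} (f : M → G) : Fam1 M G.lie :=
  fun x v => mderivTo M G (fun y => f y * (f x)⁻¹) x G.e v

end FLieGroup

/-- A Lie 2-group, i.e. a crossed module of Fréchet Lie groups. -/
structure LieTwoGroup : Type (u + 1) where
  H : FLieGroup.{u}
  G : FLieGroup.{u}
  t : H →* G
  α : G →* MulAut H
  smooth_t : IsSmooth H G t
  smooth_α : IsSmooth (G.prod H.toMfd) H (fun p : G × H => α p.1 p.2)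
  t_α : ∀ (g : G) (h : H), t (α g h) = g * t h * g⁻¹
  α_t : ∀ h h' : H, α (t h) h' = h * h' * h⁻¹

namespace LieTwoGroup

variable (Γ : LieTwoGroup.{u})

/-- The Lie algebra of `G`. -/
abbrev 𝔤 : FrechetSpace.{u} := Γ.G.lie

/-- The Lie algebra of `H`. -/
abbrev 𝔥 : FrechetSpace.{u} := Γ.H.lie

/-- The Lie algebra homomorphism `t_*`. -/
def tStar (Y : Γ.𝔥) : Γ.𝔤 := mderivTo Γ.H Γ.G Γ.t 1 Γ.G.e Y

/-- The Lie algebra automorphism `(α_g)_*`. -/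
def αStar (g : Γ.G) (Y : Γ.𝔥) : Γ.𝔥 := mderivTo Γ.H Γ.H (Γ.α g) 1 Γ.H.e Y

/-- The derivative `(α̃_h)_*` at the unit of the map `α̃_h : G → H`, `g ↦ h⁻¹ α(g, h)`. -/
def αTilde (h : Γ.H) (X : Γ.𝔤) : Γ.𝔥 :=
  mderivTo Γ.G Γ.H (fun g : Γ.G => h⁻¹ * Γ.α g h) 1 Γ.H.e X

/-- The infinitesimal action `α_*` of the Lie algebra of `G` on the one of `H`. -/
def αLie (X : Γ.𝔤) (Y : Γ.𝔥) : Γ.𝔥 :=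
  mderivTo Γ.G (Mfd.ofFrechet Γ.𝔥) (fun g : Γ.G => Γ.αStar g Y) 1 ⟨⟩ X

/-- A Lie 2-group is central if `G` (equivalently, `G/t(H)`) acts trivially on `ker t`. -/
def IsCentral : Prop := ∀ (g : Γ.G) (h : Γ.H), Γ.t h = 1 → Γ.α g h = h

/-- Adjustments. -/
structure IsAdjustment (κ : Γ.G → Γ.𝔤 → Γ.𝔥) : Prop where
  add : ∀ g X Y, κ g (X + Y) = κ g X + κ g Y
  smul : ∀ g (c : ℝ) X, κ g (c • X) = c • κ g X
  continuous : ∀ g, Continuous (κ g)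
  smooth : ∀ X, IsSmooth Γ.G (Mfd.ofFrechet Γ.𝔥) (fun g => κ g X)
  map_mul : ∀ g₁ g₂ X, κ (g₁ * g₂) X = κ g₁ (Γ.G.Ad g₂ X) + κ g₂ X
  map_t : ∀ h X, κ (Γ.t h) X = Γ.αTilde h⁻¹ X
  map_tStar : ∀ g Y, κ g (Γ.tStar Y) = Γ.αStar g Y - Y

end LieTwoGroup

/-! ### `Γ`-connections and gauge transformations -/

section Gauge

variable (Γ : LieTwoGroup.{u})

/-- A `Γ`-connection on `X`. -/
structure GammaConnection (X : Mfd.{u}) : Type u where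
  A : Fam1 X Γ.𝔤
  B : Fam2 X Γ.𝔥
  isForm_A : IsForm1 X Γ.𝔤 A
  isForm_B : IsForm2 X Γ.𝔥 B

/-- The fake curvature `dA + ½[A ∧ A] - t_*(B)`. -/
def fcurv {M : Mfd.{u}} (A : Fam1 M Γ.𝔤) (B : Fam2 M Γ.𝔥) : Fam2 M Γ.𝔤 :=
  fun x v w => extD A x v w + (1 / 2 : ℝ) • wedge Γ.G.bracket A A x v w - Γ.tStar (B x v w)

/-- A `Γ`-connection is fake-flat if its fake curvature vanishes. -/
def GammaConnection.FakeFlat {Γ : LieTwoGroup.{u}} {X : Mfd.{u}} (D : GammaConnection Γ X) :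
    Prop := ∀ x v w, fcurv Γ D.A D.B x v w = 0

/-- `(g, φ)` is a gauge transformation between connections with 1-forms `A` and `A'`:
`A' + t_*(φ) = Ad_g(A) - g^*θ̄`. -/
structure IsGaugeTransf {M : Mfd.{u}} (A A' : Fam1 M Γ.𝔤) (g : M → Γ.G) (φ : Fam1 M Γ.𝔥) :
    Prop where
  smooth : IsSmooth M Γ.G g
  isForm : IsForm1 M Γ.𝔥 φ
  eq : ∀ x v, A' x v + Γ.tStar (φ x v) = Γ.G.Ad (g x) (A x v) - Γ.G.rightMC g x v

/-- The expression `dφ + ½[φ ∧ φ] + α_*(A' ∧ φ) + B' - (α_g)_*(B)`. This is the curvature of a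
gauge transformation `(g, φ) : (A, B) → (A', B')`, and also the `B`-`B'`-curvature of an
`A`-`A'`-connection `φ` on a bundle with anchor `g`. -/
def gcurv {M : Mfd.{u}} (A' : Fam1 M Γ.𝔤) (B B' : Fam2 M Γ.𝔥) (g : M → Γ.G)
    (φ : Fam1 M Γ.𝔥) : Fam2 M Γ.𝔥 :=
  fun x v w => extD φ x v w + (1 / 2 : ℝ) • wedge Γ.H.bracket φ φ x v w
    + wedge Γ.αLie A' φ x v w + B' x v w - Γ.αStar (g x) (B x v w)

/-- `h` is, over the open subset `U`, a gauge 2-transformation `(g₁, φ₁) ⇒ (g₂, φ₂)` between gauge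
transformations with target 1-form `A'`: `g₂ = (t ∘ h) g₁` and
`Ad_h⁻¹(φ₂) + (α̃_h)_*(A') = φ₁ - h^*θ`. -/
structure IsGauge2On {M : Mfd.{u}} (U : Set M) (A' : Fam1 M Γ.𝔤) (g₁ : M → Γ.G)
    (φ₁ : Fam1 M Γ.𝔥) (g₂ : M → Γ.G) (φ₂ : Fam1 M Γ.𝔥) (h : M → Γ.H) : Prop where
  smooth : IsSmoothOn M Γ.H h U
  eq_g : ∀ x ∈ U, g₂ x = Γ.t (h x) * g₁ x
  eq_φ : ∀ x ∈ U, ∀ v, Γ.H.Ad (h x)⁻¹ (φ₂ x v) + Γ.αTilde (h x) (A' x v) =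
    φ₁ x v - Γ.H.leftMC h x v

/-- `h` is a gauge 2-transformation `pr₁^*(g₁, φ₁) ⇒ pr₂^*(g₂, φ₂)` over the fibre product
`Y₁ ×_X Y₂`. As smooth maps into this fibre product are pairs of smooth maps into `Y₁` and `Y₂`
that agree over `X`, this is expressed by pulling `h` back along all such pairs. -/
def IsGauge2 {X Y₁ Y₂ : Mfd.{u}} (π₁ : Y₁ → X) (π₂ : Y₂ → X) (A' : Fam1 X Γ.𝔤)
    (g₁ : Y₁ → Γ.G) (φ₁ : Fam1 Y₁ Γ.𝔥) (g₂ : Y₂ → Γ.G) (φ₂ : Fam1 Y₂ Γ.𝔥)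
    (h : ∀ (y₁ : Y₁) (y₂ : Y₂), π₁ y₁ = π₂ y₂ → Γ.H) : Prop :=
  ∀ (Z : Mfd.{u}) (U : Set Z) (z₁ : Z → Y₁) (z₂ : Z → Y₂) (e : ∀ z, π₁ (z₁ z) = π₂ (z₂ z)),
    IsOpen U → IsSmoothOn Z Y₁ z₁ U → IsSmoothOn Z Y₂ z₂ U →
    IsGauge2On Γ U (pull (fun z => π₁ (z₁ z)) A') (fun z => g₁ (z₁ z)) (pull z₁ φ₁)
      (fun z => g₂ (z₂ z)) (pull z₂ φ₂) (fun z => h (z₁ z) (z₂ z) (e z))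

end Gauge

/-! ### Calculus on Lie groups -/

section LieCalculus

variable {G : FLieGroup.{u}} {M : Mfd.{u}}

theorem isSmoothOn_mul {f g : M → G} {U : Set M} (hU : IsOpen U) (hf : IsSmoothOn M G f U)
    (hg : IsSmoothOn M G g U) : IsSmoothOn M G (fun x => f x * g x) U :=
  IsSmooth.comp_on G.smooth_mul hU (hf.prodMk hU hg)

theorem mderivTo_mul_one {f g : M → G} {U : Set M} (hU : IsOpen U) (hf : IsSmoothOn M G f U)
    (hg : IsSmoothOn M G g U) {x : M} (hx : x ∈ U) (hfx : f x = 1) (hgx : g x = 1)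
    (v : M.T x) :
    mderivTo M G (fun y => f y * g y) x G.e v =
      mderivTo M G f x G.e v + mderivTo M G g x G.e v := by
  have h1 : (1 : G) ∈ (G.chart G.e).source := G.mem_chart 1
  have hk : (((1 : G), (1 : G)) : G × G).1 * (((1 : G), (1 : G)) : G × G).2 ∈
      (G.chart G.e).source := by simpa using h1
  have hmul : ∀ (M' : Mfd.{u}) (f' g' : M' → G) (U' : Set M'), IsOpen U' →
      IsSmoothOn M' G f' U' → IsSmoothOn M' G g' U' → ∀ x' ∈ U', f' x' = 1 → g' x' = 1 → ∀ v',
      mderivTo M' G (fun y => f' y * g' y) x' G.e v' =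
        mderivTo (G.prod G.toMfd) G (fun p : G × G => p.1 * p.2) ((1 : G), (1 : G)) G.e
          (mderivTo M' G f' x' G.e v', mderivTo M' G g' x' G.e v') := by
    intro M' f' g' U' hU' hf' hg' x' hx' hfx' hgx' v'
    have h2 := mderivTo_comp isOpen_univ G.smooth_mul hU' (hf'.prodMk hU' hg') hx'
      (y := ((1 : G), (1 : G))) (by rw [hfx', hgx']) (mem_univ _) hk v'
    refine h2.trans ?_
    congr 1
    exact mderivTo_prodMk hf' hg' hx' (by rw [hfx']; exact h1) (by rw [hgx']; exact h1) v'
  have hadd := mderivTo_add isOpen_univ G.smooth_mul (mem_univ ((1 : G), (1 : G))) hk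
    (mderivTo M G f x G.e v, 0) (0, mderivTo M G g x G.e v)
  have hl := hmul G (fun y => y) (fun _ => 1) univ isOpen_univ isSmooth_id (isSmooth_const 1) 1
    (mem_univ _) rfl rfl (mderivTo M G f x G.e v)
  have hr := hmul G (fun _ => 1) (fun y => y) univ isOpen_univ (isSmooth_const 1) isSmooth_id 1
    (mem_univ _) rfl rfl (mderivTo M G g x G.e v)
  rw [mderivTo_const, mderivTo_id] at hl hr
  simp only [mul_one, one_mul, mderivTo_id] at hl hr
  refine (hmul M f g U hU hf hg x hx hfx hgx v).trans
    (Eq.trans ?_ (hadd.trans (congrArg₂ (· + ·) hl.symm hr.symm)))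
  congr 1
  exact Prod.ext (add_zero _).symm (zero_add _).symm

theorem isSmooth_mulLeft (g : G) : IsSmooth G G (fun x : G => g * x) :=
  isSmoothOn_mul isOpen_univ (isSmooth_const g) isSmooth_id

theorem isSmooth_conj (g : G) : IsSmooth G G (fun x : G => g * x * g⁻¹) :=
  isSmoothOn_mul isOpen_univ (isSmooth_mulLeft g) (isSmooth_const g⁻¹)

theorem conj_one_mem (g : G) : g * 1 * g⁻¹ ∈ (G.chart G.e).source := by
  simpa using G.mem_chart 1

theorem mderivTo_conj {f : M → G} {U : Set M} (hU : IsOpen U) (hf : IsSmoothOn M G f U) {x : M}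
    (hx : x ∈ U) (hfx : f x = 1) (g : G) (v : M.T x) :
    mderivTo M G (fun y => g * f y * g⁻¹) x G.e v = G.Ad g (mderivTo M G f x G.e v) :=
  mderivTo_comp isOpen_univ (isSmooth_conj g) hU hf hx hfx (mem_univ _) (conj_one_mem g) v

theorem Ad_mul (g g' : G) (X : G.lie) : G.Ad (g * g') X = G.Ad g (G.Ad g' X) := by
  have h := mderivTo_conj (M := G) isOpen_univ (isSmooth_conj g') (mem_univ (1 : G)) (by simp) g X
  rw [← FLieGroup.Ad] at h
  rw [← h, FLieGroup.Ad]
  congr 1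
  funext y
  group

theorem Ad_add (g : G) (X Y : G.lie) : G.Ad g (X + Y) = G.Ad g X + G.Ad g Y :=
  mderivTo_add isOpen_univ (isSmooth_conj g) (mem_univ (1 : G)) (conj_one_mem g) X Y

theorem leftMC_mul {f g : M → G} {U : Set M} (hU : IsOpen U) (hf : IsSmoothOn M G f U)
    (hg : IsSmoothOn M G g U) {x : M} (hx : x ∈ U) (v : M.T x) :
    G.leftMC (fun y => f y * g y) x v =
      G.Ad (g x)⁻¹ (G.leftMC f x v) + G.leftMC g x v := by
  have hf' : IsSmoothOn M G (fun y => (f x)⁻¹ * f y) U := (isSmooth_mulLeft _).comp_on hU hf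
  have hg' : IsSmoothOn M G (fun y => (g x)⁻¹ * g y) U := (isSmooth_mulLeft _).comp_on hU hg
  have hc := mderivTo_conj hU hf' hx (by simp) (g x)⁻¹ v
  have hm := mderivTo_mul_one hU ((isSmooth_conj (g x)⁻¹).comp_on hU hf') hg' hx (by simp)
    (by simp) v
  rw [hc] at hm
  unfold FLieGroup.leftMC
  rw [← hm]
  congr 1
  funext y
  group

end LieCalculus

section TwoGroupCalculus

variable (Γ : LieTwoGroup.{u})

theorem isSmooth_tilde (h : Γ.H) : IsSmooth Γ.G Γ.H (fun g : Γ.G => h⁻¹ * Γ.α g h) :=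
  (isSmooth_mulLeft h⁻¹).comp
    (IsSmooth.comp (M := Γ.G) Γ.smooth_α (isSmooth_id.prodMk (isSmooth_const h)))

theorem αTilde_mul (h h' : Γ.H) (X : Γ.𝔤) :
    Γ.αTilde (h * h') X = Γ.H.Ad h'⁻¹ (Γ.αTilde h X) + Γ.αTilde h' X := by
  have hc := mderivTo_conj isOpen_univ (isSmooth_tilde Γ h) (mem_univ (1 : Γ.G)) (by simp) h'⁻¹ X
  have hm := mderivTo_mul_one isOpen_univ ((isSmooth_conj h'⁻¹).comp (isSmooth_tilde Γ h))
    (isSmooth_tilde Γ h') (mem_univ (1 : Γ.G)) (by simp) (by simp) X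
  rw [hc] at hm
  unfold LieTwoGroup.αTilde
  rw [← hm]
  congr 1
  funext g
  rw [map_mul]
  group

theorem pull_congr {M N : Mfd.{u}} {V : FrechetSpace.{u}} {f g : M → N} {x : M}
    (h : f =ᶠ[𝓝 x] g) (ω : Fam1 N V) (v : M.T x) : pull f ω x v = pull g ω x v := by
  have h1 : ∀ y : N, f x = y → pull f ω x v = ω y (mderivTo M N f x (N.chartIdx y) v) := by
    rintro y rfl; rfl
  rw [h1 (g x) h.eq_of_nhds, mderivTo_congr h]
  rfl

/-- Vertical composition of gauge 2-transformations. -/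
theorem IsGauge2On.vcomp {M : Mfd.{u}} {U : Set M} (hU : IsOpen U) {A' : Fam1 M Γ.𝔤}
    {g₁ g₂ g₃ : M → Γ.G} {φ₁ φ₂ φ₃ : Fam1 M Γ.𝔥} {h h' : M → Γ.H}
    (H : IsGauge2On Γ U A' g₁ φ₁ g₂ φ₂ h) (H' : IsGauge2On Γ U A' g₂ φ₂ g₃ φ₃ h') :
    IsGauge2On Γ U A' g₁ φ₁ g₃ φ₃ (fun x => h' x * h x) where
  smooth := isSmoothOn_mul hU H'.smooth H.smooth
  eq_g x hx := by rw [H'.eq_g x hx, H.eq_g x hx, map_mul, mul_assoc]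
  eq_φ x hx v := by
    have e1 := H.eq_φ x hx v
    have e2 := H'.eq_φ x hx v
    rw [eq_sub_iff_add_eq] at e1 e2 ⊢
    rw [leftMC_mul hU H'.smooth H.smooth hx, αTilde_mul, mul_inv_rev, Ad_mul, ← e1, ← e2,
      Ad_add, Ad_add]
    abel

end TwoGroupCalculus

/-! ### Local data: the Hom-closure of the presheaf of `Γ`-connections -/

section Local

variable {Γ : LieTwoGroup.{u}} {X : Mfd.{u}}

/-- A 1-morphism `(π, φ, g, a) : D → D'` in the Hom-closure of the presheaf of `Γ`-connections. -/
structure LocalData (D D' : GammaConnection Γ X) : Type (u + 1) where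
  Y : Mfd.{u}
  π : Y → X
  submersion : IsSubmersion Y X π
  surjective : Function.Surjective π
  g : Y → Γ.G
  φ : Fam1 Y Γ.𝔥
  gauge : IsGaugeTransf Γ (pull π D.A) (pull π D'.A) g φ
  a : ∀ y₁ y₂ : Y, π y₁ = π y₂ → Γ.H
  gauge_a : IsGauge2 Γ π π D'.A g φ g φ a
  cocycle : ∀ (y y' y'' : Y) (e : π y = π y') (e' : π y' = π y''),
    a y' y'' e' * a y y' e = a y y'' (e.trans e')

/-- 2-morphisms in the Hom-closure. -/
@[ext] structure LocalData.Hom {D D' : GammaConnection Γ X} (L₁ L₂ : LocalData D D') :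
    Type u where
  h : ∀ (y₁ : L₁.Y) (y₂ : L₂.Y), L₁.π y₁ = L₂.π y₂ → Γ.H
  gauge : IsGauge2 Γ L₁.π L₂.π D'.A L₁.g L₁.φ L₂.g L₂.φ h
  comm : ∀ (y₁ y₁' : L₁.Y) (y₂ y₂' : L₂.Y) (e : L₁.π y₁ = L₂.π y₂) (e₁ : L₁.π y₁ = L₁.π y₁')
    (e₂ : L₂.π y₂ = L₂.π y₂'),
    L₂.a y₂ y₂' e₂ * h y₁ y₂ e = h y₁' y₂' (e₁.symm.trans (e.trans e₂)) * L₁.a y₁ y₁' e₁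

namespace LocalData

variable {D D' : GammaConnection Γ X}

theorem a_self (L : LocalData D D') (y : L.Y) : L.a y y rfl = 1 := by
  have h := L.cocycle y y y rfl rfl
  exact mul_eq_left.1 h

/-- The identity 2-morphism is given by `a`. -/
def Hom.id (L : LocalData D D') : Hom L L where
  h := L.a
  gauge := L.gauge_a
  comm y₁ y₁' y₂ y₂' e e₁ e₂ := by rw [L.cocycle, L.cocycle]

theorem Hom.comp_indep {L₁ L₂ L₃ : LocalData D D'} (h : Hom L₁ L₂) (h' : Hom L₂ L₃)
    (y₁ : L₁.Y) (y₃ : L₃.Y) (y₂ y₂' : L₂.Y) (e : L₁.π y₁ = L₂.π y₂) (e' : L₁.π y₁ = L₂.π y₂')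
    (f : L₂.π y₂ = L₃.π y₃) (f' : L₂.π y₂' = L₃.π y₃) :
    h'.h y₂ y₃ f * h.h y₁ y₂ e = h'.h y₂' y₃ f' * h.h y₁ y₂' e' := by
  have h1 := h.comm y₁ y₁ y₂ y₂' e rfl (e.symm.trans e')
  have h2 := h'.comm y₂ y₂' y₃ y₃ f (e.symm.trans e') rfl
  rw [a_self, mul_one] at h1
  rw [a_self, one_mul] at h2
  rw [h2, mul_assoc, h1]

/-- A point of `Y` over a given point of `X`. -/
def lift (L : LocalData D D') (x : X) : L.Y := (L.surjective x).choose

theorem π_lift (L : LocalData D D') (x : X) : L.π (L.lift x) = x := (L.surjective x).choose_spec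

end LocalData

/-- Submersions have smooth local sections. -/
theorem IsSubmersion.exists_section {Y X : Mfd.{u}} {π : Y → X} (hπ : IsSubmersion Y X π)
    (y : Y) : ∃ (V : Set X) (s : X → Y), IsOpen V ∧ π y ∈ V ∧ IsSmoothOn X Y s V ∧
      ∀ x ∈ V, π (s x) = x := by
  obtain ⟨F, ψ, hy, -, hψ', hpr⟩ := hπ.2 y
  have hc : IsSmooth X (X.prod (Mfd.ofFrechet F)) (fun x => (x, (ψ y).2)) :=
    isSmooth_id.prodMk (isSmooth_const (N := Mfd.ofFrechet F) (ψ y).2)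
  have hV : IsOpen ((fun x : X => (x, (ψ y).2)) ⁻¹' ψ.target) :=
    ψ.open_target.preimage hc.continuous
  refine ⟨_, fun x => ψ.symm (x, (ψ y).2), hV, ?_, ?_, ?_⟩
  · have h1 := ψ.map_source hy
    have h2 : ψ y = (π y, (ψ y).2) := by rw [← hpr y hy]
    rw [mem_preimage, ← h2]; exact h1
  · exact hψ'.comp ψ.open_target hV (hc.on _) fun x hx => hx
  · intro x hx
    rw [← hpr _ (ψ.map_target hx), ψ.right_inv hx]

namespace LocalData

variable {D D' : GammaConnection Γ X}

/-- Vertical composition of 2-morphisms: the descent of `h₂₃(y₂, y₃) h₁₂(y₁, y₂)`. -/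
def Hom.comp {L₁ L₂ L₃ : LocalData D D'} (h : Hom L₁ L₂) (h' : Hom L₂ L₃) : Hom L₁ L₃ where
  h y₁ y₃ e := h'.h (L₂.lift (L₁.π y₁)) y₃ ((L₂.π_lift _).trans e) *
    h.h y₁ (L₂.lift (L₁.π y₁)) (L₂.π_lift _).symm
  comm y₁ y₁' y₃ y₃' e e₁ e₃ := by
    rw [← mul_assoc, h'.comm (L₂.lift (L₁.π y₁)) (L₂.lift (L₁.π y₁')) y₃ y₃' _
      (by rw [L₂.π_lift, L₂.π_lift, e₁]) e₃, mul_assoc,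
      h.comm y₁ y₁' (L₂.lift (L₁.π y₁)) (L₂.lift (L₁.π y₁')) _ e₁
      (by rw [L₂.π_lift, L₂.π_lift, e₁]), mul_assoc]
  gauge := by
    intro Z U z₁ z₃ e hU hz₁ hz₃
    have hx : ∀ z ∈ U, ∃ V ⊆ U, IsOpen V ∧ z ∈ V ∧ IsGauge2On Γ V
        (pull (fun z => L₁.π (z₁ z)) D'.A) (fun z => L₁.g (z₁ z)) (pull z₁ L₁.φ)
        (fun z => L₃.g (z₃ z)) (pull z₃ L₃.φ)
        (fun z => h'.h (L₂.lift (L₁.π (z₁ z))) (z₃ z) ((L₂.π_lift _).trans (e z)) *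
          h.h (z₁ z) (L₂.lift (L₁.π (z₁ z))) (L₂.π_lift _).symm) := by
      intro z₀ hz₀
      obtain ⟨V, s, hV, hz₀V, hs, hsec⟩ :=
        L₂.submersion.exists_section (L₂.lift (L₁.π (z₁ z₀)))
      rw [L₂.π_lift] at hz₀V
      have hπz : IsSmoothOn Z X (fun z => L₁.π (z₁ z)) U := L₁.submersion.1.comp_on hU hz₁
      have hW : IsOpen (U ∩ (fun z => L₁.π (z₁ z)) ⁻¹' V) := hπz.1.isOpen_inter_preimage hU hV
      set W := U ∩ (fun z => L₁.π (z₁ z)) ⁻¹' V with hWdef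
      classical
      set z₂ : Z → L₂.Y := fun z => if z ∈ W then s (L₁.π (z₁ z)) else L₂.lift (L₁.π (z₁ z))
        with hz₂def
      have e₂ : ∀ z, L₁.π (z₁ z) = L₂.π (z₂ z) := by
        intro z
        by_cases hz : z ∈ W
        · simp only [hz₂def, if_pos hz]; exact (hsec _ hz.2).symm
        · simp only [hz₂def, if_neg hz]; exact (L₂.π_lift _).symm
      have hz₂ : IsSmoothOn Z L₂.Y z₂ W := by
        refine IsSmoothOn.congr hW (hs.comp hV hW (hπz.mono inter_subset_left)
          fun z hz => hz.2) fun z hz => ?_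
        simp only [hz₂def, if_pos hz]
      have G₁ := h.gauge Z W z₁ z₂ e₂ hW (hz₁.mono inter_subset_left) hz₂
      have G₂ := h'.gauge Z W z₂ z₃ (fun z => (e₂ z).symm.trans (e z)) hW hz₂
        (hz₃.mono inter_subset_left)
      have hfun : (fun z => L₂.π (z₂ z)) = fun z => L₁.π (z₁ z) := funext fun z => (e₂ z).symm
      rw [hfun] at G₂
      have G := G₁.vcomp Γ hW G₂
      refine ⟨W, inter_subset_left, hW, ⟨hz₀, hz₀V⟩, ?_⟩
      have heq : (fun z => h'.h (L₂.lift (L₁.π (z₁ z))) (z₃ z) ((L₂.π_lift _).trans (e z)) *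
          h.h (z₁ z) (L₂.lift (L₁.π (z₁ z))) (L₂.π_lift _).symm) = fun z =>
          h'.h (z₂ z) (z₃ z) ((e₂ z).symm.trans (e z)) * h.h (z₁ z) (z₂ z) (e₂ z) :=
        funext fun z => Hom.comp_indep h h' _ _ _ _ _ _ _ _
      rw [heq]
      exact G
    refine ⟨IsSmoothOn.of_local fun z hz => ?_, fun z hz => ?_, fun z hz v => ?_⟩
    · obtain ⟨V, -, hV, hzV, G⟩ := hx z hz
      exact ⟨V, hV, hzV, G.smooth⟩
    · obtain ⟨V, -, hV, hzV, G⟩ := hx z hz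
      exact G.eq_g z hzV
    · obtain ⟨V, -, hV, hzV, G⟩ := hx z hz
      exact G.eq_φ z hzV v

theorem Hom.comp_h {L₁ L₂ L₃ : LocalData D D'} (h : Hom L₁ L₂) (h' : Hom L₂ L₃) (y₁ : L₁.Y)
    (y₂ : L₂.Y) (y₃ : L₃.Y) (e : L₁.π y₁ = L₂.π y₂) (f : L₂.π y₂ = L₃.π y₃) :
    (Hom.comp h h').h y₁ y₃ (e.trans f) = h'.h y₂ y₃ f * h.h y₁ y₂ e :=
  Hom.comp_indep h h' _ _ _ _ _ _ _ _

/-- The Hom-category of the Hom-closure of the presheaf of `Γ`-connections on `X`. -/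
instance : CategoryTheory.Category (LocalData D D') where
  Hom := Hom
  id := Hom.id
  comp := Hom.comp
  id_comp {L₁ L₂} h := by
    refine Hom.ext (funext fun y₁ => funext fun y₂ => funext fun e => ?_)
    refine (Hom.comp_h (Hom.id L₁) h y₁ y₁ y₂ rfl e).trans ?_
    show h.h y₁ y₂ e * L₁.a y₁ y₁ rfl = h.h y₁ y₂ e
    rw [a_self, mul_one]
  comp_id {L₁ L₂} h := by
    refine Hom.ext (funext fun y₁ => funext fun y₂ => funext fun e => ?_)
    refine (Hom.comp_h h (Hom.id L₂) y₁ y₂ y₂ e rfl).trans ?_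
    show L₂.a y₂ y₂ rfl * h.h y₁ y₂ e = h.h y₁ y₂ e
    rw [a_self, one_mul]
  assoc {L₁ L₂ L₃ L₄} h h' h'' := by
    refine Hom.ext (funext fun y₁ => funext fun y₄ => funext fun e => ?_)
    have e₂ := (L₂.π_lift (L₁.π y₁)).symm
    have e₃ := (L₃.π_lift (L₁.π y₁)).symm
    rw [Hom.comp_h (Hom.comp h h') h'' y₁ (L₃.lift (L₁.π y₁)) y₄ e₃ (e₃.symm.trans e),
      Hom.comp_h h (Hom.comp h' h'') y₁ (L₂.lift (L₁.π y₁)) y₄ e₂ (e₂.symm.trans e),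
      Hom.comp_h h h' y₁ (L₂.lift (L₁.π y₁)) (L₃.lift (L₁.π y₁)) e₂ (e₂.symm.trans e₃),
      Hom.comp_h h' h'' (L₂.lift (L₁.π y₁)) (L₃.lift (L₁.π y₁)) y₄ (e₂.symm.trans e₃)
        (e₃.symm.trans e), mul_assoc]

/-- Local data whose gauge transformation is adjusted,
`curv(g, φ) = κ(g, fcurv(π^*A, π^*B))`. -/
def IsAdjusted (κ : Γ.G → Γ.𝔤 → Γ.𝔥) (D D' : GammaConnection Γ X) :
    CategoryTheory.ObjectProperty (LocalData D D') :=
  fun L => ∀ y v w, gcurv Γ (pull L.π D'.A) (pull2 L.π D.B) (pull2 L.π D'.B) L.g L.φ y v w =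
    κ (L.g y) (fcurv Γ (pull L.π D.A) (pull2 L.π D.B) y v w)

/-- Local data whose gauge transformation is flat. -/
def IsFlat (D D' : GammaConnection Γ X) : CategoryTheory.ObjectProperty (LocalData D D') :=
  fun L => ∀ y v w, gcurv Γ (pull L.π D'.A) (pull2 L.π D.B) (pull2 L.π D'.B) L.g L.φ y v w = 0

end LocalData

end Local

/-! ### Principal `Γ`-bundles with connection -/

section Bundles

/-- A principal `Γ`-bundle over `X`, i.e. a principal `H`-bundle `P` with an anchor map
`P → G`. -/
structure GammaBundle (Γ : LieTwoGroup.{u}) (X : Mfd.{u}) : Type (u + 1) where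
  P : Mfd.{u}
  proj : P → X
  smooth_proj : IsSmooth P X proj
  act : P → Γ.H → P
  smooth_act : IsSmooth (P.prod Γ.H.toMfd) P (fun p : P × Γ.H => act p.1 p.2)
  act_one : ∀ p, act p 1 = p
  act_mul : ∀ p h h', act (act p h) h' = act p (h * h')
  proj_act : ∀ p h, proj (act p h) = proj p
  locally_trivial : ∀ x : X, ∃ (U : Set X) (ψ : OpenPartialHomeomorph P (X.prod Γ.H.toMfd)),
    IsOpen U ∧ x ∈ U ∧ ψ.source = proj ⁻¹' U ∧ ψ.target = U ×ˢ (univ : Set Γ.H) ∧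
    IsSmoothOn P (X.prod Γ.H.toMfd) ψ ψ.source ∧ IsSmoothOn (X.prod Γ.H.toMfd) P ψ.symm ψ.target ∧
    ∀ p, proj p ∈ U → (ψ p).1 = proj p ∧ ∀ h, ψ (act p h) = (proj p, (ψ p).2 * h)
  anchor : P → Γ.G
  smooth_anchor : IsSmooth P Γ.G anchor
  anchor_act : ∀ p h, anchor (act p h) = (Γ.t h)⁻¹ * anchor p

/-- A principal `Γ`-bundle over `X` with an `A`-`A'`-connection `ω`. -/
structure BunCon (Γ : LieTwoGroup.{u}) (X : Mfd.{u}) (A A' : Fam1 X Γ.𝔤) : Type (u + 1)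
    extends GammaBundle Γ X where
  ω : Fam1 P Γ.𝔥
  isForm_ω : IsForm1 P Γ.𝔥 ω
  /-- `ρ^*ω = Ad_h⁻¹(pr_P^*ω) + (α̃_h)_*(A') + h^*θ` on `P × H`, where `ρ` is the action. -/
  ω_act : ∀ (q : P × Γ.H) (v : (P.prod Γ.H.toMfd).T q),
    pull (M := P.prod Γ.H.toMfd) (fun q : P × Γ.H => act q.1 q.2) ω q v =
      Γ.H.Ad q.2⁻¹ (pull (M := P.prod Γ.H.toMfd) (fun q : P × Γ.H => q.1) ω q v)
      + Γ.αTilde q.2 (pull (M := P.prod Γ.H.toMfd) (fun q : P × Γ.H => proj q.1) A' q v)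
      + Γ.H.leftMC (M := P.prod Γ.H.toMfd) (fun q : P × Γ.H => q.2) q v
  /-- `t_*(ω) = Ad_φ(A) - A' - φ^*θ̄`, where `φ` is the anchor. -/
  t_ω : ∀ p v, Γ.tStar (ω p v) =
    Γ.G.Ad (anchor p) (pull proj A p v) - pull proj A' p v - Γ.G.rightMC anchor p v

variable {Γ : LieTwoGroup.{u}} {X : Mfd.{u}} {A A' : Fam1 X Γ.𝔤}

namespace BunCon

/-- Connection-preserving morphisms of principal `Γ`-bundles. -/
@[ext] structure Hom (E E' : BunCon Γ X A A') : Type u where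
  f : E.P → E'.P
  smooth : IsSmooth E.P E'.P f
  proj_f : ∀ p, E'.proj (f p) = E.proj p
  equivariant : ∀ p h, f (E.act p h) = E'.act (f p) h
  anchor_f : ∀ p, E'.anchor (f p) = E.anchor p
  pull_ω : ∀ p v, pull f E'.ω p v = E.ω p v

/-- The category of principal `Γ`-bundles over `X` with `A`-`A'`-connections. -/
instance : CategoryTheory.Category (BunCon Γ X A A') where
  Hom := Hom
  id E :=
    { f := fun p => p
      smooth := isSmooth_id
      proj_f := fun _ => rfl
      equivariant := fun _ _ => rfl
      anchor_f := fun _ => rfl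
      pull_ω := fun p v => congrArg (E.ω p) (mderivTo_id p v) }
  comp {E E' E''} k k' :=
    { f := fun p => k'.f (k.f p)
      smooth := k'.smooth.comp k.smooth
      proj_f := fun p => by rw [k'.proj_f, k.proj_f]
      equivariant := fun p h => by rw [k.equivariant, k'.equivariant]
      anchor_f := fun p => by rw [k'.anchor_f, k.anchor_f]
      pull_ω := fun p v => by
        rw [← k.pull_ω p v, pull, mderiv_comp k'.smooth k.smooth]
        exact k'.pull_ω (k.f p) (mderiv E.P E'.P k.f p v) }

/-- `B`-`B'`-adjusted connections: `curv_{B,B'}(ω) = κ(φ, fcurv(A, B))`. -/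
def IsAdjusted (κ : Γ.G → Γ.𝔤 → Γ.𝔥) (D D' : GammaConnection Γ X) :
    CategoryTheory.ObjectProperty (BunCon Γ X D.A D'.A) :=
  fun E => ∀ p v w, gcurv Γ (pull E.proj D'.A) (pull2 E.proj D.B) (pull2 E.proj D'.B)
      E.anchor E.ω p v w =
    κ (E.anchor p) (pull2 E.proj (fcurv Γ D.A D.B) p v w)

/-- `B`-`B'`-flat connections: `curv_{B,B'}(ω) = 0`. -/
def IsFlat (D D' : GammaConnection Γ X) :
    CategoryTheory.ObjectProperty (BunCon Γ X D.A D'.A) :=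
  fun E => ∀ p v w, gcurv Γ (pull E.proj D'.A) (pull2 E.proj D.B) (pull2 E.proj D'.B)
      E.anchor E.ω p v w = 0

end BunCon

end Bundles

/-! ### Reconstruction, composition and tensor product -/

section Functors

open CategoryTheory

variable {Γ : LieTwoGroup.{u}} {X : Mfd.{u}}

/-- The reconstruction functor, which sends local data `(π, φ, g, a)` to the bundle
`P = (Y × H)/~` with `(y₁, h) ~ (y₂, a(y₁, y₂) h)`; the quotient is realized by a surjective
submersion `q : Y × H → P` whose fibres are the equivalence classes. -/
structure ReconstructionFunctor (D D' : GammaConnection Γ X) : Type (u + 1) where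
  functor : LocalData D D' ⥤ BunCon Γ X D.A D'.A
  q : ∀ L : LocalData D D', L.Y × Γ.H → (functor.obj L).P
  submersion_q : ∀ L, IsSubmersion (L.Y.prod Γ.H.toMfd) (functor.obj L).P (q L)
  surjective_q : ∀ L, Function.Surjective (q L)
  q_eq_iff : ∀ (L : LocalData D D') (y₁ y₂ : L.Y) (h₁ h₂ : Γ.H), q L (y₁, h₁) = q L (y₂, h₂) ↔
    ∃ e : L.π y₁ = L.π y₂, h₂ = L.a y₁ y₂ e * h₁
  proj_q : ∀ (L : LocalData D D') (y : L.Y) (h : Γ.H),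
    (functor.obj L).proj (q L (y, h)) = L.π y
  act_q : ∀ (L : LocalData D D') (y : L.Y) (h h' : Γ.H),
    (functor.obj L).act (q L (y, h)) h' = q L (y, h * h')
  anchor_q : ∀ (L : LocalData D D') (y : L.Y) (h : Γ.H),
    (functor.obj L).anchor (q L (y, h)) = (Γ.t h)⁻¹ * L.g y
  /-- The connection is the descent of `Ad_h⁻¹(φ) + (α̃_h)_*(A') + h^*θ`. -/
  ω_q : ∀ (L : LocalData D D') (p : L.Y × Γ.H) (v : (L.Y.prod Γ.H.toMfd).T p),
    pull (M := L.Y.prod Γ.H.toMfd) (q L) (functor.obj L).ω p v =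
      Γ.H.Ad p.2⁻¹ (pull (M := L.Y.prod Γ.H.toMfd) (fun p : L.Y × Γ.H => p.1) L.φ p v)
      + Γ.αTilde p.2 (pull (M := L.Y.prod Γ.H.toMfd) (fun p : L.Y × Γ.H => L.π p.1) D'.A p v)
      + Γ.H.leftMC (M := L.Y.prod Γ.H.toMfd) (fun p : L.Y × Γ.H => p.2) p v
  map_q : ∀ {L₁ L₂ : LocalData D D'} (h : LocalData.Hom L₁ L₂) (y₁ : L₁.Y) (y₂ : L₂.Y)
    (e : L₁.π y₁ = L₂.π y₂) (h' : Γ.H),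
    BunCon.Hom.f (functor.map (X := L₁) (Y := L₂) h) (q L₁ (y₁, h')) =
      q L₂ (y₂, h.h y₁ y₂ e * h')

/-- Composition of 1-morphisms and horizontal composition of 2-morphisms in the Hom-closure; the
fibre product `Ỹ = Y ×_X Y'` is characterized by its universal property. -/
structure CompositionFunctor (D D' D'' : GammaConnection Γ X) : Type (u + 1) where
  functor : LocalData D' D'' × LocalData D D' ⥤ LocalData D D''
  p : ∀ c, (functor.obj c).Y → c.2.Y
  p' : ∀ c, (functor.obj c).Y → c.1.Y
  isFiberProduct : ∀ c, IsFiberProduct c.2.π c.1.π (p c) (p' c)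
  π_eq : ∀ c y, (functor.obj c).π y = c.2.π (p c y)
  /-- `g̃(y, y') = g'(y') g(y)` -/
  g_eq : ∀ c y, (functor.obj c).g y = c.1.g (p' c y) * c.2.g (p c y)
  /-- `φ̃ = (α_{g'})_*(φ) + φ'` -/
  φ_eq : ∀ c y v, (functor.obj c).φ y v =
    Γ.αStar (c.1.g (p' c y)) (pull (p c) c.2.φ y v) + pull (p' c) c.1.φ y v
  /-- `ã((y₁, y₁'), (y₂, y₂')) = a'(y₁', y₂') α(g'(y₁'), a(y₁, y₂))` -/
  a_eq : ∀ c y₁ y₂ (e : (functor.obj c).π y₁ = (functor.obj c).π y₂)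
    (e' : c.1.π (p' c y₁) = c.1.π (p' c y₂)) (e'' : c.2.π (p c y₁) = c.2.π (p c y₂)),
    (functor.obj c).a y₁ y₂ e =
      c.1.a (p' c y₁) (p' c y₂) e' * Γ.α (c.1.g (p' c y₁)) (c.2.a (p c y₁) (p c y₂) e'')
  /-- `(h' ∘ h)((y₁, y₁'), (y₂, y₂')) = h'(y₁', y₂') α(g₁'(y₁'), h(y₁, y₂))` -/
  map_eq : ∀ {c₁ c₂ : LocalData D' D'' × LocalData D D'} (k : c₁ ⟶ c₂)
    y₁ y₂ (e : (functor.obj c₁).π y₁ = (functor.obj c₂).π y₂)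
    (e' : c₁.1.π (p' c₁ y₁) = c₂.1.π (p' c₂ y₂)) (e'' : c₁.2.π (p c₁ y₁) = c₂.2.π (p c₂ y₂)),
    LocalData.Hom.h (functor.map k) y₁ y₂ e =
      LocalData.Hom.h k.1 (p' c₁ y₁) (p' c₂ y₂) e' *
        Γ.α (c₁.1.g (p' c₁ y₁)) (LocalData.Hom.h k.2 (p c₁ y₁) (p c₂ y₂) e'')

/-- The partial tensor product functor, which sends bundles `P₁`, `P₂` to `(P₁ ×_X P₂)/~` with
`(p₁ h, p₂) ~ (p₁, p₂ α(φ₁(p₁)⁻¹, h))`; the fibre product `W` is characterized by its universal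
property, and the quotient is realized by a surjective submersion `τ` whose fibres are the
equivalence classes. -/
structure TensorFunctor (A A' A'' : Fam1 X Γ.𝔤) : Type (u + 1) where
  functor : BunCon Γ X A' A'' × BunCon Γ X A A' ⥤ BunCon Γ X A A''
  W : BunCon Γ X A' A'' × BunCon Γ X A A' → Mfd.{u}
  pr₁ : ∀ c, W c → c.1.P
  pr₂ : ∀ c, W c → c.2.P
  isFiberProduct : ∀ c, IsFiberProduct c.1.proj c.2.proj (pr₁ c) (pr₂ c)
  τ : ∀ c, W c → (functor.obj c).P
  submersion_τ : ∀ c, IsSubmersion (W c) (functor.obj c).P (τ c)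
  surjective_τ : ∀ c, Function.Surjective (τ c)
  τ_eq_iff : ∀ c (w w' : W c), τ c w = τ c w' ↔
    ∃ h : Γ.H, pr₁ c w = c.1.act (pr₁ c w') h ∧
      pr₂ c w' = c.2.act (pr₂ c w) (Γ.α (c.1.anchor (pr₁ c w'))⁻¹ h)
  proj_τ : ∀ c w, (functor.obj c).proj (τ c w) = c.1.proj (pr₁ c w)
  /-- `(p₁, p₂) · h = (p₁ h, p₂)` -/
  act_τ : ∀ c (w w' : W c) (h : Γ.H), pr₁ c w' = c.1.act (pr₁ c w) h → pr₂ c w' = pr₂ c w →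
    (functor.obj c).act (τ c w) h = τ c w'
  anchor_τ : ∀ c w,
    (functor.obj c).anchor (τ c w) = c.1.anchor (pr₁ c w) * c.2.anchor (pr₂ c w)
  /-- The connection is the descent of `pr₁^*ω₁ + (α_{φ₁})_*(pr₂^*ω₂)`. -/
  ω_τ : ∀ c w v, pull (τ c) (functor.obj c).ω w v =
    pull (pr₁ c) c.1.ω w v + Γ.αStar (c.1.anchor (pr₁ c w)) (pull (pr₂ c) c.2.ω w v)
  map_τ : ∀ {c c' : BunCon Γ X A' A'' × BunCon Γ X A A'} (k : c ⟶ c') (w : W c) (w' : W c'),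
    pr₁ c' w' = BunCon.Hom.f k.1 (pr₁ c w) → pr₂ c' w' = BunCon.Hom.f k.2 (pr₂ c w) →
    BunCon.Hom.f (functor.map k) (τ c w) = τ c' w'

/-- The restriction of a functor to full subcategories. -/
abbrev restrictFunctor {C : Type*} {C' : Type*} [Category C] [Category C'] (F : C ⥤ C')
    {P : ObjectProperty C} {P' : ObjectProperty C'} (hF : ∀ c, P c → P' (F.obj c)) :
    P.FullSubcategory ⥤ P'.FullSubcategory :=
  P'.lift (P.ι ⋙ F) fun c => hF c.obj c.property

/-- The restriction of a functor of two variables to full subcategories. -/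
abbrev restrictFunctor₂ {C₁ : Type*} {C₂ : Type*} {C' : Type*} [Category C₁] [Category C₂] [Category C']
    (F : C₁ × C₂ ⥤ C') {P₁ : ObjectProperty C₁} {P₂ : ObjectProperty C₂}
    {P' : ObjectProperty C'} (hF : ∀ c, P₁ c.1 → P₂ c.2 → P' (F.obj c)) :
    P₁.FullSubcategory × P₂.FullSubcategory ⥤ P'.FullSubcategory :=
  P'.lift (P₁.ι.prod P₂.ι ⋙ F) fun c => hF (c.1.obj, c.2.obj) c.1.property c.2.property

end Functors

end

end HGT

open HGT

/-!
The theorem rests on four ideas.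

*Curvature.* The curvature of a gauge transformation `(g, φ)` with target connection `(A', B')` is
governed by the form `dφ + ½[φ ∧ φ] + α_*(A' ∧ φ)`. Together with the curvature of `A'` this is the
curvature of one form, the form `(φ, A')` with values in the Lie algebra of `H ⋊ G`
(`curvature_totalForm`). Covariance of curvature under gauge transformations (`curvature_gauge`),
applied in `H ⋊ G` to `h⁻¹` and to `g'`, yields its behaviour under gauge 2-transformations
(`preCurv_gauge2`) and under composition (`preCurv_comp`); the homomorphism `(h, g) ↦ t(h) g` to `G`
computes its image under `t_*` (`curvature_add_tStar`). Covariance follows from the Maurer--Cartan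
equation `extD_rightMC`, which in turn is symmetry of second derivatives
(`SmoothOn.dirDeriv_comm`).

*Existence of the functors.* A bundle is reconstructed from local data by gluing products of open
subsets of `X` with `H` along local sections of `Y → X` (`GlueData`, `recGlue`); its connection
descends from `Y × H` because forms descend along surjective submersions
(`IsSubmersion.exists_form`). Conversely a bundle `E` has canonical local data `E.loc`: over its own
total space it is trivial, with transition function given by the division map, and its anchor and
connection are the gauge transformation. The partial tensor product of two bundles is the
reconstruction of the composition of their canonical local data.

*Comparison and equivalence.* The functors are characterized by quotient maps `q : Y × H → P` and
`τ : P₁ ×_X P₂ → P₁ ⊗ P₂`, and all further statements are derived from these characterizations. The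
natural isomorphism `comparisonIso` sends `q''((y, y'), h)` to `q'(y', h) ⊗ q(y, 1)`; a morphism of
bundles over `X` is automatically invertible (`BunCon.Hom.toIso`). Reconstruction is faithful and
full, as a morphism of reconstructed bundles sends `q(y₁, 1)` to `q(y₂, h(y₁, y₂))` for a unique
`h`, and `E` is isomorphic to the reconstruction of `E.loc` (`nonempty_iso_loc`).

*Adjusted and flat data.* Both conditions are of the form `curv(g, φ) = κ(g, fcurv(A, B))`, where
for flat data `κ = 0` and all fake curvatures vanish. The compatibility of such a condition with
gauge 2-transformations and with composition amounts to two identities for `κ`, which are collected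
in `IsCurvatureLaw`. The second one involves the fake curvature of the target, which is
`Ad_g X - t_*(κ(g, X))` if the one of the source is `X` (`HasCurvature.fcurv_eq`). As `E.loc`
consists of the anchor and the connection of `E`, it obeys the condition whenever `E` does, so that
the equivalence restricts to the full subcategories.
-/

namespace HGT

set_option linter.unusedSectionVars false

noncomputable section

/-! ### Calculus in locally convex spaces -/

section FlatCalculus

variable {E : Type u} {F : Type v} {K : Type w}
  [AddCommGroup E] [Module ℝ E] [TopologicalSpace E] [IsTopologicalAddGroup E]
  [ContinuousSMul ℝ E] [LocallyConvexSpace ℝ E] [T2Space E]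
  [AddCommGroup F] [Module ℝ F] [TopologicalSpace F] [IsTopologicalAddGroup F]
  [ContinuousSMul ℝ F] [LocallyConvexSpace ℝ F] [T2Space F]
  [AddCommGroup K] [Module ℝ K] [TopologicalSpace K] [IsTopologicalAddGroup K]
  [ContinuousSMul ℝ K] [LocallyConvexSpace ℝ K] [T2Space K]

theorem SmoothOn.comp {g : F → K} {V : Set F} (hV : IsOpen V) (hg : SmoothOn g V)
    {f : E → F} {U : Set E} (hU : IsOpen U) (hf : SmoothOn f U) (h : MapsTo f U V) :
    SmoothOn (fun y => g (f y)) U := fun n => (hg n).comp hV hU (hf n) h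

theorem SmoothOn.prodMk {f : E → F} {g : E → K} {U : Set E} (hU : IsOpen U)
    (hf : SmoothOn f U) (hg : SmoothOn g U) : SmoothOn (fun y => (f y, g y)) U :=
  fun n => (hf n).prodMk hU (hg n)

theorem SmoothOn.mono {f : E → F} {U V : Set E} (hf : SmoothOn f U) (h : V ⊆ U) :
    SmoothOn f V := fun n => (hf n).mono h

theorem SmoothOn.congr {f g : E → F} {U : Set E} (hU : IsOpen U) (hf : SmoothOn f U)
    (h : EqOn f g U) : SmoothOn g U := fun n => (hf n).congr hU h

theorem SmoothOn.of_local {f : E → F} {U : Set E}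
    (h : ∀ x ∈ U, ∃ V, IsOpen V ∧ x ∈ V ∧ SmoothOn f V) : SmoothOn f U := fun n =>
  CkOn.of_local fun x hx => by
    obtain ⟨V, hV, hxV, hf⟩ := h x hx
    exact ⟨V, hV, hxV, hf n⟩

theorem smoothOn_clm (L : E →L[ℝ] F) (U : Set E) : SmoothOn L U := fun n => CkOn.clm n L U

theorem smoothOn_id (U : Set E) : SmoothOn (fun x : E => x) U :=
  smoothOn_clm (ContinuousLinearMap.id ℝ E) U

theorem smoothOn_fst (U : Set (E × F)) : SmoothOn (fun p : E × F => p.1) U :=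
  smoothOn_clm (ContinuousLinearMap.fst ℝ E F) U

theorem smoothOn_snd (U : Set (E × F)) : SmoothOn (fun p : E × F => p.2) U :=
  smoothOn_clm (ContinuousLinearMap.snd ℝ E F) U

theorem smoothOn_const (c : F) (U : Set E) : SmoothOn (fun _ : E => c) U :=
  fun n => CkOn.const n c U

theorem SmoothOn.clm_comp (L : F →L[ℝ] K) {f : E → F} {U : Set E} (hU : IsOpen U)
    (hf : SmoothOn f U) : SmoothOn (fun x => L (f x)) U :=
  (smoothOn_clm L univ).comp isOpen_univ hU hf (mapsTo_univ _ _)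

theorem SmoothOn.add {f g : E → F} {U : Set E} (hU : IsOpen U) (hf : SmoothOn f U)
    (hg : SmoothOn g U) : SmoothOn (fun x => f x + g x) U :=
  (hf.prodMk hU hg).clm_comp (ContinuousLinearMap.fst ℝ F F + ContinuousLinearMap.snd ℝ F F) hU

theorem SmoothOn.continuousOn {f : E → F} {U : Set E} (hf : SmoothOn f U) : ContinuousOn f U :=
  (hf 0).continuousOn

theorem SmoothOn.deriv {f : E → F} {U : Set E} (hf : SmoothOn f U) :
    SmoothOn (fun p : E × E => dirDeriv f p.1 p.2) (U ×ˢ (univ : Set E)) :=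
  fun n => (hf (n + 1)).2.2

theorem SmoothOn.deriv_const {f : E → F} {U : Set E} (hU : IsOpen U) (hf : SmoothOn f U) (v : E) :
    SmoothOn (fun x => dirDeriv f x v) U :=
  SmoothOn.comp (g := fun p : E × E => dirDeriv f p.1 p.2) (f := fun x => (x, v))
    (hU.prod isOpen_univ) hf.deriv hU ((smoothOn_id U).prodMk hU (smoothOn_const v U))
    fun _ hx => ⟨hx, mem_univ _⟩

theorem SmoothOn.hasDirDeriv {f : E → F} {U : Set E} (hf : SmoothOn f U) {x : E} (hx : x ∈ U)
    (v : E) : HasDirDeriv f x v (dirDeriv f x v) :=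
  hasDirDeriv_dirDeriv ((hf 1).2.1 x hx v)

theorem dirDeriv_comp {g : F → K} {V : Set F} (hV : IsOpen V) (hg : SmoothOn g V)
    {f : E → F} {U : Set E} (hf : SmoothOn f U) {x : E} (hx : x ∈ U) (hfx : f x ∈ V) (v : E) :
    dirDeriv (fun y => g (f y)) x v = dirDeriv g (f x) (dirDeriv f x v) :=
  ((hf.hasDirDeriv hx v).comp hV (hg 1) hfx).dirDeriv

theorem HasDirDeriv.add {f g : E → F} {x v : E} {L L' : F} (hf : HasDirDeriv f x v L)
    (hg : HasDirDeriv g x v L') : HasDirDeriv (fun y => f y + g y) x v (L + L') := by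
  refine (Tendsto.add hf hg).congr fun s => ?_
  rw [← smul_add, add_sub_add_comm]

theorem HasDirDeriv.sub {f g : E → F} {x v : E} {L L' : F} (hf : HasDirDeriv f x v L)
    (hg : HasDirDeriv g x v L') : HasDirDeriv (fun y => f y - g y) x v (L - L') := by
  refine (Tendsto.sub hf hg).congr fun s => ?_
  rw [← smul_sub, sub_sub_sub_comm]

/-- The directional derivative of a linear map is the map itself, without continuity. -/
theorem hasDirDeriv_linear {f : E → F} (hf : IsLinearMap ℝ f) (x v : E) :
    HasDirDeriv f x v (f v) := by
  refine tendsto_const_nhds.congr' ?_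
  filter_upwards [self_mem_nhdsWithin] with s hs
  have hs' : s ≠ 0 := hs
  rw [hf.map_add, add_sub_cancel_left, hf.map_smul, smul_smul, inv_mul_cancel₀ hs', one_smul]

theorem dirDeriv_slice_right (f : E × F → K) (x : E) (y w : F) :
    dirDeriv (fun y' => f (x, y')) y w = dirDeriv f (x, y) (0, w) :=
  dirDeriv_eq_of fun L => by simp [HasDirDeriv]

theorem dirDeriv_slice_left (f : E × F → K) (x v : E) (y : F) :
    dirDeriv (fun x' => f (x', y)) x v = dirDeriv f (x, y) (v, 0) :=
  dirDeriv_eq_of fun L => by simp [HasDirDeriv]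

theorem SmoothOn.dirDeriv_pair {f : E × F → K} {U : Set (E × F)} (hU : IsOpen U)
    (hf : SmoothOn f U) {p : E × F} (hp : p ∈ U) (v : E) (w : F) :
    dirDeriv f p (v, w) = dirDeriv (fun x' => f (x', p.2)) p.1 v
      + dirDeriv (fun y' => f (p.1, y')) p.2 w := by
  rw [dirDeriv_slice_right, dirDeriv_slice_left, ← (hf 1).dirDeriv_add hU hp]
  simp

theorem SmoothOn.isLinearMap {f : E → F} {U : Set E} (hU : IsOpen U)
    (hf : SmoothOn f U) {x : E} (hx : x ∈ U) : IsLinearMap ℝ (dirDeriv f x) where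
  map_add v w := (hf 1).dirDeriv_add hU hx v w
  map_smul c v := (hf 1).dirDeriv_smul hx c v

/-- The second difference quotient converges, in the weak topology, to the second derivative. -/
theorem SmoothOn.tendsto_second_difference {f : E → F} {U : Set E} (hU : IsOpen U)
    (hf : SmoothOn f U) {x : E} (hx : x ∈ U) (v w : E) (φ : F →L[ℝ] ℝ) :
    Tendsto (fun s : ℝ => s⁻¹ * (s⁻¹ *
        φ (f (x + s • v + s • w) - f (x + s • v) - f (x + s • w) + f x)))
      (𝓝[≠] 0) (𝓝 (φ (dirDeriv (fun y => dirDeriv f y w) x v))) := by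
  obtain ⟨C, ⟨hC, hCc⟩, hCU⟩ :=
    ((LocallyConvexSpace.convex_basis (𝕜 := ℝ) x).mem_iff).1 (hU.mem_nhds hx)
  have t0 : Tendsto (fun s : ℝ => s) (𝓝[≠] 0) (𝓝 0) := tendsto_id.mono_left nhdsWithin_le_nhds
  have tx : Tendsto (fun _ : ℝ => x) (𝓝[≠] (0 : ℝ)) (𝓝 x) := tendsto_const_nhds
  have tv : Tendsto (fun s : ℝ => x + s • v) (𝓝[≠] 0) (𝓝 x) := by
    simpa using tx.add (t0.smul_const v)
  have tw : Tendsto (fun s : ℝ => x + s • w) (𝓝[≠] 0) (𝓝 x) := by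
    simpa using tx.add (t0.smul_const w)
  have tvw : Tendsto (fun s : ℝ => x + s • v + s • w) (𝓝[≠] 0) (𝓝 x) := by
    simpa using tv.add (t0.smul_const w)
  -- the mean value theorem in the direction `w`
  have key : ∀ᶠ s in 𝓝[≠] (0 : ℝ), ∃ r ∈ Ioo (0 : ℝ) 1,
      s⁻¹ * φ (f (x + s • v + s • w) - f (x + s • v) - f (x + s • w) + f x) =
        φ (dirDeriv f (x + (r * s) • w + s • v) w - dirDeriv f (x + (r * s) • w) w) := by
    filter_upwards [tv hC, tw hC, tvw hC, self_mem_nhdsWithin] with s h1 h2 h3 hs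
    have hs' : s ≠ 0 := hs
    have hd : ∀ (z : E), z ∈ C → z + s • w ∈ C → ∀ r ∈ Icc (0 : ℝ) 1,
        HasDerivAt (fun r : ℝ => φ (f (z + (r * s) • w)))
          (s * φ (dirDeriv f (z + (r * s) • w) w)) r := by
      intro z hz hz' r hr
      have hm : z + (r * s) • w ∈ U := by
        have := hCU (hCc.add_smul_sub_mem hz hz' hr)
        simpa [smul_smul] using this
      rw [hasDerivAt_iff_tendsto_slope_zero]
      have h4 := (φ.continuous.tendsto _).comp ((hf.hasDirDeriv hm w).const_smul s)
      rw [map_smul, smul_eq_mul] at h4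
      refine h4.congr fun t => ?_
      simp only [Function.comp, map_smul, map_sub, smul_eq_mul]
      rw [add_mul, add_smul, smul_smul, add_assoc]
    have hx' : x ∈ C := mem_of_mem_nhds hC
    obtain ⟨r, hr, hre⟩ := exists_hasDerivAt_eq_slope
      (fun r : ℝ => φ (f (x + s • v + (r * s) • w)) - φ (f (x + (r * s) • w)))
      (fun r => s * φ (dirDeriv f (x + s • v + (r * s) • w) w)
        - s * φ (dirDeriv f (x + (r * s) • w) w)) one_pos
      (fun r hr => ((hd _ h1 h3 r hr).sub (hd _ hx' h2 r hr)).continuousAt.continuousWithinAt)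
      (fun r hr => (hd _ h1 h3 r ⟨hr.1.le, hr.2.le⟩).sub (hd _ hx' h2 r ⟨hr.1.le, hr.2.le⟩))
    refine ⟨r, hr, ?_⟩
    simp only [one_mul, zero_mul, zero_smul, add_zero, sub_zero, div_one] at hre
    have e1 : x + (r * s) • w + s • v = x + s • v + (r * s) • w := by abel
    rw [e1, map_sub, map_add, map_sub, map_sub]
    rw [inv_mul_eq_div, div_eq_iff hs', sub_mul]
    linarith
  choose! r hr hre using fun s (h : ∃ r ∈ Ioo (0 : ℝ) 1,
      s⁻¹ * φ (f (x + s • v + s • w) - f (x + s • v) - f (x + s • w) + f x) =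
        φ (dirDeriv f (x + (r * s) • w + s • v) w - dirDeriv f (x + (r * s) • w) w)) => h
  have trs : Tendsto (fun s : ℝ => r s * s) (𝓝[≠] 0) (𝓝 0) := by
    refine squeeze_zero_norm' ?_ (by simpa using t0.norm)
    filter_upwards [key] with s hs
    have := hr s hs
    rw [norm_mul]
    refine mul_le_of_le_one_left (norm_nonneg _) ?_
    rw [Real.norm_eq_abs, abs_le]
    constructor <;> linarith [this.1, this.2]
  have tb : Tendsto (fun s : ℝ => x + (r s * s) • w) (𝓝[≠] 0) (𝓝 x) := by
    simpa using tx.add (trs.smul_const w)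
  have hg := (hf.deriv_const hU w 1).tendsto_slope hU hx (l := 𝓝[≠] 0) (v := v)
    (a := fun _ => v) le_rfl tb tendsto_const_nhds
  refine ((φ.continuous.tendsto _).comp hg).congr' ?_
  filter_upwards [key] with s hs
  rw [hre s hs]
  simp only [Function.comp, map_smul, smul_eq_mul]

/-- Symmetry of second derivatives. -/
theorem SmoothOn.dirDeriv_comm {f : E → F} {U : Set E} (hU : IsOpen U)
    (hf : SmoothOn f U) {x : E} (hx : x ∈ U) (v w : E) :
    dirDeriv (fun y => dirDeriv f y w) x v = dirDeriv (fun y => dirDeriv f y v) x w := by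
  by_contra hne
  obtain ⟨φ, hφ⟩ := SeparatingDual.exists_separating_of_ne (R := ℝ) hne
  refine hφ (tendsto_nhds_unique (hf.tendsto_second_difference hU hx v w φ) ?_)
  refine (hf.tendsto_second_difference hU hx w v φ).congr fun s => ?_
  have e1 : x + s • w + s • v = x + s • v + s • w := by abel
  rw [e1]
  congr 4
  abel

end FlatCalculus

/-! ### Smooth maps in charts, and pullback of differential forms -/

section Manifolds

variable {M N K : Mfd.{u}} {V W : FrechetSpace.{u}}

theorem mderivTo_smul {f : M → N} {U : Set M} (hf : IsSmoothOn M N f U)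
    {x : M} (hx : x ∈ U) {j : N.ι} (hj : f x ∈ (N.chart j).source) (c : ℝ) (v : M.T x) :
    mderivTo M N f x j (c • v) = c • mderivTo M N f x j v :=
  (hf.2 _ j 1).dirDeriv_smul (mem_repDom hx hj) c v

theorem isLinearMap_mderivTo {f : M → N} {U : Set M} (hU : IsOpen U) (hf : IsSmoothOn M N f U)
    {x : M} (hx : x ∈ U) {j : N.ι} (hj : f x ∈ (N.chart j).source) :
    IsLinearMap ℝ (mderivTo M N f x j) where
  map_add := mderivTo_add hU hf hx hj
  map_smul := mderivTo_smul hf hx hj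

theorem isLinearMap_mderiv {f : M → N} {U : Set M} (hU : IsOpen U) (hf : IsSmoothOn M N f U)
    {x : M} (hx : x ∈ U) : IsLinearMap ℝ (mderiv M N f x) :=
  isLinearMap_mderivTo hU hf hx (N.mem_chart _)

theorem mderiv_comp_of_mem {g : N → K} {O : Set N} (hO : IsOpen O) (hg : IsSmoothOn N K g O)
    {f : M → N} {U : Set M} (hU : IsOpen U) (hf : IsSmoothOn M N f U) {x : M} (hx : x ∈ U)
    (hfx : f x ∈ O) (v : M.T x) :
    mderiv M K (fun x => g (f x)) x v = mderiv N K g (f x) (mderiv M N f x v) :=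
  mderivTo_comp hO hg hU hf hx rfl hfx (K.mem_chart _) v

theorem IsSmoothOn.of_charts {f : M → V} {U : Set M} (hU : IsOpen U)
    (h : ∀ i, SmoothOn (fun e => f ((M.chart i).symm e))
      ((M.chart i).target ∩ (M.chart i).symm ⁻¹' U)) :
    IsSmoothOn M (Mfd.ofFrechet V) f U := by
  refine ⟨fun x hx => ContinuousAt.continuousWithinAt ?_, fun i j => (h i).mono ?_⟩
  · have hs := M.mem_chart x
    set i := M.chartIdx x
    have hO : IsOpen ((M.chart i).target ∩ (M.chart i).symm ⁻¹' U) :=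
      (M.chart i).isOpen_inter_preimage_symm hU
    have hm : M.chart i x ∈ (M.chart i).target ∩ (M.chart i).symm ⁻¹' U :=
      ⟨(M.chart i).map_source hs, by rwa [mem_preimage, (M.chart i).left_inv hs]⟩
    have h1 := ((h i).continuousOn.continuousAt (hO.mem_nhds hm))
    have h2 : ContinuousAt (fun y => f ((M.chart i).symm (M.chart i y))) x :=
      ContinuousAt.comp (f := M.chart i) h1 ((M.chart i).continuousAt hs)
    refine h2.congr ?_
    filter_upwards [(M.chart i).open_source.mem_nhds hs] with y hy
    rw [(M.chart i).left_inv hy]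
  · rintro e ⟨h1, h2, -⟩
    exact ⟨h1, h2⟩

theorem IsSmoothOn.in_chart {f : M → V} {U : Set M}
    (hf : IsSmoothOn M (Mfd.ofFrechet V) f U) (i : M.ι) :
    SmoothOn (fun e => f ((M.chart i).symm e)) ((M.chart i).target ∩ (M.chart i).symm ⁻¹' U) :=
  (hf.2 i ⟨⟩).mono fun _ he => ⟨he.1, he.2, mem_univ _⟩

theorem SmoothOn.isSmoothOn {f : V → W} {U : Set V} (hU : IsOpen U) (hf : SmoothOn f U) :
    IsSmoothOn (Mfd.ofFrechet V) (Mfd.ofFrechet W) f U :=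
  IsSmoothOn.of_charts (M := Mfd.ofFrechet V) hU fun _ => hf.mono fun _ he => he.2

theorem IsSmoothOn.smoothOn {f : V → W} {U : Set V}
    (hf : IsSmoothOn (Mfd.ofFrechet V) (Mfd.ofFrechet W) f U) : SmoothOn f U :=
  (IsSmoothOn.in_chart (M := Mfd.ofFrechet V) hf ⟨⟩).mono fun _ he => ⟨mem_univ _, he⟩

theorem isSmoothOn_chart (i : M.ι) :
    IsSmoothOn M (Mfd.ofFrechet (M.model i)) (M.chart i) (M.chart i).source :=
  IsSmoothOn.of_charts (M.chart i).open_source fun j n => M.smooth_transition j i n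

theorem isSmoothOn_chart_symm (i : M.ι) :
    IsSmoothOn (Mfd.ofFrechet (M.model i)) M (M.chart i).symm (M.chart i).target :=
  ⟨(M.chart i).continuousOn_symm, fun _ j n => (M.smooth_transition i j n).mono
    fun _ he => ⟨he.2.1, he.2.2⟩⟩

theorem isOpen_chart_preimage {U : Set M} (hU : IsOpen U) (i : M.ι) :
    IsOpen ((M.chart i).target ∩ (M.chart i).symm ⁻¹' U) :=
  (M.chart i).isOpen_inter_preimage_symm hU

/-- The chain rule in arbitrary charts. -/
theorem dirDeriv_rep_comp {g : N → K} {O : Set N} (hO : IsOpen O) (hg : IsSmoothOn N K g O)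
    {f : M → N} {U : Set M} (hU : IsOpen U) (hf : IsSmoothOn M N f U) {x : M} (hx : x ∈ U)
    (hfx : f x ∈ O) {i : M.ι} (hi : x ∈ (M.chart i).source) {j : N.ι}
    (hj : f x ∈ (N.chart j).source) {k : K.ι} (hk : g (f x) ∈ (K.chart k).source)
    (v : M.model i) :
    dirDeriv (rep M K i k fun x => g (f x)) (M.chart i x) v =
      dirDeriv (rep N K j k g) (N.chart j (f x)) (dirDeriv (rep M N i j f) (M.chart i x) v) := by
  have hm : M.chart i x ∈ repDom M N i j f U :=
    ⟨(M.chart i).map_source hi, by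
      rw [mem_preimage, (M.chart i).left_inv hi]; exact ⟨hx, hj⟩⟩
  have hfx' : rep M N i j f (M.chart i x) = N.chart j (f x) := by
    simp only [rep, (M.chart i).left_inv hi]
  have he : (rep M K i k fun x => g (f x)) =ᶠ[𝓝 (M.chart i x)]
      fun e => rep N K j k g (rep M N i j f e) := by
    filter_upwards [(isOpen_repDom hU hf.1 i j).mem_nhds hm] with e he
    simp only [rep, (N.chart j).left_inv he.2.2]
  have hm' : rep M N i j f (M.chart i x) ∈ repDom N K j k g O := by
    rw [hfx']
    exact ⟨(N.chart j).map_source hj, by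
      rw [mem_preimage, (N.chart j).left_inv hj]; exact ⟨hfx, hk⟩⟩
  rw [dirDeriv_congr he, dirDeriv_comp (isOpen_repDom hO hg.1 j k) (hg.2 j k) (hf.2 i j) hm hm',
    hfx']

theorem mderivTo_chartVec {f : M → N} {U : Set M} (hU : IsOpen U) (hf : IsSmoothOn M N f U)
    {x : M} (hx : x ∈ U) {i : M.ι} (hi : x ∈ (M.chart i).source) {k : N.ι}
    (hk : f x ∈ (N.chart k).source) (v : M.model i) :
    mderivTo M N f x k (chartVec M i x v) = dirDeriv (rep M N i k f) (M.chart i x) v :=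
  (dirDeriv_rep_comp hU hf isOpen_univ isSmooth_id (mem_univ x) hx hi (M.mem_chart x) hk v).symm

theorem mderiv_chartVec {f : M → N} {U : Set M} (hU : IsOpen U) (hf : IsSmoothOn M N f U)
    {x : M} (hx : x ∈ U) {i : M.ι} (hi : x ∈ (M.chart i).source) {j : N.ι}
    (hj : f x ∈ (N.chart j).source) (v : M.model i) :
    mderiv M N f x (chartVec M i x v) =
      chartVec N j (f x) (dirDeriv (rep M N i j f) (M.chart i x) v) :=
  (mderivTo_chartVec hU hf hx hi (N.mem_chart _) v).trans
    (dirDeriv_rep_comp isOpen_univ isSmooth_id hU hf hx (mem_univ _) hi hj (N.mem_chart _) v)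

theorem chartVec_chartIdx (x : M) (v : M.T x) : chartVec M (M.chartIdx x) x v = v :=
  mderivTo_id x v

/-- The coefficient function of a 1-form in the chart `i`. -/
def coeff (ω : Fam1 M V) (i : M.ι) (p : M.model i × M.model i) : V :=
  ω ((M.chart i).symm p.1) (chartVec M i ((M.chart i).symm p.1) p.2)

theorem coeff_chart (ω : Fam1 M V) {i : M.ι} {x : M} (hx : x ∈ (M.chart i).source)
    (v : M.model i) : coeff ω i (M.chart i x, v) = ω x (chartVec M i x v) := by
  simp only [coeff]
  rw [(M.chart i).left_inv hx]

/-- Smoothness of a family of linear forms over a subset, tested in charts. -/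
def FormSmoothOn (ω : Fam1 M V) (U : Set M) : Prop :=
  ∀ i, SmoothOn (coeff ω i)
    (((M.chart i).target ∩ (M.chart i).symm ⁻¹' U) ×ˢ (univ : Set (M.model i)))

theorem IsForm1.formSmoothOn {ω : Fam1 M V} (hω : IsForm1 M V ω) (U : Set M) :
    FormSmoothOn ω U := fun i => (hω.smooth i).mono fun _ hp => ⟨hp.1.1, mem_univ _⟩

theorem FormSmoothOn.isForm1 {ω : Fam1 M V} (hω : FormSmoothOn ω univ)
    (hl : ∀ x, IsLinearMap ℝ (ω x)) : IsForm1 M V ω where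
  add x := (hl x).map_add
  smul x := (hl x).map_smul
  smooth i := (hω i).mono fun _ hp => ⟨⟨hp.1, mem_univ _⟩, mem_univ _⟩

theorem FormSmoothOn.of_local {ω : Fam1 M V} {U : Set M}
    (h : ∀ x ∈ U, ∃ O, IsOpen O ∧ x ∈ O ∧ FormSmoothOn ω O) : FormSmoothOn ω U := by
  refine fun i => SmoothOn.of_local fun p hp => ?_
  obtain ⟨O, hO, hx, hω⟩ := h _ hp.1.2
  exact ⟨_, (isOpen_chart_preimage hO i).prod isOpen_univ, ⟨⟨hp.1.1, hx⟩, mem_univ _⟩, hω i⟩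

theorem FormSmoothOn.congr {ω η : Fam1 M V} {U : Set M} (hU : IsOpen U) (hω : FormSmoothOn ω U)
    (h : ∀ x ∈ U, ∀ v, ω x v = η x v) : FormSmoothOn η U := fun i =>
  (hω i).congr ((isOpen_chart_preimage hU i).prod isOpen_univ) fun _ hp => h _ hp.1.2 _

theorem FormSmoothOn.add {ω η : Fam1 M V} {U : Set M} (hU : IsOpen U) (hω : FormSmoothOn ω U)
    (hη : FormSmoothOn η U) : FormSmoothOn (fun x v => ω x v + η x v) U := fun i =>
  (hω i).add ((isOpen_chart_preimage hU i).prod isOpen_univ) (hη i)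

theorem coeff_pull {f : M → N} {U : Set M} (hU : IsOpen U) (hf : IsSmoothOn M N f U)
    (ω : Fam1 N V) {i : M.ι} {j : N.ι} {e : M.model i} (he : e ∈ repDom M N i j f U)
    (v : M.model i) :
    coeff (pull f ω) i (e, v) =
      coeff ω j (rep M N i j f e, dirDeriv (rep M N i j f) e v) := by
  have h1 := mderiv_chartVec hU hf he.2.1 ((M.chart i).map_target he.1) he.2.2 v
  rw [(M.chart i).right_inv he.1] at h1
  simp only [coeff, pull, rep]
  rw [(N.chart j).left_inv he.2.2, h1]

theorem FormSmoothOn.pull {f : M → N} {U : Set M} (hU : IsOpen U) (hf : IsSmoothOn M N f U)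
    {ω : Fam1 N V} {O : Set N} (hO : IsOpen O) (hω : FormSmoothOn ω O) (h : MapsTo f U O) :
    FormSmoothOn (pull f ω) U := by
  refine fun i => SmoothOn.of_local fun p hp => ?_
  set j := N.chartIdx (f ((M.chart i).symm p.1)) with hj
  have hD := isOpen_repDom hU hf.1 i j
  have hDu := hD.prod (isOpen_univ (X := M.model i))
  refine ⟨_, hDu, ⟨⟨hp.1.1, hp.1.2, N.mem_chart _⟩, mem_univ _⟩, ?_⟩
  have h1 : SmoothOn (fun p : M.model i × M.model i => rep M N i j f p.1)
      (repDom M N i j f U ×ˢ univ) :=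
    SmoothOn.comp (f := fun p : M.model i × M.model i => p.1) hD (hf.2 i j) hDu
      (smoothOn_fst _) fun p hp => hp.1
  refine SmoothOn.congr hDu (SmoothOn.comp (g := coeff ω j) ((isOpen_chart_preimage hO j).prod
    isOpen_univ) (hω j) hDu (h1.prodMk hDu (hf.2 i j).deriv) ?_) ?_
  · rintro q ⟨hq, -⟩
    refine ⟨⟨(N.chart j).map_source hq.2.2, ?_⟩, mem_univ _⟩
    simp only [mem_preimage, rep, (N.chart j).left_inv hq.2.2]
    exact h hq.2.1
  · rintro ⟨e, v⟩ ⟨hq, -⟩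
    exact (coeff_pull hU hf ω hq v).symm

theorem isForm1_pull {f : M → N} (hf : IsSmooth M N f) {ω : Fam1 N V} (hω : IsForm1 N V ω) :
    IsForm1 M V (pull f ω) :=
  (FormSmoothOn.pull isOpen_univ hf isOpen_univ (hω.formSmoothOn univ)
    (mapsTo_univ _ _)).isForm1 fun x =>
    ⟨fun v w => by
      simp only [pull]; rw [(isLinearMap_mderiv isOpen_univ hf (mem_univ x)).map_add, hω.add],
    fun c v => by
      simp only [pull]; rw [(isLinearMap_mderiv isOpen_univ hf (mem_univ x)).map_smul, hω.smul]⟩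

theorem pull_comp {g : N → K} {O : Set N} (hO : IsOpen O) (hg : IsSmoothOn N K g O)
    {f : M → N} {U : Set M} (hU : IsOpen U) (hf : IsSmoothOn M N f U) {x : M} (hx : x ∈ U)
    (hfx : f x ∈ O) (ω : Fam1 K V) (v : M.T x) :
    pull (fun x => g (f x)) ω x v = pull f (pull g ω) x v := by
  simp only [pull]
  rw [mderiv_comp_of_mem hO hg hU hf hx hfx]

theorem pull2_comp {g : N → K} (hg : IsSmooth N K g) {f : M → N} (hf : IsSmooth M N f)
    (ω : Fam2 K V) (x : M) (v w : M.T x) :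
    pull2 (fun x => g (f x)) ω x v w = pull2 f (pull2 g ω) x v w := by
  simp only [pull2]
  rw [mderiv_comp hg hf, mderiv_comp hg hf]

theorem pull_id (ω : Fam1 M V) (x : M) (v : M.T x) : pull (fun x => x) ω x v = ω x v :=
  congrArg (ω x) (mderivTo_id x v)

theorem coeff_isLinearMap {ω : Fam1 M V} (hω : IsForm1 M V ω) {i : M.ι} {x : M}
    (hi : x ∈ (M.chart i).source) : IsLinearMap ℝ (fun v => coeff ω i (M.chart i x, v)) := by
  have hl : IsLinearMap ℝ (chartVec M i x) :=
    SmoothOn.isLinearMap (isOpen_repDom (M := M) (N := M) (f := fun y => y) isOpen_univ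
      continuousOn_id i _) ((isSmooth_id (M := M)).2 i (M.chartIdx x))
      ⟨(M.chart i).map_source hi, by
        rw [mem_preimage, (M.chart i).left_inv hi]; exact ⟨mem_univ _, M.mem_chart x⟩⟩
  constructor
  · intro v w
    simp only [coeff_chart ω hi]
    rw [hl.map_add, hω.add]
  · intro c v
    simp only [coeff_chart ω hi]
    rw [hl.map_smul, hω.smul]

/-- The exterior derivative commutes with pullback. -/
theorem extD_pull {f : M → N} (hf : IsSmooth M N f) {ω : Fam1 N V} (hω : IsForm1 N V ω)
    (x : M) (v w : M.T x) : extD (pull f ω) x v w = pull2 f (extD ω) x v w := by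
  set i := M.chartIdx x with hi
  set j := N.chartIdx (f x) with hj
  set F := rep M N i j f with hF
  set e := M.chart i x with he
  have hD : IsOpen (repDom M N i j f univ) := isOpen_repDom isOpen_univ hf.1 i j
  have heD : e ∈ repDom M N i j f univ := mem_repDom (mem_univ x) (N.mem_chart _)
  have hFs : SmoothOn F (repDom M N i j f univ) := hf.2 i j
  have hFe : F e = N.chart j (f x) := by
    simp only [hF, rep, he, (M.chart i).left_inv (M.mem_chart x)]
  have hT : IsOpen ((N.chart j).target ×ˢ (univ : Set (N.model j))) :=
    (N.chart j).open_target.prod isOpen_univ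
  have hmem : ∀ u : N.model j, (F e, u) ∈ (N.chart j).target ×ˢ (univ : Set (N.model j)) :=
    fun u => ⟨by rw [hFe]; exact (N.chart j).map_source (N.mem_chart _), mem_univ _⟩
  have hlin : IsLinearMap ℝ (fun u => coeff ω j (F e, u)) := by
    rw [hFe]; exact coeff_isLinearMap hω (N.mem_chart _)
  have key : ∀ v w : M.model i, dirDeriv (fun e' => coeff (pull f ω) i (e', w)) e v =
      dirDeriv (fun y => coeff ω j (y, dirDeriv F e w)) (F e) (dirDeriv F e v) +
        coeff ω j (F e, dirDeriv (fun e' => dirDeriv F e' w) e v) := by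
    intro v w
    have h1 : (fun e' => coeff (pull f ω) i (e', w)) =ᶠ[𝓝 e]
        fun e' => coeff ω j (F e', dirDeriv F e' w) := by
      filter_upwards [hD.mem_nhds heD] with e' he'
      exact coeff_pull isOpen_univ hf ω he' w
    have h2 := (hFs.hasDirDeriv heD v).prodMk ((hFs.deriv_const hD w).hasDirDeriv heD v)
    have h3 := HasDirDeriv.comp (g := coeff ω j) (f := fun y => (F y, dirDeriv F y w)) hT
      (hω.smooth j 1) (hmem _) h2
    rw [dirDeriv_congr h1, h3.dirDeriv]
    rw [SmoothOn.dirDeriv_pair (f := coeff ω j) hT (hω.smooth j) (hmem _)]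
    congr 1
    exact (hasDirDeriv_linear hlin _ _).dirDeriv
  have hl : extD (pull f ω) x v w = dirDeriv (fun e' => coeff (pull f ω) i (e', w)) e v -
      dirDeriv (fun e' => coeff (pull f ω) i (e', v)) e w := rfl
  have hr : pull2 f (extD ω) x v w =
      dirDeriv (fun y => coeff ω j (y, dirDeriv F e w)) (N.chart j (f x)) (dirDeriv F e v) -
      dirDeriv (fun y => coeff ω j (y, dirDeriv F e v)) (N.chart j (f x)) (dirDeriv F e w) := rfl
  rw [hl, hr, key, key, hFs.dirDeriv_comm hD heD v w, hFe]
  abel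

/-- The tangent maps of a smooth family of maps that send `n₀` into a fixed chart domain depend
smoothly on the parameter. -/
theorem isSmooth_mderivTo {F : M × N → K} (hF : IsSmooth (M.prod N) K F) (n₀ : N) (k : K.ι)
    (hk : ∀ m, F (m, n₀) ∈ (K.chart k).source) :
    IsSmooth (M.prod (Mfd.ofFrechet (N.T n₀))) (Mfd.ofFrechet (K.model k))
      (fun p : M × N.T n₀ => mderivTo N K (fun n => F (p.1, n)) n₀ k p.2) := by
  refine IsSmoothOn.of_charts (M := M.prod (Mfd.ofFrechet (N.T n₀))) isOpen_univ fun i => ?_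
  obtain ⟨i, _⟩ := i
  set j := N.chartIdx n₀ with hj
  have hD : IsOpen (repDom (M.prod N) K (i, j) k F univ) :=
    isOpen_repDom isOpen_univ hF.1 (i, j) k
  have hs := (hF.2 (i, j) k).deriv
  have hT : IsOpen ((M.chart i).target ×ˢ (univ : Set (N.model j))) :=
    (M.chart i).open_target.prod isOpen_univ
  refine SmoothOn.mono (U := (M.chart i).target ×ˢ (univ : Set (N.model j))) ?_
    fun p hp => hp.1
  refine SmoothOn.congr hT (f := fun p : M.model i × N.model j =>
    dirDeriv (rep (M.prod N) K (i, j) k F) (p.1, N.chart j n₀) (0, p.2)) ?_ ?_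
  · refine SmoothOn.comp (f := fun p : M.model i × N.model j =>
      (((p.1, N.chart j n₀) : M.model i × N.model j), ((0, p.2) : M.model i × N.model j)))
      (hD.prod isOpen_univ) hs hT ?_ ?_
    · exact (((smoothOn_fst _).prodMk hT
        (smoothOn_const _ _)).prodMk hT ((smoothOn_const _ _).prodMk hT
        (smoothOn_snd _)))
    · rintro p hp
      refine ⟨⟨⟨hp.1, (N.chart j).map_source (N.mem_chart n₀)⟩, mem_univ _, ?_⟩, mem_univ _⟩
      have : (N.chart j).symm (N.chart j n₀) = n₀ := (N.chart j).left_inv (N.mem_chart n₀)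
      have h2 := hk ((M.chart i).symm p.1)
      rw [← this] at h2
      exact h2
  · intro p hp
    exact (dirDeriv_slice_right (rep (M.prod N) K (i, j) k F) p.1 (N.chart j n₀) p.2).symm

/-- Every fibre of a submersion that is not empty contains a point at which the tangent map is
surjective, namely a value of a local section. Hence forms on the target are determined by their
pullbacks. -/
theorem IsSubmersion.mderiv_surjective {π : M → N} (hπ : IsSubmersion M N π) (x : M) :
    ∃ x' : M, π x' = π x ∧ Function.Surjective (mderiv M N π x') := by
  obtain ⟨O, s, hO, hx, hs, hsec⟩ := hπ.exists_section x
  refine ⟨s (π x), hsec _ hx, ?_⟩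
  have key : ∀ y : N, π x = y → ∀ u : N.T y,
      mderivTo M N π (s (π x)) (N.chartIdx y) (mderiv N M s (π x)
        (mderivTo N N (fun y => y) y (N.chartIdx (π x)) u)) = u := by
    rintro y rfl u
    have h1 : mderivTo N N (fun y => y) (π x) (N.chartIdx (π x)) u = u := mderivTo_id _ u
    rw [h1]
    have h2 := mderivTo_comp isOpen_univ hπ.1 hO hs hx rfl (mem_univ _) (k := N.chartIdx (π x))
      (by rw [hsec _ hx]; exact N.mem_chart _) u
    rw [mderivTo_congr (g := fun y => y) (eventually_of_mem (hO.mem_nhds hx) hsec),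
      mderivTo_id] at h2
    exact h2.symm
  exact fun u => ⟨_, key _ (hsec _ hx).symm u⟩

end Manifolds

/-! ### Smooth pairings and exterior derivatives -/

section Pairings

variable {M N K M' : Mfd.{u}} {V W : FrechetSpace.{u}}

theorem isSmoothOn_pair_const {ρ : M' × V → W}
    (hρ : IsSmooth (M'.prod (Mfd.ofFrechet V)) (Mfd.ofFrechet W) ρ) {g : M → M'} {U : Set M}
    (hU : IsOpen U) (hg : IsSmoothOn M M' g U) (c : V) :
    IsSmoothOn M (Mfd.ofFrechet W) (fun x => ρ (g x, c)) U :=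
  hρ.comp_on hU (hg.prodMk hU (IsSmooth.on (isSmooth_const (N := Mfd.ofFrechet V) c) U))

/-- A smooth map `ρ` that is applied pointwise to a map `g` and a 1-form `ω` gives a smooth family
of maps on tangent vectors. -/
theorem FormSmoothOn.pairing {ρ : M' × V → W}
    (hρ : IsSmooth (M'.prod (Mfd.ofFrechet V)) (Mfd.ofFrechet W) ρ) {g : M → M'} {U : Set M}
    (hU : IsOpen U) (hg : IsSmoothOn M M' g U) {ω : Fam1 M V} (hω : FormSmoothOn ω U) :
    FormSmoothOn (fun x v => ρ (g x, ω x v)) U := by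
  intro i
  set E := M.model i
  set D : Set (E.prod E) := ((M.chart i).target ∩ (M.chart i).symm ⁻¹' U) ×ˢ (univ : Set E)
  have hO := isOpen_chart_preimage hU i
  have hD : IsOpen D := hO.prod isOpen_univ
  have h1 : IsSmoothOn (Mfd.ofFrechet (E.prod E)) (Mfd.ofFrechet E) (fun p : E × E => p.1) D :=
    SmoothOn.isSmoothOn (V := E.prod E) hD (smoothOn_fst D)
  have h2 : IsSmoothOn (Mfd.ofFrechet (E.prod E)) M
      (fun p : E × E => (M.chart i).symm p.1) D :=
    (isSmoothOn_chart_symm i).comp (M.chart i).open_target hD h1 fun p hp => hp.1.1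
  have h3 : IsSmoothOn (Mfd.ofFrechet (E.prod E)) M'
      (fun p : E × E => g ((M.chart i).symm p.1)) D :=
    IsSmoothOn.comp hU hg hD h2 fun p hp => hp.1.2
  have h4 := hρ.comp_on hD (h3.prodMk hD (SmoothOn.isSmoothOn (V := E.prod E) hD (hω i)))
  exact IsSmoothOn.smoothOn (V := E.prod E) h4

/-- The derivative along the diagonal is the sum of the two partial derivatives. -/
theorem dirDeriv_diag {E F : FrechetSpace.{u}} {Φ : E × E → F} {O : Set (E × E)} (hO : IsOpen O)
    (hΦ : SmoothOn Φ O) {e : E} (he : (e, e) ∈ O) (v : E) :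
    dirDeriv (fun e' => Φ (e', e')) e v =
      dirDeriv (fun e' => Φ (e', e)) e v + dirDeriv (fun e' => Φ (e, e')) e v := by
  rw [dirDeriv_comp (f := fun e' : E => (e', e')) (g := Φ) hO hΦ (smoothOn_clm
    ((ContinuousLinearMap.id ℝ E).prod (ContinuousLinearMap.id ℝ E)) univ) (mem_univ e) he]
  have h := (hasDirDeriv_clm
    ((ContinuousLinearMap.id ℝ E).prod (ContinuousLinearMap.id ℝ E)) e v).dirDeriv
  have h' : dirDeriv (fun e' : E => (e', e')) e v = (v, v) := h
  rw [h', hΦ.dirDeriv_pair hO he]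

theorem IsForm1.coeff_smooth_const {ω : Fam1 M V} (hω : IsForm1 M V ω) (i : M.ι) (w : M.model i) :
    SmoothOn (fun e => coeff ω i (e, w)) (M.chart i).target :=
  SmoothOn.comp (g := coeff ω i) (f := fun e => (e, w))
    ((M.chart i).open_target.prod isOpen_univ) (hω.smooth i) (M.chart i).open_target
    ((smoothOn_id _).prodMk (M.chart i).open_target (smoothOn_const _ _))
    fun _ he => ⟨he, mem_univ _⟩

theorem extD_eq (ω : Fam1 M V) (x : M) (v w : M.T x) : extD ω x v w =
    dirDeriv (fun e => coeff ω (M.chartIdx x) (e, w)) (M.chart (M.chartIdx x) x) v -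
      dirDeriv (fun e => coeff ω (M.chartIdx x) (e, v)) (M.chart (M.chartIdx x) x) w := rfl

theorem extD_add {ω η : Fam1 M V} (hω : IsForm1 M V ω) (hη : IsForm1 M V η) (x : M)
    (v w : M.T x) :
    extD (fun x v => ω x v + η x v) x v w = extD ω x v w + extD η x v w := by
  have h : ∀ v w : M.T x, dirDeriv (fun e => coeff (fun x v => ω x v + η x v) (M.chartIdx x)
      (e, w)) (M.chart (M.chartIdx x) x) v =
      dirDeriv (fun e => coeff ω (M.chartIdx x) (e, w)) (M.chart (M.chartIdx x) x) v +
      dirDeriv (fun e => coeff η (M.chartIdx x) (e, w)) (M.chart (M.chartIdx x) x) v := fun v w =>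
    (((hω.coeff_smooth_const _ w).hasDirDeriv ((M.chart _).map_source (M.mem_chart x)) v).add
    ((hη.coeff_smooth_const _ w).hasDirDeriv ((M.chart _).map_source (M.mem_chart x)) v)).dirDeriv
  rw [extD_eq, extD_eq, extD_eq, h, h]
  abel

theorem extD_sub {ω η : Fam1 M V} (hω : IsForm1 M V ω) (hη : IsForm1 M V η) (x : M)
    (v w : M.T x) :
    extD (fun x v => ω x v - η x v) x v w = extD ω x v w - extD η x v w := by
  have h : ∀ v w : M.T x, dirDeriv (fun e => coeff (fun x v => ω x v - η x v) (M.chartIdx x)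
      (e, w)) (M.chart (M.chartIdx x) x) v =
      dirDeriv (fun e => coeff ω (M.chartIdx x) (e, w)) (M.chart (M.chartIdx x) x) v -
      dirDeriv (fun e => coeff η (M.chartIdx x) (e, w)) (M.chart (M.chartIdx x) x) v := fun v w =>
    (((hω.coeff_smooth_const _ w).hasDirDeriv ((M.chart _).map_source (M.mem_chart x)) v).sub
    ((hη.coeff_smooth_const _ w).hasDirDeriv ((M.chart _).map_source (M.mem_chart x)) v)).dirDeriv
  rw [extD_eq, extD_eq, extD_eq, h, h]
  abel

/-- The Leibniz rule for a pairing `ρ` which is linear in the second argument. -/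
theorem extD_pairing {ρ : M' × V → W}
    (hρ : IsSmooth (M'.prod (Mfd.ofFrechet V)) (Mfd.ofFrechet W) ρ)
    (hl : ∀ m, IsLinearMap ℝ (fun v => ρ (m, v))) {g : M → M'}
    (hg : IsSmooth M M' g) {ω : Fam1 M V} (hω : IsForm1 M V ω) (x : M) (v w : M.T x) :
    extD (fun x v => ρ (g x, ω x v)) x v w = ρ (g x, extD ω x v w) +
      (mderivTo M (Mfd.ofFrechet W) (fun y => ρ (g y, ω x w)) x ⟨⟩ v -
        mderivTo M (Mfd.ofFrechet W) (fun y => ρ (g y, ω x v)) x ⟨⟩ w) := by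
  set i := M.chartIdx x with hi
  set E := M.model i with hE
  set e := M.chart i x with he
  set T := (M.chart i).target
  have hT : IsOpen T := (M.chart i).open_target
  have heT : e ∈ T := (M.chart i).map_source (M.mem_chart x)
  have hex : (M.chart i).symm e = x := (M.chart i).left_inv (M.mem_chart x)
  have key : ∀ v w : E, dirDeriv (fun e' => coeff (fun x v => ρ (g x, ω x v)) i (e', w)) e v =
      mderivTo M (Mfd.ofFrechet W) (fun y => ρ (g y, ω x w)) x ⟨⟩ v +
      ρ (g x, dirDeriv (fun e' => coeff ω i (e', w)) e v) := by
    intro v w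
    have hTT : IsOpen (T ×ˢ T : Set (E.prod E)) := hT.prod hT
    have h1 : IsSmoothOn (Mfd.ofFrechet (E.prod E)) M' (fun p : E × E => g ((M.chart i).symm p.1))
        (T ×ˢ T : Set (E.prod E)) :=
      hg.comp_on hTT ((isSmoothOn_chart_symm i).comp hT hTT
        (SmoothOn.isSmoothOn (V := E.prod E) hTT (smoothOn_fst _)) fun p hp => hp.1)
    have h2 : IsSmoothOn (Mfd.ofFrechet (E.prod E)) (Mfd.ofFrechet V)
        (fun p : E × E => coeff ω i (p.2, w)) (T ×ˢ T : Set (E.prod E)) :=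
      SmoothOn.isSmoothOn (V := E.prod E) hTT
        (SmoothOn.comp (f := fun p : E × E => p.2) hT (hω.coeff_smooth_const i w) hTT
          (smoothOn_snd _) fun p hp => hp.2)
    have h3 : SmoothOn (fun p : E × E => ρ (g ((M.chart i).symm p.1), coeff ω i (p.2, w)))
        (T ×ˢ T) :=
      IsSmoothOn.smoothOn (V := E.prod E) (hρ.comp_on hTT (h1.prodMk hTT h2))
    have h4 := dirDeriv_diag (Φ := fun p : E × E =>
      ρ (g ((M.chart i).symm p.1), coeff ω i (p.2, w))) hTT h3 (e := e) ⟨heT, heT⟩ v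
    refine h4.trans ?_
    congr 1
    · have h5 : coeff ω i (e, w) = ω x w := by
        rw [coeff_chart ω (M.mem_chart x), chartVec_chartIdx]
      simp only [h5]
      rfl
    · simp only [hex]
      have h6 : SmoothOn (fun z : V => ρ (g x, z)) univ := by
        have := IsSmooth.comp (M := Mfd.ofFrechet V) hρ ((isSmooth_const (M := Mfd.ofFrechet V)
          (g x)).prodMk (isSmooth_id (M := Mfd.ofFrechet V)))
        exact IsSmoothOn.smoothOn this
      rw [dirDeriv_comp (g := fun z : V => ρ (g x, z)) isOpen_univ h6
        (hω.coeff_smooth_const i w) heT (mem_univ _)]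
      exact (hasDirDeriv_linear (hl (g x)) _ _).dirDeriv
  rw [extD_eq, extD_eq, key, key, (hl (g x)).map_sub]
  abel

theorem mderivTo_linear {L : V → W} (hL : IsLinearMap ℝ L)
    (hs : IsSmooth (Mfd.ofFrechet V) (Mfd.ofFrechet W) L) {f : M → V} {U : Set M} (hU : IsOpen U)
    (hf : IsSmoothOn M (Mfd.ofFrechet V) f U) {x : M} (hx : x ∈ U) (v : M.T x) :
    mderivTo M (Mfd.ofFrechet W) (fun y => L (f y)) x ⟨⟩ v =
      L (mderivTo M (Mfd.ofFrechet V) f x ⟨⟩ v) :=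
  (mderivTo_comp isOpen_univ hs hU hf hx rfl (mem_univ _) (mem_univ _) v).trans
    (hasDirDeriv_linear hL _ _).dirDeriv

theorem extD_linear {L : V → W} (hL : IsLinearMap ℝ L)
    (hs : IsSmooth (Mfd.ofFrechet V) (Mfd.ofFrechet W) L) {ω : Fam1 M V} (hω : IsForm1 M V ω)
    (x : M) (v w : M.T x) : extD (fun x v => L (ω x v)) x v w = L (extD ω x v w) := by
  have h : ∀ v w : M.T x, dirDeriv (fun e => coeff (fun x v => L (ω x v)) (M.chartIdx x)
      (e, w)) (M.chart (M.chartIdx x) x) v =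
      L (dirDeriv (fun e => coeff ω (M.chartIdx x) (e, w)) (M.chart (M.chartIdx x) x) v) :=
    fun v w => (dirDeriv_comp (g := L) isOpen_univ (IsSmoothOn.smoothOn hs)
      (hω.coeff_smooth_const _ w) ((M.chart _).map_source (M.mem_chart x)) (mem_univ _) v).trans
      (hasDirDeriv_linear hL _ _).dirDeriv
  rw [extD_eq, extD_eq, h, h, hL.map_sub]

/-- The tangent map at a single point, as a map of Fréchet spaces, is smooth. -/
theorem isSmooth_mderivTo_vec {f : M → N} {U : Set M} (hU : IsOpen U) (hf : IsSmoothOn M N f U)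
    {x : M} (hx : x ∈ U) {j : N.ι} (hj : f x ∈ (N.chart j).source) :
    IsSmooth (Mfd.ofFrechet (M.T x)) (Mfd.ofFrechet (N.model j)) (mderivTo M N f x j) := by
  refine SmoothOn.isSmoothOn isOpen_univ ?_
  exact SmoothOn.comp (g := fun p : M.T x × M.T x => dirDeriv (rep M N (M.chartIdx x) j f) p.1 p.2)
    (f := fun v => (M.chart (M.chartIdx x) x, v)) ((isOpen_repDom hU hf.1 _ _).prod isOpen_univ)
    (hf.2 _ j).deriv isOpen_univ ((smoothOn_const _ _).prodMk isOpen_univ (smoothOn_id _))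
    fun v _ => ⟨mem_repDom hx hj, mem_univ _⟩

end Pairings

/-! ### Adjoint action, bracket and Maurer--Cartan forms -/

section LieGroups

variable {G G' : FLieGroup.{u}} {M N : Mfd.{u}}

theorem isSmoothOn_inv {f : M → G} {U : Set M} (hU : IsOpen U) (hf : IsSmoothOn M G f U) :
    IsSmoothOn M G (fun x => (f x)⁻¹) U := IsSmooth.comp_on G.smooth_inv hU hf

theorem mem_source_of_eq_one {g : G} (h : g = 1) : g ∈ (G.chart G.e).source := by
  rw [h]; exact G.mem_chart 1

theorem isSmooth_Ad : IsSmooth (G.toMfd.prod (Mfd.ofFrechet G.lie)) (Mfd.ofFrechet G.lie)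
    (fun p : G × G.lie => G.Ad p.1 p.2) := by
  have h1 : IsSmooth (G.toMfd.prod G.toMfd) G.toMfd (fun p : G × G => p.1 * p.2 * p.1⁻¹) :=
    isSmoothOn_mul isOpen_univ (isSmoothOn_mul isOpen_univ isSmooth_fst isSmooth_snd)
      (isSmoothOn_inv isOpen_univ isSmooth_fst)
  exact isSmooth_mderivTo h1 (1 : G) G.e fun m => conj_one_mem m

theorem isLinearMap_Ad (g : G) : IsLinearMap ℝ (G.Ad g) :=
  isLinearMap_mderivTo isOpen_univ (isSmooth_conj g) (mem_univ (1 : G)) (conj_one_mem g)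

theorem Ad_one (X : G.lie) : G.Ad 1 X = X := by
  have h : (fun x : G => 1 * x * (1 : G)⁻¹) = fun x => x := by funext x; group
  unfold FLieGroup.Ad
  rw [h]
  exact mderivTo_id (M := G) 1 X

theorem Ad_inv_Ad (g : G) (X : G.lie) : G.Ad g⁻¹ (G.Ad g X) = X := by
  rw [← Ad_mul, inv_mul_cancel, Ad_one]

theorem isSmooth_Ad_const (X : G.lie) :
    IsSmooth G.toMfd (Mfd.ofFrechet G.lie) (fun g : G => G.Ad g X) :=
  isSmoothOn_pair_const isSmooth_Ad isOpen_univ isSmooth_id X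

theorem isLinearMap_bracket_left (Y : G.lie) : IsLinearMap ℝ (fun X => G.bracket X Y) :=
  isLinearMap_mderivTo isOpen_univ (isSmooth_Ad_const Y) (mem_univ (1 : G)) (mem_univ _)

theorem mderivTo_mul_inv_self {f : M → G} {U : Set M} (hU : IsOpen U) (hf : IsSmoothOn M G f U)
    {x : M} (hx : x ∈ U) (hfx : f x = 1) (v : M.T x) :
    mderivTo M G (fun y => (f y)⁻¹) x G.e v = - mderivTo M G f x G.e v := by
  have h := mderivTo_mul_one hU hf (isSmoothOn_inv hU hf) hx hfx (by rw [hfx, inv_one]) v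
  simp only [mul_inv_cancel] at h
  rw [mderivTo_const] at h
  exact (neg_eq_of_add_eq_zero_right h.symm).symm

theorem isSmoothOn_mul_const {f : M → G} {U : Set M} (hU : IsOpen U) (hf : IsSmoothOn M G f U)
    (g : G) : IsSmoothOn M G (fun x => f x * g) U :=
  isSmoothOn_mul hU hf (IsSmooth.on (isSmooth_const g) U)

theorem isSmoothOn_const_mul {f : M → G} {U : Set M} (hU : IsOpen U) (hf : IsSmoothOn M G f U)
    (g : G) : IsSmoothOn M G (fun x => g * f x) U :=
  isSmoothOn_mul hU (IsSmooth.on (isSmooth_const g) U) hf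

theorem rightMC_eq_Ad {f : M → G} {U : Set M} (hU : IsOpen U) (hf : IsSmoothOn M G f U)
    {x : M} (hx : x ∈ U) (v : M.T x) : G.rightMC f x v = G.Ad (f x) (G.leftMC f x v) := by
  have h := mderivTo_conj hU (isSmoothOn_const_mul hU hf (f x)⁻¹) hx (by simp) (f x) v
  unfold FLieGroup.leftMC
  rw [← h]
  simp [FLieGroup.rightMC]

theorem leftMC_eq_Ad {f : M → G} {U : Set M} (hU : IsOpen U) (hf : IsSmoothOn M G f U)
    {x : M} (hx : x ∈ U) (v : M.T x) : G.leftMC f x v = G.Ad (f x)⁻¹ (G.rightMC f x v) := by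
  rw [rightMC_eq_Ad hU hf hx, Ad_inv_Ad]

theorem rightMC_inv {f : M → G} {U : Set M} (hU : IsOpen U) (hf : IsSmoothOn M G f U)
    {x : M} (hx : x ∈ U) (v : M.T x) :
    G.rightMC (fun y => (f y)⁻¹) x v = - G.leftMC f x v := by
  have h := mderivTo_mul_inv_self hU (isSmoothOn_const_mul hU hf (f x)⁻¹) hx (by simp) v
  unfold FLieGroup.leftMC
  rw [← h]
  simp [FLieGroup.rightMC]

theorem rightMC_mul {f g : M → G} {U : Set M} (hU : IsOpen U) (hf : IsSmoothOn M G f U)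
    (hg : IsSmoothOn M G g U) {x : M} (hx : x ∈ U) (v : M.T x) :
    G.rightMC (fun y => f y * g y) x v = G.rightMC f x v + G.Ad (f x) (G.rightMC g x v) := by
  rw [rightMC_eq_Ad hU (isSmoothOn_mul hU hf hg) hx, leftMC_mul hU hf hg hx, rightMC_eq_Ad hU hf hx,
    rightMC_eq_Ad hU hg hx, Ad_mul, ← Ad_add, (isLinearMap_Ad (g x)).map_add, ← Ad_mul (g x),
    mul_inv_cancel, Ad_one]

theorem leftMC_const (g : G) (x : M) (v : M.T x) : G.leftMC (fun _ : M => g) x v = 0 :=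
  mderivTo_const x _ _ v

theorem leftMC_congr {f g : M → G} {x : M} (h : f =ᶠ[𝓝 x] g) (v : M.T x) :
    G.leftMC f x v = G.leftMC g x v := by
  unfold FLieGroup.leftMC
  rw [h.eq_of_nhds]
  exact mderivTo_congr (h.mono fun y hy => by simp only [hy]) _ v

theorem leftMC_comp {k : N → G} {O : Set N} (hO : IsOpen O) (hk : IsSmoothOn N G k O) {f : M → N}
    {U : Set M} (hU : IsOpen U) (hf : IsSmoothOn M N f U) {x : M} (hx : x ∈ U) (hfx : f x ∈ O)
    (v : M.T x) : G.leftMC (fun y => k (f y)) x v = pull f (G.leftMC k) x v :=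
  mderivTo_comp hO (isSmoothOn_const_mul hO hk (k (f x))⁻¹) hU hf hx rfl hfx
    (mem_source_of_eq_one (by simp)) v

theorem rightMC_comp {k : N → G} {O : Set N} (hO : IsOpen O) (hk : IsSmoothOn N G k O) {f : M → N}
    {U : Set M} (hU : IsOpen U) (hf : IsSmoothOn M N f U) {x : M} (hx : x ∈ U) (hfx : f x ∈ O)
    (v : M.T x) : G.rightMC (fun y => k (f y)) x v = pull f (G.rightMC k) x v :=
  mderivTo_comp hO (isSmoothOn_mul_const hO hk (k (f x))⁻¹) hU hf hx rfl hfx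
    (mem_source_of_eq_one (by simp)) v

theorem isLinearMap_rightMC {f : M → G} {U : Set M} (hU : IsOpen U) (hf : IsSmoothOn M G f U)
    {x : M} (hx : x ∈ U) : IsLinearMap ℝ (G.rightMC f x) :=
  isLinearMap_mderivTo hU (isSmoothOn_mul_const hU hf _) hx (mem_source_of_eq_one (by simp))

theorem isLinearMap_leftMC {f : M → G} {U : Set M} (hU : IsOpen U) (hf : IsSmoothOn M G f U)
    {x : M} (hx : x ∈ U) : IsLinearMap ℝ (G.leftMC f x) :=
  isLinearMap_mderivTo hU (isSmoothOn_const_mul hU hf _) hx (mem_source_of_eq_one (by simp))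

theorem coeff_rightMC {f : M → G} {U : Set M} (hU : IsOpen U) (hf : IsSmoothOn M G f U)
    {i : M.ι} {e : M.model i} (he : e ∈ (M.chart i).target ∩ (M.chart i).symm ⁻¹' U)
    (w : M.model i) : coeff (G.rightMC f) i (e, w) =
      G.rightMC (M := Mfd.ofFrechet (M.model i)) (fun e => f ((M.chart i).symm e)) e w := by
  have h := mderivTo_chartVec hU (isSmoothOn_mul_const hU hf (f ((M.chart i).symm e))⁻¹) he.2
    ((M.chart i).map_target he.1) (k := G.e) (mem_source_of_eq_one (by simp)) w
  rw [(M.chart i).right_inv he.1] at h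
  exact h

theorem smoothOn_chart_comp {E : FrechetSpace.{u}} {f : E → M} {O : Set E} (hO : IsOpen O)
    (hf : IsSmoothOn (Mfd.ofFrechet E) M f O) (i : M.ι) :
    SmoothOn (fun e => M.chart i (f e)) (O ∩ f ⁻¹' (M.chart i).source) := by
  have hO' : IsOpen (O ∩ f ⁻¹' (M.chart i).source) :=
    hf.1.isOpen_inter_preimage hO (M.chart i).open_source
  exact IsSmoothOn.smoothOn ((isSmoothOn_chart i).comp (M.chart i).open_source hO'
    (hf.mono inter_subset_left) fun e he => he.2)

theorem formSmoothOn_rightMC {f : M → G} {U : Set M} (hU : IsOpen U) (hf : IsSmoothOn M G f U) :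
    FormSmoothOn (G.rightMC f) U := by
  intro i
  set E := M.model i
  set T := (M.chart i).target ∩ (M.chart i).symm ⁻¹' U with hTdef
  have hT : IsOpen T := isOpen_chart_preimage hU i
  set u : E → G := fun e => f ((M.chart i).symm e) with hu
  have hus : IsSmoothOn (Mfd.ofFrechet E) G u T :=
    IsSmoothOn.comp hU hf hT ((isSmoothOn_chart_symm i).mono inter_subset_left) fun e he => he.2
  have hTT : IsOpen (T ×ˢ T : Set (E.prod E)) := hT.prod hT
  have hfst : IsSmoothOn (Mfd.ofFrechet (E.prod E)) G (fun p : E × E => u p.1)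
      (T ×ˢ T : Set (E.prod E)) :=
    IsSmoothOn.comp hT hus hTT (SmoothOn.isSmoothOn (V := E.prod E) hTT (smoothOn_fst _))
      fun p hp => hp.1
  have hsnd : IsSmoothOn (Mfd.ofFrechet (E.prod E)) G (fun p : E × E => u p.2)
      (T ×ˢ T : Set (E.prod E)) :=
    IsSmoothOn.comp hT hus hTT (SmoothOn.isSmoothOn (V := E.prod E) hTT (smoothOn_snd _))
      fun p hp => hp.2
  have hprod := isSmoothOn_mul hTT hsnd (isSmoothOn_inv hTT hfst)
  have hs := smoothOn_chart_comp hTT hprod G.e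
  have hO : IsOpen ((T ×ˢ T : Set (E.prod E)) ∩
      (fun p : E × E => u p.2 * (u p.1)⁻¹) ⁻¹' (G.chart G.e).source) :=
    hprod.1.isOpen_inter_preimage hTT (G.chart G.e).open_source
  have hTu : IsOpen (T ×ˢ (univ : Set E)) := hT.prod isOpen_univ
  refine SmoothOn.congr hTu (f := fun p : E × E =>
    dirDeriv (fun q : E × E => G.chart G.e (u q.2 * (u q.1)⁻¹)) (p.1, p.1) (0, p.2)) ?_ ?_
  · refine SmoothOn.comp (f := fun p : E × E => (((p.1, p.1) : E × E), ((0, p.2) : E × E)))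
      (hO.prod isOpen_univ) hs.deriv hTu ?_ ?_
    · exact (((smoothOn_fst _).prodMk hTu (smoothOn_fst _)).prodMk hTu
        ((smoothOn_const _ _).prodMk hTu (smoothOn_snd _)))
    · rintro p hp
      exact ⟨⟨⟨hp.1, hp.1⟩, mem_source_of_eq_one (by simp)⟩, mem_univ _⟩
  · rintro ⟨e, w⟩ ⟨he, -⟩
    rw [coeff_rightMC hU hf he w]
    exact (dirDeriv_slice_right (fun q : E × E => G.chart G.e (u q.2 * (u q.1)⁻¹)) e e w).symm

theorem isForm1_rightMC {f : M → G} (hf : IsSmooth M G f) : IsForm1 M G.lie (G.rightMC f) :=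
  (formSmoothOn_rightMC isOpen_univ hf).isForm1 fun x =>
    isLinearMap_rightMC isOpen_univ hf (mem_univ x)

theorem formSmoothOn_leftMC {f : M → G} {U : Set M} (hU : IsOpen U) (hf : IsSmoothOn M G f U) :
    FormSmoothOn (G.leftMC f) U :=
  ((formSmoothOn_rightMC hU hf).pairing isSmooth_Ad hU (isSmoothOn_inv hU hf)).congr hU
    fun _ hx v => (leftMC_eq_Ad hU hf hx v).symm

end LieGroups

/-! ### The Maurer--Cartan equation -/

section MaurerCartan

variable {G G' : FLieGroup.{u}} {M N : Mfd.{u}}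

/-- Moving a family of group elements changes `Ad` by the bracket with the right Maurer--Cartan
form. -/
theorem mderivTo_Ad {g : M → G} {U : Set M} (hU : IsOpen U) (hg : IsSmoothOn M G g U) {x : M}
    (hx : x ∈ U) (Z : G.lie) (v : M.T x) :
    mderivTo M (Mfd.ofFrechet G.lie) (fun y => G.Ad (g y) Z) x ⟨⟩ v =
      G.bracket (G.rightMC g x v) (G.Ad (g x) Z) := by
  have h := mderivTo_comp isOpen_univ (isSmooth_Ad_const (G.Ad (g x) Z)) hU
    (isSmoothOn_mul_const hU hg (g x)⁻¹) hx (mul_inv_cancel _) (mem_univ _) (k := ⟨⟩)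
    (mem_univ _) v
  have e : (fun y => G.Ad (g y) Z) = fun y => G.Ad (g y * (g x)⁻¹) (G.Ad (g x) Z) := by
    funext y; rw [← Ad_mul, inv_mul_cancel_right]
  rw [e]
  exact h

section Flat

variable {E : FrechetSpace.{u}}

theorem isSmoothOn_translate (a : E) (U : Set E) (hU : IsOpen U) :
    IsSmoothOn (Mfd.ofFrechet E) (Mfd.ofFrechet E) (fun b => a + b) U :=
  SmoothOn.isSmoothOn hU ((smoothOn_const a U).add hU (smoothOn_id U))

theorem dirDeriv_translate {F : FrechetSpace.{u}} (f : E → F) (a w : E) :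
    dirDeriv (fun b => f (a + b)) 0 w = dirDeriv f a w :=
  dirDeriv_eq_of fun L => by simp [HasDirDeriv]

/-- Both sides are the mixed second derivative at `(e₀, 0)` of
`(a, b) ↦ u(a + b) u(a)⁻¹ (u(e₀ + b) u(e₀)⁻¹)⁻¹`, a map which equals `1` on both axes. -/
theorem dirDeriv_rightMC_comm {u : E → G} {T : Set E} (hT : IsOpen T)
    (hu : IsSmoothOn (Mfd.ofFrechet E) G u T) {e₀ : E} (he₀ : e₀ ∈ T) (v w : E) :
    dirDeriv (fun e => G.rightMC (M := Mfd.ofFrechet E) u e w) e₀ v =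
      dirDeriv (fun e => G.rightMC (M := Mfd.ofFrechet E) u e v) e₀ w -
        G.bracket (G.rightMC (M := Mfd.ofFrechet E) u e₀ w)
          (G.rightMC (M := Mfd.ofFrechet E) u e₀ v) := by
  set θ : E → E → G.lie := fun e w => G.rightMC (M := Mfd.ofFrechet E) u e w with hθ
  set R : E × E → G := fun p => u (p.1 + p.2) * (u p.1)⁻¹ * (u (e₀ + p.2) * (u e₀)⁻¹)⁻¹ with hR
  set c := G.chart G.e with hc
  -- the domain of `R`
  set O : Set (E × E) := {p | p.1 ∈ T ∧ p.1 + p.2 ∈ T ∧ e₀ + p.2 ∈ T} with hO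
  have hOo : IsOpen O := (hT.preimage continuous_fst).inter
    ((hT.preimage (continuous_fst.add continuous_snd)).inter
      (hT.preimage (continuous_const.add continuous_snd)))
  have s1 : IsSmoothOn (Mfd.ofFrechet (E.prod E)) G (fun p : E × E => u p.1) O :=
    IsSmoothOn.comp hT hu hOo (SmoothOn.isSmoothOn (V := E.prod E) hOo (smoothOn_fst _))
      fun p hp => hp.1
  have s2 : IsSmoothOn (Mfd.ofFrechet (E.prod E)) G (fun p : E × E => u (p.1 + p.2)) O :=
    IsSmoothOn.comp hT hu hOo (SmoothOn.isSmoothOn (V := E.prod E) hOo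
      ((smoothOn_fst _).add hOo (smoothOn_snd _))) fun p hp => hp.2.1
  have s3 : IsSmoothOn (Mfd.ofFrechet (E.prod E)) G (fun p : E × E => u (e₀ + p.2)) O :=
    IsSmoothOn.comp hT hu hOo (SmoothOn.isSmoothOn (V := E.prod E) hOo
      ((smoothOn_const _ _).add hOo (smoothOn_snd _))) fun p hp => hp.2.2
  have sR : IsSmoothOn (Mfd.ofFrechet (E.prod E)) G R O :=
    isSmoothOn_mul hOo (isSmoothOn_mul hOo s2 (isSmoothOn_inv hOo s1))
      (isSmoothOn_inv hOo (isSmoothOn_mul_const hOo s3 _))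
  have hcR := smoothOn_chart_comp (E := E.prod E) hOo sR G.e
  have hO' : IsOpen (O ∩ R ⁻¹' c.source) := sR.1.isOpen_inter_preimage hOo c.open_source
  have h0 : ((e₀, 0) : E × E) ∈ O ∩ R ⁻¹' c.source :=
    ⟨⟨he₀, by simpa using he₀, by simpa using he₀⟩, mem_source_of_eq_one (by simp [hR])⟩
  -- the partial derivative in the second variable at `b = 0`
  have p2 : ∀ a ∈ T, dirDeriv (fun q => c (R q)) ((a, 0) : E × E) (0, w) = θ a w - θ e₀ w := by
    intro a ha
    rw [← dirDeriv_slice_right (fun q : E × E => c (R q)) a 0 w]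
    have hD : ∀ a : E, IsOpen {b : E | a + b ∈ T} := fun a =>
      hT.preimage (continuous_const.add continuous_id)
    have sT : ∀ a : E, IsSmoothOn (Mfd.ofFrechet E) G (fun b => u (a + b) * (u a)⁻¹)
        {b : E | a + b ∈ T} := fun a =>
      isSmoothOn_mul_const (hD a) (IsSmoothOn.comp hT hu (hD a)
        (isSmoothOn_translate a _ (hD a)) fun b hb => hb) _
    set D : Set E := {b : E | a + b ∈ T} ∩ {b : E | e₀ + b ∈ T} with hDdef
    have hDo : IsOpen D := (hD a).inter (hD e₀)
    have h0D : (0 : E) ∈ D := ⟨by simpa using ha, by simpa using he₀⟩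
    have hm := mderivTo_mul_one (M := Mfd.ofFrechet E) hDo ((sT a).mono inter_subset_left)
      (isSmoothOn_inv hDo ((sT e₀).mono inter_subset_right)) h0D (by simp) (by simp) w
    rw [mderivTo_mul_inv_self (M := Mfd.ofFrechet E) (hD e₀) (sT e₀) h0D.2 (by simp)] at hm
    refine hm.trans ?_
    rw [sub_eq_add_neg]
    exact congrArg₂ (fun x y => x + -y)
      (dirDeriv_translate (fun e => c (u e * (u a)⁻¹)) a w)
      (dirDeriv_translate (fun e => c (u e * (u e₀)⁻¹)) e₀ w)
  -- the partial derivative in the first variable at `a = e₀`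
  have p1 : ∀ b, e₀ + b ∈ T → dirDeriv (fun q => c (R q)) ((e₀, b) : E × E) (v, 0) =
      θ (e₀ + b) v - G.Ad (u (e₀ + b) * (u e₀)⁻¹) (θ e₀ v) := by
    intro b hb
    rw [← dirDeriv_slice_left (fun q : E × E => c (R q)) e₀ v b]
    set P := u (e₀ + b) * (u e₀)⁻¹ with hP
    have hR' : (fun a => R (a, b)) = fun a => (u (a + b) * (u (e₀ + b))⁻¹) *
        (P * (u a * (u e₀)⁻¹)⁻¹ * P⁻¹) := by
      funext a; simp only [hR, hP]; group
    set D : Set E := T ∩ {a : E | a + b ∈ T} with hDdef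
    have hD2 : IsOpen {a : E | a + b ∈ T} := hT.preimage (continuous_id.add continuous_const)
    have hDo : IsOpen D := hT.inter hD2
    have h0D : e₀ ∈ D := ⟨he₀, hb⟩
    have sA : IsSmoothOn (Mfd.ofFrechet E) G (fun a => u (a + b) * (u (e₀ + b))⁻¹) D :=
      isSmoothOn_mul_const hDo (IsSmoothOn.comp hT hu hDo
        (SmoothOn.isSmoothOn hDo ((smoothOn_id D).add hDo (smoothOn_const b D)))
        fun a ha => ha.2) _
    have sB : IsSmoothOn (Mfd.ofFrechet E) G (fun a => u a * (u e₀)⁻¹) T :=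
      isSmoothOn_mul_const hT hu _
    have sB' := (isSmoothOn_inv hT sB).mono (inter_subset_left : D ⊆ T)
    have hm := mderivTo_mul_one (M := Mfd.ofFrechet E) hDo sA ((isSmooth_conj P).comp_on hDo sB')
      h0D (by simp) (by simp) v
    rw [mderivTo_conj (M := Mfd.ofFrechet E) hDo sB' h0D (by simp),
      mderivTo_mul_inv_self (M := Mfd.ofFrechet E) hT sB he₀ (by simp),
      (isLinearMap_Ad P).map_neg] at hm
    have e1 : (fun a => c (R (a, b))) = fun a => c ((u (a + b) * (u (e₀ + b))⁻¹) *
        (P * (u a * (u e₀)⁻¹)⁻¹ * P⁻¹)) := by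
      funext a; exact congrArg c (congrFun hR' a)
    rw [e1]
    refine hm.trans ?_
    rw [← sub_eq_add_neg]
    refine congrArg₂ (fun x y => x - y) ?_ rfl
    exact dirDeriv_eq_of (f := fun a => c (u (a + b) * (u (e₀ + b))⁻¹))
      (g := fun a => c (u a * (u (e₀ + b))⁻¹)) fun L => by
        simp [HasDirDeriv, add_right_comm]
  -- symmetry of the second derivatives
  have hcomm := hcR.dirDeriv_comm hO' h0 ((v, 0) : E × E) ((0, w) : E × E)
  have l1 := dirDeriv_slice_left (fun q => dirDeriv (fun q => c (R q)) q ((0, w) : E × E))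
    e₀ v (0 : E)
  have l2 := dirDeriv_slice_right (fun q => dirDeriv (fun q => c (R q)) q ((v, 0) : E × E))
    e₀ (0 : E) w
  rw [← l1, ← l2] at hcomm
  have sθ : ∀ w : E, SmoothOn (fun e => θ e w) T := by
    intro w
    have h := formSmoothOn_rightMC (M := Mfd.ofFrechet E) hT hu ⟨⟩
    have h' := SmoothOn.comp (f := fun e : E => (e, w)) (((isOpen_univ.inter hT).prod
      (isOpen_univ (X := E)))) h hT ((smoothOn_id T).prodMk hT (smoothOn_const w T))
      fun e he => ⟨⟨mem_univ _, he⟩, mem_univ _⟩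
    refine h'.congr hT fun e he => ?_
    have := coeff_rightMC (M := Mfd.ofFrechet E) hT hu (i := ⟨⟩) ⟨mem_univ _, he⟩ w
    exact this
  have d1 : dirDeriv (fun a => dirDeriv (fun q => c (R q)) ((a, 0) : E × E) (0, w)) e₀ v =
      dirDeriv (fun e => θ e w) e₀ v := by
    rw [dirDeriv_congr (eventually_of_mem (hT.mem_nhds he₀) p2)]
    have := ((sθ w).hasDirDeriv he₀ v).sub (hasDirDeriv_const (θ e₀ w) e₀ v)
    rw [sub_zero] at this
    exact this.dirDeriv
  have d2 : dirDeriv (fun b => dirDeriv (fun q => c (R q)) ((e₀, b) : E × E) (v, 0)) 0 w =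
      dirDeriv (fun e => θ e v) e₀ w - G.bracket (θ e₀ w) (θ e₀ v) := by
    have hD : IsOpen {b : E | e₀ + b ∈ T} := hT.preimage (continuous_const.add continuous_id)
    have h0D : (0 : E) ∈ {b : E | e₀ + b ∈ T} := by simpa using he₀
    have sD := isSmoothOn_translate e₀ _ hD
    have sA : SmoothOn (fun b => θ (e₀ + b) v) {b : E | e₀ + b ∈ T} :=
      (sθ v).comp hT hD (IsSmoothOn.smoothOn sD) fun b hb => hb
    have sB : IsSmoothOn (Mfd.ofFrechet E) G (fun b => u (e₀ + b) * (u e₀)⁻¹)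
        {b : E | e₀ + b ∈ T} :=
      isSmoothOn_mul_const hD (IsSmoothOn.comp hT hu hD sD fun b hb => hb) _
    have sC := IsSmoothOn.smoothOn ((isSmooth_Ad_const (θ e₀ v)).comp_on hD sB)
    rw [dirDeriv_congr (eventually_of_mem (hD.mem_nhds h0D) p1),
      ((sA.hasDirDeriv h0D w).sub (sC.hasDirDeriv h0D w)).dirDeriv]
    congr 1
    · exact dirDeriv_translate (fun e => θ e v) e₀ w
    · have h := mderivTo_comp isOpen_univ (isSmooth_Ad_const (θ e₀ v)) (M := Mfd.ofFrechet E) hD sB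
        h0D (y := 1) (by simp) (mem_univ _) (k := ⟨⟩) (mem_univ _) w
      refine h.trans ?_
      have h2 : mderivTo (Mfd.ofFrechet E) G (fun b => u (e₀ + b) * (u e₀)⁻¹) 0 G.e w = θ e₀ w :=
        dirDeriv_translate (fun e => c (u e * (u e₀)⁻¹)) e₀ w
      exact congrArg (fun X => G.bracket X (θ e₀ v)) h2
  rw [d1, d2] at hcomm
  exact hcomm

end Flat

theorem extD_rightMC_aux {f : M → G} (hf : IsSmooth M G f) (x : M) (v w : M.T x) :
    extD (G.rightMC f) x v w = - G.bracket (G.rightMC f x w) (G.rightMC f x v) := by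
  set i := M.chartIdx x
  have hT := (M.chart i).open_target
  have hx : M.chart i x ∈ (M.chart i).target := (M.chart i).map_source (M.mem_chart x)
  have hu : IsSmoothOn (Mfd.ofFrechet (M.model i)) G (fun e => f ((M.chart i).symm e))
      (M.chart i).target := hf.comp_on hT (isSmoothOn_chart_symm i)
  have h := dirDeriv_rightMC_comm hT hu hx v w
  have hc : ∀ e ∈ (M.chart i).target, ∀ w, G.rightMC (M := Mfd.ofFrechet (M.model i))
      (fun e => f ((M.chart i).symm e)) e w = coeff (G.rightMC f) i (e, w) := fun e he w =>
    (coeff_rightMC isOpen_univ hf ⟨he, mem_univ _⟩ w).symm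
  have hc' : ∀ w, (fun e => G.rightMC (M := Mfd.ofFrechet (M.model i))
      (fun e => f ((M.chart i).symm e)) e w) =ᶠ[𝓝 (M.chart i x)]
      fun e => coeff (G.rightMC f) i (e, w) :=
    fun w => eventually_of_mem (hT.mem_nhds hx) fun e he => hc e he w
  rw [dirDeriv_congr (hc' v), dirDeriv_congr (hc' w), hc _ hx, hc _ hx,
    coeff_chart _ (M.mem_chart x), coeff_chart _ (M.mem_chart x), chartVec_chartIdx,
    chartVec_chartIdx] at h
  rw [extD_eq, h]
  abel

theorem bracket_antisymm (X Y : G.lie) : G.bracket X Y = - G.bracket Y X := by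
  have h : ∀ Z : G.lie, G.rightMC (M := G) (fun x : G => x) 1 Z = Z := by
    intro Z
    have : (fun y : G => y * (1 : G)⁻¹) = fun y => y := by funext y; simp
    simp only [FLieGroup.rightMC, this]
    exact mderivTo_id (M := G) 1 Z
  have h1 := extD_rightMC_aux (isSmooth_id (M := G)) 1 X Y
  have h2 := extD_rightMC_aux (isSmooth_id (M := G)) 1 Y X
  have h3 : extD (M := G) (G.rightMC (M := G) fun x : G => x) 1 X Y =
      - extD (M := G) (G.rightMC (M := G) fun x : G => x) 1 Y X := by
    rw [extD_eq, extD_eq, neg_sub]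
  rw [h3, h2, neg_neg] at h1
  exact (congrArg₂ G.bracket (h X) (h Y)).symm.trans
    (h1.trans (congrArg₂ (fun A B => - G.bracket A B) (h Y) (h X)))

/-- The Maurer--Cartan equation for the right-invariant form. -/
theorem extD_rightMC {f : M → G} (hf : IsSmooth M G f) (x : M) (v w : M.T x) :
    extD (G.rightMC f) x v w = G.bracket (G.rightMC f x v) (G.rightMC f x w) := by
  rw [extD_rightMC_aux hf, ← bracket_antisymm]

theorem isLinearMap_bracket_right (X : G.lie) : IsLinearMap ℝ (fun Y => G.bracket X Y) where
  map_add Y Z := by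
    rw [bracket_antisymm, (isLinearMap_bracket_left X).map_add, bracket_antisymm X Y,
      bracket_antisymm X Z, neg_add]
  map_smul c Y := by
    rw [bracket_antisymm, (isLinearMap_bracket_left X).map_smul, bracket_antisymm X Y, smul_neg]

/-- The derivative of a homomorphism at the unit. -/
def lieMap (f : G →* G') (X : G.lie) : G'.lie := mderivTo G G' f 1 G'.e X

theorem isLinearMap_lieMap {f : G →* G'} (hf : IsSmooth G G' f) : IsLinearMap ℝ (lieMap f) :=
  isLinearMap_mderivTo isOpen_univ hf (mem_univ (1 : G)) (mem_source_of_eq_one (map_one f))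

theorem isSmooth_lieMap {f : G →* G'} (hf : IsSmooth G G' f) :
    IsSmooth (Mfd.ofFrechet G.lie) (Mfd.ofFrechet G'.lie) (lieMap f) :=
  isSmooth_mderivTo_vec isOpen_univ hf (mem_univ (1 : G)) (mem_source_of_eq_one (map_one f))

theorem mderivTo_hom {f : G →* G'} (hf : IsSmooth G G' f) {k : M → G} {U : Set M} (hU : IsOpen U)
    (hk : IsSmoothOn M G k U) {x : M} (hx : x ∈ U) (hkx : k x = 1) (v : M.T x) :
    mderivTo M G' (fun y => f (k y)) x G'.e v = lieMap f (mderivTo M G k x G.e v) :=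
  mderivTo_comp isOpen_univ hf hU hk hx hkx (mem_univ _) (mem_source_of_eq_one (map_one f)) v

theorem lieMap_Ad {f : G →* G'} (hf : IsSmooth G G' f) (g : G) (X : G.lie) :
    lieMap f (G.Ad g X) = G'.Ad (f g) (lieMap f X) := by
  have h1 := mderivTo_hom hf isOpen_univ (isSmooth_conj g) (mem_univ (1 : G)) (by simp) X
  have h2 := mderivTo_conj isOpen_univ hf (mem_univ (1 : G)) (map_one f) (f g) X
  simp only [map_mul, map_inv] at h1
  exact h1.symm.trans h2

theorem rightMC_hom {f : G →* G'} (hf : IsSmooth G G' f) {k : M → G} {U : Set M} (hU : IsOpen U)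
    (hk : IsSmoothOn M G k U) {x : M} (hx : x ∈ U) (v : M.T x) :
    G'.rightMC (fun y => f (k y)) x v = lieMap f (G.rightMC k x v) := by
  have h := mderivTo_hom hf hU (isSmoothOn_mul_const hU hk (k x)⁻¹) hx (by simp) v
  simp only [map_mul, map_inv] at h
  exact h

theorem leftMC_hom {f : G →* G'} (hf : IsSmooth G G' f) {k : M → G} {U : Set M} (hU : IsOpen U)
    (hk : IsSmoothOn M G k U) {x : M} (hx : x ∈ U) (v : M.T x) :
    G'.leftMC (fun y => f (k y)) x v = lieMap f (G.leftMC k x v) := by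
  have h := mderivTo_hom hf hU (isSmoothOn_const_mul hU hk (k x)⁻¹) hx (by simp) v
  simp only [map_mul, map_inv] at h
  exact h

theorem lieMap_bracket {f : G →* G'} (hf : IsSmooth G G' f) (X Y : G.lie) :
    lieMap f (G.bracket X Y) = G'.bracket (lieMap f X) (lieMap f Y) := by
  have h1 := mderivTo_linear (isLinearMap_lieMap hf) (isSmooth_lieMap hf) isOpen_univ
    (isSmooth_Ad_const Y) (mem_univ (1 : G)) X
  have h2 := mderivTo_comp isOpen_univ (isSmooth_Ad_const (lieMap f Y)) isOpen_univ hf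
    (mem_univ (1 : G)) (map_one f) (mem_univ _) (k := ⟨⟩) (mem_univ _) X
  simp only [lieMap_Ad hf] at h1
  exact h1.symm.trans h2

theorem Ad_bracket (g : G) (X Y : G.lie) :
    G.Ad g (G.bracket X Y) = G.bracket (G.Ad g X) (G.Ad g Y) :=
  lieMap_bracket (f := (MulAut.conj g).toMonoidHom) (isSmooth_conj g) X Y

/-- The curvature `dA + ½[A ∧ A]`. -/
def curvature (A : Fam1 M G.lie) : Fam2 M G.lie :=
  fun x v w => extD A x v w + (1 / 2 : ℝ) • wedge G.bracket A A x v w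

theorem wedge_bracket_self (A : Fam1 M G.lie) (x : M) (v w : M.T x) :
    (1 / 2 : ℝ) • wedge G.bracket A A x v w = G.bracket (A x v) (A x w) := by
  rw [wedge, bracket_antisymm (A x w), sub_neg_eq_add, ← two_smul ℝ, smul_smul]
  norm_num

theorem curvature_eq (A : Fam1 M G.lie) (x : M) (v w : M.T x) :
    curvature A x v w = extD A x v w + G.bracket (A x v) (A x w) := by
  rw [curvature, wedge_bracket_self]

theorem curvature_lieMap {f : G →* G'} (hf : IsSmooth G G' f) {A : Fam1 M G.lie}
    (hA : IsForm1 M G.lie A) (x : M) (v w : M.T x) :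
    curvature (fun x v => lieMap f (A x v)) x v w = lieMap f (curvature A x v w) := by
  rw [curvature_eq, curvature_eq, extD_linear (isLinearMap_lieMap hf) (isSmooth_lieMap hf) hA,
    (isLinearMap_lieMap hf).map_add, lieMap_bracket hf]

theorem IsForm1.Ad {g : M → G} (hg : IsSmooth M G g) {A : Fam1 M G.lie}
    (hA : IsForm1 M G.lie A) : IsForm1 M G.lie (fun x v => G.Ad (g x) (A x v)) :=
  ((hA.formSmoothOn univ).pairing isSmooth_Ad isOpen_univ hg).isForm1 fun x =>
    ⟨fun v w => by rw [hA.add, Ad_add], fun c v => by rw [hA.smul, (isLinearMap_Ad _).map_smul]⟩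

/-- Covariance of the curvature under gauge transformations. -/
theorem curvature_gauge {g : M → G} (hg : IsSmooth M G g) {A : Fam1 M G.lie}
    (hA : IsForm1 M G.lie A) (x : M) (v w : M.T x) :
    curvature (fun x v => G.Ad (g x) (A x v) - G.rightMC g x v) x v w =
      G.Ad (g x) (curvature A x v w) := by
  rw [curvature_eq, curvature_eq, extD_sub (hA.Ad hg) (isForm1_rightMC hg), extD_rightMC hg,
    extD_pairing (ρ := fun p : G × G.lie => G.Ad p.1 p.2) isSmooth_Ad (fun m => isLinearMap_Ad m)
      hg hA]
  simp only [mderivTo_Ad isOpen_univ hg (mem_univ x)]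
  rw [(isLinearMap_Ad (g x)).map_add, Ad_bracket, (isLinearMap_bracket_left _).map_sub,
    (isLinearMap_bracket_right _).map_sub, (isLinearMap_bracket_right _).map_sub,
    bracket_antisymm (G.Ad (g x) (A x v)) (G.rightMC g x w)]
  abel

end MaurerCartan

/-! ### The infinitesimal crossed module -/

section CrossedModule

variable (Γ : LieTwoGroup.{u}) {M N : Mfd.{u}}

theorem isLinearMap_tStar : IsLinearMap ℝ Γ.tStar := isLinearMap_lieMap Γ.smooth_t

theorem isSmooth_α (g : Γ.G) : IsSmooth Γ.H Γ.H (Γ.α g) :=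
  IsSmooth.comp (M := Γ.H) Γ.smooth_α ((isSmooth_const g).prodMk isSmooth_id)

theorem isLinearMap_αStar (g : Γ.G) : IsLinearMap ℝ (Γ.αStar g) :=
  isLinearMap_lieMap (f := (Γ.α g).toMonoidHom) (isSmooth_α Γ g)

theorem isLinearMap_αTilde (h : Γ.H) : IsLinearMap ℝ (Γ.αTilde h) :=
  isLinearMap_mderivTo isOpen_univ (isSmooth_tilde Γ h) (mem_univ (1 : Γ.G))
    (mem_source_of_eq_one (by simp))

theorem isSmooth_αStar : IsSmooth (Γ.G.toMfd.prod (Mfd.ofFrechet Γ.𝔥)) (Mfd.ofFrechet Γ.𝔥)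
    (fun p : Γ.G × Γ.𝔥 => Γ.αStar p.1 p.2) :=
  isSmooth_mderivTo Γ.smooth_α (1 : Γ.H) Γ.H.e fun m => mem_source_of_eq_one (map_one (Γ.α m))

theorem isSmooth_αTilde : IsSmooth (Γ.H.toMfd.prod (Mfd.ofFrechet Γ.𝔤)) (Mfd.ofFrechet Γ.𝔥)
    (fun p : Γ.H × Γ.𝔤 => Γ.αTilde p.1 p.2) := by
  have h1 : IsSmooth (Γ.H.toMfd.prod Γ.G.toMfd) Γ.H.toMfd
      (fun p : Γ.H × Γ.G => p.1⁻¹ * Γ.α p.2 p.1) :=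
    isSmoothOn_mul isOpen_univ (isSmoothOn_inv isOpen_univ isSmooth_fst)
      (IsSmooth.comp (M := Γ.H.toMfd.prod Γ.G.toMfd) Γ.smooth_α
        (isSmooth_snd.prodMk isSmooth_fst))
  exact isSmooth_mderivTo h1 (1 : Γ.G) Γ.H.e fun m => mem_source_of_eq_one (by simp)

theorem isSmoothOn_α {g : M → Γ.G} {h : M → Γ.H} {U : Set M} (hU : IsOpen U)
    (hg : IsSmoothOn M Γ.G g U) (hh : IsSmoothOn M Γ.H h U) :
    IsSmoothOn M Γ.H (fun x => Γ.α (g x) (h x)) U :=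
  Γ.smooth_α.comp_on hU (hg.prodMk hU hh)

theorem mderivTo_α {k : M → Γ.H} {U : Set M} (hU : IsOpen U) (hk : IsSmoothOn M Γ.H k U) {x : M}
    (hx : x ∈ U) (hkx : k x = 1) (g : Γ.G) (v : M.T x) :
    mderivTo M Γ.H (fun y => Γ.α g (k y)) x Γ.H.e v = Γ.αStar g (mderivTo M Γ.H k x Γ.H.e v) :=
  mderivTo_hom (f := (Γ.α g).toMonoidHom) (isSmooth_α Γ g) hU hk hx hkx v

theorem mderivTo_tilde {k : M → Γ.G} {U : Set M} (hU : IsOpen U) (hk : IsSmoothOn M Γ.G k U)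
    {x : M} (hx : x ∈ U) (hkx : k x = 1) (h : Γ.H) (v : M.T x) :
    mderivTo M Γ.H (fun y => h⁻¹ * Γ.α (k y) h) x Γ.H.e v =
      Γ.αTilde h (mderivTo M Γ.G k x Γ.G.e v) :=
  mderivTo_comp isOpen_univ (isSmooth_tilde Γ h) hU hk hx hkx (mem_univ _)
    (mem_source_of_eq_one (by simp)) v

theorem αStar_mul (g g' : Γ.G) (Y : Γ.𝔥) : Γ.αStar (g * g') Y = Γ.αStar g (Γ.αStar g' Y) := by
  have h := mderivTo_α Γ isOpen_univ (isSmooth_α Γ g') (mem_univ (1 : Γ.H)) (map_one _) g Y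
  rw [LieTwoGroup.αStar, map_mul]
  exact h

theorem αStar_t (h : Γ.H) (Y : Γ.𝔥) : Γ.αStar (Γ.t h) Y = Γ.H.Ad h Y := by
  have : (fun x => Γ.α (Γ.t h) x) = fun x => h * x * h⁻¹ := funext fun x => Γ.α_t h x
  unfold LieTwoGroup.αStar FLieGroup.Ad
  rw [← this]

theorem tStar_αStar (g : Γ.G) (Y : Γ.𝔥) : Γ.tStar (Γ.αStar g Y) = Γ.G.Ad g (Γ.tStar Y) := by
  have h1 := mderivTo_hom Γ.smooth_t isOpen_univ (isSmooth_α Γ g) (mem_univ (1 : Γ.H))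
    (map_one _) Y
  have h2 := mderivTo_conj isOpen_univ Γ.smooth_t (mem_univ (1 : Γ.H)) (map_one _) g Y
  simp only [← Γ.t_α] at h2
  exact h1.symm.trans h2

theorem αTilde_tStar (h : Γ.H) (Y : Γ.𝔥) :
    Γ.αTilde h (Γ.tStar Y) = Γ.H.Ad h⁻¹ Y - Y := by
  have h1 := mderivTo_tilde Γ isOpen_univ Γ.smooth_t (mem_univ (1 : Γ.H)) (map_one _) h Y
  have h2 := mderivTo_mul_one isOpen_univ (isSmooth_conj h⁻¹)
    (isSmoothOn_inv isOpen_univ (isSmooth_id (M := Γ.H))) (mem_univ (1 : Γ.H)) (by simp)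
    (by simp) Y
  rw [mderivTo_mul_inv_self isOpen_univ (isSmooth_id (M := Γ.H)) (mem_univ (1 : Γ.H)) rfl,
    mderivTo_id] at h2
  have e : (fun y : Γ.H => h⁻¹ * Γ.α (Γ.t y) h) = fun y => h⁻¹ * y * h⁻¹⁻¹ * y⁻¹ := by
    funext y; rw [Γ.α_t]; group
  rw [e] at h1
  exact h1.symm.trans (h2.trans (sub_eq_add_neg _ _).symm)

theorem tStar_αTilde (h : Γ.H) (X : Γ.𝔤) :
    Γ.tStar (Γ.αTilde h X) = Γ.G.Ad (Γ.t h)⁻¹ X - X := by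
  have h1 := mderivTo_hom Γ.smooth_t isOpen_univ (isSmooth_tilde Γ h) (mem_univ (1 : Γ.G))
    (by simp) X
  have h2 := mderivTo_mul_one isOpen_univ (isSmooth_conj (Γ.t h)⁻¹)
    (isSmoothOn_inv isOpen_univ (isSmooth_id (M := Γ.G))) (mem_univ (1 : Γ.G)) (by simp)
    (by simp) X
  rw [mderivTo_mul_inv_self isOpen_univ (isSmooth_id (M := Γ.G)) (mem_univ (1 : Γ.G)) rfl,
    mderivTo_id] at h2
  have e : (fun y : Γ.G => Γ.t (h⁻¹ * Γ.α y h)) =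
      fun y => (Γ.t h)⁻¹ * y * (Γ.t h)⁻¹⁻¹ * y⁻¹ := by
    funext y; rw [map_mul, Γ.t_α, map_inv]; group
  rw [e] at h1
  exact h1.symm.trans (h2.trans (sub_eq_add_neg _ _).symm)

theorem αTilde_one (X : Γ.𝔤) : Γ.αTilde 1 X = 0 := by
  have h := αTilde_mul Γ 1 1 X
  rw [mul_one, inv_one, Ad_one] at h
  exact left_eq_add.1 h

theorem αTilde_αStar (g : Γ.G) (h : Γ.H) (X : Γ.𝔤) :
    Γ.αTilde (Γ.α g h) (Γ.G.Ad g X) = Γ.αStar g (Γ.αTilde h X) := by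
  have h1 := mderivTo_tilde Γ isOpen_univ (isSmooth_conj g) (mem_univ (1 : Γ.G)) (by simp)
    (Γ.α g h) X
  have h2 := mderivTo_α Γ isOpen_univ (isSmooth_tilde Γ h) (mem_univ (1 : Γ.G)) (by simp) g X
  have e : (fun y : Γ.G => (Γ.α g h)⁻¹ * Γ.α (g * y * g⁻¹) (Γ.α g h)) =
      fun y => Γ.α g (h⁻¹ * Γ.α y h) := by
    funext y
    simp [map_mul, MulAut.mul_apply]
  rw [e] at h1
  exact h1.symm.trans h2

theorem αStar_Ad (g : Γ.G) (h : Γ.H) (Y : Γ.𝔥) :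
    Γ.αStar g (Γ.H.Ad h Y) = Γ.H.Ad (Γ.α g h) (Γ.αStar g Y) :=
  lieMap_Ad (f := (Γ.α g).toMonoidHom) (isSmooth_α Γ g) h Y

theorem leftMC_α {g : M → Γ.G} {h : M → Γ.H} {U : Set M} (hU : IsOpen U)
    (hg : IsSmoothOn M Γ.G g U) (hh : IsSmoothOn M Γ.H h U) {x : M} (hx : x ∈ U) (v : M.T x) :
    Γ.H.leftMC (fun y => Γ.α (g y) (h y)) x v =
      Γ.αTilde (Γ.α (g x) (h x)) (Γ.G.rightMC g x v) + Γ.αStar (g x) (Γ.H.leftMC h x v) := by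
  set k := Γ.α (g x) (h x) with hk
  have s1 := isSmoothOn_mul_const hU hg (g x)⁻¹
  have s2 := isSmoothOn_const_mul hU hh (h x)⁻¹
  have s3 : IsSmoothOn M Γ.H (fun y => k⁻¹ * Γ.α (g y * (g x)⁻¹) k) U :=
    isSmoothOn_const_mul hU (isSmoothOn_α Γ hU s1 (IsSmooth.on (isSmooth_const k) U)) k⁻¹
  have s4 : IsSmoothOn M Γ.H (fun y => Γ.α (g y) ((h x)⁻¹ * h y)) U := isSmoothOn_α Γ hU hg s2
  have h1 := mderivTo_tilde Γ hU s1 hx (mul_inv_cancel _) k v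
  have h2 := mderivTo_mul_one hU s3 s4 hx (by simp) (by simp) v
  have e : (fun y => k⁻¹ * Γ.α (g y * (g x)⁻¹) k * Γ.α (g y) ((h x)⁻¹ * h y)) =
      fun y => (Γ.α (g x) (h x))⁻¹ * Γ.α (g y) (h y) := by
    funext y
    simp [hk, map_mul, MulAut.mul_apply, mul_assoc]
  rw [e, h1] at h2
  refine h2.trans (congrArg₂ (· + ·) rfl ?_)
  -- `α(-, 1)` is constant, so that at the point `(g(x), 1)` the derivative of `α` in the direction
  -- of `G` vanishes, and only the direction of `H` contributes
  have h3 : mderivTo M Γ.H (fun y => Γ.α (g y) ((h x)⁻¹ * h y)) x Γ.H.e v =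
      mderivTo (Γ.G.toMfd.prod Γ.H.toMfd) Γ.H (fun p : Γ.G × Γ.H => Γ.α p.1 p.2)
        ((g x, (1 : Γ.H)) : Γ.G × Γ.H) Γ.H.e
        ((mderivTo M Γ.G g x (Γ.G.chartIdx (g x)) v : _),
          (mderivTo M Γ.H (fun y => (h x)⁻¹ * h y) x Γ.H.e v : _)) := by
    have h4 := mderivTo_comp isOpen_univ Γ.smooth_α hU (hg.prodMk hU s2) hx
      (y := ((g x, (1 : Γ.H)) : Γ.G × Γ.H)) (by simp) (mem_univ _)
      (mem_source_of_eq_one (map_one _)) v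
    refine h4.trans ?_
    congr 1
    exact mderivTo_prodMk hg s2 hx (Γ.G.mem_chart _) (mem_source_of_eq_one (by simp)) v
  rw [h3]
  have hmem : (fun p : Γ.G × Γ.H => Γ.α p.1 p.2) ((g x, (1 : Γ.H)) : Γ.G × Γ.H) ∈
      (Γ.H.chart Γ.H.e).source := mem_source_of_eq_one (map_one _)
  set a := mderivTo M Γ.G g x (Γ.G.chartIdx (g x)) v
  set b := mderivTo M Γ.H (fun y => (h x)⁻¹ * h y) x Γ.H.e v
  have hadd := mderivTo_add isOpen_univ Γ.smooth_α (mem_univ ((g x, (1 : Γ.H)) : Γ.G × Γ.H))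
    hmem (a, 0) (0, b)
  have e2 : (((a, 0) : Γ.G.T (g x) × Γ.H.T 1) + (0, b)) = (a, b) :=
    Prod.ext (add_zero _) (zero_add _)
  have ha : mderivTo (Γ.G.toMfd.prod Γ.H.toMfd) Γ.H (fun p : Γ.G × Γ.H => Γ.α p.1 p.2)
      ((g x, (1 : Γ.H)) : Γ.G × Γ.H) Γ.H.e ((a, 0) : Γ.G.T (g x) × Γ.H.T 1) = 0 := by
    have h5 := mderivTo_comp isOpen_univ Γ.smooth_α isOpen_univ
      ((isSmooth_id (M := Γ.G)).prodMk (isSmooth_const (N := Γ.H) (1 : Γ.H))) (mem_univ (g x))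
      rfl (mem_univ _) hmem a
    have h6 := mderivTo_prodMk (isSmooth_id (M := Γ.G)) (isSmooth_const (N := Γ.H) (1 : Γ.H))
      (mem_univ (g x)) (Γ.G.mem_chart _) (Γ.H.mem_chart _) a
    rw [mderivTo_id, mderivTo_const] at h6
    simp only [map_one] at h5
    rw [mderivTo_const] at h5
    exact (congrArg _ h6.symm).trans h5.symm
  have hb : mderivTo (Γ.G.toMfd.prod Γ.H.toMfd) Γ.H (fun p : Γ.G × Γ.H => Γ.α p.1 p.2)
      ((g x, (1 : Γ.H)) : Γ.G × Γ.H) Γ.H.e ((0, b) : Γ.G.T (g x) × Γ.H.T 1) =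
        Γ.αStar (g x) b := by
    have h5 := mderivTo_comp isOpen_univ Γ.smooth_α isOpen_univ
      ((isSmooth_const (N := Γ.G) (g x)).prodMk (isSmooth_id (M := Γ.H))) (mem_univ (1 : Γ.H))
      rfl (mem_univ _) hmem b
    have h6 := mderivTo_prodMk (isSmooth_const (N := Γ.G) (g x)) (isSmooth_id (M := Γ.H))
      (mem_univ (1 : Γ.H)) (Γ.G.mem_chart _) (Γ.H.mem_chart _) b
    rw [mderivTo_id, mderivTo_const] at h6
    exact (congrArg _ h6.symm).trans h5.symm
  refine (congrArg _ e2.symm).trans (hadd.trans ?_)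
  refine (congrArg₂ (· + ·) ha hb).trans (zero_add _)

theorem αLie_tStar (Y' Y : Γ.𝔥) : Γ.αLie (Γ.tStar Y') Y = Γ.H.bracket Y' Y := by
  have s : IsSmooth Γ.G (Mfd.ofFrechet Γ.𝔥) (fun g => Γ.αStar g Y) :=
    isSmoothOn_pair_const (isSmooth_αStar Γ) isOpen_univ isSmooth_id Y
  have h := mderivTo_comp isOpen_univ s isOpen_univ Γ.smooth_t (mem_univ (1 : Γ.H))
    (map_one Γ.t) (mem_univ _) (k := ⟨⟩) (mem_univ _) Y'
  simp only [αStar_t] at h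
  exact h.symm

theorem isLinearMap_αLie_left (Y : Γ.𝔥) : IsLinearMap ℝ (fun X => Γ.αLie X Y) :=
  isLinearMap_mderivTo isOpen_univ
    (isSmoothOn_pair_const (isSmooth_αStar Γ) isOpen_univ (isSmooth_id (M := Γ.G)) Y)
    (mem_univ (1 : Γ.G)) (mem_univ _)

end CrossedModule

/-! ### The semidirect product and the curvature identities -/

section Semidirect

variable (Γ : LieTwoGroup.{u}) {M N : Mfd.{u}}

/-- The semidirect product `H ⋊ G` as a Fréchet Lie group. A pair of an `𝔥`-valued and a
`𝔤`-valued 1-form is a 1-form with values in its Lie algebra. -/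
def LieTwoGroup.semidirect : FLieGroup.{u} where
  toMfd := Γ.H.toMfd.prod Γ.G.toMfd
  group := (SemidirectProduct.equivProd (φ := Γ.α)).symm.group
  smooth_mul := by
    have s1 : IsSmooth ((Γ.H.toMfd.prod Γ.G.toMfd).prod (Γ.H.toMfd.prod Γ.G.toMfd))
        (Γ.H.toMfd.prod Γ.G.toMfd) Prod.fst := isSmooth_fst
    have s2 : IsSmooth ((Γ.H.toMfd.prod Γ.G.toMfd).prod (Γ.H.toMfd.prod Γ.G.toMfd))
        (Γ.H.toMfd.prod Γ.G.toMfd) Prod.snd := isSmooth_snd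
    have h1 := isSmooth_fst.comp s1
    have h2 := isSmooth_snd.comp s1
    have h3 := isSmooth_fst.comp s2
    have h4 := isSmooth_snd.comp s2
    exact (isSmoothOn_mul isOpen_univ h1 (isSmoothOn_α Γ isOpen_univ h2 h3)).prodMk isOpen_univ
      (isSmoothOn_mul isOpen_univ h2 h4)
  smooth_inv := by
    have h1 : IsSmooth (Γ.H.toMfd.prod Γ.G.toMfd) Γ.H.toMfd Prod.fst := isSmooth_fst
    have h2 : IsSmooth (Γ.H.toMfd.prod Γ.G.toMfd) Γ.G.toMfd Prod.snd := isSmooth_snd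
    exact (isSmoothOn_α Γ isOpen_univ (isSmoothOn_inv isOpen_univ h2)
      (isSmoothOn_inv isOpen_univ h1)).prodMk isOpen_univ (isSmoothOn_inv isOpen_univ h2)

/-- The inclusion `H → H ⋊ G`. -/
def LieTwoGroup.inl : Γ.H →* Γ.semidirect where
  toFun h := ((h, 1) : Γ.H × Γ.G)
  map_one' := rfl
  map_mul' h h' := Prod.ext
    (by
      show h * h' = h * Γ.α 1 h'
      simp)
    (by
      show (1 : Γ.G) = 1 * 1
      simp)

/-- The inclusion `G → H ⋊ G`. -/
def LieTwoGroup.inr : Γ.G →* Γ.semidirect where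
  toFun g := ((1, g) : Γ.H × Γ.G)
  map_one' := rfl
  map_mul' g g' := Prod.ext
    (by
      show (1 : Γ.H) = 1 * Γ.α g 1
      simp)
    rfl

/-- The homomorphism `H ⋊ G → G`, `(h, g) ↦ t(h) g`. -/
def LieTwoGroup.total : Γ.semidirect →* Γ.G where
  toFun (p : Γ.H × Γ.G) := Γ.t p.1 * p.2
  map_one' := by
    show Γ.t 1 * 1 = 1
    simp
  map_mul' (p q : Γ.H × Γ.G) := by
    show Γ.t (p.1 * Γ.α p.2 q.1) * (p.2 * q.2) = Γ.t p.1 * p.2 * (Γ.t q.1 * q.2)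
    rw [map_mul, Γ.t_α]
    group

theorem isSmooth_inl : IsSmooth Γ.H Γ.semidirect Γ.inl :=
  (isSmooth_id (M := Γ.H)).prodMk (isSmooth_const (N := Γ.G) (1 : Γ.G))

theorem isSmooth_inr : IsSmooth Γ.G Γ.semidirect Γ.inr :=
  (isSmooth_const (N := Γ.H) (1 : Γ.H)).prodMk (isSmooth_id (M := Γ.G))

theorem isSmooth_total : IsSmooth Γ.semidirect Γ.G Γ.total := by
  have h1 : IsSmooth (Γ.H.toMfd.prod Γ.G.toMfd) Γ.H.toMfd Prod.fst := isSmooth_fst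
  have h2 : IsSmooth (Γ.H.toMfd.prod Γ.G.toMfd) Γ.G.toMfd Prod.snd := isSmooth_snd
  exact isSmoothOn_mul isOpen_univ (Γ.smooth_t.comp h1) h2

theorem total_inl (h : Γ.H) : Γ.total (Γ.inl h) = Γ.t h := mul_one _

theorem total_inr (g : Γ.G) : Γ.total (Γ.inr g) = g := by
  show Γ.t 1 * g = g
  simp

theorem inr_conj_inl (g : Γ.G) (h : Γ.H) :
    Γ.inr g * Γ.inl h * (Γ.inr g)⁻¹ = Γ.inl (Γ.α g h) := by
  rw [mul_inv_eq_iff_eq_mul]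
  refine Prod.ext ?_ ?_
  · show 1 * Γ.α g h = Γ.α g h * Γ.α 1 1
    simp
  · show g * 1 = 1 * g
    simp

theorem inl_conj_inr (h : Γ.H) (g : Γ.G) :
    Γ.inl h * Γ.inr g * (Γ.inl h)⁻¹ = Γ.inl (h * Γ.α g h⁻¹) * Γ.inr g := by
  rw [mul_inv_eq_iff_eq_mul]
  refine Prod.ext ?_ ?_
  · show h * Γ.α 1 1 = (h * Γ.α g h⁻¹) * Γ.α 1 1 * Γ.α (1 * g) h
    simp
  · show (1 : Γ.G) * g = 1 * g * 1
    simp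

theorem lieInl_injective : Function.Injective (lieMap Γ.inl) := by
  have hs : IsSmooth Γ.semidirect Γ.H (fun p : Γ.H × Γ.G => p.1) :=
    isSmooth_fst (M := Γ.H.toMfd) (N := Γ.G.toMfd)
  refine Function.LeftInverse.injective (g := fun Z => mderivTo Γ.semidirect Γ.H
    (fun p : Γ.H × Γ.G => p.1) (1 : Γ.semidirect) Γ.H.e Z) fun Y => ?_
  have h := mderivTo_comp isOpen_univ hs isOpen_univ (isSmooth_inl Γ) (mem_univ (1 : Γ.H))
    (map_one _) (mem_univ _) (k := Γ.H.e) (Γ.H.mem_chart 1) Y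
  refine h.symm.trans ?_
  exact mderivTo_id (M := Γ.H) 1 Y

theorem lieMap_comp {G₁ G₂ G₃ : FLieGroup.{u}} {f : G₁ →* G₂} (hf : IsSmooth G₁ G₂ f)
    {k : G₂ →* G₃} (hk : IsSmooth G₂ G₃ k) (X : G₁.lie) :
    lieMap k (lieMap f X) = mderivTo G₁ G₃ (fun x => k (f x)) 1 G₃.e X :=
  (mderivTo_hom hk isOpen_univ hf (mem_univ (1 : G₁)) (map_one f) X).symm

theorem lieMap_total_inl (Y : Γ.𝔥) : lieMap Γ.total (lieMap Γ.inl Y) = Γ.tStar Y := by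
  rw [lieMap_comp (isSmooth_inl Γ) (isSmooth_total Γ)]
  simp only [total_inl]
  rfl

theorem lieMap_total_inr (X : Γ.𝔤) : lieMap Γ.total (lieMap Γ.inr X) = X := by
  rw [lieMap_comp (isSmooth_inr Γ) (isSmooth_total Γ)]
  simp only [total_inr]
  exact mderivTo_id (M := Γ.G) 1 X

theorem Ad_inr_lieInl (g : Γ.G) (Y : Γ.𝔥) :
    Γ.semidirect.Ad (Γ.inr g) (lieMap Γ.inl Y) = lieMap Γ.inl (Γ.αStar g Y) := by
  have h1 := mderivTo_conj isOpen_univ (isSmooth_inl Γ) (mem_univ (1 : Γ.H)) (map_one _)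
    (Γ.inr g) Y
  have h2 := mderivTo_hom (isSmooth_inl Γ) isOpen_univ (isSmooth_α Γ g) (mem_univ (1 : Γ.H))
    (map_one _) Y
  simp only [inr_conj_inl] at h1
  exact h1.symm.trans h2

theorem Ad_inr_lieInr (g : Γ.G) (X : Γ.𝔤) :
    Γ.semidirect.Ad (Γ.inr g) (lieMap Γ.inr X) = lieMap Γ.inr (Γ.G.Ad g X) :=
  (lieMap_Ad (isSmooth_inr Γ) g X).symm

theorem Ad_inl_lieInl (h : Γ.H) (Y : Γ.𝔥) :
    Γ.semidirect.Ad (Γ.inl h) (lieMap Γ.inl Y) = lieMap Γ.inl (Γ.H.Ad h Y) :=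
  (lieMap_Ad (isSmooth_inl Γ) h Y).symm

theorem Ad_inl_lieInr (h : Γ.H) (X : Γ.𝔤) :
    Γ.semidirect.Ad (Γ.inl h) (lieMap Γ.inr X) =
      lieMap Γ.inl (Γ.αTilde h⁻¹ X) + lieMap Γ.inr X := by
  have h1 := mderivTo_conj isOpen_univ (isSmooth_inr Γ) (mem_univ (1 : Γ.G)) (map_one _)
    (Γ.inl h) X
  have s := isSmooth_tilde Γ h⁻¹
  simp only [inv_inv] at s
  have h2 := mderivTo_hom (isSmooth_inl Γ) isOpen_univ s (mem_univ (1 : Γ.G)) (by simp) X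
  have h3 := mderivTo_mul_one isOpen_univ ((isSmooth_inl Γ).comp s) (isSmooth_inr Γ)
    (mem_univ (1 : Γ.G)) (by simp) (map_one _) X
  simp only [inl_conj_inr] at h1
  rw [h2] at h3
  refine h1.symm.trans (h3.trans ?_)
  unfold LieTwoGroup.αTilde
  rw [inv_inv]
  rfl

theorem bracket_lieInr_lieInl (X : Γ.𝔤) (Y : Γ.𝔥) :
    Γ.semidirect.bracket (lieMap Γ.inr X) (lieMap Γ.inl Y) = lieMap Γ.inl (Γ.αLie X Y) := by
  have h1 := mderivTo_comp isOpen_univ (isSmooth_Ad_const (lieMap Γ.inl Y)) isOpen_univ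
    (isSmooth_inr Γ) (mem_univ (1 : Γ.G)) (map_one _) (mem_univ _) (k := ⟨⟩) (mem_univ _) X
  have h2 := mderivTo_linear (isLinearMap_lieMap (isSmooth_inl Γ))
    (isSmooth_lieMap (isSmooth_inl Γ)) isOpen_univ
    (isSmoothOn_pair_const (isSmooth_αStar Γ) isOpen_univ (isSmooth_id (M := Γ.G)) Y)
    (mem_univ (1 : Γ.G)) X
  simp only [Ad_inr_lieInl] at h1
  exact h1.symm.trans h2

theorem isLinearMap_αLie_right (X : Γ.𝔤) : IsLinearMap ℝ (fun Y => Γ.αLie X Y) where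
  map_add Y Z := by
    apply lieInl_injective Γ
    have hl := isLinearMap_lieMap (isSmooth_inl Γ)
    rw [hl.map_add, ← bracket_lieInr_lieInl, ← bracket_lieInr_lieInl, ← bracket_lieInr_lieInl,
      ← (isLinearMap_bracket_right _).map_add, ← hl.map_add]
  map_smul c Y := by
    apply lieInl_injective Γ
    have hl := isLinearMap_lieMap (isSmooth_inl Γ)
    rw [hl.map_smul, ← bracket_lieInr_lieInl, ← bracket_lieInr_lieInl,
      ← (isLinearMap_bracket_right _).map_smul, ← hl.map_smul]

variable {Γ}

/-- The part `dφ + ½[φ ∧ φ] + α_*(A ∧ φ)` of the curvature that does not involve the 2-forms. -/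
def preCurv (A : Fam1 M Γ.𝔤) (φ : Fam1 M Γ.𝔥) : Fam2 M Γ.𝔥 :=
  fun x v w => extD φ x v w + (1 / 2 : ℝ) • wedge Γ.H.bracket φ φ x v w + wedge Γ.αLie A φ x v w

theorem preCurv_eq (A : Fam1 M Γ.𝔤) (φ : Fam1 M Γ.𝔥) (x : M) (v w : M.T x) :
    preCurv A φ x v w = extD φ x v w + Γ.H.bracket (φ x v) (φ x w) +
      (Γ.αLie (A x v) (φ x w) - Γ.αLie (A x w) (φ x v)) := by
  rw [preCurv, wedge_bracket_self]
  rfl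

theorem gcurv_eq (A' : Fam1 M Γ.𝔤) (B B' : Fam2 M Γ.𝔥) (g : M → Γ.G) (φ : Fam1 M Γ.𝔥) (x : M)
    (v w : M.T x) :
    gcurv Γ A' B B' g φ x v w = preCurv A' φ x v w + B' x v w - Γ.αStar (g x) (B x v w) := rfl

theorem fcurv_eq (A : Fam1 M Γ.𝔤) (B : Fam2 M Γ.𝔥) (x : M) (v w : M.T x) :
    fcurv Γ A B x v w = curvature A x v w - Γ.tStar (B x v w) := rfl

theorem IsForm1.add_form {V : FrechetSpace.{u}} {ω η : Fam1 M V} (hω : IsForm1 M V ω)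
    (hη : IsForm1 M V η) : IsForm1 M V (fun x v => ω x v + η x v) :=
  (FormSmoothOn.add isOpen_univ (hω.formSmoothOn _) (hη.formSmoothOn _)).isForm1 fun x =>
    ⟨fun v w => by rw [hω.add, hη.add, add_add_add_comm],
      fun c v => by rw [hω.smul, hη.smul, smul_add]⟩

theorem IsForm1.linear_comp {V W : FrechetSpace.{u}} {L : V → W} (hL : IsLinearMap ℝ L)
    (hs : IsSmooth (Mfd.ofFrechet V) (Mfd.ofFrechet W) L) {ω : Fam1 M V} (hω : IsForm1 M V ω) :
    IsForm1 M W (fun x v => L (ω x v)) where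
  add x v w := by rw [hω.add, hL.map_add]
  smul x c v := by rw [hω.smul, hL.map_smul]
  smooth i := SmoothOn.comp isOpen_univ (IsSmoothOn.smoothOn hs)
    ((M.chart i).open_target.prod isOpen_univ) (hω.smooth i) (mapsTo_univ _ _)

/-- The 1-form with values in the Lie algebra of `H ⋊ G` with components `φ` and `A`. -/
def totalForm (A : Fam1 M Γ.𝔤) (φ : Fam1 M Γ.𝔥) : Fam1 M Γ.semidirect.lie :=
  fun x v => lieMap Γ.inl (φ x v) + lieMap Γ.inr (A x v)

theorem isForm1_totalForm {A : Fam1 M Γ.𝔤} {φ : Fam1 M Γ.𝔥} (hA : IsForm1 M Γ.𝔤 A)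
    (hφ : IsForm1 M Γ.𝔥 φ) : IsForm1 M Γ.semidirect.lie (totalForm A φ) :=
  (hφ.linear_comp (isLinearMap_lieMap (isSmooth_inl Γ)) (isSmooth_lieMap (isSmooth_inl Γ))).add_form
    (hA.linear_comp (isLinearMap_lieMap (isSmooth_inr Γ)) (isSmooth_lieMap (isSmooth_inr Γ)))

theorem curvature_totalForm {A : Fam1 M Γ.𝔤} {φ : Fam1 M Γ.𝔥} (hA : IsForm1 M Γ.𝔤 A)
    (hφ : IsForm1 M Γ.𝔥 φ) (x : M) (v w : M.T x) :
    curvature (totalForm A φ) x v w =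
      lieMap Γ.inl (preCurv A φ x v w) + lieMap Γ.inr (curvature A x v w) := by
  have h1 := isLinearMap_lieMap (isSmooth_inl Γ)
  have h2 := isLinearMap_lieMap (isSmooth_inr Γ)
  have s1 := isSmooth_lieMap (isSmooth_inl Γ)
  have s2 := isSmooth_lieMap (isSmooth_inr Γ)
  rw [curvature_eq, curvature_eq, preCurv_eq]
  have e : extD (totalForm A φ) x v w =
      lieMap Γ.inl (extD φ x v w) + lieMap Γ.inr (extD A x v w) := by
    rw [← extD_linear h1 s1 hφ x v w, ← extD_linear h2 s2 hA x v w]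
    exact extD_add (hφ.linear_comp h1 s1) (hA.linear_comp h2 s2) x v w
  rw [e]
  simp only [totalForm]
  rw [(isLinearMap_bracket_left _).map_add, (isLinearMap_bracket_right _).map_add,
    (isLinearMap_bracket_right _).map_add, bracket_lieInr_lieInl,
    bracket_antisymm (lieMap Γ.inl (φ x v)) (lieMap Γ.inr (A x w)), bracket_lieInr_lieInl,
    ← lieMap_bracket (isSmooth_inl Γ), ← lieMap_bracket (isSmooth_inr Γ), h1.map_add, h1.map_add,
    h1.map_sub, h2.map_add]
  abel

theorem lieMap_total_totalForm (Y : Γ.𝔥) (X : Γ.𝔤) :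
    lieMap Γ.total (lieMap Γ.inl Y + lieMap Γ.inr X) = Γ.tStar Y + X := by
  rw [(isLinearMap_lieMap (isSmooth_total Γ)).map_add, lieMap_total_inl, lieMap_total_inr]

/-- The curvature of `A + t_* φ`: this is the image of the curvature of `(φ, A)` under the
homomorphism `(h, g) ↦ t(h) g` from `H ⋊ G` to `G`. -/
theorem curvature_add_tStar {A : Fam1 M Γ.𝔤} {φ : Fam1 M Γ.𝔥} (hA : IsForm1 M Γ.𝔤 A)
    (hφ : IsForm1 M Γ.𝔥 φ) (x : M) (v w : M.T x) :
    curvature (fun x v => A x v + Γ.tStar (φ x v)) x v w =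
      Γ.tStar (preCurv A φ x v w) + curvature A x v w := by
  have h := curvature_lieMap (isSmooth_total Γ) (isForm1_totalForm hA hφ) x v w
  rw [curvature_totalForm hA hφ, lieMap_total_totalForm] at h
  simp only [totalForm, lieMap_total_totalForm] at h
  rw [← h]
  simp only [add_comm]

/-- `t_*` of the curvature of a gauge transformation is the difference of the fake curvatures. -/
theorem IsGaugeTransf.tStar_gcurv {A A' : Fam1 M Γ.𝔤} {B B' : Fam2 M Γ.𝔥} {g : M → Γ.G}
    {φ : Fam1 M Γ.𝔥} (H : IsGaugeTransf Γ A A' g φ) (hA : IsForm1 M Γ.𝔤 A)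
    (hA' : IsForm1 M Γ.𝔤 A') (x : M) (v w : M.T x) :
    Γ.tStar (gcurv Γ A' B B' g φ x v w) =
      Γ.G.Ad (g x) (fcurv Γ A B x v w) - fcurv Γ A' B' x v w := by
  have h1 := curvature_add_tStar hA' H.isForm x v w
  have e : (fun x v => A' x v + Γ.tStar (φ x v)) =
      fun x v => Γ.G.Ad (g x) (A x v) - Γ.G.rightMC g x v := by
    funext x v; exact H.eq x v
  rw [e, curvature_gauge H.smooth hA] at h1
  rw [gcurv_eq, fcurv_eq, fcurv_eq, (isLinearMap_tStar Γ).map_sub, (isLinearMap_tStar Γ).map_add,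
    tStar_αStar, (isLinearMap_Ad _).map_sub, h1]
  abel

/-- Behaviour of the curvature under gauge 2-transformations: it is covariance of the curvature
of `(φ, A')` under the gauge transformation `h⁻¹` in `H ⋊ G`. -/
theorem preCurv_gauge2 {A : Fam1 M Γ.𝔤} {φ₁ φ₂ : Fam1 M Γ.𝔥} {h : M → Γ.H} (hh : IsSmooth M Γ.H h)
    (hA : IsForm1 M Γ.𝔤 A) (hφ₁ : IsForm1 M Γ.𝔥 φ₁) (hφ₂ : IsForm1 M Γ.𝔥 φ₂)
    (e : ∀ x v, φ₁ x v = Γ.H.Ad (h x)⁻¹ (φ₂ x v) + Γ.αTilde (h x) (A x v) + Γ.H.leftMC h x v)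
    (x : M) (v w : M.T x) :
    preCurv A φ₁ x v w =
      Γ.H.Ad (h x)⁻¹ (preCurv A φ₂ x v w) + Γ.αTilde (h x) (curvature A x v w) := by
  have h1 := isLinearMap_lieMap (isSmooth_inl Γ)
  have hi : IsSmooth M Γ.H (fun x => (h x)⁻¹) := isSmoothOn_inv isOpen_univ hh
  have hs : IsSmooth M Γ.semidirect (fun x => Γ.inl (h x)⁻¹) := (isSmooth_inl Γ).comp hi
  have hg := curvature_gauge hs (isForm1_totalForm hA hφ₂) x v w
  have e1 : (fun x v => Γ.semidirect.Ad (Γ.inl (h x)⁻¹) (totalForm A φ₂ x v) -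
      Γ.semidirect.rightMC (fun x => Γ.inl (h x)⁻¹) x v) = totalForm A φ₁ := by
    funext x v
    rw [rightMC_hom (isSmooth_inl Γ) isOpen_univ hi (mem_univ x), rightMC_inv isOpen_univ hh
      (mem_univ x)]
    simp only [totalForm]
    rw [(isLinearMap_Ad _).map_add, Ad_inl_lieInl, Ad_inl_lieInr, inv_inv, e, h1.map_neg,
      h1.map_add, h1.map_add]
    abel
  rw [e1, curvature_totalForm hA hφ₁, curvature_totalForm hA hφ₂, (isLinearMap_Ad _).map_add,
    Ad_inl_lieInl, Ad_inl_lieInr, inv_inv, ← add_assoc, ← h1.map_add] at hg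
  exact lieInl_injective Γ (add_right_cancel hg)

/-- Behaviour of the curvature of a gauge transformation under gauge 2-transformations. -/
theorem gcurv_gauge2 {A' : Fam1 M Γ.𝔤} {B B' : Fam2 M Γ.𝔥} {g₁ g₂ : M → Γ.G}
    {φ₁ φ₂ : Fam1 M Γ.𝔥} {h : M → Γ.H} (hh : IsSmooth M Γ.H h)
    (hA : IsForm1 M Γ.𝔤 A') (hφ₁ : IsForm1 M Γ.𝔥 φ₁) (hφ₂ : IsForm1 M Γ.𝔥 φ₂)
    (e : ∀ x v, φ₁ x v = Γ.H.Ad (h x)⁻¹ (φ₂ x v) + Γ.αTilde (h x) (A' x v) + Γ.H.leftMC h x v)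
    (eg : ∀ x, g₂ x = Γ.t (h x) * g₁ x) (x : M) (v w : M.T x) :
    gcurv Γ A' B B' g₁ φ₁ x v w = Γ.H.Ad (h x)⁻¹ (gcurv Γ A' B B' g₂ φ₂ x v w) +
      Γ.αTilde (h x) (fcurv Γ A' B' x v w) := by
  rw [gcurv_eq, gcurv_eq, fcurv_eq, preCurv_gauge2 hh hA hφ₁ hφ₂ e, (isLinearMap_Ad _).map_sub,
    (isLinearMap_Ad _).map_add, (isLinearMap_αTilde Γ _).map_sub, αTilde_tStar, eg, αStar_mul,
    αStar_t, Ad_inv_Ad]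
  abel

theorem IsForm1.αStar {g : M → Γ.G} (hg : IsSmooth M Γ.G g) {φ : Fam1 M Γ.𝔥}
    (hφ : IsForm1 M Γ.𝔥 φ) : IsForm1 M Γ.𝔥 (fun x v => Γ.αStar (g x) (φ x v)) :=
  ((hφ.formSmoothOn univ).pairing (isSmooth_αStar Γ) isOpen_univ hg).isForm1 fun x =>
    ⟨fun v w => by rw [hφ.add, (isLinearMap_αStar Γ _).map_add],
      fun c v => by rw [hφ.smul, (isLinearMap_αStar Γ _).map_smul]⟩

/-- Additivity of the curvature under composition: it is covariance of the curvature of `(φ, A')`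
under the gauge transformation `g'` in `H ⋊ G`, followed by a change of the second component. -/
theorem preCurv_comp {A' A'' : Fam1 M Γ.𝔤} {g' : M → Γ.G} {φ φ' : Fam1 M Γ.𝔥}
    (H' : IsGaugeTransf Γ A' A'' g' φ') (hA' : IsForm1 M Γ.𝔤 A') (hA'' : IsForm1 M Γ.𝔤 A'')
    (hφ : IsForm1 M Γ.𝔥 φ) (x : M) (v w : M.T x) :
    preCurv A'' (fun x v => Γ.αStar (g' x) (φ x v) + φ' x v) x v w =
      Γ.αStar (g' x) (preCurv A' φ x v w) + preCurv A'' φ' x v w := by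
  have h1 := isLinearMap_lieMap (isSmooth_inl Γ)
  have h2 := isLinearMap_lieMap (isSmooth_inr Γ)
  have hs : IsSmooth M Γ.semidirect (fun x => Γ.inr (g' x)) := (isSmooth_inr Γ).comp H'.smooth
  have hg := curvature_gauge hs (isForm1_totalForm hA' hφ) x v w
  have hψ := hφ.αStar H'.smooth
  have hA₀ : IsForm1 M Γ.𝔤 (fun x v => A'' x v + Γ.tStar (φ' x v)) :=
    hA''.add_form (H'.isForm.linear_comp (isLinearMap_tStar Γ) (isSmooth_lieMap Γ.smooth_t))
  have e1 : (fun x v => Γ.semidirect.Ad (Γ.inr (g' x)) (totalForm A' φ x v) -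
      Γ.semidirect.rightMC (fun x => Γ.inr (g' x)) x v) =
      totalForm (fun x v => A'' x v + Γ.tStar (φ' x v)) fun x v => Γ.αStar (g' x) (φ x v) := by
    funext x v
    rw [rightMC_hom (isSmooth_inr Γ) isOpen_univ H'.smooth (mem_univ x)]
    simp only [totalForm]
    rw [(isLinearMap_Ad _).map_add, Ad_inr_lieInl, Ad_inr_lieInr, H'.eq, h2.map_sub]
    abel
  have e2 : curvature (fun x v => A'' x v + Γ.tStar (φ' x v)) x v w =
      Γ.G.Ad (g' x) (curvature A' x v w) := by
    rw [← curvature_gauge H'.smooth hA']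
    congr 1
    funext x v
    exact H'.eq x v
  rw [e1, curvature_totalForm hA₀ hψ, curvature_totalForm hA' hφ, (isLinearMap_Ad _).map_add,
    Ad_inr_lieInl, Ad_inr_lieInr, e2] at hg
  rw [← lieInl_injective Γ (add_right_cancel hg), preCurv_eq, preCurv_eq, preCurv_eq,
    extD_add hψ H'.isForm]
  simp only [(isLinearMap_bracket_left _).map_add, (isLinearMap_bracket_right _).map_add,
    (isLinearMap_αLie_right Γ _).map_add, (isLinearMap_αLie_left Γ _).map_add, αLie_tStar]
  rw [bracket_antisymm (φ' x w) (Γ.αStar (g' x) (φ x v))]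
  abel

/-- Additivity of the curvature of gauge transformations under composition. -/
theorem gcurv_comp {A' A'' : Fam1 M Γ.𝔤} {B B' B'' : Fam2 M Γ.𝔥} {g g' : M → Γ.G}
    {φ φ' : Fam1 M Γ.𝔥} (H' : IsGaugeTransf Γ A' A'' g' φ') (hA' : IsForm1 M Γ.𝔤 A')
    (hA'' : IsForm1 M Γ.𝔤 A'') (hφ : IsForm1 M Γ.𝔥 φ) (x : M) (v w : M.T x) :
    gcurv Γ A'' B B'' (fun x => g' x * g x) (fun x v => Γ.αStar (g' x) (φ x v) + φ' x v) x v w =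
      Γ.αStar (g' x) (gcurv Γ A' B B' g φ x v w) + gcurv Γ A'' B' B'' g' φ' x v w := by
  rw [gcurv_eq, gcurv_eq, gcurv_eq, preCurv_comp H' hA' hA'' hφ, (isLinearMap_αStar Γ _).map_sub,
    (isLinearMap_αStar Γ _).map_add, αStar_mul]
  abel

theorem gcurv_pull {f : M → N} (hf : IsSmooth M N f) {A' : Fam1 N Γ.𝔤} {B B' : Fam2 N Γ.𝔥}
    {g : N → Γ.G} {φ : Fam1 N Γ.𝔥} (hφ : IsForm1 N Γ.𝔥 φ) (x : M) (v w : M.T x) :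
    gcurv Γ (pull f A') (pull2 f B) (pull2 f B') (fun x => g (f x)) (pull f φ) x v w =
      pull2 f (gcurv Γ A' B B' g φ) x v w := by
  rw [gcurv, extD_pull hf hφ]
  rfl

theorem fcurv_pull {f : M → N} (hf : IsSmooth M N f) {A : Fam1 N Γ.𝔤} {B : Fam2 N Γ.𝔥}
    (hA : IsForm1 N Γ.𝔤 A) (x : M) (v w : M.T x) :
    fcurv Γ (pull f A) (pull2 f B) x v w = pull2 f (fcurv Γ A B) x v w := by
  rw [fcurv, extD_pull hf hA]
  rfl

end Semidirect

/-! ### Gluing manifolds -/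

/-- Data that make a set `P` into a manifold: partial bijections `e i` onto open subsets of
manifolds, with smooth transition maps. The map `pr` to a Hausdorff space, together with the
condition that points in the same fibre lie in a common chart, makes `P` Hausdorff. -/
structure GlueData (P : Type u) where
  I : Type u
  N : I → Mfd.{u}
  e : ∀ i, PartialEquiv P (N i)
  idx : P → I
  mem : ∀ p, p ∈ (e (idx p)).source
  isOpen_overlap : ∀ i j, IsOpen ((e i).target ∩ (e i).symm ⁻¹' (e j).source)
  smooth : ∀ i j, IsSmoothOn (N i) (N j) (fun z => e j ((e i).symm z))
    ((e i).target ∩ (e i).symm ⁻¹' (e j).source)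
  base : Mfd.{u}
  pr : P → base
  continuousOn_pr : ∀ i, ContinuousOn (fun z => pr ((e i).symm z)) (e i).target
  sep : ∀ p p', pr p = pr p' → ∃ i, p ∈ (e i).source ∧ p' ∈ (e i).source

namespace GlueData

variable {P : Type u} (D : GlueData P)

theorem isOpen_target (i : D.I) : IsOpen (D.e i).target := by
  have h := D.isOpen_overlap i i
  have e : (D.e i).target ∩ (D.e i).symm ⁻¹' (D.e i).source = (D.e i).target :=
    inter_eq_left.2 fun z hz => (D.e i).map_target hz
  rwa [e] at h

/-- The topology for which a set is open if and only if it is open in all charts. -/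
@[reducible] def topology : TopologicalSpace P where
  IsOpen U := ∀ i, IsOpen ((D.e i).target ∩ (D.e i).symm ⁻¹' U)
  isOpen_univ i := by simpa using D.isOpen_target i
  isOpen_inter U V hU hV i := by
    have := (hU i).inter (hV i)
    rwa [← inter_inter_distrib_left, ← preimage_inter] at this
  isOpen_sUnion S hS i := by
    rw [preimage_sUnion, inter_iUnion₂]
    exact isOpen_biUnion fun U hU => hS U hU i

theorem isOpen_iff {U : Set P} :
    @IsOpen P D.topology U ↔ ∀ i, IsOpen ((D.e i).target ∩ (D.e i).symm ⁻¹' U) := Iff.rfl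

theorem isOpen_source_inter (i : D.I) {O : Set (D.N i)} (hO : IsOpen O) :
    @IsOpen P D.topology ((D.e i).source ∩ D.e i ⁻¹' O) := by
  rw [isOpen_iff]
  intro j
  have h := (D.smooth j i).1.isOpen_inter_preimage (D.isOpen_overlap j i) hO
  rwa [inter_assoc] at h

theorem isOpen_source (i : D.I) : @IsOpen P D.topology (D.e i).source := by
  simpa using D.isOpen_source_inter i isOpen_univ

/-- The partial bijections are homeomorphisms onto open subsets. -/
def homeo (i : D.I) : @OpenPartialHomeomorph P (D.N i) D.topology _ :=
  letI := D.topology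
  { toPartialEquiv := D.e i
    open_source := D.isOpen_source i
    open_target := D.isOpen_target i
    continuousOn_toFun := by
      rw [continuousOn_open_iff (D.isOpen_source i)]
      exact fun O hO => D.isOpen_source_inter i hO
    continuousOn_invFun := by
      rw [continuousOn_open_iff (D.isOpen_target i)]
      exact fun O hO => hO i }

theorem continuous_pr : @Continuous P D.base D.topology _ D.pr := by
  let _ := D.topology
  rw [continuous_def]
  intro O hO i
  exact (D.continuousOn_pr i).isOpen_inter_preimage (D.isOpen_target i) hO

theorem t2Space : @T2Space P D.topology := by
  let _ := D.topology
  refine ⟨fun p p' hne => ?_⟩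
  by_cases h : D.pr p = D.pr p'
  · obtain ⟨i, hp, hp'⟩ := D.sep p p' h
    have hne' : D.e i p ≠ D.e i p' := fun he => hne ((D.e i).injOn hp hp' he)
    obtain ⟨O, O', hO, hO', hpO, hpO', hd⟩ := t2_separation hne'
    refine ⟨_, _, D.isOpen_source_inter i hO, D.isOpen_source_inter i hO', ⟨hp, hpO⟩,
      ⟨hp', hpO'⟩, ?_⟩
    exact (hd.preimage (D.e i)).mono inter_subset_right inter_subset_right
  · obtain ⟨O, O', hO, hO', hpO, hpO', hd⟩ := t2_separation h
    exact ⟨_, _, hO.preimage D.continuous_pr, hO'.preimage D.continuous_pr, hpO, hpO',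
      hd.preimage D.pr⟩

/-- The glued manifold. -/
def mfd : Mfd.{u} :=
  letI := D.topology
  letI := D.t2Space
  { carrier := P
    ι := Σ i, (D.N i).ι
    model := fun k => (D.N k.1).model k.2
    chart := fun k => (D.homeo k.1).trans ((D.N k.1).chart k.2)
    chartIdx := fun p => ⟨D.idx p, (D.N (D.idx p)).chartIdx (D.e (D.idx p) p)⟩
    mem_chart := fun p => by
      rw [OpenPartialHomeomorph.trans_source]
      exact ⟨D.mem p, (D.N (D.idx p)).mem_chart _⟩
    smooth_transition := fun k l => by
      refine SmoothOn.mono (U := repDom (D.N k.1) (D.N l.1) k.2 l.2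
        (fun z => D.e l.1 ((D.e k.1).symm z))
        ((D.e k.1).target ∩ (D.e k.1).symm ⁻¹' (D.e l.1).source)) ((D.smooth k.1 l.1).2 k.2 l.2) ?_
      rintro z ⟨hz, hz'⟩
      rw [OpenPartialHomeomorph.trans_target] at hz
      rw [mem_preimage, OpenPartialHomeomorph.trans_source] at hz'
      exact ⟨hz.1, ⟨hz.2, hz'.1⟩, hz'.2⟩ }

/-- The charts of a glued manifold, as maps to the manifolds `N i`. -/
def piece (i : D.I) : OpenPartialHomeomorph D.mfd (D.N i) := D.homeo i

theorem isSmoothOn_piece (i : D.I) :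
    IsSmoothOn D.mfd (D.N i) (D.piece i) (D.piece i).source := by
  refine ⟨(D.piece i).continuousOn, fun k j => ?_⟩
  refine SmoothOn.mono (U := repDom (D.N k.1) (D.N i) k.2 j
    (fun z => D.e i ((D.e k.1).symm z))
    ((D.e k.1).target ∩ (D.e k.1).symm ⁻¹' (D.e i).source)) ((D.smooth k.1 i).2 k.2 j) ?_
  rintro z ⟨hz, hz1, hz2⟩
  change z ∈ ((D.e k.1).trans ((D.N k.1).chart k.2).toPartialEquiv).target at hz
  rw [PartialEquiv.trans_target] at hz
  exact ⟨hz.1, ⟨hz.2, hz1⟩, hz2⟩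

theorem isSmoothOn_piece_symm (i : D.I) :
    IsSmoothOn (D.N i) D.mfd (D.piece i).symm (D.piece i).target := by
  refine ⟨(D.piece i).continuousOn_symm, fun j k => ?_⟩
  refine SmoothOn.mono (U := repDom (D.N i) (D.N k.1) j k.2
    (fun z => D.e k.1 ((D.e i).symm z))
    ((D.e i).target ∩ (D.e i).symm ⁻¹' (D.e k.1).source)) ((D.smooth i k.1).2 j k.2) ?_
  rintro z ⟨hz, hz1, hz2⟩
  change (D.e i).symm (((D.N i).chart j).symm z) ∈
    ((D.e k.1).trans ((D.N k.1).chart k.2).toPartialEquiv).source at hz2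
  rw [PartialEquiv.trans_source] at hz2
  exact ⟨hz, ⟨hz1, hz2.1⟩, hz2.2⟩

/-- Smoothness of maps into a glued manifold is tested in the charts. -/
theorem isSmoothOn_of_piece {M : Mfd.{u}} {f : M → D.mfd} {U : Set M} (hU : IsOpen U) (i : D.I)
    (hs : ∀ x ∈ U, f x ∈ (D.e i).source) (hf : IsSmoothOn M (D.N i) (fun x => D.e i (f x)) U) :
    IsSmoothOn M D.mfd f U :=
  ((D.isSmoothOn_piece_symm i).comp (D.isOpen_target i) hU hf
    fun x hx => (D.e i).map_source (hs x hx)).congr hU fun x hx => (D.e i).left_inv (hs x hx)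

/-- Smoothness of maps on a glued manifold is tested in the charts. -/
theorem isSmooth_of_piece {M : Mfd.{u}} {f : D.mfd → M}
    (hf : ∀ i, ∃ k : D.N i → M, IsSmoothOn (D.N i) M k (D.e i).target ∧
      ∀ p ∈ (D.e i).source, f p = k (D.e i p)) : IsSmooth D.mfd M f := by
  refine IsSmoothOn.of_local fun p _ => ?_
  obtain ⟨k, hk, he⟩ := hf (D.idx p)
  refine ⟨(D.e (D.idx p)).source, D.isOpen_source _, D.mem p, ?_⟩
  exact (hk.comp (D.isOpen_target _) (D.isOpen_source (D.idx p)) (D.isSmoothOn_piece (D.idx p))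
    fun q hq => (D.e _).map_source hq).congr (D.isOpen_source (D.idx p)) fun q hq => (he q hq).symm

end GlueData

/-! ### Submersions -/

/-- A map is a submersion if it has, locally, the form of a projection from a product of
manifolds. -/
theorem IsSubmersion.of_local {Y X : Mfd.{u}} {π : Y → X} (hπ : IsSmooth Y X π)
    (h : ∀ y : Y, ∃ (N : Mfd.{u}) (O : Set Y) (O' : Set (X.prod N)) (r : Y → N)
      (σ : X × N → Y), IsOpen O ∧ IsOpen O' ∧ y ∈ O ∧ IsSmoothOn Y N r O ∧
      IsSmoothOn (X.prod N) Y σ O' ∧ (∀ z ∈ O, (π z, r z) ∈ O') ∧ (∀ p ∈ O', σ p ∈ O) ∧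
      (∀ z ∈ O, σ (π z, r z) = z) ∧ ∀ p ∈ O', π (σ p) = p.1 ∧ r (σ p) = p.2) :
    IsSubmersion Y X π := by
  refine ⟨hπ, fun y => ?_⟩
  obtain ⟨N, O, O', r, σ, hO, hO', hy, hr, hσ, m1, m2, l1, l2⟩ := h y
  set j := N.chartIdx (r y) with hj
  set c := N.chart j
  have hOc : IsOpen (O ∩ r ⁻¹' c.source) := hr.1.isOpen_inter_preimage hO c.open_source
  have s1 : IsSmoothOn (X.prod (Mfd.ofFrechet (N.model j))) X (fun q => q.1)
      (univ ×ˢ c.target) := isSmooth_fst.on _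
  have hT : IsOpen (univ ×ˢ c.target : Set (X.prod (Mfd.ofFrechet (N.model j)))) :=
    isOpen_univ.prod c.open_target
  have s2 : IsSmoothOn (X.prod (Mfd.ofFrechet (N.model j))) N (fun q => c.symm q.2)
      (univ ×ˢ c.target) :=
    (isSmoothOn_chart_symm j).comp c.open_target hT (isSmooth_snd.on _) fun q hq => hq.2
  have s3 : IsSmoothOn (X.prod (Mfd.ofFrechet (N.model j))) (X.prod N)
      (fun q => (q.1, c.symm q.2)) (univ ×ˢ c.target) := s1.prodMk hT s2
  set T : Set (X.prod (Mfd.ofFrechet (N.model j))) :=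
    (univ ×ˢ c.target) ∩ (fun q => ((q.1, c.symm q.2) : X × N)) ⁻¹' O' with hTdef
  have hTo : IsOpen T := s3.1.isOpen_inter_preimage hT hO'
  have s4 : IsSmoothOn (X.prod (Mfd.ofFrechet (N.model j))) Y (fun q => σ (q.1, c.symm q.2)) T :=
    hσ.comp hO' hTo (s3.mono inter_subset_left) fun q hq => hq.2
  have s5 : IsSmoothOn Y (X.prod (Mfd.ofFrechet (N.model j))) (fun z => (π z, c (r z)))
      (O ∩ r ⁻¹' c.source) :=
    (hπ.on _).prodMk hOc ((isSmoothOn_chart j).comp c.open_source hOc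
      (hr.mono inter_subset_left) fun z hz => hz.2)
  refine ⟨N.model j,
    { toFun := fun z => (π z, c (r z))
      invFun := fun q => σ (q.1, c.symm q.2)
      source := O ∩ r ⁻¹' c.source
      target := T
      map_source' := ?_
      map_target' := ?_
      left_inv' := ?_
      right_inv' := ?_
      open_source := hOc
      open_target := hTo
      continuousOn_toFun := s5.1
      continuousOn_invFun := s4.1 }, ⟨hy, N.mem_chart _⟩, s5, s4, fun z _ => rfl⟩
  · rintro z ⟨hz, hz'⟩
    refine ⟨⟨mem_univ _, c.map_source hz'⟩, ?_⟩
    show (π z, c.symm (c (r z))) ∈ O'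
    rw [c.left_inv hz']
    exact m1 z hz
  · rintro q ⟨hq, hq'⟩
    refine ⟨m2 _ hq', ?_⟩
    show r (σ (q.1, c.symm q.2)) ∈ c.source
    rw [(l2 _ hq').2]
    exact c.map_target hq.2
  · rintro z ⟨hz, hz'⟩
    show σ (π z, c.symm (c (r z))) = z
    rw [c.left_inv hz', l1 z hz]
  · rintro q ⟨hq, hq'⟩
    show (π (σ (q.1, c.symm q.2)), c (r (σ (q.1, c.symm q.2)))) = q
    rw [(l2 _ hq').1, (l2 _ hq').2, c.right_inv hq.2]

/-- A local section of a submersion through a given point, extended to all points of the base by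
an arbitrary choice of preimages. -/
theorem IsSubmersion.exists_global_section {Y X : Mfd.{u}} {π : Y → X} (hπ : IsSubmersion Y X π)
    (hsurj : Function.Surjective π) (x : X) : ∃ (V : Set X) (s : X → Y), IsOpen V ∧ x ∈ V ∧
      IsSmoothOn X Y s V ∧ ∀ x, π (s x) = x := by
  classical
  obtain ⟨y, rfl⟩ := hsurj x
  obtain ⟨V, s, hV, hy, hs, hsec⟩ := hπ.exists_section y
  refine ⟨V, fun x => if x ∈ V then s x else (hsurj x).choose, hV, hy,
    hs.congr hV fun x hx => ?_, fun x => ?_⟩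
  · simp only [if_pos hx]
  · by_cases hx : x ∈ V
    · simp only [if_pos hx]; exact hsec x hx
    · simp only [if_neg hx]; exact (hsurj x).choose_spec

/-- A map on the target of a surjective submersion is smooth if its pullback is. -/
theorem IsSubmersion.isSmooth_of_comp {Y X N : Mfd.{u}} {π : Y → X} (hπ : IsSubmersion Y X π)
    (hsurj : Function.Surjective π) {f : X → N} (hf : IsSmooth Y N fun y => f (π y)) :
    IsSmooth X N f := by
  refine IsSmoothOn.of_local fun x _ => ?_
  obtain ⟨V, s, hV, hx, hs, hsec⟩ := hπ.exists_global_section hsurj x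
  refine ⟨V, hV, hx, (hf.comp_on hV hs).congr hV fun x _ => ?_⟩
  simp only [hsec]

/-- A 1-form on the target of a surjective submersion is determined by its pullback. -/
theorem IsSubmersion.pull_injective {Y X : Mfd.{u}} {V : FrechetSpace.{u}} {π : Y → X}
    (hπ : IsSubmersion Y X π) (hsurj : Function.Surjective π) {ω η : Fam1 X V}
    (h : ∀ y v, pull π ω y v = pull π η y v) (x : X) (v : X.T x) : ω x v = η x v := by
  obtain ⟨y, rfl⟩ := hsurj x
  obtain ⟨y', e, hy'⟩ := hπ.mderiv_surjective y
  revert v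
  rw [← e]
  intro v
  obtain ⟨u, rfl⟩ := hy' v
  exact h y' u

/-- A 2-form on the target of a surjective submersion is determined by its pullback. -/
theorem IsSubmersion.pull2_injective {Y X : Mfd.{u}} {V : FrechetSpace.{u}} {π : Y → X}
    (hπ : IsSubmersion Y X π) (hsurj : Function.Surjective π) {ω η : Fam2 X V}
    (h : ∀ y v w, pull2 π ω y v w = pull2 π η y v w) (x : X) (v w : X.T x) :
    ω x v w = η x v w := by
  obtain ⟨y, rfl⟩ := hsurj x
  obtain ⟨y', e, hy'⟩ := hπ.mderiv_surjective y
  revert v w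
  rw [← e]
  intro v w
  obtain ⟨u, rfl⟩ := hy' v
  obtain ⟨u', rfl⟩ := hy' w
  exact h y' u u'

/-! ### Fibre products of submersions -/

section FibreProduct

variable {X Y Y' : Mfd.{u}}

/-- The underlying set of the fibre product. -/
@[ext] structure FibrePt (π : Y → X) (π' : Y' → X) : Type u where
  fst : Y
  snd : Y'
  eq : π fst = π' snd

/-- The model of the fibre of a submersion near `y`. -/
def IsSubmersion.fibreModel {π : Y → X} (hπ : IsSubmersion Y X π) (y : Y) : FrechetSpace.{u} :=
  (hπ.2 y).choose

/-- A chart near `y` in which the submersion `π` is a projection. -/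
def IsSubmersion.triv {π : Y → X} (hπ : IsSubmersion Y X π) (y : Y) :
    OpenPartialHomeomorph Y (X.prod (Mfd.ofFrechet (hπ.fibreModel y))) :=
  (hπ.2 y).choose_spec.choose

section

variable {π : Y → X} (hπ : IsSubmersion Y X π) (y : Y)

theorem IsSubmersion.mem_triv : y ∈ (hπ.triv y).source := (hπ.2 y).choose_spec.choose_spec.1

theorem IsSubmersion.isSmoothOn_triv : IsSmoothOn Y (X.prod (Mfd.ofFrechet (hπ.fibreModel y)))
    (hπ.triv y) (hπ.triv y).source := (hπ.2 y).choose_spec.choose_spec.2.1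

theorem IsSubmersion.isSmoothOn_triv_symm :
    IsSmoothOn (X.prod (Mfd.ofFrechet (hπ.fibreModel y))) Y
      (hπ.triv y).symm (hπ.triv y).target := (hπ.2 y).choose_spec.choose_spec.2.2.1

theorem IsSubmersion.triv_fst {z : Y} (hz : z ∈ (hπ.triv y).source) :
    (hπ.triv y z).1 = π z := (hπ.2 y).choose_spec.choose_spec.2.2.2 z hz

theorem IsSubmersion.triv_eq {z : Y} (hz : z ∈ (hπ.triv y).source) :
    hπ.triv y z = (π z, (hπ.triv y z).2) := Prod.ext (hπ.triv_fst y hz) rfl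

theorem IsSubmersion.proj_triv_symm {q : X × hπ.fibreModel y} (hq : q ∈ (hπ.triv y).target) :
    π ((hπ.triv y).symm q) = q.1 := by
  rw [← hπ.triv_fst y ((hπ.triv y).map_target hq), (hπ.triv y).right_inv hq]

theorem IsSubmersion.isSmoothOn_triv_snd : IsSmoothOn Y (Mfd.ofFrechet (hπ.fibreModel y))
    (fun z => (hπ.triv y z).2) (hπ.triv y).source :=
  (isSmooth_snd (M := X) (N := Mfd.ofFrechet (hπ.fibreModel y))).comp_on (hπ.triv y).open_source
    (hπ.isSmoothOn_triv y)

end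

section

variable {π : Y → X} (hπ : IsSubmersion Y X π) {π' : Y' → X}

open Classical in
/-- Where `Y` is the product `X × F`, the fibre product `Y ×_X Y'` is the product `Y' × F`. -/
def fibreChart (π' : Y' → X) (p : FibrePt π π') :
    PartialEquiv (FibrePt π π') (Y'.prod (Mfd.ofFrechet (hπ.fibreModel p.fst))) where
  toFun z := (z.snd, (hπ.triv p.fst z.fst).2)
  invFun q := if h : ((π' q.1, q.2) : X × hπ.fibreModel p.fst) ∈ (hπ.triv p.fst).target then
    ⟨(hπ.triv p.fst).symm (π' q.1, q.2), q.1, hπ.proj_triv_symm p.fst h⟩ else p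
  source := {z | z.fst ∈ (hπ.triv p.fst).source}
  target := {q | ((π' q.1, q.2) : X × hπ.fibreModel p.fst) ∈ (hπ.triv p.fst).target}
  map_source' z hz := by
    have h := (hπ.triv p.fst).map_source hz
    rw [hπ.triv_eq p.fst hz, z.eq] at h
    exact h
  map_target' q hq := by
    have h : ((π' q.1, q.2) : X × hπ.fibreModel p.fst) ∈ (hπ.triv p.fst).target := hq
    rw [dif_pos h]
    exact (hπ.triv p.fst).map_target h
  left_inv' z hz := by
    have h := (hπ.triv p.fst).map_source hz
    have e := hπ.triv_eq p.fst hz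
    rw [e, z.eq] at h
    rw [dif_pos h]
    refine FibrePt.ext ?_ rfl
    rw [z.eq] at e
    show (hπ.triv p.fst).symm (π' z.snd, (hπ.triv p.fst z.fst).2) = z.fst
    rw [← e, (hπ.triv p.fst).left_inv hz]
  right_inv' q hq := by
    have h : ((π' q.1, q.2) : X × hπ.fibreModel p.fst) ∈ (hπ.triv p.fst).target := hq
    rw [dif_pos h]
    show (q.1, (hπ.triv p.fst ((hπ.triv p.fst).symm (π' q.1, q.2))).2) = q
    rw [(hπ.triv p.fst).right_inv h]

theorem fibreChart_symm_fst (p : FibrePt π π') {q : Y' × hπ.fibreModel p.fst}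
    (hq : q ∈ (fibreChart hπ π' p).target) :
    ((fibreChart hπ π' p).symm q).fst = (hπ.triv p.fst).symm (π' q.1, q.2) := by
  classical
  have h : ((π' q.1, q.2) : X × hπ.fibreModel p.fst) ∈ (hπ.triv p.fst).target := hq
  exact congrArg FibrePt.fst (dif_pos h)

theorem fibreChart_symm_snd (p : FibrePt π π') {q : Y' × hπ.fibreModel p.fst}
    (hq : q ∈ (fibreChart hπ π' p).target) : ((fibreChart hπ π' p).symm q).snd = q.1 := by
  classical
  have h : ((π' q.1, q.2) : X × hπ.fibreModel p.fst) ∈ (hπ.triv p.fst).target := hq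
  exact congrArg FibrePt.snd (dif_pos h)

theorem isOpen_fibreChart_target (hπ' : IsSmooth Y' X π') (p : FibrePt π π') :
    IsOpen (fibreChart hπ π' p).target :=
  (hπ.triv p.fst).open_target.preimage ((hπ'.continuous.comp continuous_fst).prodMk continuous_snd)

theorem isSmoothOn_fibreChart_symm_fst (hπ' : IsSmooth Y' X π') (p : FibrePt π π') :
    IsSmoothOn (Y'.prod (Mfd.ofFrechet (hπ.fibreModel p.fst))) Y
      (fun q => ((fibreChart hπ π' p).symm q).fst) (fibreChart hπ π' p).target := by
  have hO := isOpen_fibreChart_target hπ hπ' p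
  refine IsSmoothOn.congr hO ((hπ.isSmoothOn_triv_symm p.fst).comp (hπ.triv p.fst).open_target hO
    (((hπ'.comp isSmooth_fst).prodMk isSmooth_snd).on _) fun _ hq => hq) fun q hq => ?_
  exact (fibreChart_symm_fst hπ p hq).symm

theorem isSmoothOn_fibreChart_symm_snd (hπ' : IsSmooth Y' X π') (p : FibrePt π π') :
    IsSmoothOn (Y'.prod (Mfd.ofFrechet (hπ.fibreModel p.fst))) Y'
      (fun q => ((fibreChart hπ π' p).symm q).snd) (fibreChart hπ π' p).target :=
  IsSmoothOn.congr (isOpen_fibreChart_target hπ hπ' p)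
    (isSmooth_fst.on _) fun _ hq => (fibreChart_symm_snd hπ p hq).symm

variable (hπ' : IsSmooth Y' X π')

/-- The fibre product `Y ×_X Y'` for a submersion `π : Y → X`. -/
def fibreGlue : GlueData (FibrePt π π') where
  I := FibrePt π π'
  N p := Y'.prod (Mfd.ofFrechet (hπ.fibreModel p.fst))
  e p := fibreChart hπ π' p
  idx p := p
  mem p := hπ.mem_triv p.fst
  isOpen_overlap p p' := (isSmoothOn_fibreChart_symm_fst hπ hπ' p).1.isOpen_inter_preimage
    (isOpen_fibreChart_target hπ hπ' p) (hπ.triv p'.fst).open_source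
  smooth p p' := by
    have hO := (isSmoothOn_fibreChart_symm_fst hπ hπ' p).1.isOpen_inter_preimage
      (isOpen_fibreChart_target hπ hπ' p) (hπ.triv p'.fst).open_source
    exact ((isSmoothOn_fibreChart_symm_snd hπ hπ' p).mono inter_subset_left).prodMk hO
      ((hπ.isSmoothOn_triv_snd p'.fst).comp (hπ.triv p'.fst).open_source hO
        ((isSmoothOn_fibreChart_symm_fst hπ hπ' p).mono inter_subset_left) fun q hq => hq.2)
  base := Y.prod Y'
  pr p := (p.fst, p.snd)
  continuousOn_pr p := (isSmoothOn_fibreChart_symm_fst hπ hπ' p).1.prodMk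
    (isSmoothOn_fibreChart_symm_snd hπ hπ' p).1
  sep p p' h := by
    obtain rfl : p = p' := FibrePt.ext (congrArg Prod.fst h) (congrArg Prod.snd h)
    exact ⟨p, hπ.mem_triv p.fst, hπ.mem_triv p.fst⟩

/-- The fibre product as a manifold. -/
def fibreMfd : Mfd.{u} := (fibreGlue hπ hπ').mfd

/-- The first projection of the fibre product. -/
def fibreFst (p : fibreMfd hπ hπ') : Y := FibrePt.fst (π := π) (π' := π') p

/-- The second projection of the fibre product. -/
def fibreSnd (p : fibreMfd hπ hπ') : Y' := FibrePt.snd (π := π) (π' := π') p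

theorem fibre_eq (p : fibreMfd hπ hπ') : π (fibreFst hπ hπ' p) = π' (fibreSnd hπ hπ' p) :=
  FibrePt.eq (π := π) (π' := π') p

/-- The point of the fibre product with given components. -/
def fibreMk (y : Y) (y' : Y') (e : π y = π' y') : fibreMfd hπ hπ' :=
  (⟨y, y', e⟩ : FibrePt π π')

theorem fibre_ext {p p' : fibreMfd hπ hπ'} (h : fibreFst hπ hπ' p = fibreFst hπ hπ' p')
    (h' : fibreSnd hπ hπ' p = fibreSnd hπ hπ' p') : p = p' :=
  FibrePt.ext (π := π) (π' := π') h h'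

theorem isSmooth_fibreFst : IsSmooth (fibreMfd hπ hπ') Y (fibreFst hπ hπ') :=
  (fibreGlue hπ hπ').isSmooth_of_piece fun p =>
    ⟨_, isSmoothOn_fibreChart_symm_fst hπ hπ' p, fun q hq => by
      rw [show (fibreGlue hπ hπ').e p q = fibreChart hπ π' p q from rfl,
        (fibreChart hπ π' p).left_inv hq]
      rfl⟩

theorem isSmooth_fibreSnd : IsSmooth (fibreMfd hπ hπ') Y' (fibreSnd hπ hπ') :=
  (fibreGlue hπ hπ').isSmooth_of_piece fun p =>
    ⟨_, isSmoothOn_fibreChart_symm_snd hπ hπ' p, fun q hq => by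
      rw [show (fibreGlue hπ hπ').e p q = fibreChart hπ π' p q from rfl,
        (fibreChart hπ π' p).left_inv hq]
      rfl⟩

theorem isSmoothOn_fibre {Z : Mfd.{u}} {f : Z → fibreMfd hπ hπ'} {U : Set Z} (hU : IsOpen U)
    (h1 : IsSmoothOn Z Y (fun z => fibreFst hπ hπ' (f z)) U)
    (h2 : IsSmoothOn Z Y' (fun z => fibreSnd hπ hπ' (f z)) U) :
    IsSmoothOn Z (fibreMfd hπ hπ') f U := by
  refine IsSmoothOn.of_local fun z hz => ?_
  set p : FibrePt π π' := f z with hp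
  have hO := h1.1.isOpen_inter_preimage hU (hπ.triv p.fst).open_source
  refine ⟨_, hO, ⟨hz, hπ.mem_triv p.fst⟩, ?_⟩
  refine (fibreGlue hπ hπ').isSmoothOn_of_piece hO p (fun x hx => hx.2) ?_
  exact (h2.mono inter_subset_left).prodMk hO ((hπ.isSmoothOn_triv_snd p.fst).comp
    (hπ.triv p.fst).open_source hO (h1.mono inter_subset_left) fun x hx => hx.2)

theorem isFiberProduct_fibreMfd : IsFiberProduct π π' (fibreFst hπ hπ') (fibreSnd hπ hπ') := by
  refine ⟨isSmooth_fibreFst hπ hπ', isSmooth_fibreSnd hπ hπ', fibre_eq hπ hπ', ?_⟩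
  intro Z f₁ f₂ h₁ h₂ e
  refine ⟨fun z => fibreMk hπ hπ' (f₁ z) (f₂ z) (e z), ⟨?_, fun _ => rfl, fun _ => rfl⟩, ?_⟩
  · exact isSmoothOn_fibre hπ hπ' isOpen_univ h₁ h₂
  · rintro f ⟨-, e₁, e₂⟩
    funext z
    exact fibre_ext hπ hπ' (e₁ z) (e₂ z)

/-- If `π` and `π'` are submersions, then so is `Y ×_X Y' → X`. -/
theorem isSubmersion_fibre (hs' : IsSubmersion Y' X π') :
    IsSubmersion (fibreMfd hπ hπ') X (fun p => π (fibreFst hπ hπ' p)) := by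
  refine IsSubmersion.of_local (hπ.1.comp (isSmooth_fibreFst hπ hπ')) fun p => ?_
  obtain ⟨F, ψ, hy, hψ, hψs, hpr⟩ := hπ.2 (fibreFst hπ hπ' p)
  obtain ⟨F', ψ', hy', hψ', hψs', hpr'⟩ := hs'.2 (fibreSnd hπ hπ' p)
  have hpt₁ : ∀ q ∈ ψ.target, π (ψ.symm q) = q.1 := fun q hq => by
    rw [← hpr _ (ψ.map_target hq), ψ.right_inv hq]
  have hpt₂ : ∀ q ∈ ψ'.target, π' (ψ'.symm q) = q.1 := fun q hq => by
    rw [← hpr' _ (ψ'.map_target hq), ψ'.right_inv hq]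
  set N := (Mfd.ofFrechet F).prod (Mfd.ofFrechet F') with hN
  set O : Set (fibreMfd hπ hπ') := fibreFst hπ hπ' ⁻¹' ψ.source ∩ fibreSnd hπ hπ' ⁻¹' ψ'.source
    with hOdef
  have hO : IsOpen O := (ψ.open_source.preimage (isSmooth_fibreFst hπ hπ').continuous).inter
    (ψ'.open_source.preimage (isSmooth_fibreSnd hπ hπ').continuous)
  have c1 : IsSmooth (X.prod N) (X.prod (Mfd.ofFrechet F)) (fun q : X × (F × F') =>
      (q.1, q.2.1)) :=
    isSmooth_fst.prodMk ((isSmooth_fst (M := Mfd.ofFrechet F) (N := Mfd.ofFrechet F')).comp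
      isSmooth_snd)
  have c2 : IsSmooth (X.prod N) (X.prod (Mfd.ofFrechet F')) (fun q : X × (F × F') =>
      (q.1, q.2.2)) :=
    isSmooth_fst.prodMk ((isSmooth_snd (M := Mfd.ofFrechet F) (N := Mfd.ofFrechet F')).comp
      isSmooth_snd)
  set O' : Set (X.prod N) := (fun q : X × (F × F') => ((q.1, q.2.1) : X × F)) ⁻¹' ψ.target ∩
    (fun q : X × (F × F') => ((q.1, q.2.2) : X × F')) ⁻¹' ψ'.target with hO'def
  have hO' : IsOpen O' := (ψ.open_target.preimage c1.continuous).inter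
    (ψ'.open_target.preimage c2.continuous)
  have he : ∀ q ∈ O', π (ψ.symm (q.1, q.2.1)) = π' (ψ'.symm (q.1, q.2.2)) := fun q hq =>
    (hpt₁ _ hq.1).trans
      (hpt₂ _ hq.2).symm
  classical
  set σ : X × (F × F') → fibreMfd hπ hπ' := fun q => if h : q ∈ O' then
    fibreMk hπ hπ' (ψ.symm (q.1, q.2.1)) (ψ'.symm (q.1, q.2.2)) (he q h) else p with hσ
  have hσ1 : ∀ q ∈ O', fibreFst hπ hπ' (σ q) = ψ.symm (q.1, q.2.1) := fun q hq => by
    simp only [hσ, dif_pos hq]; rfl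
  have hσ2 : ∀ q ∈ O', fibreSnd hπ hπ' (σ q) = ψ'.symm (q.1, q.2.2) := fun q hq => by
    simp only [hσ, dif_pos hq]; rfl
  have hpt : ∀ z ∈ O, ((π (fibreFst hπ hπ' z), (ψ (fibreFst hπ hπ' z)).2) : X × F) =
      ψ (fibreFst hπ hπ' z) ∧ ((π (fibreFst hπ hπ' z), (ψ' (fibreSnd hπ hπ' z)).2) : X × F') =
      ψ' (fibreSnd hπ hπ' z) := fun z hz =>
    ⟨Prod.ext (hpr _ hz.1).symm rfl,
      Prod.ext ((fibre_eq hπ hπ' z).trans (hpr' _ hz.2).symm) rfl⟩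
  have hmem : ∀ z ∈ O, (((π (fibreFst hπ hπ' z), ((ψ (fibreFst hπ hπ' z)).2,
      (ψ' (fibreSnd hπ hπ' z)).2))) : X × (F × F')) ∈ O' := fun z hz =>
    ⟨by
      show ((π (fibreFst hπ hπ' z), (ψ (fibreFst hπ hπ' z)).2) : X × F) ∈ ψ.target
      rw [(hpt z hz).1]; exact ψ.map_source hz.1, by
      show ((π (fibreFst hπ hπ' z), (ψ' (fibreSnd hπ hπ' z)).2) : X × F') ∈ ψ'.target
      rw [(hpt z hz).2]; exact ψ'.map_source hz.2⟩
  refine ⟨N, O, O', fun z => ((ψ (fibreFst hπ hπ' z)).2, (ψ' (fibreSnd hπ hπ' z)).2), σ, hO, hO',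
    ⟨hy, hy'⟩, ?_, ?_, hmem, ?_, ?_, ?_⟩
  · exact (((isSmooth_snd (M := X) (N := Mfd.ofFrechet F)).comp_on ψ.open_source hψ).comp
      ψ.open_source hO ((isSmooth_fibreFst hπ hπ').on _)
      fun z hz => hz.1).prodMk hO
        (((isSmooth_snd (M := X) (N := Mfd.ofFrechet F')).comp_on ψ'.open_source hψ').comp
      ψ'.open_source hO
      ((isSmooth_fibreSnd hπ hπ').on _) fun z hz => hz.2)
  · refine isSmoothOn_fibre hπ hπ' hO' ?_ ?_
    · exact (hψs.comp ψ.open_target hO' (c1.on _) fun q hq => hq.1).congr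
        hO' fun q hq => (hσ1 q hq).symm
    · exact (hψs'.comp ψ'.open_target hO' (c2.on _)
        fun q hq => hq.2).congr hO' fun q hq => (hσ2 q hq).symm
  · intro q hq
    refine ⟨?_, ?_⟩
    · rw [mem_preimage, hσ1 q hq]; exact ψ.map_target hq.1
    · rw [mem_preimage, hσ2 q hq]; exact ψ'.map_target hq.2
  · intro z hz
    refine fibre_ext hπ hπ' ?_ ?_
    · rw [hσ1 _ (hmem z hz), (hpt z hz).1, ψ.left_inv hz.1]
    · rw [hσ2 _ (hmem z hz), (hpt z hz).2, ψ'.left_inv hz.2]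
  · intro q hq
    refine ⟨?_, Prod.ext ?_ ?_⟩
    · rw [hσ1 q hq]; exact hpt₁ _ hq.1
    · show (ψ (fibreFst hπ hπ' (σ q))).2 = q.2.1
      rw [hσ1 q hq, ψ.right_inv hq.1]
    · show (ψ' (fibreSnd hπ hπ' (σ q))).2 = q.2.2
      rw [hσ2 q hq, ψ'.right_inv hq.2]

end

end FibreProduct

/-! ### Gauge 2-transformations -/

section GaugeForm

variable {Γ : LieTwoGroup.{u}} {M N : Mfd.{u}}

/-- The 1-form `Ad_h⁻¹(φ) + (α̃_h)_*(A') + h^*θ`. A gauge 2-transformation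
`h : (g₁, φ₁) ⇒ (g₂, φ₂)` satisfies `φ₁ = gaugeForm h A' φ₂`. -/
def gaugeForm (h : M → Γ.H) (A' : Fam1 M Γ.𝔤) (φ : Fam1 M Γ.𝔥) : Fam1 M Γ.𝔥 :=
  fun x v => Γ.H.Ad (h x)⁻¹ (φ x v) + Γ.αTilde (h x) (A' x v) + Γ.H.leftMC h x v

theorem IsGauge2On.eq_gaugeForm {U : Set M} {A' : Fam1 M Γ.𝔤} {g₁ g₂ : M → Γ.G}
    {φ₁ φ₂ : Fam1 M Γ.𝔥} {h : M → Γ.H} (H : IsGauge2On Γ U A' g₁ φ₁ g₂ φ₂ h) {x : M} (hx : x ∈ U)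
    (v : M.T x) : φ₁ x v = gaugeForm h A' φ₂ x v := by
  have := H.eq_φ x hx v
  rw [gaugeForm, this, sub_add_cancel]

theorem IsGauge2On.of_eq {U : Set M} {A' : Fam1 M Γ.𝔤} {g₁ g₂ : M → Γ.G}
    {φ₁ φ₂ : Fam1 M Γ.𝔥} {h : M → Γ.H} (hh : IsSmoothOn M Γ.H h U)
    (eg : ∀ x ∈ U, g₂ x = Γ.t (h x) * g₁ x)
    (e : ∀ x ∈ U, ∀ v, φ₁ x v = gaugeForm h A' φ₂ x v) : IsGauge2On Γ U A' g₁ φ₁ g₂ φ₂ h :=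
  ⟨hh, eg, fun x hx v => by rw [e x hx v, gaugeForm, add_sub_cancel_right]⟩

theorem gaugeForm_mul {U : Set M} (hU : IsOpen U) {a h : M → Γ.H} (ha : IsSmoothOn M Γ.H a U)
    (hh : IsSmoothOn M Γ.H h U) (A' : Fam1 M Γ.𝔤) (φ : Fam1 M Γ.𝔥) {x : M} (hx : x ∈ U)
    (v : M.T x) :
    gaugeForm (fun x => a x * h x) A' φ x v = gaugeForm h A' (gaugeForm a A' φ) x v := by
  simp only [gaugeForm]
  rw [leftMC_mul hU ha hh hx, αTilde_mul, mul_inv_rev, Ad_mul, Ad_add, Ad_add]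
  abel

theorem gaugeForm_one (A' : Fam1 M Γ.𝔤) (φ : Fam1 M Γ.𝔥) (x : M) (v : M.T x) :
    gaugeForm (fun _ => (1 : Γ.H)) A' φ x v = φ x v := by
  rw [gaugeForm, leftMC_const, αTilde_one, inv_one, Ad_one, add_zero, add_zero]

theorem gaugeForm_congr {h h' : M → Γ.H} {A A' : Fam1 M Γ.𝔤} {φ φ' : Fam1 M Γ.𝔥} {x : M}
    (hh : h =ᶠ[𝓝 x] h') {v : M.T x} (eA : A x v = A' x v) (eφ : φ x v = φ' x v) :
    gaugeForm h A φ x v = gaugeForm h' A' φ' x v := by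
  rw [gaugeForm, gaugeForm, leftMC_congr hh, hh.eq_of_nhds, eA, eφ]

theorem pull_gaugeForm {O : Set N} (hO : IsOpen O) {h : N → Γ.H} (hh : IsSmoothOn N Γ.H h O)
    {U : Set M} (hU : IsOpen U) {f : M → N} (hf : IsSmoothOn M N f U) {x : M} (hx : x ∈ U)
    (hfx : f x ∈ O) (A' : Fam1 N Γ.𝔤) (φ : Fam1 N Γ.𝔥) (v : M.T x) :
    pull f (gaugeForm h A' φ) x v = gaugeForm (fun x => h (f x)) (pull f A') (pull f φ) x v := by
  rw [gaugeForm, leftMC_comp hO hh hU hf hx hfx]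
  rfl

theorem isForm1_gaugeForm {h : M → Γ.H} (hh : IsSmooth M Γ.H h) {A' : Fam1 M Γ.𝔤}
    (hA : IsForm1 M Γ.𝔤 A') {φ : Fam1 M Γ.𝔥} (hφ : IsForm1 M Γ.𝔥 φ) :
    IsForm1 M Γ.𝔥 (gaugeForm h A' φ) := by
  have h1 := hφ.Ad (isSmoothOn_inv isOpen_univ hh)
  have h2 : IsForm1 M Γ.𝔥 (fun x v => Γ.αTilde (h x) (A' x v)) :=
    ((hA.formSmoothOn univ).pairing (isSmooth_αTilde Γ) isOpen_univ hh).isForm1 fun x =>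
      ⟨fun v w => by rw [hA.add, (isLinearMap_αTilde Γ _).map_add],
        fun c v => by rw [hA.smul, (isLinearMap_αTilde Γ _).map_smul]⟩
  have h3 : IsForm1 M Γ.𝔥 (Γ.H.leftMC h) := (formSmoothOn_leftMC isOpen_univ hh).isForm1
    fun x => isLinearMap_leftMC isOpen_univ hh (mem_univ x)
  exact (h1.add_form h2).add_form h3

theorem IsGaugeTransf.congr {A₁ A₂ A₁' A₂' : Fam1 M Γ.𝔤} {g : M → Γ.G} {φ : Fam1 M Γ.𝔥}
    (H : IsGaugeTransf Γ A₁ A₁' g φ) (e : ∀ x v, A₁ x v = A₂ x v)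
    (e' : ∀ x v, A₁' x v = A₂' x v) : IsGaugeTransf Γ A₂ A₂' g φ :=
  ⟨H.smooth, H.isForm, fun x v => by rw [← e, ← e', H.eq]⟩

theorem IsGaugeTransf.pull {f : M → N} (hf : IsSmooth M N f) {A A' : Fam1 N Γ.𝔤} {g : N → Γ.G}
    {φ : Fam1 N Γ.𝔥} (H : IsGaugeTransf Γ A A' g φ) :
    IsGaugeTransf Γ (pull f A) (pull f A') (fun x => g (f x)) (HGT.pull f φ) :=
  ⟨H.smooth.comp hf, isForm1_pull hf H.isForm, fun x v => by
    rw [rightMC_comp isOpen_univ H.smooth isOpen_univ hf (mem_univ x) (mem_univ _)]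
    exact H.eq (f x) (mderiv M N f x v)⟩

/-- A gauge 2-transformation with given target has a gauge transformation as its source. -/
theorem IsGaugeTransf.gauge2 {A A' : Fam1 M Γ.𝔤} (hA' : IsForm1 M Γ.𝔤 A') {g : M → Γ.G}
    {φ : Fam1 M Γ.𝔥} (H : IsGaugeTransf Γ A A' g φ) {h : M → Γ.H} (hh : IsSmooth M Γ.H h) :
    IsGaugeTransf Γ A A' (fun x => (Γ.t (h x))⁻¹ * g x) (gaugeForm h A' φ) := by
  have ht : IsSmooth M Γ.G (fun x => Γ.t (h x)) := Γ.smooth_t.comp hh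
  have hi : IsSmooth M Γ.G (fun x => (Γ.t (h x))⁻¹) := isSmoothOn_inv isOpen_univ ht
  refine ⟨isSmoothOn_mul isOpen_univ hi H.smooth, isForm1_gaugeForm hh hA' H.isForm, fun x v => ?_⟩
  have e := H.eq x v
  have hL := isLinearMap_tStar Γ
  have e1 : Γ.tStar (Γ.H.Ad (h x)⁻¹ (φ x v)) = Γ.G.Ad (Γ.t (h x))⁻¹ (Γ.tStar (φ x v)) := by
    rw [← αStar_t, tStar_αStar, map_inv]
  have e2 : Γ.tStar (Γ.H.leftMC h x v) = Γ.G.leftMC (fun x => Γ.t (h x)) x v :=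
    (leftMC_hom Γ.smooth_t isOpen_univ hh (mem_univ x) v).symm
  rw [gaugeForm, hL.map_add, hL.map_add, e1, e2, tStar_αTilde,
    rightMC_mul isOpen_univ hi H.smooth (mem_univ x), rightMC_inv isOpen_univ ht (mem_univ x),
    Ad_mul]
  have e3 := congrArg (Γ.G.Ad (Γ.t (h x))⁻¹) e
  rw [Ad_add, (isLinearMap_Ad _).map_sub] at e3
  rw [← sub_eq_zero] at e3 ⊢
  rw [← e3]
  abel

/-- Composition of gauge transformations. -/
theorem IsGaugeTransf.comp {A A' A'' : Fam1 M Γ.𝔤} {g g' : M → Γ.G} {φ φ' : Fam1 M Γ.𝔥}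
    (H : IsGaugeTransf Γ A A' g φ) (H' : IsGaugeTransf Γ A' A'' g' φ') :
    IsGaugeTransf Γ A A'' (fun x => g' x * g x)
      (fun x v => Γ.αStar (g' x) (φ x v) + φ' x v) := by
  refine ⟨isSmoothOn_mul isOpen_univ H'.smooth H.smooth,
    (H.isForm.αStar H'.smooth).add_form H'.isForm, fun x v => ?_⟩
  have e := congrArg (Γ.G.Ad (g' x)) (H.eq x v)
  have e' := H'.eq x v
  rw [Ad_add, (isLinearMap_Ad _).map_sub] at e
  rw [(isLinearMap_tStar Γ).map_add, tStar_αStar,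
    rightMC_mul isOpen_univ H'.smooth H.smooth (mem_univ x), Ad_mul]
  rw [eq_sub_iff_add_eq] at e e' ⊢
  rw [← e, ← sub_eq_zero] at *
  rw [← sub_eq_zero] at e'
  rw [← e']
  abel

/-- Whiskering of a gauge 2-transformation by a gauge transformation `(g', φ') : A' → A''`. -/
theorem IsGauge2On.whisker_left {U : Set M} (hU : IsOpen U) {A' A'' : Fam1 M Γ.𝔤}
    {g₁ g₂ g' : M → Γ.G} {φ₁ φ₂ φ' : Fam1 M Γ.𝔥} {h : M → Γ.H}
    (H : IsGauge2On Γ U A' g₁ φ₁ g₂ φ₂ h) (hg' : IsSmoothOn M Γ.G g' U)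
    (e' : ∀ x ∈ U, ∀ v,
      A'' x v + Γ.tStar (φ' x v) = Γ.G.Ad (g' x) (A' x v) - Γ.G.rightMC g' x v) :
    IsGauge2On Γ U A'' (fun x => g' x * g₁ x) (fun x v => Γ.αStar (g' x) (φ₁ x v) + φ' x v)
      (fun x => g' x * g₂ x) (fun x v => Γ.αStar (g' x) (φ₂ x v) + φ' x v)
      (fun x => Γ.α (g' x) (h x)) := by
  refine .of_eq (isSmoothOn_α Γ hU hg' H.smooth) (fun x hx => ?_) fun x hx v => ?_
  · rw [Γ.t_α, H.eq_g x hx]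
    group
  · have hA : A'' x v = Γ.G.Ad (g' x) (A' x v) - Γ.G.rightMC g' x v - Γ.tStar (φ' x v) :=
      eq_sub_of_add_eq (e' x hx v)
    have hT := isLinearMap_αTilde Γ (Γ.α (g' x) (h x))
    have hS := isLinearMap_αStar Γ (g' x)
    rw [gaugeForm, hA, hT.map_sub, hT.map_sub, αTilde_αStar, αTilde_tStar,
      leftMC_α Γ hU hg' H.smooth hx, H.eq_gaugeForm hx v, gaugeForm, hS.map_add, hS.map_add,
      αStar_Ad, Ad_add, map_inv]
    abel

/-- Whiskering of a gauge 2-transformation by a gauge transformation `(g, φ)` on the other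
side. -/
theorem IsGauge2On.whisker_right {U : Set M} {A'' : Fam1 M Γ.𝔤}
    {g₁ g₂ : M → Γ.G} {φ₁ φ₂ : Fam1 M Γ.𝔥} {h : M → Γ.H}
    (H : IsGauge2On Γ U A'' g₁ φ₁ g₂ φ₂ h) (g : M → Γ.G) (φ : Fam1 M Γ.𝔥) :
    IsGauge2On Γ U A'' (fun x => g₁ x * g x) (fun x v => Γ.αStar (g₁ x) (φ x v) + φ₁ x v)
      (fun x => g₂ x * g x) (fun x v => Γ.αStar (g₂ x) (φ x v) + φ₂ x v) h := by
  refine .of_eq H.smooth (fun x hx => ?_) fun x hx v => ?_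
  · rw [H.eq_g x hx, mul_assoc]
  · rw [H.eq_gaugeForm hx v, gaugeForm, gaugeForm, H.eq_g x hx, αStar_mul, αStar_t, Ad_add,
      Ad_inv_Ad]
    abel

end GaugeForm

/-- The values of a gauge 2-transformation relate `g₁` and `g₂` pointwise. -/
theorem IsGauge2.eq_g {Γ : LieTwoGroup.{u}} {X Y₁ Y₂ : Mfd.{u}} {π₁ : Y₁ → X} {π₂ : Y₂ → X}
    {A' : Fam1 X Γ.𝔤} {g₁ : Y₁ → Γ.G} {φ₁ : Fam1 Y₁ Γ.𝔥} {g₂ : Y₂ → Γ.G} {φ₂ : Fam1 Y₂ Γ.𝔥}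
    {h : ∀ (y₁ : Y₁) (y₂ : Y₂), π₁ y₁ = π₂ y₂ → Γ.H} (H : IsGauge2 Γ π₁ π₂ A' g₁ φ₁ g₂ φ₂ h)
    (y₁ : Y₁) (y₂ : Y₂) (e : π₁ y₁ = π₂ y₂) : g₂ y₂ = Γ.t (h y₁ y₂ e) * g₁ y₁ :=
  (H X univ (fun _ => y₁) (fun _ => y₂) (fun _ => e) isOpen_univ (isSmooth_const y₁)
    (isSmooth_const y₂)).eq_g (π₁ y₁) (mem_univ _)

/-! ### Descent of 1-forms -/

theorem isLinearMap_pull {M N : Mfd.{u}} {V : FrechetSpace.{u}} {U : Set M} (hU : IsOpen U)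
    {f : M → N} (hf : IsSmoothOn M N f U) {η : Fam1 N V} (hη : IsForm1 N V η) {x : M}
    (hx : x ∈ U) : IsLinearMap ℝ (pull f η x) := by
  have h := isLinearMap_mderiv hU hf hx
  exact ⟨fun v w => by rw [pull, h.map_add, hη.add]; rfl,
    fun c v => by rw [pull, h.map_smul, hη.smul]; rfl⟩

/-- A 1-form on the source of a surjective submersion descends if its two pullbacks to the fibre
product agree. -/
theorem IsSubmersion.exists_form {Z P : Mfd.{u}} {V : FrechetSpace.{u}} {q : Z → P}
    (hq : IsSubmersion Z P q) (hs : Function.Surjective q) {η : Fam1 Z V} (hη : IsForm1 Z V η)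
    (hc : ∀ (W : Mfd.{u}) (U : Set W) (z₁ z₂ : W → Z), IsOpen U → IsSmoothOn W Z z₁ U →
      IsSmoothOn W Z z₂ U → (∀ w, q (z₁ w) = q (z₂ w)) →
      ∀ w ∈ U, ∀ v, pull z₁ η w v = pull z₂ η w v) :
    ∃ ω : Fam1 P V, IsForm1 P V ω ∧ ∀ z v, pull q ω z v = η z v := by
  choose O s hO hp hs hsec using fun p => hq.exists_global_section hs p
  refine ⟨fun p v => pull (s p) η p v, ?_, fun z v => ?_⟩
  · refine FormSmoothOn.isForm1 (FormSmoothOn.of_local fun p _ => ⟨O p, hO p, hp p, ?_⟩)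
      fun p => isLinearMap_pull (hO p) (hs p) hη (hp p)
    refine ((hη.formSmoothOn univ).pull (hO p) (hs p) isOpen_univ (mapsTo_univ _ _)).congr (hO p)
      fun p' hp' v => ?_
    exact hc P (O p ∩ O p') (s p) (s p') ((hO p).inter (hO p'))
      ((hs p).mono inter_subset_left) ((hs p').mono inter_subset_right)
      (fun x => (hsec p x).trans (hsec p' x).symm) p' ⟨hp', hp p'⟩ v
  · have hU : IsOpen (q ⁻¹' O (q z)) := (hO (q z)).preimage hq.1.continuous
    have h1 := pull_comp (hO (q z)) (hs (q z)) hU (hq.1.on _) (x := z) (hp (q z)) (hp (q z)) η v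
    refine h1.symm.trans ?_
    rw [← pull_id η z v]
    exact hc Z _ (fun x => s (q z) (q x)) (fun x => x) hU
      ((hs (q z)).comp (hO (q z)) hU (hq.1.on _) fun x hx => hx) (isSmooth_id.on _)
      (fun x => hsec _ _) z (hp (q z)) v

/-! ### Principal bundles -/

namespace GammaBundle

variable {Γ : LieTwoGroup.{u}} {X : Mfd.{u}} (E : GammaBundle Γ X)

theorem act_injective (p : E.P) {h h' : Γ.H} (e : E.act p h = E.act p h') : h = h' := by
  obtain ⟨U, ψ, -, hx, -, -, -, -, hψ⟩ := E.locally_trivial (E.proj p)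
  have h1 := congrArg ψ e
  rw [(hψ p hx).2, (hψ p hx).2] at h1
  exact mul_left_cancel (congrArg Prod.snd h1)

theorem act_inv_eq {p p' : E.P} {h : Γ.H} (e : E.act p' h = p) : E.act p h⁻¹ = p' := by
  rw [← e, E.act_mul, mul_inv_cancel, E.act_one]

theorem exists_div {p p' : E.P} (e : E.proj p = E.proj p') : ∃ h, E.act p' h = p := by
  obtain ⟨U, ψ, -, hx, hs, -, -, -, hψ⟩ := E.locally_trivial (E.proj p)
  have hx' : E.proj p' ∈ U := e ▸ hx
  refine ⟨(ψ p').2⁻¹ * (ψ p).2, ψ.injOn ?_ ?_ ?_⟩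
  · rw [hs, mem_preimage, E.proj_act]; exact hx'
  · rw [hs]; exact hx
  · rw [(hψ p' hx').2, mul_inv_cancel_left, ← e]
    exact Prod.ext (hψ p hx).1.symm rfl

/-- The element `h` of the structure group with `p' h = p`. -/
def div (p p' : E.P) (e : E.proj p = E.proj p') : Γ.H := (E.exists_div e).choose

theorem act_div {p p' : E.P} (e : E.proj p = E.proj p') : E.act p' (E.div p p' e) = p :=
  (E.exists_div e).choose_spec

theorem div_eq {p p' : E.P} (e : E.proj p = E.proj p') {h : Γ.H} (eh : E.act p' h = p) :
    E.div p p' e = h := E.act_injective p' ((E.act_div e).trans eh.symm)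

theorem div_mul_div {p p' p'' : E.P} (e : E.proj p = E.proj p') (e' : E.proj p' = E.proj p'') :
    E.div p' p'' e' * E.div p p' e = E.div p p'' (e.trans e') := by
  refine (E.div_eq _ ?_).symm
  rw [← E.act_mul, E.act_div, E.act_div]

theorem isSmoothOn_div {Z : Mfd.{u}} {z z' : Z → E.P} {U : Set Z} (hU : IsOpen U)
    (hz : IsSmoothOn Z E.P z U) (hz' : IsSmoothOn Z E.P z' U)
    (e : ∀ x, E.proj (z x) = E.proj (z' x)) :
    IsSmoothOn Z Γ.H (fun x => E.div (z x) (z' x) (e x)) U := by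
  refine IsSmoothOn.of_local fun x₀ hx₀ => ?_
  obtain ⟨V, ψ, hV, hx, hs, -, hψs, -, hψ⟩ := E.locally_trivial (E.proj (z x₀))
  have hW : IsOpen (U ∩ (fun x => E.proj (z x)) ⁻¹' V) :=
    (E.smooth_proj.comp_on hU hz).1.isOpen_inter_preimage hU hV
  have hsnd : IsSmoothOn E.P Γ.H (fun p => (ψ p).2) ψ.source :=
    (isSmooth_snd (M := X) (N := Γ.H.toMfd)).comp_on ψ.open_source hψs
  have h1 : IsSmoothOn Z Γ.H (fun x => (ψ (z x)).2) (U ∩ (fun x => E.proj (z x)) ⁻¹' V) :=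
    hsnd.comp ψ.open_source hW (hz.mono inter_subset_left) fun x hx => by
      rw [hs]; exact hx.2
  have h2 : IsSmoothOn Z Γ.H (fun x => (ψ (z' x)).2) (U ∩ (fun x => E.proj (z x)) ⁻¹' V) :=
    hsnd.comp ψ.open_source hW (hz'.mono inter_subset_left) fun x hx => by
      rw [hs, mem_preimage, ← e]; exact hx.2
  refine ⟨_, hW, ⟨hx₀, hx⟩, (isSmoothOn_mul hW (isSmoothOn_inv hW h2) h1).congr hW
    fun x hx => ?_⟩
  refine (E.div_eq (e x) (ψ.injOn ?_ ?_ ?_)).symm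
  · rw [hs, mem_preimage, E.proj_act, ← e]; exact hx.2
  · rw [hs]; exact hx.2
  · rw [(hψ (z' x) (by rw [← e]; exact hx.2)).2, mul_inv_cancel_left, ← e]
    exact Prod.ext (hψ (z x) hx.2).1.symm rfl

theorem isSubmersion_proj : IsSubmersion E.P X E.proj := by
  refine IsSubmersion.of_local E.smooth_proj fun p => ?_
  obtain ⟨U, ψ, hU, hx, hs, ht, hψs, hψs', hψ⟩ := E.locally_trivial (E.proj p)
  have hψ1 : ∀ z ∈ ψ.source, (E.proj z, (ψ z).2) = ψ z := fun z hz =>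
    Prod.ext (hψ z (by rwa [hs] at hz)).1.symm rfl
  refine ⟨Γ.H, ψ.source, ψ.target, fun z => (ψ z).2, ψ.symm, ψ.open_source, ψ.open_target,
    by rw [hs]; exact hx, (isSmooth_snd (M := X) (N := Γ.H.toMfd)).comp_on ψ.open_source hψs,
    hψs', ?_, fun q hq => ψ.map_target hq, ?_, ?_⟩
  · intro z hz
    rw [hψ1 z hz]
    exact ψ.map_source hz
  · intro z hz
    rw [hψ1 z hz]
    exact ψ.left_inv hz
  · intro q hq
    have h := hψ1 _ (ψ.map_target hq)
    rw [ψ.right_inv hq] at h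
    exact ⟨congrArg Prod.fst h, congrArg Prod.snd (ψ.right_inv hq)⟩

theorem surjective_proj : Function.Surjective E.proj := by
  intro x
  obtain ⟨U, ψ, hU, hx, hs, ht, -, -, hψ⟩ := E.locally_trivial x
  have hq : ((x, 1) : X × Γ.H) ∈ ψ.target := by rw [ht]; exact ⟨hx, mem_univ _⟩
  have h := (hψ (ψ.symm (x, 1)) (by have := ψ.map_target hq; rwa [hs] at this)).1
  rw [ψ.right_inv hq] at h
  exact ⟨_, h.symm⟩

theorem isSmoothOn_act {Z : Mfd.{u}} {p : Z → E.P} {k : Z → Γ.H} {U : Set Z} (hU : IsOpen U)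
    (hp : IsSmoothOn Z E.P p U) (hk : IsSmoothOn Z Γ.H k U) :
    IsSmoothOn Z E.P (fun z => E.act (p z) (k z)) U :=
  IsSmooth.comp_on E.smooth_act hU (hp.prodMk hU hk)

end GammaBundle

namespace BunCon

variable {Γ : LieTwoGroup.{u}} {X : Mfd.{u}} {A A' : Fam1 X Γ.𝔤} (E : BunCon Γ X A A')

/-- The transformation of the connection under the action of a function with values in the
structure group. -/
theorem pull_act {Z : Mfd.{u}} {p : Z → E.P} {k : Z → Γ.H} {U : Set Z} (hU : IsOpen U)
    (hp : IsSmoothOn Z E.P p U) (hk : IsSmoothOn Z Γ.H k U) {z : Z} (hz : z ∈ U) (v : Z.T z) :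
    pull (fun z => E.act (p z) (k z)) E.ω z v =
      gaugeForm k (pull (fun z => E.proj (p z)) A') (pull p E.ω) z v := by
  have hpk := hp.prodMk hU hk
  have hproj : IsSmooth (E.P.prod Γ.H.toMfd) X (fun q : E.P × Γ.H => E.proj q.1) :=
    E.smooth_proj.comp isSmooth_fst
  rw [pull_comp (f := fun z => ((p z, k z) : E.P × Γ.H)) isOpen_univ E.smooth_act hU hpk hz
    (mem_univ _)]
  refine (E.ω_act (p z, k z) _).trans ?_
  have e1 := pull_comp (N := E.P.prod Γ.H.toMfd) (f := fun z => ((p z, k z) : E.P × Γ.H))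
    (g := fun q : E.P × Γ.H => E.proj q.1) isOpen_univ hproj hU hpk hz (mem_univ _) A' v
  have e2 := pull_comp (N := E.P.prod Γ.H.toMfd) (f := fun z => ((p z, k z) : E.P × Γ.H))
    (g := fun q : E.P × Γ.H => q.1) isOpen_univ isSmooth_fst hU hpk hz (mem_univ _) E.ω v
  have e3 := leftMC_comp (N := E.P.prod Γ.H.toMfd) (f := fun z => ((p z, k z) : E.P × Γ.H))
    (k := fun q : E.P × Γ.H => q.2) isOpen_univ isSmooth_snd hU hpk hz (mem_univ _) v
  rw [gaugeForm]
  exact congrArg₂ (· + ·) (congrArg₂ (· + ·) (congrArg _ e2.symm) (congrArg _ e1.symm)) e3.symm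

theorem isGaugeTransf :
    IsGaugeTransf Γ (pull E.proj A) (pull E.proj A') E.anchor E.ω :=
  ⟨E.smooth_anchor, E.isForm_ω, fun p v => by rw [E.t_ω]; abel⟩

/-- If `p` and `p'` are points of bundles related by a connection-preserving morphism `f`, then the
element `h` with `f p = p' h` is a gauge 2-transformation. -/
theorem isGauge2_div {E E' : BunCon Γ X A A'} (f : Hom E E') :
    IsGauge2 Γ E.proj E'.proj A' E.anchor E.ω E'.anchor E'.ω
      (fun p p' e => E'.div (f.f p) p' ((f.proj_f p).trans e)) := by
  intro Z U z z' e hU hz hz'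
  have hfz : IsSmoothOn Z E'.P (fun x => f.f (z x)) U := f.smooth.comp_on hU hz
  have e' : ∀ x, E'.proj (f.f (z x)) = E'.proj (z' x) := fun x => (f.proj_f _).trans (e x)
  have hd := E'.isSmoothOn_div hU hfz hz' e'
  refine .of_eq hd (fun x hx => ?_) fun x hx v => ?_
  · have h1 := E'.anchor_act (z' x) (E'.div _ _ (e' x))
    rw [E'.act_div, f.anchor_f] at h1
    rw [h1, mul_inv_cancel_left]
  · have h1 := E'.pull_act hU hz' hd hx v
    simp only [E'.act_div] at h1
    have h2 : pull (fun x => f.f (z x)) E'.ω x v = pull z E.ω x v := by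
      rw [pull_comp isOpen_univ f.smooth hU hz hx (mem_univ _)]
      exact f.pull_ω _ _
    rw [← h2, h1]
    simp only [e]

theorem Hom.div_mul_div {E E' : BunCon Γ X A A'} (f : Hom E E') {p₁ p₁' : E.P} {p₂' : E'.P}
    (e : E'.proj (f.f p₁') = E'.proj p₂') (e₁ : E.proj p₁ = E.proj p₁') :
    E'.div (f.f p₁') p₂' e * E.div p₁ p₁' e₁ =
      E'.div (f.f p₁) p₂' ((f.proj_f p₁).trans (e₁.trans ((f.proj_f p₁').symm.trans e))) := by
  refine (E'.div_eq _ ?_).symm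
  rw [← E'.act_mul, E'.act_div, ← f.equivariant, E.act_div]

end BunCon

section Loc

open CategoryTheory

variable {Γ : LieTwoGroup.{u}} {X : Mfd.{u}} {D D' : GammaConnection Γ X}

/-- A bundle as local data: the bundle trivializes canonically over its total space. -/
def BunCon.loc (E : BunCon Γ X D.A D'.A) : LocalData D D' where
  Y := E.P
  π := E.proj
  submersion := E.isSubmersion_proj
  surjective := E.surjective_proj
  g := E.anchor
  φ := E.ω
  gauge := E.isGaugeTransf
  a p p' e := E.div p p' e
  gauge_a := BunCon.isGauge2_div (𝟙 E : BunCon.Hom E E)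
  cocycle _ _ _ e e' := E.div_mul_div e e'

/-- Morphisms of bundles as 2-morphisms of local data. -/
def BunCon.Hom.loc {E E' : BunCon Γ X D.A D'.A} (f : BunCon.Hom E E') :
    LocalData.Hom E.loc E'.loc where
  h p p' e := E'.div (f.f p) p' ((f.proj_f p).trans e)
  gauge := BunCon.isGauge2_div f
  comm p₁ p₁' p₂ p₂' e e₁ e₂ := by
    exact (E'.div_mul_div _ e₂).trans (f.div_mul_div _ e₁).symm

/-- The functor from bundles to local data. -/
def locFunctor (D D' : GammaConnection Γ X) : BunCon Γ X D.A D'.A ⥤ LocalData D D' where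
  obj E := E.loc
  map {E E'} f := BunCon.Hom.loc (E := E) (E' := E') f
  map_id _ := rfl
  map_comp {E E' E''} f f' := by
    refine LocalData.Hom.ext (funext fun p => funext fun p'' => funext fun e => ?_)
    refine Eq.trans ?_ (LocalData.Hom.comp_h (BunCon.Hom.loc (E := E) (E' := E') f)
      (BunCon.Hom.loc (E := E') (E' := E'') f') p (BunCon.Hom.f f p) p''
      (BunCon.Hom.proj_f f p).symm ((BunCon.Hom.proj_f f p).trans e)).symm
    refine (mul_eq_left.2 ?_).symm
    exact E'.div_eq rfl (E'.act_one _)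

end Loc

/-! ### Composition of local data -/

section Composition

variable {Γ : LieTwoGroup.{u}} {X : Mfd.{u}} {D D' D'' : GammaConnection Γ X}

/-- The interchange law. -/
theorem α_interchange (g : Γ.G) (h h' k k' : Γ.H) :
    k' * Γ.α (Γ.t h' * g) k * (h' * Γ.α g h) = k' * h' * Γ.α g (k * h) := by
  rw [map_mul, MulAut.mul_apply, Γ.α_t, map_mul]
  group

theorem IsGauge2On.congr {M : Mfd.{u}} {U : Set M} {A₁ A₂ : Fam1 M Γ.𝔤} {g₁ g₂ : M → Γ.G}
    {φ₁ φ₁' φ₂ φ₂' : Fam1 M Γ.𝔥} {h : M → Γ.H} (H : IsGauge2On Γ U A₁ g₁ φ₁ g₂ φ₂ h)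
    (eA : ∀ x ∈ U, ∀ v, A₁ x v = A₂ x v) (e₁ : ∀ x ∈ U, ∀ v, φ₁ x v = φ₁' x v)
    (e₂ : ∀ x ∈ U, ∀ v, φ₂ x v = φ₂' x v) : IsGauge2On Γ U A₂ g₁ φ₁' g₂ φ₂' h :=
  ⟨H.smooth, H.eq_g, fun x hx v => by rw [← eA x hx, ← e₁ x hx, ← e₂ x hx, H.eq_φ x hx]⟩

namespace LocalData

variable (L' : LocalData D' D'') (L : LocalData D D')

/-- The fibre product of the domains of two local data. -/
def compY : Mfd.{u} := fibreMfd L.submersion L'.submersion.1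

/-- The projection to the domain of the first factor. -/
def compP : compY L' L → L.Y := fibreFst L.submersion L'.submersion.1

/-- The projection to the domain of the second factor. -/
def compP' : compY L' L → L'.Y := fibreSnd L.submersion L'.submersion.1

theorem isSmooth_compP : IsSmooth (compY L' L) L.Y (compP L' L) := isSmooth_fibreFst _ _

theorem isSmooth_compP' : IsSmooth (compY L' L) L'.Y (compP' L' L) := isSmooth_fibreSnd _ _

theorem comp_eq (y : compY L' L) : L.π (compP L' L y) = L'.π (compP' L' L y) := fibre_eq _ _ y

/-- The 1-form `(α_{g'})_*(φ) + φ'` of a composition. -/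
def compΦ : Fam1 (compY L' L) Γ.𝔥 := fun y v =>
  Γ.αStar (L'.g (compP' L' L y)) (pull (compP L' L) L.φ y v) + pull (compP' L' L) L'.φ y v

theorem comp_gauge : IsGaugeTransf Γ (pull (fun y => L.π (compP L' L y)) D.A)
    (pull (fun y => L.π (compP L' L y)) D''.A)
    (fun y => L'.g (compP' L' L y) * L.g (compP L' L y)) (compΦ L' L) := by
  have h := isSmooth_compP L' L
  have h' := isSmooth_compP' L' L
  have H := L.gauge.pull h
  have H' := L'.gauge.pull h'
  have hfun : (fun y => L'.π (compP' L' L y)) = fun y => L.π (compP L' L y) :=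
    funext fun y => (comp_eq L' L y).symm
  refine IsGaugeTransf.comp (A' := pull (fun y => L.π (compP L' L y)) D'.A)
    (φ := pull (compP L' L) L.φ) (φ' := pull (compP' L' L) L'.φ)
    (H.congr (fun y v => ?_) fun y v => ?_) (H'.congr (fun y v => ?_) fun y v => ?_)
  · exact (pull_comp isOpen_univ L.submersion.1 isOpen_univ h (mem_univ _) (mem_univ _) _ v).symm
  · exact (pull_comp isOpen_univ L.submersion.1 isOpen_univ h (mem_univ _) (mem_univ _) _ v).symm
  · rw [← hfun]
    exact (pull_comp isOpen_univ L'.submersion.1 isOpen_univ h' (mem_univ _) (mem_univ _) _ v).symm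
  · rw [← hfun]
    exact (pull_comp isOpen_univ L'.submersion.1 isOpen_univ h' (mem_univ _) (mem_univ _) _ v).symm

/-- The horizontal composition of gauge 2-transformations. -/
theorem isGauge2_hcomp {L₁' L₂' : LocalData D' D''} {L₁ L₂ : LocalData D D'}
    {h' : ∀ (y₁ : L₁'.Y) (y₂ : L₂'.Y), L₁'.π y₁ = L₂'.π y₂ → Γ.H}
    {h : ∀ (y₁ : L₁.Y) (y₂ : L₂.Y), L₁.π y₁ = L₂.π y₂ → Γ.H}
    (H' : IsGauge2 Γ L₁'.π L₂'.π D''.A L₁'.g L₁'.φ L₂'.g L₂'.φ h')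
    (H : IsGauge2 Γ L₁.π L₂.π D'.A L₁.g L₁.φ L₂.g L₂.φ h) :
    IsGauge2 Γ (fun y => L₁.π (compP L₁' L₁ y)) (fun y => L₂.π (compP L₂' L₂ y)) D''.A
      (fun y => L₁'.g (compP' L₁' L₁ y) * L₁.g (compP L₁' L₁ y)) (compΦ L₁' L₁)
      (fun y => L₂'.g (compP' L₂' L₂ y) * L₂.g (compP L₂' L₂ y)) (compΦ L₂' L₂)
      (fun y₁ y₂ e => h' (compP' L₁' L₁ y₁) (compP' L₂' L₂ y₂)
          ((comp_eq L₁' L₁ y₁).symm.trans (e.trans (comp_eq L₂' L₂ y₂))) *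
        Γ.α (L₁'.g (compP' L₁' L₁ y₁)) (h (compP L₁' L₁ y₁) (compP L₂' L₂ y₂) e)) := by
  intro Z U z₁ z₂ e hU hz₁ hz₂
  have s₁ := (isSmooth_compP L₁' L₁).comp_on hU hz₁
  have s₂ := (isSmooth_compP L₂' L₂).comp_on hU hz₂
  have s₁' := (isSmooth_compP' L₁' L₁).comp_on hU hz₁
  have s₂' := (isSmooth_compP' L₂' L₂).comp_on hU hz₂
  have G := H Z U (fun z => compP L₁' L₁ (z₁ z)) (fun z => compP L₂' L₂ (z₂ z)) e hU s₁ s₂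
  have G' := H' Z U (fun z => compP' L₁' L₁ (z₁ z)) (fun z => compP' L₂' L₂ (z₂ z))
    (fun z => (comp_eq L₁' L₁ _).symm.trans ((e z).trans (comp_eq L₂' L₂ _))) hU s₁' s₂'
  have hfun : (fun z => L₁'.π (compP' L₁' L₁ (z₁ z))) = fun z => L₁.π (compP L₁' L₁ (z₁ z)) :=
    funext fun z => (comp_eq L₁' L₁ _).symm
  have pc : ∀ (A : Fam1 X Γ.𝔤), ∀ x ∈ U, ∀ v, pull (fun z => L₁.π (compP L₁' L₁ (z₁ z))) A x v =
      pull (fun z => compP' L₁' L₁ (z₁ z)) (pull L₁'.π A) x v := fun A x hx v => by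
    rw [← hfun]
    exact pull_comp isOpen_univ L₁'.submersion.1 hU s₁' hx (mem_univ _) A v
  have W := G.whisker_left (A'' := pull (fun z => L₁.π (compP L₁' L₁ (z₁ z))) D''.A)
    (g' := fun z => L₁'.g (compP' L₁' L₁ (z₁ z)))
    (φ' := pull (fun z => compP' L₁' L₁ (z₁ z)) L₁'.φ) hU
    (L₁'.gauge.smooth.comp_on hU s₁') fun x hx v => by
      rw [pc D''.A x hx, pc D'.A x hx,
        rightMC_comp isOpen_univ L₁'.gauge.smooth hU s₁' hx (mem_univ _)]
      exact L₁'.gauge.eq _ _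
  rw [hfun] at G'
  have W' := G'.whisker_right (fun z => L₂.g (compP L₂' L₂ (z₂ z)))
    (pull (fun z => compP L₂' L₂ (z₂ z)) L₂.φ)
  refine (W.vcomp Γ hU W').congr (fun _ _ _ => rfl) (fun x hx v => ?_) fun x hx v => ?_
  · exact congrArg₂ (· + ·) (congrArg _ (pull_comp isOpen_univ (isSmooth_compP L₁' L₁) hU hz₁ hx
      (mem_univ _) _ v)) (pull_comp isOpen_univ (isSmooth_compP' L₁' L₁) hU hz₁ hx
      (mem_univ _) _ v)
  · exact congrArg₂ (· + ·) (congrArg _ (pull_comp isOpen_univ (isSmooth_compP L₂' L₂) hU hz₂ hx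
      (mem_univ _) _ v)) (pull_comp isOpen_univ (isSmooth_compP' L₂' L₂) hU hz₂ hx
      (mem_univ _) _ v)

/-- The composition of local data. -/
def compose : LocalData D D'' where
  Y := compY L' L
  π y := L.π (compP L' L y)
  submersion := isSubmersion_fibre L.submersion L'.submersion.1 L'.submersion
  surjective x := by
    obtain ⟨y, rfl⟩ := L.surjective x
    obtain ⟨y', e⟩ := L'.surjective (L.π y)
    exact ⟨fibreMk _ _ y y' e.symm, rfl⟩
  g y := L'.g (compP' L' L y) * L.g (compP L' L y)
  φ := compΦ L' L
  gauge := comp_gauge L' L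
  a y₁ y₂ e := L'.a (compP' L' L y₁) (compP' L' L y₂)
      ((comp_eq L' L y₁).symm.trans (e.trans (comp_eq L' L y₂))) *
    Γ.α (L'.g (compP' L' L y₁)) (L.a (compP L' L y₁) (compP L' L y₂) e)
  gauge_a := isGauge2_hcomp L'.gauge_a L.gauge_a
  cocycle y y' y'' e e' := by
    have e₁ := (comp_eq L' L y).symm.trans (e.trans (comp_eq L' L y'))
    rw [L'.gauge_a.eq_g (compP' L' L y) (compP' L' L y') e₁, α_interchange, L'.cocycle, L.cocycle]

/-- The horizontal composition of 2-morphisms. -/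
def Hom.hcomp {L₁' L₂' : LocalData D' D''} {L₁ L₂ : LocalData D D'} (h' : Hom L₁' L₂')
    (h : Hom L₁ L₂) : Hom (compose L₁' L₁) (compose L₂' L₂) where
  h y₁ y₂ e := h'.h (compP' L₁' L₁ y₁) (compP' L₂' L₂ y₂)
      ((comp_eq L₁' L₁ y₁).symm.trans (e.trans (comp_eq L₂' L₂ y₂))) *
    Γ.α (L₁'.g (compP' L₁' L₁ y₁)) (h.h (compP L₁' L₁ y₁) (compP L₂' L₂ y₂) e)
  gauge := isGauge2_hcomp h'.gauge h.gauge
  comm y₁ y₁' y₂ y₂' e e₁ e₂ := by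
    have f := (comp_eq L₁' L₁ y₁).symm.trans (e.trans (comp_eq L₂' L₂ y₂))
    have f₁ := (comp_eq L₁' L₁ y₁).symm.trans (e₁.trans (comp_eq L₁' L₁ y₁'))
    have f₂ := (comp_eq L₂' L₂ y₂).symm.trans (e₂.trans (comp_eq L₂' L₂ y₂'))
    show L₂'.a (compP' L₂' L₂ y₂) (compP' L₂' L₂ y₂') f₂ *
        Γ.α (L₂'.g (compP' L₂' L₂ y₂)) (L₂.a (compP L₂' L₂ y₂) (compP L₂' L₂ y₂') e₂) *
        (h'.h (compP' L₁' L₁ y₁) (compP' L₂' L₂ y₂) f *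
          Γ.α (L₁'.g (compP' L₁' L₁ y₁)) (h.h (compP L₁' L₁ y₁) (compP L₂' L₂ y₂) e)) =
      h'.h (compP' L₁' L₁ y₁') (compP' L₂' L₂ y₂') (f₁.symm.trans (f.trans f₂)) *
        Γ.α (L₁'.g (compP' L₁' L₁ y₁'))
          (h.h (compP L₁' L₁ y₁') (compP L₂' L₂ y₂') (e₁.symm.trans (e.trans e₂))) *
        (L₁'.a (compP' L₁' L₁ y₁) (compP' L₁' L₁ y₁') f₁ *
          Γ.α (L₁'.g (compP' L₁' L₁ y₁)) (L₁.a (compP L₁' L₁ y₁) (compP L₁' L₁ y₁') e₁))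
    rw [h'.gauge.eq_g _ _ f, L₁'.gauge_a.eq_g _ _ f₁, α_interchange, α_interchange,
      h'.comm _ _ _ _ f f₁ f₂, h.comm _ _ _ _ e e₁ e₂]

end LocalData

open CategoryTheory

/-- Composition of local data as a functor. -/
def compFunctor (D D' D'' : GammaConnection Γ X) :
    LocalData D' D'' × LocalData D D' ⥤ LocalData D D'' where
  obj c := LocalData.compose c.1 c.2
  map {c c'} k := LocalData.Hom.hcomp (L₁' := c.1) (L₂' := c'.1) (L₁ := c.2) (L₂ := c'.2) k.1 k.2
  map_id _ := rfl
  map_comp {c₁ c₂ c₃} k k' := by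
    refine LocalData.Hom.ext (funext fun y₁ => funext fun y₃ => funext fun e => ?_)
    set y₂ := (LocalData.compose c₂.1 c₂.2).lift (c₁.2.π (LocalData.compP c₁.1 c₁.2 y₁))
    have e₁₂ : c₁.2.π (LocalData.compP c₁.1 c₁.2 y₁) = c₂.2.π (LocalData.compP c₂.1 c₂.2 y₂) :=
      ((LocalData.compose c₂.1 c₂.2).π_lift (c₁.2.π (LocalData.compP c₁.1 c₁.2 y₁))).symm
    have e₂₃ : c₂.2.π (LocalData.compP c₂.1 c₂.2 y₂) = c₃.2.π (LocalData.compP c₃.1 c₃.2 y₃) :=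
      e₁₂.symm.trans e
    have f₁₂ := (LocalData.comp_eq c₁.1 c₁.2 y₁).symm.trans (e₁₂.trans
      (LocalData.comp_eq c₂.1 c₂.2 y₂))
    have f₂₃ := (LocalData.comp_eq c₂.1 c₂.2 y₂).symm.trans (e₂₃.trans
      (LocalData.comp_eq c₃.1 c₃.2 y₃))
    refine Eq.trans ?_ (LocalData.Hom.comp_h
      (LocalData.Hom.hcomp (L₁' := c₁.1) (L₂' := c₂.1) (L₁ := c₁.2) (L₂ := c₂.2) k.1 k.2)
      (LocalData.Hom.hcomp (L₁' := c₂.1) (L₂' := c₃.1) (L₁ := c₂.2) (L₂ := c₃.2) k'.1 k'.2)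
      y₁ y₂ y₃ e₁₂ e₂₃).symm
    have h1 := LocalData.Hom.comp_h (L₁ := c₁.1) (L₂ := c₂.1) (L₃ := c₃.1) k.1 k'.1 _ _ _ f₁₂ f₂₃
    have h2 := LocalData.Hom.comp_h (L₁ := c₁.2) (L₂ := c₂.2) (L₃ := c₃.2) k.2 k'.2 _ _ _ e₁₂ e₂₃
    refine (congrArg₂ (fun a b => a * Γ.α (c₁.1.g (LocalData.compP' c₁.1 c₁.2 y₁)) b)
      h1 h2).trans ?_
    refine (α_interchange _ _ _ _ _).symm.trans ?_
    rw [← LocalData.Hom.gauge k.1 |>.eq_g _ _ f₁₂]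
    rfl

/-- The composition functor with its structure. -/
def compositionFunctor (D D' D'' : GammaConnection Γ X) : CompositionFunctor D D' D'' where
  functor := compFunctor D D' D''
  p c := LocalData.compP c.1 c.2
  p' c := LocalData.compP' c.1 c.2
  isFiberProduct c := isFiberProduct_fibreMfd c.2.submersion c.1.submersion.1
  π_eq _ _ := rfl
  g_eq _ _ := rfl
  φ_eq _ _ _ := rfl
  a_eq _ _ _ _ _ _ := rfl
  map_eq _ _ _ _ _ _ := rfl

end Composition

/-! ### Reconstruction of bundles from local data -/

section Reconstruction

variable {Γ : LieTwoGroup.{u}} {X : Mfd.{u}}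

/-- The 1-forms `Ad_k⁻¹(φ) + (α̃_k)_*(A') + k^*θ` are compatible with gauge 2-transformations. -/
theorem IsGauge2.gaugeForm_mul {Y₁ Y₂ : Mfd.{u}} {π₁ : Y₁ → X} {π₂ : Y₂ → X} {A' : Fam1 X Γ.𝔤}
    {g₁ : Y₁ → Γ.G} {φ₁ : Fam1 Y₁ Γ.𝔥} {g₂ : Y₂ → Γ.G} {φ₂ : Fam1 Y₂ Γ.𝔥}
    {h : ∀ (y₁ : Y₁) (y₂ : Y₂), π₁ y₁ = π₂ y₂ → Γ.H} (H : IsGauge2 Γ π₁ π₂ A' g₁ φ₁ g₂ φ₂ h)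
    {Z : Mfd.{u}} {U : Set Z} (hU : IsOpen U) {y₁ : Z → Y₁} {y₂ : Z → Y₂} {k : Z → Γ.H}
    (e : ∀ z, π₁ (y₁ z) = π₂ (y₂ z)) (h₁ : IsSmoothOn Z Y₁ y₁ U) (h₂ : IsSmoothOn Z Y₂ y₂ U)
    (hk : IsSmoothOn Z Γ.H k U) {z : Z} (hz : z ∈ U) (v : Z.T z) :
    gaugeForm (fun z => h (y₁ z) (y₂ z) (e z) * k z) (pull (fun z => π₁ (y₁ z)) A')
      (pull y₂ φ₂) z v = gaugeForm k (pull (fun z => π₁ (y₁ z)) A') (pull y₁ φ₁) z v := by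
  have G := H Z U y₁ y₂ e hU h₁ h₂
  rw [HGT.gaugeForm_mul hU G.smooth hk _ _ hz]
  exact gaugeForm_congr (Filter.EventuallyEq.refl _ _) rfl (G.eq_gaugeForm hz v).symm

/-- The underlying set of the bundle `(Y × H)/~`: every point is represented by a unique pair
`(y, val)` with `y` the chosen lift of `pt`. -/
@[ext] structure RecPt (Γ : LieTwoGroup.{u}) (X : Mfd.{u}) : Type u where
  pt : X
  val : Γ.H

namespace LocalData

variable {D D' : GammaConnection Γ X} (L : LocalData D D')

theorem a_congr {y y₁ y₂ : L.Y} (h : y₁ = y₂) (e : L.π y = L.π y₁) :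
    L.a y y₁ e = L.a y y₂ (h ▸ e) := by subst h; rfl

theorem isSmoothOn_a {Z : Mfd.{u}} {U : Set Z} (hU : IsOpen U) {y y' : Z → L.Y}
    (hy : IsSmoothOn Z L.Y y U) (hy' : IsSmoothOn Z L.Y y' U) (e : ∀ z, L.π (y z) = L.π (y' z)) :
    IsSmoothOn Z Γ.H (fun z => L.a (y z) (y' z) (e z)) U :=
  (L.gauge_a Z U y y' e hU hy hy').smooth

/-- The domain of smoothness of the section `L.sec x`. -/
def secDom (x : X) : Set X := (L.submersion.exists_global_section L.surjective x).choose

/-- A section of `π` that is smooth near `x`. -/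
def sec (x : X) : X → L.Y :=
  (L.submersion.exists_global_section L.surjective x).choose_spec.choose

theorem isOpen_secDom (x : X) : IsOpen (L.secDom x) :=
  (L.submersion.exists_global_section L.surjective x).choose_spec.choose_spec.1

theorem mem_secDom (x : X) : x ∈ L.secDom x :=
  (L.submersion.exists_global_section L.surjective x).choose_spec.choose_spec.2.1

theorem isSmoothOn_sec (x : X) : IsSmoothOn X L.Y (L.sec x) (L.secDom x) :=
  (L.submersion.exists_global_section L.surjective x).choose_spec.choose_spec.2.2.1

theorem π_sec (x x' : X) : L.π (L.sec x x') = x' :=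
  (L.submersion.exists_global_section L.surjective x).choose_spec.choose_spec.2.2.2 x'

/-- The element `k` for which `(y, k)` represents the given point of the bundle. -/
def recDiv (p : RecPt Γ X) (y : L.Y) (e : L.π y = p.pt) : Γ.H :=
  L.a (L.lift p.pt) y ((L.π_lift _).trans e.symm) * p.val

/-- The projection `Y × H → (Y × H)/~`. -/
def recMk (y : L.Y) (k : Γ.H) : RecPt Γ X :=
  ⟨L.π y, L.a y (L.lift (L.π y)) (L.π_lift _).symm * k⟩

theorem a_mul_a_mul {y y' y'' : L.Y} (e : L.π y = L.π y') (e' : L.π y' = L.π y'') (k : Γ.H) :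
    L.a y' y'' e' * (L.a y y' e * k) = L.a y y'' (e.trans e') * k := by
  rw [← mul_assoc, L.cocycle]

theorem recDiv_recMk (y y' : L.Y) (k : Γ.H) (e : L.π y' = L.π y) :
    L.recDiv (L.recMk y k) y' e = L.a y y' e.symm * k :=
  L.a_mul_a_mul _ _ k

theorem recMk_recDiv (p : RecPt Γ X) (y : L.Y) (e : L.π y = p.pt) :
    L.recMk y (L.recDiv p y e) = p := by
  refine RecPt.ext e ?_
  show L.a y (L.lift (L.π y)) _ * (L.a (L.lift p.pt) y _ * p.val) = p.val
  rw [L.a_mul_a_mul, L.a_congr (congrArg L.lift e), L.a_self, one_mul]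

theorem recMk_eq_iff (y₁ y₂ : L.Y) (k₁ k₂ : Γ.H) : L.recMk y₁ k₁ = L.recMk y₂ k₂ ↔
    ∃ e : L.π y₁ = L.π y₂, k₂ = L.a y₁ y₂ e * k₁ := by
  constructor
  · intro h
    have e : L.π y₁ = L.π y₂ := congrArg RecPt.pt h
    refine ⟨e, ?_⟩
    have h1 := L.recDiv_recMk y₁ y₂ k₁ e.symm
    have h2 := L.recDiv_recMk y₂ y₂ k₂ rfl
    rw [L.a_self, one_mul] at h2
    rw [← h1, ← h2]
    simp only [h]
  · rintro ⟨e, rfl⟩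
    refine RecPt.ext e ?_
    show L.a y₁ (L.lift (L.π y₁)) _ * k₁ = L.a y₂ (L.lift (L.π y₂)) _ * (L.a y₁ y₂ e * k₁)
    rw [L.a_mul_a_mul, L.a_congr (congrArg L.lift e)]

/-- The local trivialization of the bundle given by a section of `π`. -/
def recChart (i : X) : PartialEquiv (RecPt Γ X) (X.prod Γ.H.toMfd) where
  toFun p := (p.pt, L.recDiv p (L.sec i p.pt) (L.π_sec i p.pt))
  invFun q := L.recMk (L.sec i q.1) q.2
  source := {p | p.pt ∈ L.secDom i}
  target := L.secDom i ×ˢ univ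
  map_source' p hp := ⟨hp, mem_univ _⟩
  map_target' q hq := by
    show L.π (L.sec i q.1) ∈ L.secDom i
    rw [L.π_sec]
    exact hq.1
  left_inv' p _ := L.recMk_recDiv p (L.sec i p.pt) (L.π_sec i p.pt)
  right_inv' q _ := by
    have e : (L.recMk (L.sec i q.1) q.2).pt = q.1 := L.π_sec i q.1
    refine Prod.ext e ?_
    refine (L.recDiv_recMk (L.sec i q.1) (L.sec i (L.π (L.sec i q.1))) q.2 (L.π_sec _ _)).trans ?_
    rw [L.a_congr (congrArg (L.sec i) (L.π_sec i q.1)), L.a_self, one_mul]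

theorem recChart_overlap (i j : X) : (L.recChart i).target ∩
    (L.recChart i).symm ⁻¹' (L.recChart j).source = (L.secDom i ∩ L.secDom j) ×ˢ univ := by
  ext q
  refine ⟨fun h => ⟨⟨h.1.1, ?_⟩, mem_univ _⟩, fun h => ⟨⟨h.1.1, mem_univ _⟩, ?_⟩⟩
  · have h2 : L.π (L.sec i q.1) ∈ L.secDom j := h.2
    rwa [L.π_sec] at h2
  · show L.π (L.sec i q.1) ∈ L.secDom j
    rw [L.π_sec]
    exact h.1.2

/-- The bundle as a glued manifold. -/
def recGlue : GlueData (RecPt Γ X) where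
  I := X
  N _ := X.prod Γ.H.toMfd
  e := L.recChart
  idx p := p.pt
  mem p := L.mem_secDom p.pt
  isOpen_overlap i j := by
    rw [L.recChart_overlap]
    exact ((L.isOpen_secDom i).inter (L.isOpen_secDom j)).prod isOpen_univ
  smooth i j := by
    have hO : IsOpen ((L.secDom i ∩ L.secDom j) ×ˢ (univ : Set Γ.H)) :=
      ((L.isOpen_secDom i).inter (L.isOpen_secDom j)).prod isOpen_univ
    have h1 : IsSmoothOn (X.prod Γ.H.toMfd) L.Y (fun q => L.sec i q.1)
        ((L.secDom i ∩ L.secDom j) ×ˢ (univ : Set Γ.H)) :=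
      (L.isSmoothOn_sec i).comp (L.isOpen_secDom i) hO (isSmooth_fst.on _) fun q hq => hq.1.1
    have h2 : IsSmoothOn (X.prod Γ.H.toMfd) L.Y (fun q => L.sec j q.1)
        ((L.secDom i ∩ L.secDom j) ×ˢ (univ : Set Γ.H)) :=
      (L.isSmoothOn_sec j).comp (L.isOpen_secDom j) hO (isSmooth_fst.on _) fun q hq => hq.1.2
    have h3 := (isSmooth_fst.on _).prodMk hO (isSmoothOn_mul hO (L.isSmoothOn_a hO h1 h2
      fun q => (L.π_sec i q.1).trans (L.π_sec j q.1).symm) (isSmooth_snd.on _))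
    rw [L.recChart_overlap]
    refine h3.congr hO fun q _ => ?_
    refine Prod.ext (L.π_sec i q.1).symm (Eq.trans ?_ (L.recDiv_recMk (L.sec i q.1)
      (L.sec j (L.π (L.sec i q.1))) q.2 (L.π_sec _ _)).symm)
    rw [L.a_congr (congrArg (L.sec j) (L.π_sec i q.1))]
  base := X
  pr p := p.pt
  continuousOn_pr i := continuousOn_fst.congr fun q _ => L.π_sec i q.1
  sep p p' h := ⟨p.pt, L.mem_secDom p.pt, by
    show p'.pt ∈ L.secDom p.pt
    rw [← h]
    exact L.mem_secDom p.pt⟩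

/-- The total space of the reconstructed bundle. -/
def recMfd : Mfd.{u} := L.recGlue.mfd

/-- The projection of the reconstructed bundle. -/
def recProj (p : L.recMfd) : X := RecPt.pt (Γ := Γ) p

/-- The projection `Y × H → (Y × H)/~` as a map of manifolds. -/
def recQ (z : L.Y × Γ.H) : L.recMfd := L.recMk z.1 z.2

/-- The element `k` for which `(y, k)` represents `p`. -/
def recD (p : L.recMfd) (y : L.Y) (e : L.π y = L.recProj p) : Γ.H := L.recDiv p y e

theorem recProj_recQ (z : L.Y × Γ.H) : L.recProj (L.recQ z) = L.π z.1 := rfl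

theorem recQ_recD (p : L.recMfd) (y : L.Y) (e : L.π y = L.recProj p) :
    L.recQ (y, L.recD p y e) = p := L.recMk_recDiv p y e

theorem recD_recQ (y y' : L.Y) (k : Γ.H) (e : L.π y' = L.π y) :
    L.recD (L.recQ (y, k)) y' e = L.a y y' e.symm * k := L.recDiv_recMk y y' k e

theorem recQ_eq_iff (y₁ y₂ : L.Y) (k₁ k₂ : Γ.H) : L.recQ (y₁, k₁) = L.recQ (y₂, k₂) ↔
    ∃ e : L.π y₁ = L.π y₂, k₂ = L.a y₁ y₂ e * k₁ := L.recMk_eq_iff y₁ y₂ k₁ k₂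

theorem surjective_recQ : Function.Surjective L.recQ := fun p =>
  ⟨_, L.recQ_recD p (L.lift (L.recProj p)) (L.π_lift _)⟩

theorem isSmooth_recProj : IsSmooth L.recMfd X L.recProj :=
  L.recGlue.isSmooth_of_piece fun _ => ⟨Prod.fst, isSmooth_fst.on _, fun _ _ => rfl⟩

theorem isSmooth_recQ : IsSmooth (L.Y.prod Γ.H.toMfd) L.recMfd L.recQ := by
  refine IsSmoothOn.of_local fun z _ => ?_
  have hπ : IsSmooth (L.Y.prod Γ.H.toMfd) X (fun z : L.Y × Γ.H => L.π z.1) :=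
    L.submersion.1.comp isSmooth_fst
  have hO : IsOpen ((fun z : L.Y × Γ.H => L.π z.1) ⁻¹' L.secDom (L.π z.1)) :=
    (L.isOpen_secDom _).preimage hπ.continuous
  refine ⟨_, hO, L.mem_secDom _, L.recGlue.isSmoothOn_of_piece hO (L.π z.1) (fun z' hz' => hz') ?_⟩
  have h1 : IsSmoothOn (L.Y.prod Γ.H.toMfd) L.Y (fun z' => L.sec (L.π z.1) (L.π z'.1))
      ((fun z : L.Y × Γ.H => L.π z.1) ⁻¹' L.secDom (L.π z.1)) :=
    (L.isSmoothOn_sec _).comp (L.isOpen_secDom _) hO (hπ.on _) fun z' hz' => hz'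
  refine ((hπ.on _).prodMk hO (isSmoothOn_mul hO (L.isSmoothOn_a hO (isSmooth_fst.on _) h1
    fun z' => (L.π_sec _ _).symm) (isSmooth_snd.on _))).congr hO fun z' hz' => ?_
  exact Prod.ext rfl (L.recD_recQ _ _ _ (L.π_sec _ _)).symm

theorem isSmoothOn_recQ {Z : Mfd.{u}} {U : Set Z} (hU : IsOpen U) {y : Z → L.Y} {k : Z → Γ.H}
    (hy : IsSmoothOn Z L.Y y U) (hk : IsSmoothOn Z Γ.H k U) :
    IsSmoothOn Z L.recMfd (fun z => L.recQ (y z, k z)) U :=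
  L.isSmooth_recQ.comp_on hU (hy.prodMk hU hk)

theorem isSmoothOn_recD {Z : Mfd.{u}} {U : Set Z} (hU : IsOpen U) {p : Z → L.recMfd}
    {y : Z → L.Y} (hp : IsSmoothOn Z L.recMfd p U) (hy : IsSmoothOn Z L.Y y U)
    (e : ∀ z, L.π (y z) = L.recProj (p z)) :
    IsSmoothOn Z Γ.H (fun z => L.recD (p z) (y z) (e z)) U := by
  refine IsSmoothOn.of_local fun z hz => ?_
  set i := L.recProj (p z) with hi
  have hpr := L.isSmooth_recProj.comp_on hU hp
  have hO := hpr.1.isOpen_inter_preimage hU (L.isOpen_secDom i)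
  have h1 : IsSmoothOn Z Γ.H (fun z => (L.recGlue.piece i (p z)).2)
      (U ∩ (fun z => L.recProj (p z)) ⁻¹' L.secDom i) :=
    ((isSmooth_snd (M := X) (N := Γ.H.toMfd)).comp_on (L.recGlue.piece i).open_source
      (L.recGlue.isSmoothOn_piece i)).comp (L.recGlue.piece i).open_source hO
      (hp.mono inter_subset_left) fun z hz => hz.2
  have h2 : IsSmoothOn Z L.Y (fun z => L.sec i (L.recProj (p z)))
      (U ∩ (fun z => L.recProj (p z)) ⁻¹' L.secDom i) :=
    (L.isSmoothOn_sec i).comp (L.isOpen_secDom i) hO (hpr.mono inter_subset_left) fun z hz => hz.2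
  refine ⟨_, hO, ⟨hz, L.mem_secDom i⟩, (isSmoothOn_mul hO (L.isSmoothOn_a hO h2
    (hy.mono inter_subset_left) fun z => (L.π_sec _ _).trans (e z).symm) h1).congr hO
    fun z hz => ?_⟩
  exact L.a_mul_a_mul _ _ _

theorem isSubmersion_recQ : IsSubmersion (L.Y.prod Γ.H.toMfd) L.recMfd L.recQ := by
  refine IsSubmersion.of_local L.isSmooth_recQ fun z => ?_
  obtain ⟨F, ψ, hy, hψ, hψs, hpr⟩ := L.submersion.2 z.1
  have hpt : ∀ q ∈ ψ.target, L.π (ψ.symm q) = q.1 := fun q hq => by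
    rw [← hpr _ (ψ.map_target hq), ψ.right_inv hq]
  have hψ1 : ∀ y ∈ ψ.source, ((L.π y, (ψ y).2) : X × F) = ψ y := fun y h =>
    Prod.ext (hpr y h).symm rfl
  have hc : IsSmooth (L.recMfd.prod (Mfd.ofFrechet F)) (X.prod (Mfd.ofFrechet F))
      (fun c => (L.recProj c.1, c.2)) := (L.isSmooth_recProj.comp isSmooth_fst).prodMk isSmooth_snd
  have hO : IsOpen (Prod.fst ⁻¹' ψ.source : Set (L.Y × Γ.H)) :=
    ψ.open_source.preimage continuous_fst
  set O' : Set (L.recMfd.prod (Mfd.ofFrechet F)) :=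
    (fun c => ((L.recProj c.1, c.2) : X × F)) ⁻¹' ψ.target
  have hO' : IsOpen O' := ψ.open_target.preimage hc.continuous
  classical
  set y : L.recMfd × F → L.Y := fun c => if c ∈ O' then ψ.symm (L.recProj c.1, c.2) else
    L.lift (L.recProj c.1) with hydef
  have hy1 : ∀ c ∈ O', y c = ψ.symm (L.recProj c.1, c.2) := fun c hc => if_pos hc
  have hy2 : ∀ c, L.π (y c) = L.recProj c.1 := fun c => by
    by_cases h : c ∈ O'
    · rw [hy1 c h]; exact hpt _ h
    · rw [show y c = L.lift (L.recProj c.1) from if_neg h, L.π_lift]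
  have hys : IsSmoothOn (L.recMfd.prod (Mfd.ofFrechet F)) L.Y y O' :=
    (hψs.comp ψ.open_target hO' (hc.on _) fun c hc => hc).congr hO' fun c hc => (hy1 c hc).symm
  refine ⟨Mfd.ofFrechet F, Prod.fst ⁻¹' ψ.source, O', fun z => (ψ z.1).2,
    fun c => (y c, L.recD c.1 (y c) (hy2 c)), hO, hO', hy, ?_, ?_, ?_, ?_, ?_, ?_⟩
  · exact ((isSmooth_snd (M := X) (N := Mfd.ofFrechet F)).comp_on ψ.open_source hψ).comp
      ψ.open_source hO (isSmooth_fst.on _) fun z hz => hz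
  · exact hys.prodMk hO' (L.isSmoothOn_recD hO' (isSmooth_fst.on _) hys hy2)
  · intro z' hz'
    show ((L.π z'.1, (ψ z'.1).2) : X × F) ∈ ψ.target
    rw [hψ1 _ hz']
    exact ψ.map_source hz'
  · intro c hc
    show y c ∈ ψ.source
    rw [hy1 c hc]
    exact ψ.map_target hc
  · intro z' hz'
    have hm : ((L.recQ z', (ψ z'.1).2) : L.recMfd × F) ∈ O' := by
      show ((L.π z'.1, (ψ z'.1).2) : X × F) ∈ ψ.target
      rw [hψ1 _ hz']
      exact ψ.map_source hz'
    have h1 : y (L.recQ z', (ψ z'.1).2) = z'.1 := by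
      rw [hy1 _ hm, L.recProj_recQ, hψ1 _ hz', ψ.left_inv hz']
    refine Prod.ext h1 ?_
    refine (L.recD_recQ z'.1 (y (L.recQ z', (ψ z'.1).2)) z'.2 (hy2 _)).trans ?_
    rw [L.a_congr h1, L.a_self, one_mul]
  · intro c hc
    refine ⟨L.recQ_recD _ _ _, ?_⟩
    show (ψ (y c)).2 = c.2
    rw [hy1 c hc, ψ.right_inv hc]

/-- The action of the structure group on the reconstructed bundle. -/
def recAct (p : L.recMfd) (h : Γ.H) : L.recMfd :=
  RecPt.mk (RecPt.pt (Γ := Γ) p) (RecPt.val (X := X) p * h)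

theorem recAct_recQ (y : L.Y) (k h : Γ.H) : L.recAct (L.recQ (y, k)) h = L.recQ (y, k * h) :=
  RecPt.ext rfl (mul_assoc _ _ _)

/-- The anchor of the reconstructed bundle. -/
def recAnchor (p : L.recMfd) : Γ.G :=
  (Γ.t (RecPt.val (X := X) p))⁻¹ * L.g (L.lift (L.recProj p))

theorem recAnchor_recQ (y : L.Y) (k : Γ.H) :
    L.recAnchor (L.recQ (y, k)) = (Γ.t k)⁻¹ * L.g y := by
  have e : L.π y = L.π (L.lift (L.π y)) := (L.π_lift _).symm
  show (Γ.t (L.a y (L.lift (L.π y)) e * k))⁻¹ * L.g (L.lift (L.π y)) = (Γ.t k)⁻¹ * L.g y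
  rw [L.gauge_a.eq_g y (L.lift (L.π y)) e, map_mul]
  group

/-- The 1-form on `Y × H` that descends to the connection of the reconstructed bundle. -/
def recForm : Fam1 (L.Y.prod Γ.H.toMfd) Γ.𝔥 :=
  gaugeForm (M := L.Y.prod Γ.H.toMfd) (fun z : L.Y × Γ.H => z.2)
    (pull (M := L.Y.prod Γ.H.toMfd) (fun z : L.Y × Γ.H => L.π z.1) D'.A)
    (pull (M := L.Y.prod Γ.H.toMfd) (fun z : L.Y × Γ.H => z.1) L.φ)

theorem isSmooth_π_fst : IsSmooth (L.Y.prod Γ.H.toMfd) X (fun z : L.Y × Γ.H => L.π z.1) :=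
  L.submersion.1.comp isSmooth_fst

theorem isForm1_recForm : IsForm1 (L.Y.prod Γ.H.toMfd) Γ.𝔥 L.recForm :=
  isForm1_gaugeForm isSmooth_snd (isForm1_pull L.isSmooth_π_fst D'.isForm_A)
    (isForm1_pull isSmooth_fst L.gauge.isForm)

theorem pull_recForm {Z : Mfd.{u}} {U : Set Z} (hU : IsOpen U) {y : Z → L.Y} {k : Z → Γ.H}
    (hy : IsSmoothOn Z L.Y y U) (hk : IsSmoothOn Z Γ.H k U) {z : Z} (hz : z ∈ U) (v : Z.T z) :
    pull (N := L.Y.prod Γ.H.toMfd) (fun z => (y z, k z)) L.recForm z v =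
      gaugeForm k (pull (fun z => L.π (y z)) D'.A) (pull y L.φ) z v := by
  have hyk := hy.prodMk hU hk
  have h1 := pull_gaugeForm (N := L.Y.prod Γ.H.toMfd) (h := fun z : L.Y × Γ.H => z.2)
    (f := fun z => ((y z, k z) : L.Y × Γ.H)) isOpen_univ isSmooth_snd hU hyk hz (mem_univ _)
    (pull (M := L.Y.prod Γ.H.toMfd) (fun z : L.Y × Γ.H => L.π z.1) D'.A)
    (pull (M := L.Y.prod Γ.H.toMfd) (fun z : L.Y × Γ.H => z.1) L.φ) v
  refine h1.trans (gaugeForm_congr (Filter.EventuallyEq.refl _ _) ?_ ?_)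
  · exact (pull_comp (N := L.Y.prod Γ.H.toMfd) (f := fun z => ((y z, k z) : L.Y × Γ.H))
      (g := fun z : L.Y × Γ.H => L.π z.1) isOpen_univ L.isSmooth_π_fst hU hyk hz (mem_univ _)
      D'.A v).symm
  · exact (pull_comp (N := L.Y.prod Γ.H.toMfd) (f := fun z => ((y z, k z) : L.Y × Γ.H))
      (g := fun z : L.Y × Γ.H => z.1) isOpen_univ isSmooth_fst hU hyk hz (mem_univ _)
      L.φ v).symm

/-- The form `recForm` on `Y × H` descends to the bundle: two lifts of a map into the bundle differ
by the gauge 2-transformation `a`, hence give the same pullback. -/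
theorem exists_recω : ∃ ω : Fam1 L.recMfd Γ.𝔥, IsForm1 L.recMfd Γ.𝔥 ω ∧
    ∀ z v, pull L.recQ ω z v = L.recForm z v := by
  refine L.isSubmersion_recQ.exists_form L.surjective_recQ L.isForm1_recForm
    fun W U z₁ z₂ hU h₁ h₂ e w hw v => ?_
  have s₁ := (isSmooth_fst (M := L.Y) (N := Γ.H.toMfd)).comp_on hU h₁
  have s₁' := (isSmooth_snd (M := L.Y) (N := Γ.H.toMfd)).comp_on hU h₁
  have s₂ := (isSmooth_fst (M := L.Y) (N := Γ.H.toMfd)).comp_on hU h₂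
  have s₂' := (isSmooth_snd (M := L.Y) (N := Γ.H.toMfd)).comp_on hU h₂
  have e' : ∀ w, ∃ e : L.π (z₁ w).1 = L.π (z₂ w).1, (z₂ w).2 = L.a _ _ e * (z₁ w).2 := fun w =>
    (L.recQ_eq_iff _ _ _ _).1 (e w)
  refine (L.pull_recForm hU s₁ s₁' hw v).trans (Eq.trans ?_ (L.pull_recForm hU s₂ s₂' hw v).symm)
  refine (L.gauge_a.gaugeForm_mul hU (fun w => (e' w).choose) s₁ s₂ s₁' hw v).symm.trans ?_
  have hfun : (fun w => L.π (z₁ w).1) = fun w => L.π (z₂ w).1 := funext fun w => (e' w).choose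
  refine gaugeForm_congr (Filter.Eventually.of_forall fun w => (e' w).choose_spec.symm) ?_ rfl
  rw [hfun]

/-- The connection of the reconstructed bundle. -/
def recω : Fam1 L.recMfd Γ.𝔥 := L.exists_recω.choose

theorem isForm1_recω : IsForm1 L.recMfd Γ.𝔥 L.recω := L.exists_recω.choose_spec.1

theorem pull_recω (z : L.Y × Γ.H) (v : (L.Y.prod Γ.H.toMfd).T z) :
    pull (M := L.Y.prod Γ.H.toMfd) L.recQ L.recω z v = L.recForm z v :=
  L.exists_recω.choose_spec.2 z v

theorem pull_recQ_recω {Z : Mfd.{u}} {U : Set Z} (hU : IsOpen U) {y : Z → L.Y} {k : Z → Γ.H}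
    (hy : IsSmoothOn Z L.Y y U) (hk : IsSmoothOn Z Γ.H k U) {z : Z} (hz : z ∈ U) (v : Z.T z) :
    pull (fun z => L.recQ (y z, k z)) L.recω z v =
      gaugeForm k (pull (fun z => L.π (y z)) D'.A) (pull y L.φ) z v := by
  rw [pull_comp (N := L.Y.prod Γ.H.toMfd) (f := fun z => ((y z, k z) : L.Y × Γ.H)) isOpen_univ
    L.isSmooth_recQ hU (hy.prodMk hU hk) hz (mem_univ _), ← L.pull_recForm hU hy hk hz]
  exact L.pull_recω _ _

end LocalData

end Reconstruction

/-! ### The reconstruction functor -/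

section ReconstructionFunctor

variable {Γ : LieTwoGroup.{u}} {X : Mfd.{u}}

namespace LocalData

variable {D D' : GammaConnection Γ X} (L : LocalData D D')

theorem recAct_eq (p : L.recMfd) (h : Γ.H) (y : L.Y) (e : L.π y = L.recProj p) :
    L.recAct p h = L.recQ (y, L.recD p y e * h) := by
  rw [← L.recAct_recQ, L.recQ_recD]

theorem isSmooth_recAct :
    IsSmooth (L.recMfd.prod Γ.H.toMfd) L.recMfd (fun q => L.recAct q.1 q.2) := by
  refine IsSmoothOn.of_local fun q _ => ?_
  set i := L.recProj q.1
  have hpr : IsSmooth (L.recMfd.prod Γ.H.toMfd) X (fun q => L.recProj q.1) :=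
    L.isSmooth_recProj.comp isSmooth_fst
  have hO : IsOpen ((fun q : L.recMfd × Γ.H => L.recProj q.1) ⁻¹' L.secDom i) :=
    (L.isOpen_secDom i).preimage hpr.continuous
  have hs : IsSmoothOn (L.recMfd.prod Γ.H.toMfd) L.Y (fun q => L.sec i (L.recProj q.1))
      ((fun q : L.recMfd × Γ.H => L.recProj q.1) ⁻¹' L.secDom i) :=
    (L.isSmoothOn_sec i).comp (L.isOpen_secDom i) hO (hpr.on _) fun q hq => hq
  refine ⟨_, hO, L.mem_secDom i, (L.isSmoothOn_recQ hO hs (isSmoothOn_mul hO (L.isSmoothOn_recD hO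
    (isSmooth_fst.on _) hs fun q => L.π_sec i _) (isSmooth_snd.on _))).congr hO fun q _ => ?_⟩
  exact (L.recAct_eq _ _ _ _).symm

theorem isSmooth_recAnchor : IsSmooth L.recMfd Γ.G L.recAnchor := by
  refine L.isSubmersion_recQ.isSmooth_of_comp L.surjective_recQ ?_
  have h : IsSmooth (L.Y.prod Γ.H.toMfd) Γ.G (fun z : L.Y × Γ.H => (Γ.t z.2)⁻¹ * L.g z.1) :=
    isSmoothOn_mul isOpen_univ (isSmoothOn_inv isOpen_univ (Γ.smooth_t.comp isSmooth_snd))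
      (L.gauge.smooth.comp isSmooth_fst)
  exact IsSmoothOn.congr isOpen_univ h fun z _ => (L.recAnchor_recQ z.1 z.2).symm

theorem recAnchor_recAct (p : L.recMfd) (h : Γ.H) :
    L.recAnchor (L.recAct p h) = (Γ.t h)⁻¹ * L.recAnchor p := by
  obtain ⟨⟨y, k⟩, rfl⟩ := L.surjective_recQ p
  rw [L.recAct_recQ, L.recAnchor_recQ, L.recAnchor_recQ, map_mul, mul_inv_rev, mul_assoc]

theorem recω_act (q : L.recMfd × Γ.H) (v : (L.recMfd.prod Γ.H.toMfd).T q) :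
    pull (M := L.recMfd.prod Γ.H.toMfd) (fun q : L.recMfd × Γ.H => L.recAct q.1 q.2) L.recω q v =
      gaugeForm (M := L.recMfd.prod Γ.H.toMfd) (fun q : L.recMfd × Γ.H => q.2)
        (pull (M := L.recMfd.prod Γ.H.toMfd) (fun q : L.recMfd × Γ.H => L.recProj q.1) D'.A)
        (pull (M := L.recMfd.prod Γ.H.toMfd) (fun q : L.recMfd × Γ.H => q.1) L.recω) q v := by
  set i := L.recProj q.1 with hi
  have hpr : IsSmooth (L.recMfd.prod Γ.H.toMfd) X (fun q => L.recProj q.1) :=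
    L.isSmooth_recProj.comp isSmooth_fst
  have hO : IsOpen ((fun q : L.recMfd × Γ.H => L.recProj q.1) ⁻¹' L.secDom i) :=
    (L.isOpen_secDom i).preimage hpr.continuous
  have hs : IsSmoothOn (L.recMfd.prod Γ.H.toMfd) L.Y (fun q => L.sec i (L.recProj q.1))
      ((fun q : L.recMfd × Γ.H => L.recProj q.1) ⁻¹' L.secDom i) :=
    (L.isSmoothOn_sec i).comp (L.isOpen_secDom i) hO (hpr.on _) fun q hq => hq
  have hd := L.isSmoothOn_recD (Z := L.recMfd.prod Γ.H.toMfd) (p := fun q => q.1) hO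
    (isSmooth_fst.on _) hs fun q => L.π_sec i _
  have hk : IsSmoothOn (L.recMfd.prod Γ.H.toMfd) Γ.H (fun q => q.2)
    ((fun q : L.recMfd × Γ.H => L.recProj q.1) ⁻¹' L.secDom i) := isSmooth_snd.on _
  have hq : q ∈ (fun q : L.recMfd × Γ.H => L.recProj q.1) ⁻¹' L.secDom i := L.mem_secDom i
  have hfun : (fun q : L.recMfd × Γ.H => L.π (L.sec i (L.recProj q.1))) =
      fun q => L.recProj q.1 := funext fun q => L.π_sec i _
  have h1 := L.pull_recQ_recω hO hs (isSmoothOn_mul hO hd hk) hq v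
  have h2 := L.pull_recQ_recω hO hs hd hq v
  simp only [← L.recAct_eq, L.recQ_recD, hfun] at h1 h2
  rw [h1, gaugeForm_mul hO hd hk _ _ hq]
  exact gaugeForm_congr (Filter.EventuallyEq.refl _ _) rfl h2.symm

theorem t_recω (p : L.recMfd) (v : L.recMfd.T p) : Γ.tStar (L.recω p v) =
    Γ.G.Ad (L.recAnchor p) (pull L.recProj D.A p v) - pull L.recProj D'.A p v -
      Γ.G.rightMC L.recAnchor p v := by
  refine L.isSubmersion_recQ.pull_injective L.surjective_recQ
    (ω := fun p v => Γ.tStar (L.recω p v)) (η := fun p v =>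
      Γ.G.Ad (L.recAnchor p) (pull L.recProj D.A p v) - pull L.recProj D'.A p v -
      Γ.G.rightMC L.recAnchor p v) (fun z v => ?_) p v
  have hπ := L.isSmooth_π_fst
  have H0 := L.gauge.pull (M := L.Y.prod Γ.H.toMfd) (f := fun z : L.Y × Γ.H => z.1) isSmooth_fst
  have pc : ∀ A : Fam1 X Γ.𝔤, ∀ (z : L.Y × Γ.H) (v : (L.Y.prod Γ.H.toMfd).T z),
      pull (M := L.Y.prod Γ.H.toMfd) (fun z : L.Y × Γ.H => z.1) (pull L.π A) z v =
      pull (M := L.Y.prod Γ.H.toMfd) (fun z : L.Y × Γ.H => L.π z.1) A z v := fun A z v =>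
    (pull_comp (M := L.Y.prod Γ.H.toMfd) (f := fun z : L.Y × Γ.H => z.1) isOpen_univ
      L.submersion.1 isOpen_univ isSmooth_fst (mem_univ _) (mem_univ _) A v).symm
  have H1 := H0.congr (pc D.A) (pc D'.A)
  have H2 := H1.gauge2 (isForm1_pull hπ D'.isForm_A) (h := fun z : L.Y × Γ.H => z.2) isSmooth_snd
  have e := H2.eq z v
  have pq : ∀ A : Fam1 X Γ.𝔤, pull (M := L.Y.prod Γ.H.toMfd) (fun z : L.Y × Γ.H => L.π z.1) A z v =
      pull L.recQ (pull L.recProj A) z v := fun A =>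
    pull_comp (M := L.Y.prod Γ.H.toMfd) (f := L.recQ) isOpen_univ L.isSmooth_recProj isOpen_univ
      L.isSmooth_recQ (mem_univ z) (mem_univ _) A v
  have hfun : (fun z : L.Y × Γ.H => (Γ.t z.2)⁻¹ * L.g z.1) = fun z => L.recAnchor (L.recQ z) :=
    funext fun z => (L.recAnchor_recQ z.1 z.2).symm
  have eR : Γ.G.rightMC (M := L.Y.prod Γ.H.toMfd)
      (fun z : L.Y × Γ.H => (Γ.t z.2)⁻¹ * L.g z.1) z v =
      pull L.recQ (Γ.G.rightMC L.recAnchor) z v := by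
    rw [hfun]
    exact rightMC_comp (M := L.Y.prod Γ.H.toMfd) (f := L.recQ) isOpen_univ L.isSmooth_recAnchor
      isOpen_univ L.isSmooth_recQ (mem_univ z) (mem_univ _) v
  rw [pq, pq, eR, show (Γ.t z.2)⁻¹ * L.g z.1 = L.recAnchor (L.recQ z) from congrFun hfun z] at e
  have e0 : Γ.tStar (pull L.recQ L.recω z v) = Γ.tStar (L.recForm z v) :=
    congrArg _ (L.pull_recω z v)
  exact e0.trans ((eq_sub_of_add_eq' e).trans (sub_right_comm _ _ _))

/-- The reconstructed bundle. -/
def reconstruct : BunCon Γ X D.A D'.A where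
  P := L.recMfd
  proj := L.recProj
  smooth_proj := L.isSmooth_recProj
  act := L.recAct
  smooth_act := L.isSmooth_recAct
  act_one _ := RecPt.ext rfl (mul_one _)
  act_mul _ _ _ := RecPt.ext rfl (mul_assoc _ _ _)
  proj_act _ _ := rfl
  locally_trivial x := ⟨L.secDom x, L.recGlue.piece x, L.isOpen_secDom x, L.mem_secDom x, rfl, rfl,
    L.recGlue.isSmoothOn_piece x, L.recGlue.isSmoothOn_piece_symm x, fun _ _ => ⟨rfl, fun _ =>
      Prod.ext rfl (mul_assoc _ _ _).symm⟩⟩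
  anchor := L.recAnchor
  smooth_anchor := L.isSmooth_recAnchor
  anchor_act := L.recAnchor_recAct
  ω := L.recω
  isForm_ω := L.isForm1_recω
  ω_act := L.recω_act
  t_ω := L.t_recω

variable {L} {L₁ L₂ L₃ : LocalData D D'}

/-- The map of bundles `(y₁, k) ↦ (y₂, h(y₁, y₂) k)`. -/
def Hom.recMap (h : Hom L₁ L₂) (p : L₁.recMfd) : L₂.recMfd :=
  L₂.recQ (L₂.lift (L₁.recProj p), h.h (L₁.lift (L₁.recProj p)) (L₂.lift (L₁.recProj p))
    ((L₁.π_lift _).trans (L₂.π_lift _).symm) * RecPt.val (X := X) p)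

theorem Hom.recMap_recQ (h : Hom L₁ L₂) (y₁ : L₁.Y) (y₂ : L₂.Y) (e : L₁.π y₁ = L₂.π y₂)
    (k : Γ.H) : h.recMap (L₁.recQ (y₁, k)) = L₂.recQ (y₂, h.h y₁ y₂ e * k) := by
  refine (L₂.recQ_eq_iff _ _ _ _).2 ⟨(L₂.π_lift _).trans e, ?_⟩
  have f : L₁.π y₁ = L₁.π (L₁.lift (L₁.π y₁)) := (L₁.π_lift _).symm
  have f' : L₂.π y₂ = L₂.π (L₂.lift (L₁.π y₁)) := (L₂.π_lift _).symm ▸ e.symm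
  have hc := h.comm y₁ (L₁.lift (L₁.π y₁)) y₂ (L₂.lift (L₁.π y₁)) e f f'
  show _ = L₂.a (L₂.lift (L₁.π y₁)) y₂ f'.symm * (h.h (L₁.lift (L₁.π y₁)) (L₂.lift (L₁.π y₁))
    (f.symm.trans (e.trans f')) * (L₁.a y₁ (L₁.lift (L₁.π y₁)) f * k))
  rw [← mul_assoc (h.h _ _ _), ← hc, mul_assoc, L₂.a_mul_a_mul, L₂.a_self, one_mul]

/-- The map of bundles given by a 2-morphism, in terms of a local section. -/
theorem Hom.recMap_recQ_sec (h : Hom L₁ L₂) (i : X) (z : L₁.Y × Γ.H) :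
    h.recMap (L₁.recQ z) = L₂.recQ (L₂.sec i (L₁.π z.1),
      h.h z.1 (L₂.sec i (L₁.π z.1)) (L₂.π_sec i _).symm * z.2) :=
  h.recMap_recQ z.1 _ _ z.2

/-- The morphism of bundles given by a 2-morphism of local data. -/
def Hom.reconstruct (h : Hom L₁ L₂) : BunCon.Hom L₁.reconstruct L₂.reconstruct := by
  have hO : ∀ i, IsOpen ((fun z : L₁.Y × Γ.H => L₁.π z.1) ⁻¹' L₂.secDom i) := fun i =>
    (L₂.isOpen_secDom i).preimage L₁.isSmooth_π_fst.continuous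
  have hs : ∀ i, IsSmoothOn (L₁.Y.prod Γ.H.toMfd) L₂.Y (fun z => L₂.sec i (L₁.π z.1))
      ((fun z : L₁.Y × Γ.H => L₁.π z.1) ⁻¹' L₂.secDom i) := fun i =>
    (L₂.isSmoothOn_sec i).comp (L₂.isOpen_secDom i) (hO i) (L₁.isSmooth_π_fst.on _) fun q hq => hq
  have hh : ∀ i, IsSmoothOn (L₁.Y.prod Γ.H.toMfd) Γ.H
      (fun z => h.h z.1 (L₂.sec i (L₁.π z.1)) (L₂.π_sec i _).symm)
      ((fun z : L₁.Y × Γ.H => L₁.π z.1) ⁻¹' L₂.secDom i) := fun i =>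
    (h.gauge (L₁.Y.prod Γ.H.toMfd) _ _ _ (fun z => (L₂.π_sec i (L₁.π z.1)).symm) (hO i)
      (isSmooth_fst.on _) (hs i)).smooth
  have hsm : IsSmooth L₁.recMfd L₂.recMfd h.recMap := by
    refine L₁.isSubmersion_recQ.isSmooth_of_comp L₁.surjective_recQ
      (IsSmoothOn.of_local fun z _ => ⟨_, hO (L₁.π z.1), L₂.mem_secDom _, ?_⟩)
    refine (L₂.isSmoothOn_recQ (hO _) (hs _) (isSmoothOn_mul (hO _) (hh _)
      (isSmooth_snd.on _))).congr (hO _) fun z' _ => ?_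
    exact (h.recMap_recQ_sec _ z').symm
  have key : ∀ p : L₁.recMfd, ∃ z : L₁.Y × Γ.H, L₁.recQ z = p := L₁.surjective_recQ
  refine ⟨h.recMap, hsm, fun p => ?_, fun p k => ?_, fun p => ?_, fun p v => ?_⟩
  · exact L₂.π_lift _
  · obtain ⟨⟨y, k'⟩, rfl⟩ := key p
    have e := (L₂.π_sec (L₁.π y) (L₁.π y)).symm
    show h.recMap (L₁.recAct (L₁.recQ (y, k')) k) = L₂.recAct (h.recMap (L₁.recQ (y, k'))) k
    rw [L₁.recAct_recQ, h.recMap_recQ y _ e, h.recMap_recQ y _ e, L₂.recAct_recQ, mul_assoc]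
  · obtain ⟨⟨y, k'⟩, rfl⟩ := key p
    have e := (L₂.π_sec (L₁.π y) (L₁.π y)).symm
    show L₂.recAnchor (h.recMap (L₁.recQ (y, k'))) = L₁.recAnchor (L₁.recQ (y, k'))
    rw [h.recMap_recQ y _ e, L₂.recAnchor_recQ, L₁.recAnchor_recQ, h.gauge.eq_g y _ e, map_mul]
    group
  · refine L₁.isSubmersion_recQ.pull_injective L₁.surjective_recQ
      (ω := pull h.recMap L₂.recω) (η := L₁.recω) (fun z v => ?_) p v
    set i := L₁.π z.1
    have hz : z ∈ (fun z : L₁.Y × Γ.H => L₁.π z.1) ⁻¹' L₂.secDom i := L₂.mem_secDom i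
    have hk : IsSmoothOn (L₁.Y.prod Γ.H.toMfd) Γ.H (fun z => z.2)
      ((fun z : L₁.Y × Γ.H => L₁.π z.1) ⁻¹' L₂.secDom i) := isSmooth_snd.on _
    have h1 := L₂.pull_recQ_recω (hO i) (hs i) (isSmoothOn_mul (hO i) (hh i) hk) hz v
    have h2 : pull (M := L₁.Y.prod Γ.H.toMfd) (fun z => h.recMap (L₁.recQ z)) L₂.recω z v =
        pull L₁.recQ (pull h.recMap L₂.recω) z v :=
      pull_comp (M := L₁.Y.prod Γ.H.toMfd) isOpen_univ hsm isOpen_univ L₁.isSmooth_recQ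
        (mem_univ z) (mem_univ _) L₂.recω v
    have hfun : (fun z : L₁.Y × Γ.H => L₂.π (L₂.sec i (L₁.π z.1))) = fun z => L₁.π z.1 :=
      funext fun z => L₂.π_sec i _
    rw [hfun] at h1
    refine h2.symm.trans (Eq.trans ?_ (h1.trans ?_))
    · simp only [h.recMap_recQ_sec i]
    · exact (h.gauge.gaugeForm_mul (Z := L₁.Y.prod Γ.H.toMfd) (hO i)
        (fun z => (L₂.π_sec i (L₁.π z.1)).symm) (isSmooth_fst.on _) (hs i) hk hz v).trans
        (L₁.pull_recω z v).symm

end LocalData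

open CategoryTheory

/-- Reconstruction as a functor. -/
def recFunctor (D D' : GammaConnection Γ X) : LocalData D D' ⥤ BunCon Γ X D.A D'.A where
  obj L := L.reconstruct
  map {L₁ L₂} h := LocalData.Hom.reconstruct (L₁ := L₁) (L₂ := L₂) h
  map_id L := by
    refine BunCon.Hom.ext (funext fun p => ?_)
    obtain ⟨⟨y, k⟩, rfl⟩ := L.surjective_recQ p
    refine ((LocalData.Hom.id L).recMap_recQ y y rfl k).trans ?_
    show L.recQ (y, L.a y y rfl * k) = L.recQ (y, k)
    rw [L.a_self, one_mul]
  map_comp {L₁ L₂ L₃} h h' := by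
    refine BunCon.Hom.ext (funext fun p => ?_)
    obtain ⟨⟨y, k⟩, rfl⟩ := L₁.surjective_recQ p
    have e₂ := (L₂.π_lift (L₁.π y)).symm
    have e₃ := (L₃.π_lift (L₁.π y)).symm
    have h1 := LocalData.Hom.recMap_recQ (L₁ := L₁) (L₂ := L₂) h y _ e₂ k
    have h2 := LocalData.Hom.recMap_recQ (L₁ := L₂) (L₂ := L₃) h' _ _ (e₂.symm.trans e₃)
      (LocalData.Hom.h h y _ e₂ * k)
    refine (LocalData.Hom.recMap_recQ (L₁ := L₁) (L₂ := L₃) (h ≫ h') y _ e₃ k).trans (Eq.trans ?_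
      ((congrArg (LocalData.Hom.recMap (L₁ := L₂) (L₂ := L₃) h') h1).trans h2).symm)
    rw [← mul_assoc, ← LocalData.Hom.comp_h]
    rfl

/-- The reconstruction functor with its structure. -/
def reconstructionFunctor (D D' : GammaConnection Γ X) : ReconstructionFunctor D D' where
  functor := recFunctor D D'
  q L := L.recQ
  submersion_q L := L.isSubmersion_recQ
  surjective_q L := L.surjective_recQ
  q_eq_iff L := L.recQ_eq_iff
  proj_q _ _ _ := rfl
  act_q L := L.recAct_recQ
  anchor_q L := L.recAnchor_recQ
  ω_q L := L.pull_recω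
  map_q {L₁ L₂} h := LocalData.Hom.recMap_recQ (L₁ := L₁) (L₂ := L₂) h

end ReconstructionFunctor

/-! ### The partial tensor product -/

section Tensor

variable {Γ : LieTwoGroup.{u}} {X : Mfd.{u}} {D D' D'' : GammaConnection Γ X}

theorem IsFiberProduct.symm {Y₁ Y₂ W : Mfd.{u}} {π₁ : Y₁ → X} {π₂ : Y₂ → X} {p₁ : W → Y₁}
    {p₂ : W → Y₂} (h : IsFiberProduct π₁ π₂ p₁ p₂) : IsFiberProduct π₂ π₁ p₂ p₁ := by
  refine ⟨h.2.1, h.1, fun w => (h.2.2.1 w).symm, fun Z f₁ f₂ h₁ h₂ e => ?_⟩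
  obtain ⟨f, ⟨hf, e₁, e₂⟩, hu⟩ := h.2.2.2 Z f₂ f₁ h₂ h₁ fun z => (e z).symm
  exact ⟨f, ⟨hf, e₂, e₁⟩, fun f' hf' => hu f' ⟨hf'.1, hf'.2.2, hf'.2.1⟩⟩

/-- The equivalence relation of the partial tensor product in terms of the cocycle of the
composition. -/
theorem eq_mul_α_iff (g : Γ.G) (h d : Γ.H) :
    1 = h * Γ.α ((Γ.t h)⁻¹ * g) d ↔ d⁻¹ = Γ.α g⁻¹ h := by
  have h1 : h * Γ.α ((Γ.t h)⁻¹ * g) d = Γ.α g d * h := by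
    rw [map_mul, MulAut.mul_apply, ← map_inv, Γ.α_t]
    group
  rw [h1, eq_comm, mul_eq_one_iff_eq_inv, map_inv Γ.α, MulAut.inv_def, MulEquiv.eq_symm_apply,
    map_inv, inv_eq_iff_eq_inv]

variable (E₁ : BunCon Γ X D'.A D''.A) (E₂ : BunCon Γ X D.A D'.A)

/-- The composition of the local data of two bundles; its reconstruction is their partial tensor
product. -/
def tensorLoc : LocalData D D'' := LocalData.compose E₁.loc E₂.loc

/-- The fibre product of two bundles. -/
def tensorW : Mfd.{u} := LocalData.compY E₁.loc E₂.loc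

/-- The projection to the first bundle. -/
def tensorPr₁ : tensorW E₁ E₂ → E₁.P := LocalData.compP' E₁.loc E₂.loc

/-- The projection to the second bundle. -/
def tensorPr₂ : tensorW E₁ E₂ → E₂.P := LocalData.compP E₁.loc E₂.loc

/-- The point of the fibre product with given components. -/
def tensorMk (p₁ : E₁.P) (p₂ : E₂.P) (e : E₁.proj p₁ = E₂.proj p₂) : tensorW E₁ E₂ :=
  fibreMk E₂.loc.submersion E₁.loc.submersion.1 p₂ p₁ e.symm

/-- The projection to the partial tensor product. -/
def tensorτ (w : tensorW E₁ E₂) : (tensorLoc E₁ E₂).recMfd := (tensorLoc E₁ E₂).recQ (w, 1)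

theorem isFiberProduct_tensor :
    IsFiberProduct E₁.proj E₂.proj (tensorPr₁ E₁ E₂) (tensorPr₂ E₁ E₂) :=
  (isFiberProduct_fibreMfd E₂.loc.submersion E₁.loc.submersion.1).symm

theorem tensor_eq (w : tensorW E₁ E₂) :
    E₁.proj (tensorPr₁ E₁ E₂ w) = E₂.proj (tensorPr₂ E₁ E₂ w) :=
  (isFiberProduct_tensor E₁ E₂).2.2.1 w

theorem tensor_ext {w w' : tensorW E₁ E₂} (h₁ : tensorPr₁ E₁ E₂ w = tensorPr₁ E₁ E₂ w')
    (h₂ : tensorPr₂ E₁ E₂ w = tensorPr₂ E₁ E₂ w') : w = w' :=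
  fibre_ext E₂.loc.submersion E₁.loc.submersion.1 h₂ h₁

theorem isSmooth_tensorPr₁ : IsSmooth (tensorW E₁ E₂) E₁.P (tensorPr₁ E₁ E₂) :=
  (isFiberProduct_tensor E₁ E₂).1

theorem isSmooth_tensorPr₂ : IsSmooth (tensorW E₁ E₂) E₂.P (tensorPr₂ E₁ E₂) :=
  (isFiberProduct_tensor E₁ E₂).2.1

theorem isSmoothOn_tensorMk {Z : Mfd.{u}} {U : Set Z} (hU : IsOpen U) {p₁ : Z → E₁.P}
    {p₂ : Z → E₂.P} (h₁ : IsSmoothOn Z E₁.P p₁ U) (h₂ : IsSmoothOn Z E₂.P p₂ U)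
    (e : ∀ z, E₁.proj (p₁ z) = E₂.proj (p₂ z)) :
    IsSmoothOn Z (tensorW E₁ E₂) (fun z => tensorMk E₁ E₂ (p₁ z) (p₂ z) (e z)) U :=
  isSmoothOn_fibre E₂.loc.submersion E₁.loc.submersion.1 hU h₂ h₁

theorem isSmooth_tensorτ : IsSmooth (tensorW E₁ E₂) (tensorLoc E₁ E₂).recMfd (tensorτ E₁ E₂) :=
  (tensorLoc E₁ E₂).isSmoothOn_recQ isOpen_univ isSmooth_id (isSmooth_const (1 : Γ.H))

theorem tensorLoc_a (w w' : tensorW E₁ E₂) (e : (tensorLoc E₁ E₂).π w = (tensorLoc E₁ E₂).π w')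
    (e₁ : E₁.proj (tensorPr₁ E₁ E₂ w) = E₁.proj (tensorPr₁ E₁ E₂ w'))
    (e₂ : E₂.proj (tensorPr₂ E₁ E₂ w) = E₂.proj (tensorPr₂ E₁ E₂ w')) :
    (tensorLoc E₁ E₂).a w w' e = E₁.div (tensorPr₁ E₁ E₂ w) (tensorPr₁ E₁ E₂ w') e₁ *
      Γ.α (E₁.anchor (tensorPr₁ E₁ E₂ w))
        (E₂.div (tensorPr₂ E₁ E₂ w) (tensorPr₂ E₁ E₂ w') e₂) := rfl

theorem tensorτ_eq_iff (w w' : tensorW E₁ E₂) : tensorτ E₁ E₂ w = tensorτ E₁ E₂ w' ↔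
    ∃ h : Γ.H, tensorPr₁ E₁ E₂ w = E₁.act (tensorPr₁ E₁ E₂ w') h ∧ tensorPr₂ E₁ E₂ w' =
      E₂.act (tensorPr₂ E₁ E₂ w) (Γ.α (E₁.anchor (tensorPr₁ E₁ E₂ w'))⁻¹ h) := by
  have hw := tensor_eq E₁ E₂ w
  have hw' := tensor_eq E₁ E₂ w'
  refine ((tensorLoc E₁ E₂).recQ_eq_iff w w' 1 1).trans ⟨?_, ?_⟩
  · rintro ⟨e, h⟩
    have e₂ : E₂.proj (tensorPr₂ E₁ E₂ w) = E₂.proj (tensorPr₂ E₁ E₂ w') := e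
    have e₁ := hw.trans (e₂.trans hw'.symm)
    have ha : E₁.anchor (tensorPr₁ E₁ E₂ w) = (Γ.t (E₁.div _ _ e₁))⁻¹ *
        E₁.anchor (tensorPr₁ E₁ E₂ w') := by rw [← E₁.anchor_act, E₁.act_div]
    rw [tensorLoc_a E₁ E₂ w w' e e₁ e₂, mul_one, ha, eq_mul_α_iff] at h
    refine ⟨E₁.div _ _ e₁, (E₁.act_div e₁).symm, ?_⟩
    rw [← h]
    exact (E₂.act_inv_eq (E₂.act_div e₂)).symm
  · rintro ⟨h, h₁, h₂⟩
    have e₁ : E₁.proj (tensorPr₁ E₁ E₂ w) = E₁.proj (tensorPr₁ E₁ E₂ w') := by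
      rw [h₁, E₁.proj_act]
    have e₂ := hw.symm.trans (e₁.trans hw')
    refine ⟨e₂, ?_⟩
    have d₁ : E₁.div _ _ e₁ = h := E₁.div_eq e₁ h₁.symm
    have d₂ : E₂.div _ _ e₂ = (Γ.α (E₁.anchor (tensorPr₁ E₁ E₂ w'))⁻¹ h)⁻¹ := by
      exact E₂.div_eq e₂ (E₂.act_inv_eq h₂.symm)
    have ha : E₁.anchor (tensorPr₁ E₁ E₂ w) = (Γ.t h)⁻¹ * E₁.anchor (tensorPr₁ E₁ E₂ w') := by
      rw [← E₁.anchor_act, h₁]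
    rw [tensorLoc_a E₁ E₂ w w' e₂ e₁ e₂, d₁, d₂, mul_one, ha, eq_mul_α_iff, inv_inv]

theorem proj_tensorτ (w : tensorW E₁ E₂) :
    (tensorLoc E₁ E₂).recProj (tensorτ E₁ E₂ w) = E₁.proj (tensorPr₁ E₁ E₂ w) :=
  (tensor_eq E₁ E₂ w).symm

theorem tensorτ_act (w : tensorW E₁ E₂) (k : Γ.H) (w' : tensorW E₁ E₂)
    (h₁ : tensorPr₁ E₁ E₂ w' = E₁.act (tensorPr₁ E₁ E₂ w) k)
    (h₂ : tensorPr₂ E₁ E₂ w' = tensorPr₂ E₁ E₂ w) :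
    (tensorLoc E₁ E₂).recQ (w, k) = tensorτ E₁ E₂ w' := by
  have e₂ : E₂.proj (tensorPr₂ E₁ E₂ w) = E₂.proj (tensorPr₂ E₁ E₂ w') := by rw [h₂]
  have e₁ : E₁.proj (tensorPr₁ E₁ E₂ w) = E₁.proj (tensorPr₁ E₁ E₂ w') := by
    rw [h₁, E₁.proj_act]
  have d₁ : E₁.div _ _ e₁ = k⁻¹ := E₁.div_eq e₁ (E₁.act_inv_eq h₁.symm)
  have d₂ : E₂.div _ _ e₂ = 1 := by
    refine E₂.div_eq e₂ ?_
    rw [h₂, E₂.act_one]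
  refine ((tensorLoc E₁ E₂).recQ_eq_iff w w' k 1).2 ⟨e₂, ?_⟩
  rw [tensorLoc_a E₁ E₂ w w' e₂ e₁ e₂, d₁, d₂, map_one, mul_one, inv_mul_cancel]

/-- The free action of `H` on the fibre product whose orbits are the fibres of the projection to
the partial tensor product. -/
def tensorAct (w : tensorW E₁ E₂) (h : Γ.H) : tensorW E₁ E₂ :=
  tensorMk E₁ E₂ (E₁.act (tensorPr₁ E₁ E₂ w) h)
    (E₂.act (tensorPr₂ E₁ E₂ w) (Γ.α (E₁.anchor (tensorPr₁ E₁ E₂ w))⁻¹ h)⁻¹)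
    (by rw [E₁.proj_act, E₂.proj_act, tensor_eq])

theorem tensorτ_tensorAct (w : tensorW E₁ E₂) (h : Γ.H) :
    tensorτ E₁ E₂ (tensorAct E₁ E₂ w h) = tensorτ E₁ E₂ w := by
  refine (tensorτ_eq_iff E₁ E₂ _ _).2 ⟨h, rfl, ?_⟩
  show _ = E₂.act (E₂.act (tensorPr₂ E₁ E₂ w) _) _
  rw [E₂.act_mul, inv_mul_cancel, E₂.act_one]

/-- A section of the projection to the partial tensor product, obtained from a section
of the fibre product. -/
def tensorSec (i : X) (c : (tensorLoc E₁ E₂).recMfd) : tensorW E₁ E₂ :=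
  tensorMk E₁ E₂ (E₁.act (tensorPr₁ E₁ E₂ ((tensorLoc E₁ E₂).sec i ((tensorLoc E₁ E₂).recProj c)))
      ((tensorLoc E₁ E₂).recD c ((tensorLoc E₁ E₂).sec i ((tensorLoc E₁ E₂).recProj c))
        ((tensorLoc E₁ E₂).π_sec i _)))
    (tensorPr₂ E₁ E₂ ((tensorLoc E₁ E₂).sec i ((tensorLoc E₁ E₂).recProj c)))
    ((E₁.proj_act _ _).trans (tensor_eq E₁ E₂ _))

theorem tensorτ_tensorSec (i : X) (c : (tensorLoc E₁ E₂).recMfd) :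
    tensorτ E₁ E₂ (tensorSec E₁ E₂ i c) = c := by
  rw [← tensorτ_act E₁ E₂ ((tensorLoc E₁ E₂).sec i ((tensorLoc E₁ E₂).recProj c)) _
    (tensorSec E₁ E₂ i c) rfl rfl]
  exact (tensorLoc E₁ E₂).recQ_recD _ _ _

theorem surjective_tensorτ : Function.Surjective (tensorτ E₁ E₂) := fun c =>
  ⟨_, tensorτ_tensorSec E₁ E₂ ((tensorLoc E₁ E₂).recProj c) c⟩

theorem isSmoothOn_tensorSec (i : X) :
    IsSmoothOn (tensorLoc E₁ E₂).recMfd (tensorW E₁ E₂) (tensorSec E₁ E₂ i)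
      ((tensorLoc E₁ E₂).recProj ⁻¹' (tensorLoc E₁ E₂).secDom i) := by
  set L := tensorLoc E₁ E₂ with hL
  have hO : IsOpen (L.recProj ⁻¹' L.secDom i) :=
    (L.isOpen_secDom i).preimage L.isSmooth_recProj.continuous
  have hs : IsSmoothOn L.recMfd (tensorW E₁ E₂) (fun c => L.sec i (L.recProj c))
      (L.recProj ⁻¹' L.secDom i) :=
    (L.isSmoothOn_sec i).comp (L.isOpen_secDom i) hO (L.isSmooth_recProj.on _) fun q hq => hq
  refine isSmoothOn_tensorMk E₁ E₂ hO (E₁.isSmoothOn_act hO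
    ((isSmooth_tensorPr₁ E₁ E₂).comp_on hO hs) ?_) ((isSmooth_tensorPr₂ E₁ E₂).comp_on hO hs) _
  exact L.isSmoothOn_recD (p := fun c => c) hO (isSmooth_id.on _) hs fun c => L.π_sec i _

theorem isSubmersion_tensorτ :
    IsSubmersion (tensorW E₁ E₂) (tensorLoc E₁ E₂).recMfd (tensorτ E₁ E₂) := by
  set L := tensorLoc E₁ E₂ with hL
  refine IsSubmersion.of_local (isSmooth_tensorτ E₁ E₂) fun w => ?_
  set i := L.recProj (tensorτ E₁ E₂ w) with hi
  have hV : IsOpen (L.recProj ⁻¹' L.secDom i) :=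
    (L.isOpen_secDom i).preimage L.isSmooth_recProj.continuous
  have hO : IsOpen (tensorτ E₁ E₂ ⁻¹' (L.recProj ⁻¹' L.secDom i)) :=
    hV.preimage (isSmooth_tensorτ E₁ E₂).continuous
  have hO' : IsOpen ((L.recProj ⁻¹' L.secDom i) ×ˢ (univ : Set Γ.H)) := hV.prod isOpen_univ
  have hsτ : IsSmoothOn (tensorW E₁ E₂) (tensorW E₁ E₂)
      (fun w => tensorSec E₁ E₂ i (tensorτ E₁ E₂ w))
      (tensorτ E₁ E₂ ⁻¹' (L.recProj ⁻¹' L.secDom i)) :=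
    (isSmoothOn_tensorSec E₁ E₂ i).comp hV hO ((isSmooth_tensorτ E₁ E₂).on _) fun w hw => hw
  have hs1 : IsSmoothOn (L.recMfd.prod Γ.H.toMfd) (tensorW E₁ E₂)
      (fun q => tensorSec E₁ E₂ i q.1) ((L.recProj ⁻¹' L.secDom i) ×ˢ (univ : Set Γ.H)) :=
    (isSmoothOn_tensorSec E₁ E₂ i).comp hV hO' (isSmooth_fst.on _) fun q hq => hq.1
  have hk : IsSmoothOn (L.recMfd.prod Γ.H.toMfd) Γ.H (fun q => q.2)
    ((L.recProj ⁻¹' L.secDom i) ×ˢ (univ : Set Γ.H)) := isSmooth_snd.on _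
  have hp1 := (isSmooth_tensorPr₁ E₁ E₂).comp_on hO' hs1
  have hp2 := (isSmooth_tensorPr₂ E₁ E₂).comp_on hO' hs1
  have e : ∀ w, E₁.proj (tensorPr₁ E₁ E₂ w) =
      E₁.proj (tensorPr₁ E₁ E₂ (tensorSec E₁ E₂ i (tensorτ E₁ E₂ w))) := fun w => by
    rw [← proj_tensorτ, ← proj_tensorτ, tensorτ_tensorSec]
  refine ⟨Γ.H, _, _, fun w => E₁.div (tensorPr₁ E₁ E₂ w) _ (e w),
    fun q => tensorAct E₁ E₂ (tensorSec E₁ E₂ i q.1) q.2, hO, hO', L.mem_secDom i, ?_, ?_,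
    fun w hw => ⟨hw, mem_univ _⟩, ?_, ?_, ?_⟩
  · exact E₁.isSmoothOn_div hO ((isSmooth_tensorPr₁ E₁ E₂).on _)
      ((isSmooth_tensorPr₁ E₁ E₂).comp_on hO hsτ) e
  · exact isSmoothOn_tensorMk E₁ E₂ hO' (E₁.isSmoothOn_act hO' hp1 hk) (E₂.isSmoothOn_act hO' hp2
      (isSmoothOn_inv hO' (isSmoothOn_α Γ hO'
        (isSmoothOn_inv hO' (E₁.smooth_anchor.comp_on hO' hp1)) hk))) _
  · intro q hq
    rw [mem_preimage, tensorτ_tensorAct, tensorτ_tensorSec]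
    exact hq.1
  · intro w' _
    obtain ⟨h, h₁, h₂⟩ := (tensorτ_eq_iff E₁ E₂ w'
      (tensorSec E₁ E₂ i (tensorτ E₁ E₂ w'))).1 (tensorτ_tensorSec E₁ E₂ i _).symm
    have d : E₁.div _ _ (e w') = h := E₁.div_eq _ h₁.symm
    refine tensor_ext E₁ E₂ (E₁.act_div (e w')) ?_
    show E₂.act (tensorPr₂ E₁ E₂ (tensorSec E₁ E₂ i (tensorτ E₁ E₂ w')))
      (Γ.α (E₁.anchor (tensorPr₁ E₁ E₂ (tensorSec E₁ E₂ i (tensorτ E₁ E₂ w'))))⁻¹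
        (E₁.div _ _ (e w')))⁻¹ = tensorPr₂ E₁ E₂ w'
    rw [d]
    exact E₂.act_inv_eq h₂.symm
  · intro q hq
    have h1 : tensorτ E₁ E₂ (tensorAct E₁ E₂ (tensorSec E₁ E₂ i q.1) q.2) = q.1 := by
      rw [tensorτ_tensorAct, tensorτ_tensorSec]
    refine ⟨h1, E₁.div_eq _ ?_⟩
    rw [h1]
    rfl

theorem tensor_ω (w : tensorW E₁ E₂) (v : (tensorW E₁ E₂).T w) :
    pull (tensorτ E₁ E₂) (tensorLoc E₁ E₂).recω w v = pull (tensorPr₁ E₁ E₂) E₁.ω w v +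
      Γ.αStar (E₁.anchor (tensorPr₁ E₁ E₂ w)) (pull (tensorPr₂ E₁ E₂) E₂.ω w v) := by
  refine ((tensorLoc E₁ E₂).pull_recQ_recω (Z := tensorW E₁ E₂) isOpen_univ isSmooth_id
    (isSmooth_const (1 : Γ.H)) (mem_univ w) v).trans ?_
  rw [gaugeForm_one, add_comm]
  exact pull_id _ w v

open CategoryTheory

/-- The partial tensor product functor with its structure. -/
def tensorFunctor (D D' D'' : GammaConnection Γ X) : TensorFunctor D.A D'.A D''.A where
  functor := (locFunctor D' D'').prod (locFunctor D D') ⋙ compFunctor D D' D'' ⋙ recFunctor D D''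
  W c := tensorW c.1 c.2
  pr₁ c := tensorPr₁ c.1 c.2
  pr₂ c := tensorPr₂ c.1 c.2
  isFiberProduct c := isFiberProduct_tensor c.1 c.2
  τ c := tensorτ c.1 c.2
  submersion_τ c := isSubmersion_tensorτ c.1 c.2
  surjective_τ c := surjective_tensorτ c.1 c.2
  τ_eq_iff c := tensorτ_eq_iff c.1 c.2
  proj_τ c := proj_tensorτ c.1 c.2
  act_τ c w w' h h₁ h₂ := by
    refine ((tensorLoc c.1 c.2).recAct_recQ w 1 h).trans ?_
    rw [one_mul]
    exact tensorτ_act c.1 c.2 w h w' h₁ h₂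
  anchor_τ c w := by
    refine ((tensorLoc c.1 c.2).recAnchor_recQ w 1).trans ?_
    rw [map_one, inv_one, one_mul]
    rfl
  ω_τ c := tensor_ω c.1 c.2
  map_τ {c c'} k w w' h₁ h₂ := by
    have e₂ : c.2.proj (tensorPr₂ c.1 c.2 w) = c'.2.proj (tensorPr₂ c'.1 c'.2 w') := by
      rw [h₂]
      exact (BunCon.Hom.proj_f k.2 _).symm
    have e₁ : c.1.proj (tensorPr₁ c.1 c.2 w) = c'.1.proj (tensorPr₁ c'.1 c'.2 w') := by
      rw [h₁]
      exact (BunCon.Hom.proj_f k.1 _).symm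
    have d₁ : c'.1.div (BunCon.Hom.f k.1 (tensorPr₁ c.1 c.2 w)) (tensorPr₁ c'.1 c'.2 w')
        ((BunCon.Hom.proj_f k.1 _).trans e₁) = 1 := c'.1.div_eq _ (by rw [c'.1.act_one, h₁])
    have d₂ : c'.2.div (BunCon.Hom.f k.2 (tensorPr₂ c.1 c.2 w)) (tensorPr₂ c'.1 c'.2 w')
        ((BunCon.Hom.proj_f k.2 _).trans e₂) = 1 := c'.2.div_eq _ (by rw [c'.2.act_one, h₂])
    have hh : c'.1.div (BunCon.Hom.f k.1 (tensorPr₁ c.1 c.2 w)) (tensorPr₁ c'.1 c'.2 w')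
        ((BunCon.Hom.proj_f k.1 _).trans e₁) * Γ.α (c.1.anchor (tensorPr₁ c.1 c.2 w))
        (c'.2.div (BunCon.Hom.f k.2 (tensorPr₂ c.1 c.2 w)) (tensorPr₂ c'.1 c'.2 w')
        ((BunCon.Hom.proj_f k.2 _).trans e₂)) = 1 := by rw [d₁, d₂, map_one, mul_one]
    have hr := LocalData.Hom.recMap_recQ (L₁ := tensorLoc c.1 c.2) (L₂ := tensorLoc c'.1 c'.2)
      (LocalData.Hom.hcomp (L₁' := c.1.loc) (L₂' := c'.1.loc) (L₁ := c.2.loc) (L₂ := c'.2.loc)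
        (BunCon.Hom.loc (E := c.1) (E' := c'.1) k.1) (BunCon.Hom.loc (E := c.2) (E' := c'.2) k.2))
      w w' e₂ 1
    refine hr.trans (congrArg (fun h => (tensorLoc c'.1 c'.2).recQ (w', h)) ?_)
    rw [mul_one]
    exact hh

end Tensor

/-! ### Morphisms of bundles -/

section Morphisms

open CategoryTheory

variable {Γ : LieTwoGroup.{u}} {X : Mfd.{u}} {A A' : Fam1 X Γ.𝔤}

namespace BunCon

variable {E E' : BunCon Γ X A A'} (f : Hom E E')

theorem act_div_mul {p p' : E.P} (e : E.proj p = E.proj p') (h : Γ.H) :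
    E.act p' (E.div p p' e * h) = E.act p h := by
  rw [← E.act_mul, E.act_div]

theorem Hom.injective : Function.Injective f.f := by
  intro p p' h
  have e : E.proj p = E.proj p' := by rw [← f.proj_f, h, f.proj_f]
  have h1 : E'.act (f.f p') (E.div p p' e) = E'.act (f.f p') 1 := by
    rw [← f.equivariant, E.act_div, h, E'.act_one]
  rw [← E.act_div e, E'.act_injective _ h1, E.act_one]

theorem Hom.act_div_eq (p : E.P) (p' : E'.P) (e : E'.proj p' = E'.proj (f.f p)) :
    f.f (E.act p (E'.div p' (f.f p) e)) = p' := by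
  rw [f.equivariant, E'.act_div]

theorem Hom.surjective : Function.Surjective f.f := fun p' => by
  obtain ⟨p, hp⟩ := E.surjective_proj (E'.proj p')
  exact ⟨_, f.act_div_eq p p' (hp.symm.trans (f.proj_f p).symm)⟩

/-- Connection-preserving morphisms of principal bundles are invertible. -/
def Hom.toIso : E ≅ E' := by
  have hr : ∀ p', f.f (Function.surjInv f.surjective p') = p' := Function.surjInv_eq f.surjective
  have hsm : IsSmooth E'.P E.P (Function.surjInv f.surjective) := by
    refine IsSmoothOn.of_local fun p' _ => ?_
    obtain ⟨V, s, hV, hx, hs, hsec⟩ :=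
      E.isSubmersion_proj.exists_global_section E.surjective_proj (E'.proj p')
    have hO : IsOpen (E'.proj ⁻¹' V) := hV.preimage E'.smooth_proj.continuous
    have hs' : IsSmoothOn E'.P E.P (fun p => s (E'.proj p)) (E'.proj ⁻¹' V) :=
      hs.comp hV hO (E'.smooth_proj.on _) fun p hp => hp
    have e : ∀ p, E'.proj p = E'.proj (f.f (s (E'.proj p))) := fun p => by rw [f.proj_f, hsec]
    refine ⟨_, hO, hx, (E.isSmoothOn_act hO hs' (E'.isSmoothOn_div (z := fun p => p) hO
      (isSmooth_id.on _) (f.smooth.comp_on hO hs') e)).congr hO fun p _ => f.injective ?_⟩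
    rw [hr]
    exact f.act_div_eq _ _ (e p)
  exact
    { hom := f
      inv :=
        { f := Function.surjInv f.surjective
          smooth := hsm
          proj_f := fun p => by rw [← f.proj_f, hr]
          equivariant := fun p h => f.injective (by rw [hr, f.equivariant, hr])
          anchor_f := fun p => by rw [← f.anchor_f, hr]
          pull_ω := fun p v => by
            have h1 := pull_comp isOpen_univ f.smooth isOpen_univ hsm (mem_univ p) (mem_univ _)
              E'.ω v
            simp only [hr] at h1
            rw [pull_id] at h1
            rw [h1]
            exact (f.pull_ω _ _).symm }
      hom_inv_id := Hom.ext (funext fun p => f.injective (hr (f.f p)))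
      inv_hom_id := Hom.ext (funext hr) }

end BunCon

end Morphisms

/-! ### Properties of reconstruction -/

section Reconstruction

open CategoryTheory

variable {Γ : LieTwoGroup.{u}} {X : Mfd.{u}} {D D' : GammaConnection Γ X}

namespace ReconstructionFunctor

variable (R : ReconstructionFunctor D D') (L : LocalData D D')

theorem isSmoothOn_q {Z : Mfd.{u}} {U : Set Z} (hU : IsOpen U) {y : Z → L.Y} {k : Z → Γ.H}
    (hy : IsSmoothOn Z L.Y y U) (hk : IsSmoothOn Z Γ.H k U) :
    IsSmoothOn Z (R.functor.obj L).P (fun z => R.q L (y z, k z)) U :=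
  (R.submersion_q L).1.comp_on hU (hy.prodMk hU hk)

theorem pull_q {Z : Mfd.{u}} {U : Set Z} (hU : IsOpen U) {y : Z → L.Y} {k : Z → Γ.H}
    (hy : IsSmoothOn Z L.Y y U) (hk : IsSmoothOn Z Γ.H k U) {z : Z} (hz : z ∈ U) (v : Z.T z) :
    pull (fun z => R.q L (y z, k z)) (R.functor.obj L).ω z v =
      gaugeForm k (pull (fun z => L.π (y z)) D'.A) (pull y L.φ) z v := by
  rw [pull_comp (N := L.Y.prod Γ.H.toMfd) (f := fun z => ((y z, k z) : L.Y × Γ.H)) isOpen_univ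
    (R.submersion_q L).1 hU (hy.prodMk hU hk) hz (mem_univ _), ← L.pull_recForm hU hy hk hz]
  exact R.ω_q L _ _

theorem q_injective (y : L.Y) {h h' : Γ.H} (e : R.q L (y, h) = R.q L (y, h')) : h = h' := by
  obtain ⟨e', h1⟩ := (R.q_eq_iff L y y h h').1 e
  rw [h1, L.a_self, one_mul]

theorem q_eq {y₁ y₂ : L.Y} (e : L.π y₁ = L.π y₂) (h : Γ.H) :
    R.q L (y₁, h) = R.q L (y₂, L.a y₁ y₂ e * h) := (R.q_eq_iff L _ _ _ _).2 ⟨e, rfl⟩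

/-- Morphisms out of a reconstructed bundle are given by maps on `Y × H`. -/
theorem exists_hom (E : BunCon Γ X D.A D'.A) (F : L.Y × Γ.H → E.P)
    (hF : IsSmooth (L.Y.prod Γ.H.toMfd) E.P F)
    (hc : ∀ y₁ y₂ (e : L.π y₁ = L.π y₂) h, F (y₁, h) = F (y₂, L.a y₁ y₂ e * h))
    (hp : ∀ y h, E.proj (F (y, h)) = L.π y)
    (hact : ∀ y h k, F (y, h * k) = E.act (F (y, h)) k)
    (ha : ∀ y h, E.anchor (F (y, h)) = (Γ.t h)⁻¹ * L.g y)
    (hω : ∀ z v, pull (M := L.Y.prod Γ.H.toMfd) F E.ω z v = L.recForm z v) :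
    ∃ f : BunCon.Hom (R.functor.obj L) E, ∀ z, f.f (R.q L z) = F z := by
  have hs := R.surjective_q L
  set f : (R.functor.obj L).P → E.P := fun p => F (Function.surjInv hs p) with hf
  have hfq : ∀ z, f (R.q L z) = F z := fun z => by
    obtain ⟨e, h1⟩ := (R.q_eq_iff L _ _ _ _).1 (Function.surjInv_eq hs (R.q L z))
    refine (hc _ _ e _).trans ?_
    rw [← h1]
  have hfs : IsSmooth (R.functor.obj L).P E.P f :=
    (R.submersion_q L).isSmooth_of_comp hs (hF.congr isOpen_univ fun z _ => (hfq z).symm)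
  refine ⟨⟨f, hfs, fun p => ?_, fun p k => ?_, fun p => ?_, fun p v => ?_⟩, hfq⟩
  · obtain ⟨⟨y, h⟩, rfl⟩ := hs p
    rw [hfq, hp, R.proj_q]
  · obtain ⟨⟨y, h⟩, rfl⟩ := hs p
    rw [R.act_q, hfq, hfq, hact]
  · obtain ⟨⟨y, h⟩, rfl⟩ := hs p
    rw [hfq, ha, R.anchor_q]
  · refine (R.submersion_q L).pull_injective hs (ω := pull f E.ω) (fun z v => ?_) p v
    have h1 := pull_comp (M := L.Y.prod Γ.H.toMfd) isOpen_univ hfs isOpen_univ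
      (R.submersion_q L).1 (mem_univ z) (mem_univ _) E.ω v
    simp only [hfq] at h1
    exact h1.symm.trans ((hω z v).trans (R.ω_q L z v).symm)

theorem faithful : R.functor.Faithful where
  map_injective {L₁ L₂} h h' e := by
    refine LocalData.Hom.ext (funext fun y₁ => funext fun y₂ => funext fun e₁₂ => ?_)
    refine R.q_injective L₂ y₂ ?_
    have h1 := R.map_q (L₁ := L₁) (L₂ := L₂) h y₁ y₂ e₁₂ 1
    have h2 := R.map_q (L₁ := L₁) (L₂ := L₂) h' y₁ y₂ e₁₂ 1
    rw [mul_one] at h1 h2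
    rw [← h1, ← h2]
    exact congrArg (fun k => BunCon.Hom.f k (R.q L₁ (y₁, 1))) e

theorem proj_f_q {L₁ L₂ : LocalData D D'}
    (f : BunCon.Hom (R.functor.obj L₁) (R.functor.obj L₂)) {y₁ : L₁.Y} {y₂ : L₂.Y}
    (e : L₁.π y₁ = L₂.π y₂) : (R.functor.obj L₂).proj (f.f (R.q L₁ (y₁, 1))) =
      (R.functor.obj L₂).proj (R.q L₂ (y₂, 1)) := by
  rw [f.proj_f, R.proj_q, R.proj_q, e]

/-- The function `h` with `f(q(y₁, 1)) = q(y₂, h(y₁, y₂))`. -/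
def homOf {L₁ L₂ : LocalData D D'} (f : BunCon.Hom (R.functor.obj L₁) (R.functor.obj L₂))
    (y₁ : L₁.Y) (y₂ : L₂.Y) (e : L₁.π y₁ = L₂.π y₂) : Γ.H :=
  (R.functor.obj L₂).div (f.f (R.q L₁ (y₁, 1))) (R.q L₂ (y₂, 1)) (R.proj_f_q f e)

theorem q_homOf {L₁ L₂ : LocalData D D'} (f : BunCon.Hom (R.functor.obj L₁) (R.functor.obj L₂))
    (y₁ : L₁.Y) (y₂ : L₂.Y) (e : L₁.π y₁ = L₂.π y₂) :
    R.q L₂ (y₂, R.homOf f y₁ y₂ e) = f.f (R.q L₁ (y₁, 1)) := by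
  have h1 := (R.functor.obj L₂).act_div (R.proj_f_q f e)
  rwa [R.act_q, one_mul] at h1

theorem q_homOf_mul {L₁ L₂ : LocalData D D'}
    (f : BunCon.Hom (R.functor.obj L₁) (R.functor.obj L₂)) (y₁ : L₁.Y) (y₂ : L₂.Y)
    (e : L₁.π y₁ = L₂.π y₂) (k : Γ.H) :
    R.q L₂ (y₂, R.homOf f y₁ y₂ e * k) = f.f (R.q L₁ (y₁, k)) := by
  rw [← R.act_q, R.q_homOf, ← f.equivariant, R.act_q, one_mul]

/-- The 2-morphism of local data given by a morphism of reconstructed bundles. -/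
def preimage {L₁ L₂ : LocalData D D'} (f : BunCon.Hom (R.functor.obj L₁) (R.functor.obj L₂)) :
    LocalData.Hom L₁ L₂ where
  h := R.homOf f
  gauge := by
    intro Z U z₁ z₂ e hU hz₁ hz₂
    have h1 : IsSmoothOn Z Γ.H (fun _ => 1) U := (isSmooth_const (1 : Γ.H)).on _
    have G := BunCon.isGauge2_div f Z U (fun z => R.q L₁ (z₁ z, 1)) (fun z => R.q L₂ (z₂ z, 1))
      (fun z => by rw [R.proj_q, R.proj_q, e]) hU (R.isSmoothOn_q L₁ hU hz₁ h1)
      (R.isSmoothOn_q L₂ hU hz₂ h1)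
    simp only [R.anchor_q, map_one, inv_one, one_mul, R.proj_q] at G
    refine G.congr (fun _ _ _ => rfl) (fun z hz v => ?_) fun z hz v => ?_
    · rw [R.pull_q L₁ hU hz₁ h1 hz, gaugeForm_one]
    · rw [R.pull_q L₂ hU hz₂ h1 hz, gaugeForm_one]
  comm y₁ y₁' y₂ y₂' e e₁ e₂ := by
    refine R.q_injective L₂ y₂' ?_
    rw [← R.q_eq L₂ e₂, R.q_homOf, R.q_homOf_mul, ← mul_one (L₁.a y₁ y₁' e₁), ← R.q_eq L₁ e₁]

theorem full : R.functor.Full where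
  map_surjective {L₁ L₂} f := by
    refine ⟨R.preimage (L₁ := L₁) (L₂ := L₂) f, BunCon.Hom.ext (funext fun p => ?_)⟩
    obtain ⟨⟨y, k⟩, rfl⟩ := R.surjective_q L₁ p
    have e := (L₂.π_lift (L₁.π y)).symm
    exact (R.map_q (L₁ := L₁) (L₂ := L₂) (R.preimage f) y _ e k).trans (R.q_homOf_mul f y _ e k)

/-- Every bundle is reconstructed from its canonical trivialization over its total space. -/
theorem nonempty_iso_loc (E : BunCon Γ X D.A D'.A) : Nonempty (R.functor.obj E.loc ≅ E) := by
  obtain ⟨f, -⟩ := R.exists_hom E.loc E (fun z => E.act z.1 z.2) E.smooth_act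
    (fun p₁ p₂ e h => (E.act_div_mul e h).symm)
    (fun p h => E.proj_act p h) (fun p h k => (E.act_mul p h k).symm)
    (fun p h => E.anchor_act p h) (fun z v => E.ω_act z v)
  exact ⟨f.toIso⟩

end ReconstructionFunctor

end Reconstruction

/-! ### Reconstruction of a composition -/

section Composition

open CategoryTheory

variable {Γ : LieTwoGroup.{u}} {X : Mfd.{u}} {D D' D'' : GammaConnection Γ X}

theorem IsFiberProduct.exists_point {Y₁ Y₂ W : Mfd.{u}} {π₁ : Y₁ → X} {π₂ : Y₂ → X} {p₁ : W → Y₁}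
    {p₂ : W → Y₂} (h : IsFiberProduct π₁ π₂ p₁ p₂) (y₁ : Y₁) (y₂ : Y₂) (e : π₁ y₁ = π₂ y₂) :
    ∃ w, p₁ w = y₁ ∧ p₂ w = y₂ := by
  obtain ⟨f, ⟨-, h₁, h₂⟩, -⟩ := h.2.2.2 X (fun _ => y₁) (fun _ => y₂) (isSmooth_const _)
    (isSmooth_const _) fun _ => e
  exact ⟨f (π₁ y₁), h₁ _, h₂ _⟩

variable (K : CompositionFunctor D D' D'') (T : TensorFunctor D.A D'.A D''.A)
  (R : ReconstructionFunctor D D') (R' : ReconstructionFunctor D' D'')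
  (R'' : ReconstructionFunctor D D'')

/-- The equivalence relation of the partial tensor product of two reconstructed bundles. -/
theorem tensor_q_eq (c : LocalData D' D'' × LocalData D D')
    (w w' : T.W (R'.functor.obj c.1, R.functor.obj c.2)) (y' : c.1.Y) (y : c.2.Y) (b x : Γ.H)
    (h₁ : T.pr₁ (R'.functor.obj c.1, R.functor.obj c.2) w = R'.q c.1 (y', Γ.α (c.1.g y') x * b))
    (h₂ : T.pr₂ (R'.functor.obj c.1, R.functor.obj c.2) w = R.q c.2 (y, 1))
    (h₁' : T.pr₁ (R'.functor.obj c.1, R.functor.obj c.2) w' = R'.q c.1 (y', b))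
    (h₂' : T.pr₂ (R'.functor.obj c.1, R.functor.obj c.2) w' = R.q c.2 (y, x)) :
    T.τ _ w = T.τ _ w' := by
  refine (T.τ_eq_iff _ w w').2 ⟨b⁻¹ * (Γ.α (c.1.g y') x * b), ?_, ?_⟩
  · rw [h₁, h₁', R'.act_q, mul_inv_cancel_left]
  · rw [h₂, h₂', R.act_q, h₁', R'.anchor_q, one_mul]
    have h3 : Γ.α ((Γ.t b)⁻¹ * c.1.g y') x = b⁻¹ * (Γ.α (c.1.g y') x * b) := by
      rw [map_mul, MulAut.mul_apply, ← map_inv, Γ.α_t, inv_inv, mul_assoc]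
    rw [← h3, map_inv Γ.α, MulAut.inv_apply_self]

/-- The comparison `q''(ỹ, h) ↦ q'(y', h) ⊗ q(y, 1)` between the reconstruction of a composition
and the partial tensor product. -/
theorem exists_comparison (c : LocalData D' D'' × LocalData D D') :
    ∃ f : BunCon.Hom (R''.functor.obj (K.functor.obj c))
      (T.functor.obj (R'.functor.obj c.1, R.functor.obj c.2)),
      ∀ y h w, T.pr₁ (R'.functor.obj c.1, R.functor.obj c.2) w = R'.q c.1 (K.p' c y, h) →
        T.pr₂ (R'.functor.obj c.1, R.functor.obj c.2) w = R.q c.2 (K.p c y, 1) →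
        f.f (R''.q (K.functor.obj c) (y, h)) = T.τ _ w := by
  set d := (R'.functor.obj c.1, R.functor.obj c.2) with hd
  set L := K.functor.obj c with hL
  have hKp : IsSmooth L.Y c.2.Y (K.p c) := (K.isFiberProduct c).1
  have hKp' : IsSmooth L.Y c.1.Y (K.p' c) := (K.isFiberProduct c).2.1
  have hKe : ∀ y, c.2.π (K.p c y) = c.1.π (K.p' c y) := (K.isFiberProduct c).2.2.1
  have s' : IsSmooth (L.Y.prod Γ.H.toMfd) c.1.Y (fun z => K.p' c z.1) := hKp'.comp isSmooth_fst
  have s : IsSmooth (L.Y.prod Γ.H.toMfd) c.2.Y (fun z => K.p c z.1) := hKp.comp isSmooth_fst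
  have s₁ := R'.isSmoothOn_q c.1 isOpen_univ s' isSmooth_snd
  have s₂ := R.isSmoothOn_q c.2 isOpen_univ s (isSmooth_const (1 : Γ.H))
  obtain ⟨W, ⟨hW, hW₁, hW₂⟩, -⟩ := (T.isFiberProduct d).2.2.2 (L.Y.prod Γ.H.toMfd)
    (fun z => R'.q c.1 (K.p' c z.1, z.2)) (fun z => R.q c.2 (K.p c z.1, 1)) s₁ s₂
    (fun z => by rw [R'.proj_q, R.proj_q, hKe])
  -- the element of the partial tensor product depends only on the two components
  have huniq : ∀ w w', T.pr₁ d w = T.pr₁ d w' → T.pr₂ d w = T.pr₂ d w' → T.τ d w = T.τ d w' := by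
    intro w w' h₁ h₂
    refine (T.τ_eq_iff d w w').2 ⟨1, ?_, ?_⟩
    · rw [h₁, d.1.act_one]
    · rw [map_one, d.2.act_one, h₂]
  have hg : ∀ y₁ y₂ (e : c.1.π (K.p' c y₁) = c.1.π (K.p' c y₂)),
      c.1.g (K.p' c y₂) = Γ.t (c.1.a _ _ e) * c.1.g (K.p' c y₁) := fun y₁ y₂ e =>
    c.1.gauge_a.eq_g _ _ e
  suffices h : ∃ f : BunCon.Hom (R''.functor.obj L) (T.functor.obj d),
      ∀ z, f.f (R''.q L z) = T.τ d (W z) by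
    obtain ⟨f, hf⟩ := h
    refine ⟨f, fun y h w h₁ h₂ => (hf (y, h)).trans (huniq _ _ ?_ ?_)⟩
    · rw [h₁, hW₁]
    · rw [h₂, hW₂]
  refine R''.exists_hom L (T.functor.obj d) (fun z => T.τ d (W z))
    ((T.submersion_τ d).1.comp hW) (fun y₁ y₂ e h => ?_) (fun y h => ?_) (fun y h k => ?_)
    (fun y h => ?_) fun z v => ?_
  · have e₂ : c.2.π (K.p c y₁) = c.2.π (K.p c y₂) := by rwa [K.π_eq, K.π_eq] at e
    have e₁ : c.1.π (K.p' c y₁) = c.1.π (K.p' c y₂) := by rw [← hKe, ← hKe, e₂]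
    refine (tensor_q_eq T R R' c _ _ (K.p' c y₂) (K.p c y₂) (c.1.a _ _ e₁ * h) (c.2.a _ _ e₂)
      ?_ (hW₂ _) ?_ ?_).symm
    · rw [hW₁, K.a_eq c y₁ y₂ e e₁ e₂, hg y₁ y₂ e₁, map_mul, MulAut.mul_apply, Γ.α_t]
      congr 2
      group
    · rw [hW₁, R'.q_eq c.1 e₁]
    · rw [hW₂, R.q_eq c.2 e₂, mul_one]
  · rw [T.proj_τ, hW₁, R'.proj_q, K.π_eq, hKe]
  · refine (T.act_τ d _ _ k ?_ ?_).symm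
    · rw [hW₁, hW₁, R'.act_q]
    · rw [hW₂, hW₂]
  · rw [T.anchor_τ, hW₁, hW₂, R'.anchor_q, R.anchor_q, map_one, inv_one, one_mul, mul_assoc,
      K.g_eq]
  · have h0 := pull_comp (M := L.Y.prod Γ.H.toMfd) isOpen_univ (T.submersion_τ d).1 isOpen_univ hW
      (mem_univ z) (mem_univ _) (T.functor.obj d).ω v
    have h1 := pull_comp (M := L.Y.prod Γ.H.toMfd) isOpen_univ (T.isFiberProduct d).1 isOpen_univ hW
      (mem_univ z) (mem_univ _) d.1.ω v
    have h2 := pull_comp (M := L.Y.prod Γ.H.toMfd) isOpen_univ (T.isFiberProduct d).2.1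
      isOpen_univ hW (mem_univ z) (mem_univ _) d.2.ω v
    simp only [hW₁, hW₂] at h1 h2
    have h1' := R'.pull_q c.1 (Z := L.Y.prod Γ.H.toMfd) isOpen_univ s' isSmooth_snd (mem_univ z) v
    have h2' := R.pull_q c.2 (Z := L.Y.prod Γ.H.toMfd) isOpen_univ s (isSmooth_const (1 : Γ.H))
      (mem_univ z) v
    rw [gaugeForm_one] at h2'
    have h3 := T.ω_τ d (W z) (mderiv (L.Y.prod Γ.H.toMfd) (T.W d) W z v)
    have hA : (fun z : L.Y × Γ.H => c.1.π (K.p' c z.1)) = fun z => L.π z.1 := funext fun z => by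
      rw [K.π_eq, hKe]
    have hp1 := pull_comp (M := L.Y.prod Γ.H.toMfd) (f := fun z : L.Y × Γ.H => z.1) isOpen_univ
      hKp isOpen_univ isSmooth_fst (mem_univ z) (mem_univ _) c.2.φ v
    have hp2 := pull_comp (M := L.Y.prod Γ.H.toMfd) (f := fun z : L.Y × Γ.H => z.1) isOpen_univ
      hKp' isOpen_univ isSmooth_fst (mem_univ z) (mem_univ _) c.1.φ v
    have h4 := K.φ_eq c z.1 (mderiv (L.Y.prod Γ.H.toMfd) L.Y (fun z : L.Y × Γ.H => z.1) z v)
    refine h0.trans (h3.trans ?_)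
    refine (congrArg₂ (fun a b => a + Γ.αStar (d.1.anchor (T.pr₁ d (W z))) b)
      (h1.symm.trans h1') (h2.symm.trans h2')).trans ?_
    have hanc : d.1.anchor (T.pr₁ d (W z)) = Γ.t z.2⁻¹ * c.1.g (K.p' c z.1) := by
      rw [hW₁, R'.anchor_q, map_inv]
    rw [hanc, αStar_mul, αStar_t, hp1, hA, gaugeForm, hp2]
    show _ = Γ.H.Ad z.2⁻¹ ((K.functor.obj c).φ z.1 (mderiv (L.Y.prod Γ.H.toMfd) L.Y
      (fun z : L.Y × Γ.H => z.1) z v)) + Γ.αTilde z.2 (pull (M := L.Y.prod Γ.H.toMfd)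
        (fun z : L.Y × Γ.H => L.π z.1) D''.A z v) +
      Γ.H.leftMC (M := L.Y.prod Γ.H.toMfd) (fun z : L.Y × Γ.H => z.2) z v
    rw [h4, Ad_add, add_comm, ← add_assoc, ← add_assoc]
    rfl

end Composition

section Composition

open CategoryTheory

variable {Γ : LieTwoGroup.{u}} {X : Mfd.{u}} {D D' D'' : GammaConnection Γ X}
  (K : CompositionFunctor D D' D'') (T : TensorFunctor D.A D'.A D''.A)
  (R : ReconstructionFunctor D D') (R' : ReconstructionFunctor D' D'')
  (R'' : ReconstructionFunctor D D'')

/-- The comparison morphism of a composable pair of local data. -/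
def comparison (c : LocalData D' D'' × LocalData D D') :
    BunCon.Hom (R''.functor.obj (K.functor.obj c))
      (T.functor.obj (R'.functor.obj c.1, R.functor.obj c.2)) :=
  (exists_comparison K T R R' R'' c).choose

theorem comparison_q (c : LocalData D' D'' × LocalData D D') (y : (K.functor.obj c).Y) (h : Γ.H)
    (w : T.W (R'.functor.obj c.1, R.functor.obj c.2))
    (h₁ : T.pr₁ (R'.functor.obj c.1, R.functor.obj c.2) w = R'.q c.1 (K.p' c y, h))
    (h₂ : T.pr₂ (R'.functor.obj c.1, R.functor.obj c.2) w = R.q c.2 (K.p c y, 1)) :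
    (comparison K T R R' R'' c).f (R''.q (K.functor.obj c) (y, h)) = T.τ _ w :=
  (exists_comparison K T R R' R'' c).choose_spec y h w h₁ h₂

theorem comparison_naturality {c c' : LocalData D' D'' × LocalData D D'} (k : c ⟶ c')
    (p : (R''.functor.obj (K.functor.obj c)).P) :
    (comparison K T R R' R'' c').f (BunCon.Hom.f (R''.functor.map (K.functor.map k)) p) =
      BunCon.Hom.f (T.functor.map (X := (R'.functor.obj c.1, R.functor.obj c.2))
          (Y := (R'.functor.obj c'.1, R.functor.obj c'.2)) (R'.functor.map k.1, R.functor.map k.2))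
        ((comparison K T R R' R'' c).f p) := by
  obtain ⟨⟨y₁, h⟩, rfl⟩ := R''.surjective_q (K.functor.obj c) p
  have hKe : ∀ (c : LocalData D' D'' × LocalData D D') y, c.2.π (K.p c y) = c.1.π (K.p' c y) :=
    fun c => (K.isFiberProduct c).2.2.1
  set y₂ : (K.functor.obj c').Y := (K.functor.obj c').lift ((K.functor.obj c).π y₁) with hy₂
  have e : (K.functor.obj c).π y₁ = (K.functor.obj c').π y₂ :=
    ((K.functor.obj c').π_lift ((K.functor.obj c).π y₁)).symm
  have e₂ : c.2.π (K.p c y₁) = c'.2.π (K.p c' y₂) := by rw [← K.π_eq, ← K.π_eq, e]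
  have e₁ : c.1.π (K.p' c y₁) = c'.1.π (K.p' c' y₂) := by rw [← hKe, ← hKe, e₂]
  set k₁ := LocalData.Hom.h k.1 _ _ e₁ with hk₁
  set k₂ := LocalData.Hom.h k.2 _ _ e₂ with hk₂
  have hfp := T.isFiberProduct (R'.functor.obj c.1, R.functor.obj c.2)
  have hfp' := T.isFiberProduct (R'.functor.obj c'.1, R.functor.obj c'.2)
  have hproj : ∀ (c : LocalData D' D'' × LocalData D D') y h,
      (R'.functor.obj c.1).proj (R'.q c.1 (K.p' c y, h)) =
      (R.functor.obj c.2).proj (R.q c.2 (K.p c y, 1)) := fun c y h => by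
    rw [R'.proj_q, R.proj_q, hKe]
  have hproj' : (R'.functor.obj c'.1).proj (R'.q c'.1 (K.p' c' y₂, k₁ * h)) =
      (R.functor.obj c'.2).proj (R.q c'.2 (K.p c' y₂, k₂)) := by
    rw [R'.proj_q, R.proj_q, hKe]
  obtain ⟨w, hw₁, hw₂⟩ := hfp.exists_point _ _ (hproj c y₁ h)
  obtain ⟨w', hw₁', hw₂'⟩ := hfp'.exists_point _ _ hproj'
  obtain ⟨w'', hw₁'', hw₂''⟩ := hfp'.exists_point _ _
    (hproj c' y₂ (k₁ * Γ.α (c.1.g (K.p' c y₁)) k₂ * h))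
  have hg : c'.1.g (K.p' c' y₂) = Γ.t k₁ * c.1.g (K.p' c y₁) :=
    (LocalData.Hom.gauge k.1).eq_g _ _ e₁
  have hL : (comparison K T R R' R'' c').f (BunCon.Hom.f (R''.functor.map (K.functor.map k))
      (R''.q (K.functor.obj c) (y₁, h))) = T.τ _ w'' := by
    rw [R''.map_q (K.functor.map k) y₁ y₂ e h, K.map_eq k y₁ y₂ e e₁ e₂]
    exact comparison_q K T R R' R'' c' y₂ _ w'' hw₁'' hw₂''
  have hRt := T.map_τ (c := (R'.functor.obj c.1, R.functor.obj c.2))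
    (c' := (R'.functor.obj c'.1, R.functor.obj c'.2)) (R'.functor.map k.1, R.functor.map k.2) w w'
    (by rw [hw₁, hw₁', R'.map_q k.1 _ _ e₁]) (by rw [hw₂, hw₂', R.map_q k.2 _ _ e₂, mul_one])
  rw [hL, comparison_q K T R R' R'' c y₁ h w hw₁ hw₂]
  refine (tensor_q_eq T R R' c' _ _ (K.p' c' y₂) (K.p c' y₂) (k₁ * h) k₂ ?_ hw₂'' hw₁' hw₂').trans
    hRt.symm
  rw [hw₁'', hg, map_mul, MulAut.mul_apply, Γ.α_t]
  congr 2
  group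

/-- Reconstruction sends composition to the partial tensor product. -/
def comparisonIso : CategoryTheory.Functor.comp K.functor R''.functor ≅
    CategoryTheory.Functor.comp (R'.functor.prod R.functor) T.functor :=
  NatIso.ofComponents (fun c => (comparison K T R R' R'' c).toIso) fun k =>
    BunCon.Hom.ext (funext fun p => comparison_naturality K T R R' R'' k p)

end Composition

/-! ### Adjusted and flat gauge transformations -/

section Curvature

variable {Γ : LieTwoGroup.{u}} {X : Mfd.{u}}

/-- A function `κ` that may prescribe the curvature of gauge transformations out of connections
whose fake curvature takes values in `S`: the condition `curv(g, φ) = κ(g, fcurv)` is then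
compatible with gauge 2-transformations and with composition. The element
`Ad_g X - t_*(κ(g, X))` is the fake curvature of the target of `(g, φ)` when the one of its source
is `X`. Adjustments have this property for all fake curvatures, and `κ = 0`, which describes
flatness, has it for `S = {0}`. -/
structure IsCurvatureLaw (κ : Γ.G → Γ.𝔤 → Γ.𝔥) (S : Set Γ.𝔤) : Prop where
  gauge2 : ∀ h g, ∀ F ∈ S, κ ((Γ.t h)⁻¹ * g) F =
    Γ.H.Ad h⁻¹ (κ g F) + Γ.αTilde h (Γ.G.Ad g F - Γ.tStar (κ g F))
  comp : ∀ g' g, ∀ F ∈ S, κ (g' * g) F =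
    Γ.αStar g' (κ g F) + κ g' (Γ.G.Ad g F - Γ.tStar (κ g F))

theorem LieTwoGroup.IsAdjustment.isCurvatureLaw {κ : Γ.G → Γ.𝔤 → Γ.𝔥}
    (H : Γ.IsAdjustment κ) : IsCurvatureLaw κ univ := by
  have hs : ∀ g F F', κ g (F - F') = κ g F - κ g F' := fun g F F' => by
    rw [sub_eq_add_neg, H.add, ← neg_one_smul ℝ F', H.smul, neg_one_smul, ← sub_eq_add_neg]
  refine ⟨fun h g F _ => ?_, fun g' g F _ => ?_⟩
  · rw [← map_inv, H.map_mul, H.map_t, inv_inv, (isLinearMap_αTilde Γ h).map_sub, αTilde_tStar]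
    abel
  · rw [H.map_mul, hs, H.map_tStar]
    abel

theorem isCurvatureLaw_zero : IsCurvatureLaw (fun (_ : Γ.G) (_ : Γ.𝔤) => (0 : Γ.𝔥)) {0} := by
  refine ⟨fun h g F hF => ?_, fun g' g F _ => ?_⟩
  · rw [hF, (isLinearMap_Ad _).map_zero, (isLinearMap_Ad _).map_zero,
      (isLinearMap_tStar Γ).map_zero, sub_zero, (isLinearMap_αTilde Γ h).map_zero, add_zero]
  · rw [(isLinearMap_αStar Γ g').map_zero, add_zero]

/-- The connections whose fake curvature takes values in `S`. -/
def GammaConnection.FakeCurvatureIn (D : GammaConnection Γ X) (S : Set Γ.𝔤) : Prop :=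
  ∀ x v w, fcurv Γ D.A D.B x v w ∈ S

variable (κ : Γ.G → Γ.𝔤 → Γ.𝔥) (D D' D'' : GammaConnection Γ X) {M N : Mfd.{u}}

/-- The curvature of `(g, φ) : f^*(A, B) → f^*(A', B')` is `κ(g, f^*fcurv(A, B))`. -/
def HasCurvature (f : M → X) (g : M → Γ.G) (φ : Fam1 M Γ.𝔥) : Prop :=
  ∀ x v w, gcurv Γ (pull f D'.A) (pull2 f D.B) (pull2 f D'.B) g φ x v w =
    κ (g x) (pull2 f (fcurv Γ D.A D.B) x v w)

variable {κ D D' D''} {f : M → X} {g g' : M → Γ.G} {φ φ' : Fam1 M Γ.𝔥}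

theorem gcurv_pull_comp (hf : IsSmooth M X f) {p : N → M} (hp : IsSmooth N M p)
    (hφ : IsForm1 M Γ.𝔥 φ) (x : N) (v w : N.T x) :
    gcurv Γ (pull (fun x => f (p x)) D'.A) (pull2 (fun x => f (p x)) D.B)
        (pull2 (fun x => f (p x)) D'.B) (fun x => g (p x)) (pull p φ) x v w =
      pull2 p (gcurv Γ (pull f D'.A) (pull2 f D.B) (pull2 f D'.B) g φ) x v w := by
  rw [← gcurv_pull hp hφ]
  have e1 : pull (fun x => f (p x)) D'.A = pull p (pull f D'.A) := funext fun x => funext fun v =>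
    pull_comp isOpen_univ hf isOpen_univ hp (mem_univ x) (mem_univ _) _ v
  have e2 : ∀ B : Fam2 X Γ.𝔥, pull2 (fun x => f (p x)) B = pull2 p (pull2 f B) := fun B =>
    funext fun x => funext fun v => funext fun w => pull2_comp hf hp B x v w
  rw [e1, e2, e2]

theorem isGaugeTransf_pull_comp {A A' : Fam1 X Γ.𝔤} (hf : IsSmooth M X f) {p : N → M}
    (hp : IsSmooth N M p) (G : IsGaugeTransf Γ (pull f A) (pull f A') g φ) :
    IsGaugeTransf Γ (pull (fun x => f (p x)) A) (pull (fun x => f (p x)) A') (fun x => g (p x))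
      (pull p φ) :=
  (G.pull hp).congr
    (fun x v => (pull_comp isOpen_univ hf isOpen_univ hp (mem_univ x) (mem_univ _) _ v).symm)
    (fun x v => (pull_comp isOpen_univ hf isOpen_univ hp (mem_univ x) (mem_univ _) _ v).symm)

theorem HasCurvature.pull (hf : IsSmooth M X f) {p : N → M} (hp : IsSmooth N M p)
    (hφ : IsForm1 M Γ.𝔥 φ) (H : HasCurvature κ D D' f g φ) :
    HasCurvature κ D D' (fun x => f (p x)) (fun x => g (p x)) (pull p φ) := fun x v w => by
  rw [gcurv_pull_comp hf hp hφ, pull2_comp hf hp]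
  exact H _ _ _

/-- The curvature condition may be checked after pullback along a surjective submersion. -/
theorem HasCurvature.of_pull (hf : IsSmooth M X f) {p : N → M} (hp : IsSubmersion N M p)
    (hs : Function.Surjective p) (hφ : IsForm1 M Γ.𝔥 φ)
    (H : HasCurvature κ D D' (fun x => f (p x)) (fun x => g (p x)) (HGT.pull p φ)) :
    HasCurvature κ D D' f g φ := by
  refine hp.pull2_injective hs (η := fun x v w => κ (g x) (pull2 f (fcurv Γ D.A D.B) x v w))
    fun x v w => ?_
  rw [← gcurv_pull_comp hf hp.1 hφ, H, pull2_comp hf hp.1]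
  rfl

/-- The fake curvature of the target of a gauge transformation with prescribed curvature. -/
theorem HasCurvature.fcurv_eq (hf : IsSmooth M X f) (H : HasCurvature κ D D' f g φ)
    (G : IsGaugeTransf Γ (HGT.pull f D.A) (HGT.pull f D'.A) g φ) (x : M) (v w : M.T x) :
    pull2 f (fcurv Γ D'.A D'.B) x v w = Γ.G.Ad (g x) (pull2 f (fcurv Γ D.A D.B) x v w) -
      Γ.tStar (κ (g x) (pull2 f (fcurv Γ D.A D.B) x v w)) := by
  have h1 := G.tStar_gcurv (B := pull2 f D.B) (B' := pull2 f D'.B) (isForm1_pull hf D.isForm_A)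
    (isForm1_pull hf D'.isForm_A) x v w
  rw [H, fcurv_pull hf D.isForm_A, fcurv_pull hf D'.isForm_A] at h1
  rw [h1, sub_sub_cancel]

theorem HasCurvature.gauge2 {S : Set Γ.𝔤} (hκ : IsCurvatureLaw κ S) (hS : D.FakeCurvatureIn S)
    (hf : IsSmooth M X f) (H : HasCurvature κ D D' f g φ)
    (G : IsGaugeTransf Γ (HGT.pull f D.A) (HGT.pull f D'.A) g φ) {h : M → Γ.H}
    (hh : IsSmooth M Γ.H h) :
    HasCurvature κ D D' f (fun x => (Γ.t (h x))⁻¹ * g x) (gaugeForm h (HGT.pull f D'.A) φ) :=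
  fun x v w => by
    have hA := isForm1_pull hf D'.isForm_A
    rw [gcurv_gauge2 (g₂ := g) hh hA (isForm1_gaugeForm hh hA G.isForm) G.isForm
      (fun _ _ => rfl) (fun x => (mul_inv_cancel_left _ _).symm), H, fcurv_pull hf D'.isForm_A,
      H.fcurv_eq hf G]
    exact (hκ.gauge2 _ _ _ (hS _ _ _)).symm

theorem HasCurvature.comp {S : Set Γ.𝔤} (hκ : IsCurvatureLaw κ S) (hS : D.FakeCurvatureIn S)
    (hf : IsSmooth M X f) (H : HasCurvature κ D D' f g φ) (H' : HasCurvature κ D' D'' f g' φ')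
    (G : IsGaugeTransf Γ (HGT.pull f D.A) (HGT.pull f D'.A) g φ)
    (G' : IsGaugeTransf Γ (HGT.pull f D'.A) (HGT.pull f D''.A) g' φ') :
    HasCurvature κ D D'' f (fun x => g' x * g x)
      (fun x v => Γ.αStar (g' x) (φ x v) + φ' x v) := fun x v w => by
  rw [gcurv_comp (B' := pull2 f D'.B) G' (isForm1_pull hf D'.isForm_A)
    (isForm1_pull hf D''.isForm_A) G.isForm, H, H', H.fcurv_eq hf G]
  exact (hκ.comp _ _ _ (hS _ _ _)).symm

theorem LocalData.isAdjusted_iff (L : LocalData D D') :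
    LocalData.IsAdjusted κ D D' L ↔ HasCurvature κ D D' L.π L.g L.φ := by
  refine forall_congr' fun y => forall_congr' fun v => forall_congr' fun w => ?_
  rw [fcurv_pull L.submersion.1 D.isForm_A]

theorem BunCon.IsAdjusted.loc {E : BunCon Γ X D.A D'.A} (H : BunCon.IsAdjusted κ D D' E) :
    LocalData.IsAdjusted κ D D' E.loc := (LocalData.isAdjusted_iff E.loc).2 H

/-- On `Y × H`, the connection of the reconstructed bundle is obtained from `(g, φ)` by a gauge
2-transformation, which preserves the curvature condition. -/
theorem ReconstructionFunctor.isAdjusted {S : Set Γ.𝔤} (hκ : IsCurvatureLaw κ S)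
    (hS : D.FakeCurvatureIn S) (R : ReconstructionFunctor D D') (L : LocalData D D')
    (H : LocalData.IsAdjusted κ D D' L) : BunCon.IsAdjusted κ D D' (R.functor.obj L) := by
  have H1 := (LocalData.isAdjusted_iff L).1 H
  have H2 := H1.pull L.submersion.1 (N := L.Y.prod Γ.H.toMfd) isSmooth_fst L.gauge.isForm
  have hf : IsSmooth (L.Y.prod Γ.H.toMfd) X (fun z => L.π z.1) := L.submersion.1.comp isSmooth_fst
  have G : IsGaugeTransf (M := L.Y.prod Γ.H.toMfd) Γ (pull (fun z : L.Y × Γ.H => L.π z.1) D.A)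
      (pull (fun z : L.Y × Γ.H => L.π z.1) D'.A) (fun z => L.g z.1)
      (pull (fun z : L.Y × Γ.H => z.1) L.φ) :=
    isGaugeTransf_pull_comp L.submersion.1 isSmooth_fst L.gauge
  have H3 := H2.gauge2 hκ hS hf G isSmooth_snd
  refine HasCurvature.of_pull (R.functor.obj L).smooth_proj (R.submersion_q L) (R.surjective_q L)
    (R.functor.obj L).isForm_ω ?_
  have e1 : (fun z => (R.functor.obj L).proj (R.q L z)) = fun z => L.π z.1 :=
    funext fun z => R.proj_q L z.1 z.2
  have e2 : (fun z => (R.functor.obj L).anchor (R.q L z)) = fun z => (Γ.t z.2)⁻¹ * L.g z.1 :=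
    funext fun z => R.anchor_q L z.1 z.2
  have e3 : pull (M := L.Y.prod Γ.H.toMfd) (R.q L) (R.functor.obj L).ω = L.recForm :=
    funext fun z => funext fun v => R.ω_q L z v
  rw [e1, e2, e3]
  exact H3

theorem CompositionFunctor.isAdjusted {S : Set Γ.𝔤} (hκ : IsCurvatureLaw κ S)
    (hS : D.FakeCurvatureIn S) (K : CompositionFunctor D D' D'')
    (c : LocalData D' D'' × LocalData D D') (H' : LocalData.IsAdjusted κ D' D'' c.1)
    (H : LocalData.IsAdjusted κ D D' c.2) : LocalData.IsAdjusted κ D D'' (K.functor.obj c) := by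
  have hp := (K.isFiberProduct c).1
  have hp' := (K.isFiberProduct c).2.1
  have e' : (K.functor.obj c).π = fun y => c.1.π (K.p' c y) :=
    funext fun y => (K.π_eq c y).trans ((K.isFiberProduct c).2.2.1 y)
  have e : (fun y => c.2.π (K.p c y)) = fun y => c.1.π (K.p' c y) :=
    funext (K.isFiberProduct c).2.2.1
  have hf : IsSmooth (K.functor.obj c).Y X (fun y => c.1.π (K.p' c y)) := c.1.submersion.1.comp hp'
  have G := isGaugeTransf_pull_comp c.2.submersion.1 hp c.2.gauge
  have G' := isGaugeTransf_pull_comp c.1.submersion.1 hp' c.1.gauge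
  have H1 := ((LocalData.isAdjusted_iff c.2).1 H).pull c.2.submersion.1 hp c.2.gauge.isForm
  have H1' := ((LocalData.isAdjusted_iff c.1).1 H').pull c.1.submersion.1 hp' c.1.gauge.isForm
  rw [e] at H1 G
  have H2 := H1.comp hκ hS hf H1' G G'
  refine (LocalData.isAdjusted_iff _).2 ?_
  have eg : (K.functor.obj c).g = fun y => c.1.g (K.p' c y) * c.2.g (K.p c y) := funext (K.g_eq c)
  have eφ : (K.functor.obj c).φ = _ := funext fun y => funext (K.φ_eq c y)
  rw [e', eg, eφ]
  exact H2

theorem TensorFunctor.isAdjusted {S : Set Γ.𝔤} (hκ : IsCurvatureLaw κ S)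
    (hS : D.FakeCurvatureIn S) (T : TensorFunctor D.A D'.A D''.A)
    (c : BunCon Γ X D'.A D''.A × BunCon Γ X D.A D'.A) (H' : BunCon.IsAdjusted κ D' D'' c.1)
    (H : BunCon.IsAdjusted κ D D' c.2) : BunCon.IsAdjusted κ D D'' (T.functor.obj c) := by
  have hp := (T.isFiberProduct c).2.1
  have hp' := (T.isFiberProduct c).1
  have e : (fun y => c.2.proj (T.pr₂ c y)) = fun y => c.1.proj (T.pr₁ c y) :=
    funext fun w => ((T.isFiberProduct c).2.2.1 w).symm
  have hf : IsSmooth (T.W c) X (fun y => c.1.proj (T.pr₁ c y)) := c.1.smooth_proj.comp hp'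
  have G := isGaugeTransf_pull_comp c.2.smooth_proj hp c.2.isGaugeTransf
  have G' := isGaugeTransf_pull_comp c.1.smooth_proj hp' c.1.isGaugeTransf
  have H1 := HasCurvature.pull c.2.smooth_proj hp c.2.isForm_ω H
  have H1' := HasCurvature.pull c.1.smooth_proj hp' c.1.isForm_ω H'
  rw [e] at H1 G
  have H2 := H1.comp hκ hS hf H1' G G'
  refine HasCurvature.of_pull (T.functor.obj c).smooth_proj (T.submersion_τ c) (T.surjective_τ c)
    (T.functor.obj c).isForm_ω ?_
  have e1 : (fun w => (T.functor.obj c).proj (T.τ c w)) = _ := funext (T.proj_τ c)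
  have eg : (fun w => (T.functor.obj c).anchor (T.τ c w)) = _ := funext (T.anchor_τ c)
  have eφ : pull (T.τ c) (T.functor.obj c).ω = fun w v =>
      Γ.αStar (c.1.anchor (T.pr₁ c w)) (pull (T.pr₂ c) c.2.ω w v) + pull (T.pr₁ c) c.1.ω w v :=
    funext fun w => funext fun v => (T.ω_τ c w v).trans (add_comm _ _)
  rw [e1, eg, eφ]
  exact H2

end Curvature

/-! ### Restriction to adjusted and flat data -/

section Restriction

open CategoryTheory

variable {Γ : LieTwoGroup.{u}} {X : Mfd.{u}} {D D' D'' : GammaConnection Γ X}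
  {κ : Γ.G → Γ.𝔤 → Γ.𝔥} {S : Set Γ.𝔤}

/-- Composition, tensor product and reconstruction restrict to a curvature law. The comparison
restricts with them, because the subcategories are full. -/
theorem nonempty_restrictIso (hκ : IsCurvatureLaw κ S) (hS : D.FakeCurvatureIn S)
    (hS' : D'.FakeCurvatureIn S) (K : CompositionFunctor D D' D'')
    (T : TensorFunctor D.A D'.A D''.A) (R : ReconstructionFunctor D D')
    (R' : ReconstructionFunctor D' D'') (R'' : ReconstructionFunctor D D'') :
    ∃ (hK : ∀ c, LocalData.IsAdjusted κ D' D'' c.1 → LocalData.IsAdjusted κ D D' c.2 →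
          LocalData.IsAdjusted κ D D'' (K.functor.obj c))
      (hT : ∀ c, BunCon.IsAdjusted κ D' D'' c.1 → BunCon.IsAdjusted κ D D' c.2 →
          BunCon.IsAdjusted κ D D'' (T.functor.obj c))
      (hR : ∀ L, LocalData.IsAdjusted κ D D' L → BunCon.IsAdjusted κ D D' (R.functor.obj L))
      (hR' : ∀ L, LocalData.IsAdjusted κ D' D'' L →
          BunCon.IsAdjusted κ D' D'' (R'.functor.obj L))
      (hR'' : ∀ L, LocalData.IsAdjusted κ D D'' L →
          BunCon.IsAdjusted κ D D'' (R''.functor.obj L)),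
      Nonempty (restrictFunctor₂ K.functor hK ⋙ restrictFunctor R''.functor hR'' ≅
        (restrictFunctor R'.functor hR').prod (restrictFunctor R.functor hR) ⋙
          restrictFunctor₂ T.functor hT) := by
  refine ⟨fun c => K.isAdjusted hκ hS c, fun c => T.isAdjusted hκ hS c,
    fun L => R.isAdjusted hκ hS L, fun L => R'.isAdjusted hκ hS' L,
    fun L => R''.isAdjusted hκ hS L, ⟨?_⟩⟩
  exact Functor.fullyFaithfulCancelRight (ObjectProperty.ι _) (Functor.isoWhiskerLeft
    ((LocalData.IsAdjusted κ D' D'').ι.prod (LocalData.IsAdjusted κ D D').ι)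
    (comparisonIso K T R R' R''))

/-- A bundle whose connection obeys the curvature law has canonical local data that obey it, as the
gauge transformation in these data is the pair of the anchor and the connection. -/
theorem isEquivalence_restrictFunctor (hκ : IsCurvatureLaw κ S) (hS : D.FakeCurvatureIn S)
    (R : ReconstructionFunctor D D') :
    ∃ hR : ∀ L, LocalData.IsAdjusted κ D D' L → BunCon.IsAdjusted κ D D' (R.functor.obj L),
      (restrictFunctor R.functor hR).IsEquivalence := by
  refine ⟨fun L => R.isAdjusted hκ hS L, ?_⟩
  have := R.faithful
  have := R.full
  exact
    { essSurj := ⟨fun E => ⟨⟨E.obj.loc, BunCon.IsAdjusted.loc E.property⟩,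
        (R.nonempty_iso_loc E.obj).map fun i => ObjectProperty.isoMk _ i⟩⟩ }

end Restriction

end

end HGT

theorem mainTheorem10 (Γ : LieTwoGroup.{u}) (X : Mfd.{u}) :
    -- the reconstruction, composition and tensor product functors exist
    (∀ D D' : GammaConnection Γ X, Nonempty (ReconstructionFunctor D D')) ∧
    (∀ D D' D'' : GammaConnection Γ X, Nonempty (CompositionFunctor D D' D'')) ∧
    (∀ D D' D'' : GammaConnection Γ X, Nonempty (TensorFunctor D.A D'.A D''.A)) ∧
    -- reconstruction sends composition to the partial tensor product: the general case
    (∀ (D D' D'' : GammaConnection Γ X) (K : CompositionFunctor D D' D'')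
      (T : TensorFunctor D.A D'.A D''.A) (R : ReconstructionFunctor D D')
      (R' : ReconstructionFunctor D' D'') (R'' : ReconstructionFunctor D D''),
      Nonempty (CategoryTheory.Functor.comp K.functor R''.functor ≅
        CategoryTheory.Functor.comp (R'.functor.prod R.functor) T.functor)) ∧
    -- the adjusted case, for central `Γ` with an adjustment `κ`
    (∀ κ : Γ.G → Γ.𝔤 → Γ.𝔥, Γ.IsCentral → Γ.IsAdjustment κ →
      (∀ (D D' D'' : GammaConnection Γ X) (K : CompositionFunctor D D' D'')
        (T : TensorFunctor D.A D'.A D''.A) (R : ReconstructionFunctor D D')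
        (R' : ReconstructionFunctor D' D'') (R'' : ReconstructionFunctor D D''),
        ∃ (hK : ∀ c, LocalData.IsAdjusted κ D' D'' c.1 → LocalData.IsAdjusted κ D D' c.2 →
              LocalData.IsAdjusted κ D D'' (K.functor.obj c))
          (hT : ∀ c, BunCon.IsAdjusted κ D' D'' c.1 → BunCon.IsAdjusted κ D D' c.2 →
              BunCon.IsAdjusted κ D D'' (T.functor.obj c))
          (hR : ∀ L, LocalData.IsAdjusted κ D D' L → BunCon.IsAdjusted κ D D' (R.functor.obj L))
          (hR' : ∀ L, LocalData.IsAdjusted κ D' D'' L →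
              BunCon.IsAdjusted κ D' D'' (R'.functor.obj L))
          (hR'' : ∀ L, LocalData.IsAdjusted κ D D'' L →
              BunCon.IsAdjusted κ D D'' (R''.functor.obj L)),
          Nonempty (CategoryTheory.Functor.comp (restrictFunctor₂ K.functor hK)
              (restrictFunctor R''.functor hR'') ≅
            CategoryTheory.Functor.comp ((restrictFunctor R'.functor hR').prod (restrictFunctor R.functor hR))
              (restrictFunctor₂ T.functor hT))) ∧
      ∀ (D D' : GammaConnection Γ X) (R : ReconstructionFunctor D D'),
        ∃ hR : ∀ L, LocalData.IsAdjusted κ D D' L → BunCon.IsAdjusted κ D D' (R.functor.obj L),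
          (restrictFunctor R.functor hR).IsEquivalence) ∧
    -- the fake-flat case
    (∀ (D D' D'' : GammaConnection Γ X), D.FakeFlat → D'.FakeFlat → D''.FakeFlat →
      ∀ (K : CompositionFunctor D D' D'')
        (T : TensorFunctor D.A D'.A D''.A) (R : ReconstructionFunctor D D')
        (R' : ReconstructionFunctor D' D'') (R'' : ReconstructionFunctor D D''),
        ∃ (hK : ∀ c, LocalData.IsFlat D' D'' c.1 → LocalData.IsFlat D D' c.2 →
              LocalData.IsFlat D D'' (K.functor.obj c))
          (hT : ∀ c, BunCon.IsFlat D' D'' c.1 → BunCon.IsFlat D D' c.2 →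
              BunCon.IsFlat D D'' (T.functor.obj c))
          (hR : ∀ L, LocalData.IsFlat D D' L → BunCon.IsFlat D D' (R.functor.obj L))
          (hR' : ∀ L, LocalData.IsFlat D' D'' L → BunCon.IsFlat D' D'' (R'.functor.obj L))
          (hR'' : ∀ L, LocalData.IsFlat D D'' L → BunCon.IsFlat D D'' (R''.functor.obj L)),
          Nonempty (CategoryTheory.Functor.comp (restrictFunctor₂ K.functor hK)
              (restrictFunctor R''.functor hR'') ≅
            CategoryTheory.Functor.comp ((restrictFunctor R'.functor hR').prod (restrictFunctor R.functor hR))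
              (restrictFunctor₂ T.functor hT))) ∧
    (∀ (D D' : GammaConnection Γ X), D.FakeFlat → D'.FakeFlat →
      ∀ R : ReconstructionFunctor D D',
        ∃ hR : ∀ L, LocalData.IsFlat D D' L → BunCon.IsFlat D D' (R.functor.obj L),
          (restrictFunctor R.functor hR).IsEquivalence) := by
  refine ⟨fun D D' => ⟨reconstructionFunctor D D'⟩, fun D D' D'' => ⟨compositionFunctor D D' D''⟩,
    fun D D' D'' => ⟨tensorFunctor D D' D''⟩,
    fun D D' D'' K T R R' R'' => ⟨comparisonIso K T R R' R''⟩,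
    fun κ _ hκ => ⟨fun D D' D'' K T R R' R'' => nonempty_restrictIso hκ.isCurvatureLaw
        (fun _ _ _ => mem_univ _) (fun _ _ _ => mem_univ _) K T R R' R'',
      fun D D' R => isEquivalence_restrictFunctor hκ.isCurvatureLaw (fun _ _ _ => mem_univ _) R⟩,
    -- flatness is adjustedness with respect to `κ = 0`
    fun D D' D'' hD hD' _ K T R R' R'' =>
      nonempty_restrictIso isCurvatureLaw_zero hD hD' K T R R' R'',
    fun D D' hD _ R => isEquivalence_restrictFunctor isCurvatureLaw_zero hD R⟩
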